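/- Work on a deterministic word RAM with signed $w$-bit words on which addition, subtraction, multiplication, comparison, division with remainder, inversion of a unit modulo a word-sized modulus, and reading or writing a memory cell at a computed address each take one step; an overflow, a division by zero, an undefined modular inverse or an access outside the available memory aborts the computation. The constructive Erdős–Ginzburg–Ziv problem is: given an integer $n\ge 1$ and integers $a_1,\dots,a_{2n-1}$, output (the list of the elements of) a set $I\subseteq\{1,\dots,2n-1\}$ with $|I|=n$ and $\sum_{i\in I}a_i\equiv 0\pmod n$. The constructive Erdős–Ginzburg–Ziv problem can be solved deterministically in $O(n)$ time and $O(n)$ space. That is, there are one fixed program, using a fixed finite number of registers, and absolute constants $k,c$ such that for every $n\ge 1$, every word length $w\ge k(\lfloor\log_2 n\rfloor+1)$ and all integers $a_1,\dots,a_{2n-1}$ that fit into one word each, the program, started with $n$ in a register and $a_1,\dots,a_{2n-1}$ in the first $2n-1$ cells of a memory of $cn$ words (all other cells and registers being $0$), halts without aborting after at most $cn$ steps and leaves such a set $I$ listed in the first $n$ memory cells, each $i\in I$ exactly once and stored as the number $i-1$. -/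

import Mathlib

/-! A deterministic word RAM with signed words of `w` bits and a memory of `m` words, and the
constructive Erdős–Ginzburg–Ziv problem. -/

namespace WordRAM

/-- `z` is representable as a signed (two's complement) word of `w` bits:
`-2 ^ (w - 1) ≤ z < 2 ^ (w - 1)`. -/
def FitsWord (w : ℕ) (z : ℤ) : Prop :=
  -(2 : ℤ) ^ w ≤ 2 * z ∧ 2 * z < (2 : ℤ) ^ w

instance (w : ℕ) (z : ℤ) : Decidable (FitsWord w z) := by
  unfold FitsWord; infer_instance

/-- The unit-cost operations on words: addition, subtraction, multiplication, division with
remainder, modular inverse, and the comparisons `<`, `≤`, `=` (with result `1` or `0`). -/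
inductive Op
  | add | sub | mul | div | mod | inv | lt | le | eq

/-- The mathematical result of an operation; `none` is a fault. Division by zero is a fault.
`inv` returns, for a modulus `y ≥ 1` coprime to `x`, the `z` with `0 ≤ z < y` and
`x * z ≡ 1 [ZMOD y]`, and faults otherwise. -/
def Op.eval : Op → ℤ → ℤ → Option ℤ
  | .add, x, y => some (x + y)
  | .sub, x, y => some (x - y)
  | .mul, x, y => some (x * y)
  | .div, x, y => if y = 0 then none else some (x / y)
  | .mod, x, y => if y = 0 then none else some (x % y)
  | .inv, x, y => if 1 ≤ y ∧ Int.gcd x y = 1 then some (Int.gcdA x y % y) else none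
  | .lt, x, y => some (if x < y then 1 else 0)
  | .le, x, y => some (if x ≤ y then 1 else 0)
  | .eq, x, y => some (if x = y then 1 else 0)

theorem Op.eval_inv_spec {x y z : ℤ} (h : Op.inv.eval x y = some z) :
    0 ≤ z ∧ z < y ∧ x * z ≡ 1 [ZMOD y] := by
  simp only [Op.eval] at h
  split_ifs at h with hc
  obtain ⟨hy, hg⟩ := hc
  obtain rfl := Option.some.inj h
  refine ⟨Int.emod_nonneg _ (by omega), Int.emod_lt_of_pos _ (by omega), ?_⟩
  have h1 : x * (Int.gcdA x y % y) ≡ x * Int.gcdA x y [ZMOD y] :=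
    Int.ModEq.mul_left _ (Int.mod_modEq _ _)
  refine h1.trans ?_
  have h2 := Int.gcd_eq_gcd_ab x y
  rw [hg] at h2
  rw [Int.modEq_iff_dvd]
  exact ⟨Int.gcdB x y, by push_cast at h2; linarith⟩

/-- A machine state: the registers (a program mentions only finitely many of them) and the
memory. -/
structure State where
  reg : ℕ → ℤ
  mem : ℕ → ℤ

/-- Expressions: constants, registers, memory reads at a computed address, and operations. -/
inductive Expr
  | const (z : ℤ)
  | reg (r : ℕ)
  | load (addr : Expr)
  | bin (o : Op) (e f : Expr)

/-- The number of unit-cost instructions that evaluate an expression. -/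
def Expr.cost : Expr → ℕ
  | .const _ => 1
  | .reg _ => 1
  | .load e => e.cost + 1
  | .bin _ e f => e.cost + f.cost + 1

/-- The value `z` as a word of `w` bits; an overflow is a fault. -/
def toWord (w : ℕ) (z : ℤ) : Option ℤ :=
  if FitsWord w z then some z else none

/-- The value `z` as an address of a memory of `m` words; any other value is a fault. -/
def toAddr (m : ℕ) (z : ℤ) : Option ℕ :=
  if 0 ≤ z ∧ z < m then some z.toNat else none

/-- The value of an expression on a machine with words of `w` bits and `m` words of memory.
The value is `none` (a fault) if any intermediate result does not fit into a word, or if an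
address outside the memory is read. -/
def Expr.eval (w m : ℕ) (s : State) : Expr → Option ℤ
  | .const z => toWord w z
  | .reg r => some (s.reg r)
  | .load e => ((e.eval w m s).bind (toAddr m)).map s.mem
  | .bin o e f =>
      (e.eval w m s).bind fun x => (f.eval w m s).bind fun y => (o.eval x y).bind (toWord w)

/-- Programs: no operation, register assignment, memory write `mem[addr] := e`, sequencing,
branching and iteration (a test succeeds if its value is nonzero). -/
inductive Prog
  | skip
  | set (r : ℕ) (e : Expr)
  | store (addr e : Expr)
  | seq (p q : Prog)
  | cond (e : Expr) (p q : Prog)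
  | loop (e : Expr) (p : Prog)

/-- `Exec w m p s t s'`: on a machine with words of `w` bits and `m` words of memory, the
program `p`, started in state `s`, halts without a fault after exactly `t` steps, in state `s'`. -/
inductive Exec (w m : ℕ) : Prog → State → ℕ → State → Prop
  | skip (s : State) : Exec w m .skip s 1 s
  | set {s : State} {r : ℕ} {e : Expr} {z : ℤ} (he : e.eval w m s = some z) :
      Exec w m (.set r e) s (e.cost + 1) { s with reg := Function.update s.reg r z }
  | store {s : State} {a e : Expr} {x z : ℤ} {i : ℕ} (ha : a.eval w m s = some x)
      (hi : toAddr m x = some i) (he : e.eval w m s = some z) :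
      Exec w m (.store a e) s (a.cost + e.cost + 1) { s with mem := Function.update s.mem i z }
  | seq {p q : Prog} {s s' s'' : State} {t t' : ℕ} (hp : Exec w m p s t s')
      (hq : Exec w m q s' t' s'') : Exec w m (.seq p q) s (t + t') s''
  | cond_true {e : Expr} {p q : Prog} {s s' : State} {t : ℕ} {z : ℤ}
      (he : e.eval w m s = some z) (hz : z ≠ 0) (hp : Exec w m p s t s') :
      Exec w m (.cond e p q) s (e.cost + 1 + t) s'
  | cond_false {e : Expr} {p q : Prog} {s s' : State} {t : ℕ}
      (he : e.eval w m s = some 0) (hq : Exec w m q s t s') :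
      Exec w m (.cond e p q) s (e.cost + 1 + t) s'
  | loop_true {e : Expr} {p : Prog} {s s' s'' : State} {t t' : ℕ} {z : ℤ}
      (he : e.eval w m s = some z) (hz : z ≠ 0) (hp : Exec w m p s t s')
      (hl : Exec w m (.loop e p) s' t' s'') :
      Exec w m (.loop e p) s (e.cost + 1 + t + t') s''
  | loop_false {e : Expr} {p : Prog} {s : State} (he : e.eval w m s = some 0) :
      Exec w m (.loop e p) s (e.cost + 1) s

/-- The machine is deterministic: the running time and the final state are determined by the
program and the initial state. -/
theorem Exec.deterministic {w m : ℕ} {p : Prog} {s s₁ s₂ : State} {t₁ t₂ : ℕ}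
    (h₁ : Exec w m p s t₁ s₁) (h₂ : Exec w m p s t₂ s₂) : t₁ = t₂ ∧ s₁ = s₂ := by
  induction h₁ generalizing t₂ s₂ with
  | skip s => cases h₂; exact ⟨rfl, rfl⟩
  | set he =>
    cases h₂ with
    | set he' =>
      obtain rfl := Option.some.inj (he.symm.trans he')
      exact ⟨rfl, rfl⟩
  | store ha hi he =>
    cases h₂ with
    | store ha' hi' he' =>
      obtain rfl := Option.some.inj (ha.symm.trans ha')
      obtain rfl := Option.some.inj (hi.symm.trans hi')
      obtain rfl := Option.some.inj (he.symm.trans he')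
      exact ⟨rfl, rfl⟩
  | seq _ _ ihp ihq =>
    cases h₂ with
    | seq hp' hq' =>
      obtain ⟨rfl, rfl⟩ := ihp hp'
      obtain ⟨rfl, rfl⟩ := ihq hq'
      exact ⟨rfl, rfl⟩
  | cond_true he hz _ ihp =>
    cases h₂ with
    | cond_true he' hz' hp' =>
      obtain ⟨rfl, rfl⟩ := ihp hp'
      exact ⟨rfl, rfl⟩
    | cond_false he' hq' => exact absurd (Option.some.inj (he.symm.trans he')) hz
  | cond_false he _ ihq =>
    cases h₂ with
    | cond_true he' hz' hp' => exact absurd (Option.some.inj (he'.symm.trans he)) hz'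
    | cond_false he' hq' =>
      obtain ⟨rfl, rfl⟩ := ihq hq'
      exact ⟨rfl, rfl⟩
  | loop_true he hz _ _ ihp ihl =>
    cases h₂ with
    | loop_true he' hz' hp' hl' =>
      obtain ⟨rfl, rfl⟩ := ihp hp'
      obtain ⟨rfl, rfl⟩ := ihl hl'
      exact ⟨rfl, rfl⟩
    | loop_false he' => exact absurd (Option.some.inj (he.symm.trans he')) hz
  | loop_false he =>
    cases h₂ with
    | loop_true he' hz' hp' hl' => exact absurd (Option.some.inj (he'.symm.trans he)) hz'
    | loop_false he' => exact ⟨rfl, rfl⟩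

end WordRAM

namespace EGZ

/-- `I` solves the Erdős–Ginzburg–Ziv problem for the integers `a 0, …, a (2 n - 2)`. -/
def IsSolution (n : ℕ) (a : Fin (2 * n - 1) → ℤ) (I : Finset (Fin (2 * n - 1))) : Prop :=
  I.card = n ∧ (n : ℤ) ∣ ∑ i ∈ I, a i

/-- The input: register `0` holds `n`, memory cell `i` holds `a i` for `i < 2 n - 1`, and all
other registers and memory cells hold `0`. -/
def input (n : ℕ) (a : Fin (2 * n - 1) → ℤ) : WordRAM.State where
  reg := fun r => if r = 0 then (n : ℤ) else 0
  mem := fun i => if h : i < 2 * n - 1 then a ⟨i, h⟩ else 0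

/-- The output: the memory cells `0, …, n - 1` list the elements of `I`, each exactly once. -/
def Outputs (n : ℕ) (s : WordRAM.State) (I : Finset (Fin (2 * n - 1))) : Prop :=
  ∃ e : Fin n ≃ {i // i ∈ I}, ∀ j : Fin n, s.mem j = (((e j).1 : ℕ) : ℤ)

end EGZ

namespace EGZ

open WordRAM

set_option linter.constructorNameAsVariable false

/-! A composite modulus is handled by descending through its prime factors. While `n = D * M`, there
are `2 * M - 1` disjoint items, each a set of `D` positions whose sum is `D` times a stored value
modulo `n`. Let `p` be the least prime factor of `M` and `M = p * N`. The case of a prime, applied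
to `2 * p - 1` stored values, selects `p` of them with sum divisible by `p`; their union is an item
for `D * p`, and its value is that sum divided by `p`, modulo `N`. The `p - 1` other items are used
again, so that `2 * N - 1` such rounds are possible (`Live.round`, `wp_level`). A level costs
`O(M)`, and `2 * N ≤ M` makes the total a geometric series. For `M = 1` there is one item of `n`
positions with sum `0`.

For a prime `p`, sort the `2 * p - 1` residues. If two entries at distance `p - 1` agree, they
enclose `p` equal ones. Otherwise the entries at distance `p - 1` form `p - 1` pairs with nonzero
differences, and one entry is left over. Taking one member of each pair, and the entry left over,
one has to find a set of differences with a prescribed sum. It exists by Cauchy-Davenport; the point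
is to find it in time `O(p)`. For `p < 2 ^ 120` a table of subset sums, computed in quadratic time,
is good enough.

For larger `p`, equal differences are collected into classes, and the sums reached so far are
represented by an interval: all `x` with `(g * x - c) % p ≤ L`. To add a class of `m` elements of
value `v`, let `b` be the least multiplier for which `b * (g * v)` has a distance `e ≤ L + 1` from
`0`. Minimality makes `b` and `e` coprime. If `2 * b ≤ m + 2`, then the numbers `b * i + e * j` with
`i ≤ L`, `j ≤ m` fill an interval of length `b * L + (m - 2 * b + 2) * e` (`exists_combination`),
and this is the new interval, at scale `b * g` (`stage_chain`). The search for `b` costs `O(m)`.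
Once `L ≥ p - 1`, all residues are reached, and going backwards through the intervals yields the set
(`wp_recon`).

Let `M` be about the square root of `2 * p`. If the classes with at least `M` elements contain half
of the differences, Dirichlet's theorem provides multipliers that are small enough, and each class
increases `L` by at least its size (`reaches_high`). Otherwise most classes are small. In a list
that is sorted by value and has only small classes, entries at a suitable distance differ, but on
average not by much. From one half of the nodes in small classes, one or two rounds of such
differences produce at least `4096 * M` equal values, which are scaled to `1`. The other half then
yields differences between `64` and `4096 * M` with a sum of at least `p - 1`; the ones fill the
gaps, and the multiplier `1` always suffices (`reaches_low`). Differences of differences are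
legitimate because every node is a switch between its two children; the states are propagated to the
leaves in the end (`Balanced.step`).

The program is written in a small structured language that is compiled to the RAM. The predicate
`WP` combines a postcondition with a bound for the running time, and loops are paid for by a
potential (`WP.loop`). -/

/-! ### A structured language with named registers and interleaved arrays, and its compilation. -/

/-- The names of the registers used by the program. -/
inductive Reg
  | n | lev | sub | p | q | nid | t | k | wpos | sum | x
  | bi | bx | bk | fi | fx | xlen | ylen | zlen
  | pi | pl | pr | pd | nn | base | g | ginv | si
  | m | thr | dup | half
  | st | sg | sc | sl | cv | cm | cu | cb | cy
  | rx | rz | ri | di | dx | dv | fy | fs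
  deriving DecidableEq

/-- The names of the arrays used by the program. -/
inductive Arr
  | iv | pool | par | sel
  | val | lft | rgt | st | x | y | z | head | nxt | cnt
  | sv | ss | sc | sl | fst
  deriving DecidableEq

/-- The number of arrays; they are interleaved in the memory. -/
abbrev stride : ℕ := 19

theorem Arr.ctorIdx_lt (a : Arr) : a.ctorIdx < stride := by cases a <;> decide

/-- The contents of the named registers and of the named arrays. -/
@[ext] structure Store where
  r : Reg → ℤ
  a : Arr → ℤ → ℤ

namespace Store

def set (σ : Store) (x : Reg) (z : ℤ) : Store :=
  ⟨fun y => if y = x then z else σ.r y, σ.a⟩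

def put (σ : Store) (b : Arr) (i z : ℤ) : Store :=
  ⟨σ.r, fun c => if c = b then Function.update (σ.a c) i z else σ.a c⟩

@[simp] theorem set_a (σ : Store) (x : Reg) (z : ℤ) : (σ.set x z).a = σ.a := rfl
@[simp] theorem put_r (σ : Store) (b : Arr) (i z : ℤ) : (σ.put b i z).r = σ.r := rfl
@[simp] theorem set_r (σ : Store) (x y : Reg) (z : ℤ) :
    (σ.set x z).r y = if y = x then z else σ.r y := rfl
theorem set_r_same (σ : Store) (x : Reg) (z : ℤ) : (σ.set x z).r x = z := by simp [set_r]
@[simp] theorem put_a (σ : Store) (b c : Arr) (i z : ℤ) :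
    (σ.put b i z).a c = if c = b then Function.update (σ.a c) i z else σ.a c := rfl
theorem put_a_ne (σ : Store) {b c : Arr} (i z : ℤ) (h : c ≠ b) :
    (σ.put b i z).a c = σ.a c := by simp [h]

/-- The array and the index that correspond to a raw memory address. -/
def rawGet (σ : Store) (i : ℤ) : ℤ := σ.a (Arr.ofNat (i % stride).toNat) (i / stride)

def rawPut (σ : Store) (i z : ℤ) : Store := σ.put (Arr.ofNat (i % stride).toNat) (i / stride) z

/-- Entry `i` of the array `b` has the address `stride * i + b.ctorIdx`, so that the arrays share
the memory without fixed limits between them. `Reg.ofNat` is total; the test singles out the numbers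
that name a register, and all other registers hold `0`. -/
def toState (σ : Store) : State :=
  ⟨fun k => if (Reg.ofNat k).ctorIdx = k then σ.r (Reg.ofNat k) else 0, fun i => σ.rawGet i⟩

theorem toState_reg (σ : Store) (x : Reg) : σ.toState.reg x.ctorIdx = σ.r x := by
  simp [toState, Reg.ofNat_ctorIdx]

theorem rawGet_arr (σ : Store) (b : Arr) (i : ℤ) :
    σ.rawGet (stride * i + b.ctorIdx) = σ.a b i := by
  have hb := b.ctorIdx_lt
  have h1 : ((stride : ℤ) * i + b.ctorIdx) % stride = b.ctorIdx := by
    rw [Int.mul_add_emod_self_left]; exact Int.emod_eq_of_lt (by omega) (by exact_mod_cast hb)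
  have h2 : ((stride : ℤ) * i + b.ctorIdx) / stride = i := by
    simp only [stride] at *; omega
  rw [rawGet, h1, h2]; simp [Arr.ofNat_ctorIdx]

theorem toState_set (σ : Store) (x : Reg) (z : ℤ) :
    (σ.set x z).toState = { σ.toState with reg := Function.update σ.toState.reg x.ctorIdx z } := by
  simp only [toState, State.mk.injEq]
  refine ⟨?_, rfl⟩
  funext k
  by_cases hk : k = x.ctorIdx
  · subst hk; simp [Reg.ofNat_ctorIdx]
  · rw [Function.update_of_ne hk]
    by_cases h : (Reg.ofNat k).ctorIdx = k
    · have : Reg.ofNat k ≠ x := fun e => hk (by rw [← h, e])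
      simp [set_r, this]
    · simp [h]

theorem Arr.ofNat_inj {i j : ℕ} (hi : i < stride) (hj : j < stride)
    (h : Arr.ofNat i = Arr.ofNat j) : i = j := by
  have key : ∀ i : ℕ, i < stride → (Arr.ofNat i).ctorIdx = i := by decide
  rw [← key i hi, ← key j hj, h]

/-- An address is determined by its remainder and its quotient modulo `stride`, so different
addresses never share an array entry. -/
theorem rawPut_rawGet (σ : Store) (i j z : ℤ) :
    (σ.rawPut i z).rawGet j = if j = i then z else σ.rawGet j := by
  simp only [rawPut, rawGet, put_a]
  by_cases h : j = i
  · simp [h]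
  · rw [if_neg h]
    split_ifs with h1
    rw [Function.update_apply]
    split_ifs with h2
    · exfalso
      have := Arr.ofNat_inj (by simp only [stride]; omega) (by simp only [stride]; omega) h1
      simp only [stride] at *; omega
    · rfl
    · rfl

theorem toState_rawPut (σ : Store) (i : ℕ) (z : ℤ) :
    (σ.rawPut i z).toState = { σ.toState with mem := Function.update σ.toState.mem i z } := by
  have : (σ.rawPut i z).r = σ.r := rfl
  simp only [toState, State.mk.injEq, this, true_and]
  funext j
  rw [rawPut_rawGet]
  by_cases hj : j = i
  · simp [hj]
  · rw [Function.update_of_ne hj]; simp [hj]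

theorem rawPut_arr (σ : Store) (b : Arr) (i z : ℤ) :
    σ.rawPut (stride * i + b.ctorIdx) z = σ.put b i z := by
  have hb := b.ctorIdx_lt
  have h1 : ((stride : ℤ) * i + b.ctorIdx) % stride = b.ctorIdx := by
    rw [Int.mul_add_emod_self_left]; exact Int.emod_eq_of_lt (by omega) (by exact_mod_cast hb)
  have h2 : ((stride : ℤ) * i + b.ctorIdx) / stride = i := by
    simp only [stride] at *; omega
  rw [rawPut, h1, h2]; simp [Arr.ofNat_ctorIdx]

end Store

/-- Expressions over named registers and arrays; `raw` reads a cell at a raw address. -/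
inductive Ex
  | lit (z : ℤ)
  | reg (x : Reg)
  | arr (b : Arr) (e : Ex)
  | raw (e : Ex)
  | op (o : Op) (e f : Ex)

namespace Ex

instance : Coe Reg Ex := ⟨.reg⟩
instance (k : ℕ) : OfNat Ex k := ⟨.lit (OfNat.ofNat k)⟩
instance : Add Ex := ⟨.op .add⟩
instance : Sub Ex := ⟨.op .sub⟩
instance : Mul Ex := ⟨.op .mul⟩
instance : Div Ex := ⟨.op .div⟩
instance : Mod Ex := ⟨.op .mod⟩

def compile : Ex → Expr
  | .lit z => .const z
  | .reg x => .reg x.ctorIdx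
  | .arr b e => .load (.bin .add (.bin .mul (.const stride) e.compile) (.const b.ctorIdx))
  | .raw e => .load e.compile
  | .op o e f => .bin o e.compile f.compile

def den (σ : Store) : Ex → ℤ
  | .lit z => z
  | .reg x => σ.r x
  | .arr b e => σ.a b (e.den σ)
  | .raw e => σ.rawGet (e.den σ)
  | .op .add e f => e.den σ + f.den σ
  | .op .sub e f => e.den σ - f.den σ
  | .op .mul e f => e.den σ * f.den σ
  | .op .div e f => e.den σ / f.den σ
  | .op .mod e f => e.den σ % f.den σ
  | .op .inv e f => Int.gcdA (e.den σ) (f.den σ) % f.den σ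
  | .op .lt e f => if e.den σ < f.den σ then 1 else 0
  | .op .le e f => if e.den σ ≤ f.den σ then 1 else 0
  | .op .eq e f => if e.den σ = f.den σ then 1 else 0

def cost (e : Ex) : ℕ := e.compile.cost

theorem den_lt_eq_zero (σ : Store) (e f : Ex) :
    (Ex.op .lt e f).den σ = 0 ↔ f.den σ ≤ e.den σ := by
  rw [den]; split_ifs <;> omega

theorem den_le_eq_zero (σ : Store) (e f : Ex) :
    (Ex.op .le e f).den σ = 0 ↔ f.den σ < e.den σ := by
  rw [den]; split_ifs <;> omega

theorem den_eq_eq_zero (σ : Store) (e f : Ex) :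
    (Ex.op .eq e f).den σ = 0 ↔ e.den σ ≠ f.den σ := by
  rw [den]; split_ifs <;> omega

theorem den_mul_eq_zero (σ : Store) (e f : Ex) :
    (Ex.op .mul e f).den σ = 0 ↔ e.den σ = 0 ∨ f.den σ = 0 := by
  rw [den]; exact mul_eq_zero

end Ex

/-- A word length `w` and a memory of `m` words, with `rows` words for each array, such that
all integers of absolute value at most `big` fit into a word. -/
structure Machine where
  w : ℕ
  m : ℕ
  rows : ℕ
  big : ℤ
  hrows : stride * rows ≤ m
  hbig : stride * rows ≤ big
  hpos : 1 ≤ big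
  hstride : (stride : ℤ) ≤ big
  fits : ∀ z : ℤ, -big ≤ z → z ≤ big → FitsWord w z

variable {C : Machine}

namespace Ex

/-- The evaluation of an expression does not fault. -/
def ok (C : Machine) (σ : Store) : Ex → Prop
  | .lit z => -C.big ≤ z ∧ z ≤ C.big
  | .reg _ => True
  | .arr _ e => e.ok C σ ∧ 0 ≤ e.den σ ∧ e.den σ < C.rows
  -- For raw addresses this asks for more than lying in the memory; it is enough because raw
  -- accesses only concern the input and output cells.
  | .raw e => e.ok C σ ∧ 0 ≤ e.den σ ∧ e.den σ < C.rows
  | .op .add e f => e.ok C σ ∧ f.ok C σ ∧ -C.big ≤ e.den σ + f.den σ ∧ e.den σ + f.den σ ≤ C.big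
  | .op .sub e f => e.ok C σ ∧ f.ok C σ ∧ -C.big ≤ e.den σ - f.den σ ∧ e.den σ - f.den σ ≤ C.big
  | .op .mul e f => e.ok C σ ∧ f.ok C σ ∧ -C.big ≤ e.den σ * f.den σ ∧ e.den σ * f.den σ ≤ C.big
  | .op .div e f => e.ok C σ ∧ f.ok C σ ∧ 0 < f.den σ ∧ -C.big ≤ e.den σ / f.den σ ∧
      e.den σ / f.den σ ≤ C.big
  | .op .mod e f => e.ok C σ ∧ f.ok C σ ∧ 0 < f.den σ ∧ f.den σ ≤ C.big
  | .op .inv e f => e.ok C σ ∧ f.ok C σ ∧ 1 ≤ f.den σ ∧ f.den σ ≤ C.big ∧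
      Int.gcd (e.den σ) (f.den σ) = 1
  | .op .lt e f => e.ok C σ ∧ f.ok C σ
  | .op .le e f => e.ok C σ ∧ f.ok C σ
  | .op .eq e f => e.ok C σ ∧ f.ok C σ

theorem toWord_eq {z : ℤ} (h : -C.big ≤ z) (h' : z ≤ C.big) : toWord C.w z = some z := by
  simp [toWord, C.fits z h h']

/-- The address is less than `stride * C.rows`, and this number is bounded both by the size of the
memory and by `C.big`. -/
theorem eval_addr {σ : Store} {e : Expr} {i : ℤ} (b : Arr)
    (he : e.eval C.w C.m σ.toState = some i) (h0 : 0 ≤ i) (h1 : i < C.rows) :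
    (Expr.bin .add (.bin .mul (.const stride) e) (.const b.ctorIdx)).eval C.w C.m σ.toState =
      some (stride * i + b.ctorIdx) ∧
      toAddr C.m (stride * i + b.ctorIdx) = some (stride * i + b.ctorIdx).toNat := by
  have hb := b.ctorIdx_lt
  have hr := C.hrows; have hg := C.hbig; have hs := C.hstride
  have hm : (stride : ℤ) * C.rows ≤ C.m := by exact_mod_cast hr
  simp only [stride] at *
  constructor
  · simp only [Expr.eval, he, Option.bind_some, Op.eval]
    rw [toWord_eq (C := C) (by omega) (by omega)]
    simp only [Option.bind_some]
    rw [toWord_eq (C := C) (by push_cast; omega) (by push_cast; omega)]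
    simp only [Option.bind_some]
    rw [toWord_eq (C := C) (by omega) (by omega)]
    simp only [Option.bind_some]
    rw [toWord_eq (C := C) (by push_cast; omega) (by push_cast; omega)]
  · simp only [toAddr]; rw [if_pos]; push_cast; omega

/-- This is what `ok` is made for: it keeps the result of every operation within `C.big`, hence the
partial evaluation agrees with the total function `den`, and later proofs only deal with integers.
-/
theorem eval_compile {σ : Store} {e : Ex} (h : e.ok C σ) :
    e.compile.eval C.w C.m σ.toState = some (e.den σ) := by
  induction e with
  | lit z => exact toWord_eq h.1 h.2
  | reg x => simp [compile, Expr.eval, den, Store.toState_reg]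
  | arr b e ih =>
    obtain ⟨h1, h2, h3⟩ := h
    obtain ⟨ha, hb⟩ := eval_addr b (ih h1) h2 h3
    rw [compile, Expr.eval, ha, Option.bind_some, hb]
    have : (((stride : ℤ) * e.den σ + b.ctorIdx).toNat : ℤ) = stride * e.den σ + b.ctorIdx := by
      simp only [stride]; push_cast; omega
    simp only [Option.map_some, den, Store.toState, this, Store.rawGet_arr]
  | raw e ih =>
    obtain ⟨h1, h2, h3⟩ := h
    rw [compile, Expr.eval, ih h1, Option.bind_some]
    have hr := C.hrows
    have h4 : e.den σ < C.m := by
      have hm : (stride : ℤ) * C.rows ≤ C.m := by exact_mod_cast hr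
      simp only [stride] at *; omega
    simp only [toAddr, h2, h4, and_self, if_true, Option.map_some, den, Store.toState]
    rw [Int.toNat_of_nonneg h2]
  | op o e f ihe ihf =>
    have hp := C.hpos
    cases o
    all_goals
      rw [compile, Expr.eval, ihe h.1, Option.bind_some, ihf (by first | exact h.2.1 | exact h.2),
        Option.bind_some]
      simp only [Op.eval, den]
    · exact toWord_eq h.2.2.1 h.2.2.2
    · exact toWord_eq h.2.2.1 h.2.2.2
    · exact toWord_eq h.2.2.1 h.2.2.2
    · have := h.2.2.1
      rw [if_neg (by omega)]; exact toWord_eq h.2.2.2.1 h.2.2.2.2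
    · have := h.2.2.1; have h4 := h.2.2.2
      rw [if_neg (by omega)]
      have := Int.emod_nonneg (e.den σ) (b := f.den σ) (by omega)
      have := Int.emod_lt_of_pos (e.den σ) h.2.2.1
      exact toWord_eq (by omega) (by omega)
    · have h3 := h.2.2.1; have h4 := h.2.2.2.1
      rw [if_pos ⟨h3, h.2.2.2.2⟩]
      have := Int.emod_nonneg (Int.gcdA (e.den σ) (f.den σ)) (b := f.den σ) (by omega)
      have := Int.emod_lt_of_pos (Int.gcdA (e.den σ) (f.den σ)) (b := f.den σ) (by omega)
      exact toWord_eq (by omega) (by omega)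
    all_goals
      split_ifs <;> exact toWord_eq (by omega) (by omega)

end Ex

/-- Structured programs over named registers and arrays. -/
inductive Cd
  | skip
  | set (x : Reg) (e : Ex)
  | put (b : Arr) (i e : Ex)
  | rawPut (i e : Ex)
  | seq (c d : Cd)
  | ite (e : Ex) (c d : Cd)
  | loop (e : Ex) (c : Cd)

infixr:60 " ;; " => Cd.seq
infix:62 " ::= " => Cd.set

namespace Cd

def compile : Cd → Prog
  | .skip => .skip
  | .set x e => .set x.ctorIdx e.compile
  | .put b i e =>
      .store (.bin .add (.bin .mul (.const stride) i.compile) (.const b.ctorIdx)) e.compile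
  | .rawPut i e => .store i.compile e.compile
  | .seq c d => .seq c.compile d.compile
  | .ite e c d => .cond e.compile c.compile d.compile
  | .loop e c => .loop e.compile c.compile

/-- The registers that a program may change. -/
def wr (x : Reg) : Cd → Bool
  | .skip => false
  | .set y _ => y = x
  | .put _ _ _ => false
  | .rawPut _ _ => false
  | .seq c d => c.wr x || d.wr x
  | .ite _ c d => c.wr x || d.wr x
  | .loop _ c => c.wr x

/-- The arrays that a program may change. -/
def wa (b : Arr) : Cd → Bool
  | .skip => false
  | .set _ _ => false
  | .put c _ _ => c = b
  -- A raw write can hit every array.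
  | .rawPut _ _ => true
  | .seq c d => c.wa b || d.wa b
  | .ite _ c d => c.wa b || d.wa b
  | .loop _ c => c.wa b

end Cd

/-! ### Running times and proof rules for structured programs. -/

/-- Execution of a structured program, with its running time. -/
inductive Run (C : Machine) : Cd → Store → ℕ → Store → Prop
  | skip (σ : Store) : Run C .skip σ 1 σ
  | set {σ : Store} {x : Reg} {e : Ex} (he : e.ok C σ) :
      Run C (.set x e) σ (e.cost + 1) (σ.set x (e.den σ))
  | put {σ : Store} {b : Arr} {i e : Ex} (hi : i.ok C σ) (h0 : 0 ≤ i.den σ)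
      (h1 : i.den σ < C.rows) (he : e.ok C σ) :
      -- Four of the five additional steps compute the address `stride * i + b.ctorIdx`; the fifth
      -- is the write itself.
      Run C (.put b i e) σ (i.cost + e.cost + 5) (σ.put b (i.den σ) (e.den σ))
  | rawPut {σ : Store} {i e : Ex} (hi : i.ok C σ) (h0 : 0 ≤ i.den σ)
      (h1 : i.den σ < C.rows) (he : e.ok C σ) :
      Run C (.rawPut i e) σ (i.cost + e.cost + 1) (σ.rawPut (i.den σ) (e.den σ))
  | seq {c d : Cd} {σ σ' σ'' : Store} {t t' : ℕ} (hc : Run C c σ t σ') (hd : Run C d σ' t' σ'') :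
      Run C (.seq c d) σ (t + t') σ''
  | ite_true {e : Ex} {c d : Cd} {σ σ' : Store} {t : ℕ} (he : e.ok C σ) (hz : e.den σ ≠ 0)
      (hc : Run C c σ t σ') : Run C (.ite e c d) σ (e.cost + 1 + t) σ'
  | ite_false {e : Ex} {c d : Cd} {σ σ' : Store} {t : ℕ} (he : e.ok C σ) (hz : e.den σ = 0)
      (hd : Run C d σ t σ') : Run C (.ite e c d) σ (e.cost + 1 + t) σ'
  | loop_true {e : Ex} {c : Cd} {σ σ' σ'' : Store} {t t' : ℕ} (he : e.ok C σ) (hz : e.den σ ≠ 0)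
      (hc : Run C c σ t σ') (hl : Run C (.loop e c) σ' t' σ'') :
      Run C (.loop e c) σ (e.cost + 1 + t + t') σ''
  | loop_false {e : Ex} {c : Cd} {σ : Store} (he : e.ok C σ) (hz : e.den σ = 0) :
      Run C (.loop e c) σ (e.cost + 1) σ

/-- The step counts agree exactly, so every bound proved for `Run` is a bound for the machine. -/
theorem Run.exec {c : Cd} {σ σ' : Store} {t : ℕ} (h : Run C c σ t σ') :
    Exec C.w C.m c.compile σ.toState t σ'.toState := by
  induction h with
  | skip σ => exact .skip _
  | set he => rw [Store.toState_set]; exact .set (Ex.eval_compile he)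
  | @put σ b i e hi h0 h1 he =>
    obtain ⟨ha, hb⟩ := Ex.eval_addr b (Ex.eval_compile hi) h0 h1
    have h2 : (((stride : ℤ) * i.den σ + b.ctorIdx).toNat : ℤ) =
        stride * i.den σ + b.ctorIdx := by
      simp only [stride]; push_cast; omega
    rw [← Store.rawPut_arr, ← h2, Store.toState_rawPut]
    have := Exec.store ha hb (Ex.eval_compile he)
    have hc : i.cost + e.cost + 5 =
        (Expr.bin .add (.bin .mul (.const stride) i.compile) (.const b.ctorIdx)).cost +
          e.compile.cost + 1 := by
      simp only [Expr.cost, Ex.cost]; omega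
    rw [hc]; exact this
  | @rawPut σ i e hi h0 h1 he =>
    have hr := C.hrows
    have h4 : i.den σ < C.m := by
      have hm : (stride : ℤ) * C.rows ≤ C.m := by exact_mod_cast hr
      simp only [stride] at *; omega
    have hadr : toAddr C.m (i.den σ) = some (i.den σ).toNat := by simp [toAddr, h0, h4]
    have := Exec.store (Ex.eval_compile hi) hadr (Ex.eval_compile he)
    rw [← Store.toState_rawPut, Int.toNat_of_nonneg h0] at this
    exact this
  | seq _ _ ih ih' => exact .seq ih ih'
  | ite_true he hz _ ih => exact .cond_true (Ex.eval_compile he) hz ih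
  | ite_false he hz _ ih => exact .cond_false (hz ▸ Ex.eval_compile he) ih
  | loop_true he hz _ _ ih ih' => exact .loop_true (Ex.eval_compile he) hz ih ih'
  | loop_false he hz => exact .loop_false (hz ▸ Ex.eval_compile he)

/-- The registers and arrays that `c` does not mention as targets are the same in `σ`, `σ'`. -/
structure Frame (c : Cd) (σ σ' : Store) : Prop where
  r : ∀ x, c.wr x = false → σ'.r x = σ.r x
  a : ∀ b, c.wa b = false → σ'.a b = σ.a b

theorem Frame.refl (c : Cd) (σ : Store) : Frame c σ σ := ⟨fun _ _ => rfl, fun _ _ => rfl⟩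

theorem Frame.trans {c : Cd} {σ σ' σ'' : Store} (h : Frame c σ σ') (h' : Frame c σ' σ'') :
    Frame c σ σ'' :=
  ⟨fun x hx => (h'.r x hx).trans (h.r x hx), fun x hx => (h'.a x hx).trans (h.a x hx)⟩

theorem Frame.mono {c d : Cd} {σ σ' : Store} (h : Frame c σ σ')
    (hr : ∀ x, d.wr x = false → c.wr x = false) (ha : ∀ x, d.wa x = false → c.wa x = false) :
    Frame d σ σ' := ⟨fun x hx => h.r x (hr x hx), fun x hx => h.a x (ha x hx)⟩

theorem Run.frame {c : Cd} {σ σ' : Store} {t : ℕ} (h : Run C c σ t σ') : Frame c σ σ' := by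
  induction h with
  | skip σ => exact .refl _ _
  | @set σ y e he =>
    refine ⟨fun x hx => ?_, fun b _ => rfl⟩
    simp only [Cd.wr, decide_eq_false_iff_not] at hx
    rw [Store.set_r, if_neg (Ne.symm hx)]
  | @put σ b i e _ _ _ _ =>
    refine ⟨fun x hx => rfl, fun b' hb => ?_⟩
    simp only [Cd.wa, decide_eq_false_iff_not] at hb
    exact Store.put_a_ne _ _ _ (Ne.symm hb)
  | rawPut => exact ⟨fun x hx => rfl, fun b hb => by simp [Cd.wa] at hb⟩
  | seq _ _ ih ih' =>
    refine (ih.mono ?_ ?_).trans (ih'.mono ?_ ?_) <;> intro x hx <;>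
      simp only [Cd.wr, Cd.wa, Bool.or_eq_false_iff] at hx <;> tauto
  | ite_true _ _ _ ih =>
    refine ih.mono ?_ ?_ <;> intro x hx <;>
      simp only [Cd.wr, Cd.wa, Bool.or_eq_false_iff] at hx <;> tauto
  | ite_false _ _ _ ih =>
    refine ih.mono ?_ ?_ <;> intro x hx <;>
      simp only [Cd.wr, Cd.wa, Bool.or_eq_false_iff] at hx <;> tauto
  | loop_true _ _ _ _ ih ih' =>
    exact Frame.trans (ih.mono (fun _ h => h) (fun _ h => h)) ih'
  | loop_false => exact .refl _ _

/-- Started in `σ`, the program `c` halts within `b` steps in a state that satisfies `Q`. -/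
def WP (C : Machine) (c : Cd) (Q : Store → Prop) (b : ℕ) (σ : Store) : Prop :=
  ∃ t σ', Run C c σ t σ' ∧ t ≤ b ∧ Q σ'

/-- The new postcondition may use the `Frame`. Therefore a specification need not mention the
registers and arrays that a program leaves alone. -/
theorem WP.mono {c : Cd} {Q Q' : Store → Prop} {b b' : ℕ} {σ : Store} (h : WP C c Q b σ)
    (hb : b ≤ b') (hQ : ∀ σ', Frame c σ σ' → Q σ' → Q' σ') : WP C c Q' b' σ := by
  obtain ⟨t, σ', h1, h2, h3⟩ := h
  exact ⟨t, σ', h1, h2.trans hb, hQ _ h1.frame h3⟩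

theorem WP.seq {c d : Cd} {Q R : Store → Prop} {b b' : ℕ} {σ : Store} (h : WP C c R b σ)
    (h' : ∀ σ', Frame c σ σ' → R σ' → WP C d Q b' σ') : WP C (c ;; d) Q (b + b') σ := by
  obtain ⟨t, σ', h1, h2, h3⟩ := h
  obtain ⟨t', σ'', h4, h5, h6⟩ := h' σ' h1.frame h3
  exact ⟨t + t', σ'', .seq h1 h4, by omega, h6⟩

theorem WP.ite {e : Ex} {c d : Cd} {Q : Store → Prop} {b : ℕ} {σ : Store} (he : e.ok C σ)
    (hc : e.den σ ≠ 0 → WP C c Q b σ) (hd : e.den σ = 0 → WP C d Q b σ) :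
    WP C (.ite e c d) Q (e.cost + 1 + b) σ := by
  by_cases h : e.den σ = 0
  · obtain ⟨t, σ', h1, h2, h3⟩ := hd h
    exact ⟨_, σ', .ite_false he h h1, by omega, h3⟩
  · obtain ⟨t, σ', h1, h2, h3⟩ := hc h
    exact ⟨_, σ', .ite_true he h h1, by omega, h3⟩

namespace Cd

/-- The final state of a program without loops. -/
def fin (σ : Store) : Cd → Store
  | .skip => σ
  | .set x e => σ.set x (e.den σ)
  | .put b i e => σ.put b (i.den σ) (e.den σ)
  | .rawPut i e => σ.rawPut (i.den σ) (e.den σ)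
  | .seq c d => d.fin (c.fin σ)
  | .ite e c d => if e.den σ ≠ 0 then c.fin σ else d.fin σ
  | .loop _ _ => σ

/-- A program without loops does not fault. -/
def ok (C : Machine) (σ : Store) : Cd → Prop
  | .skip => True
  | .set _ e => e.ok C σ
  | .put _ i e => i.ok C σ ∧ e.ok C σ ∧ 0 ≤ i.den σ ∧ i.den σ < C.rows
  | .rawPut i e => i.ok C σ ∧ e.ok C σ ∧ 0 ≤ i.den σ ∧ i.den σ < C.rows
  | .seq c d => c.ok C σ ∧ d.ok C (c.fin σ)
  | .ite e c d => e.ok C σ ∧ (e.den σ ≠ 0 → c.ok C σ) ∧ (e.den σ = 0 → d.ok C σ)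
  | .loop _ _ => False

/-- A bound for the running time of a program without loops. -/
def bound : Cd → ℕ
  | .skip => 1
  | .set _ e => e.cost + 1
  | .put _ i e => i.cost + e.cost + 5
  | .rawPut i e => i.cost + e.cost + 1
  | .seq c d => c.bound + d.bound
  | .ite e c d => e.cost + 1 + max c.bound d.bound
  | .loop _ _ => 0

end Cd

/-- Programs without loops are executed symbolically: the simplifier computes `ok` and `fin`, and
linear arithmetic usually remains. -/
theorem WP.straight {c : Cd} {Q : Store → Prop} {b : ℕ} {σ : Store} (h : c.ok C σ)
    (hQ : Q (c.fin σ)) (hb : c.bound ≤ b) : WP C c Q b σ := by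
  suffices H : ∀ c : Cd, ∀ σ, c.ok C σ → ∃ t ≤ c.bound, Run C c σ t (c.fin σ) by
    obtain ⟨t, ht, hr⟩ := H c σ h
    exact ⟨t, _, hr, ht.trans hb, hQ⟩
  intro c
  induction c with
  | skip => exact fun σ _ => ⟨1, le_rfl, .skip _⟩
  | set x e => exact fun σ h => ⟨_, le_rfl, .set h⟩
  | put b i e => exact fun σ h => ⟨_, le_rfl, .put h.1 h.2.2.1 h.2.2.2 h.2.1⟩
  | rawPut i e => exact fun σ h => ⟨_, le_rfl, .rawPut h.1 h.2.2.1 h.2.2.2 h.2.1⟩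
  | seq c d ihc ihd =>
    intro σ h
    obtain ⟨t, ht, hr⟩ := ihc σ h.1
    obtain ⟨t', ht', hr'⟩ := ihd _ h.2
    exact ⟨_, add_le_add ht ht', .seq hr hr'⟩
  | ite e c d ihc ihd =>
    intro σ h
    by_cases hz : e.den σ = 0
    · obtain ⟨t, ht, hr⟩ := ihd σ (h.2.2 hz)
      refine ⟨e.cost + 1 + t, ?_, ?_⟩
      · simp only [Cd.bound]; omega
      · rw [Cd.fin, if_neg (by simpa using hz)]; exact .ite_false h.1 hz hr
    · obtain ⟨t, ht, hr⟩ := ihc σ (h.2.1 hz)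
      refine ⟨e.cost + 1 + t, ?_, ?_⟩
      · simp only [Cd.bound]; omega
      · rw [Cd.fin, if_pos hz]; exact .ite_true h.1 hz hr
  | loop e c => exact fun σ h => h.elim

/-- Loops, with an invariant `I` and a potential `Φ` that pays for the running time. -/
theorem WP.loop {e : Ex} {c : Cd} {σ : Store} (I : Store → Prop) (Φ : Store → ℕ) (h0 : I σ)
    (hok : ∀ σ', Frame c σ σ' → I σ' → e.ok C σ')
    (hstep : ∀ σ', Frame c σ σ' → I σ' → e.den σ' ≠ 0 →
      ∃ b, WP C c (fun σ'' => I σ'' ∧ b + e.cost + 1 + Φ σ'' ≤ Φ σ') b σ') :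
    WP C (.loop e c) (fun σ' => I σ' ∧ e.den σ' = 0) (Φ σ + e.cost + 1) σ := by
  -- Induction on a bound for the potential. Every iteration pays at least one step for the test, so
  -- the potential decreases strictly and termination follows as well.
  suffices H : ∀ N σ', Frame c σ σ' → I σ' → Φ σ' ≤ N →
      WP C (.loop e c) (fun σ' => I σ' ∧ e.den σ' = 0) (Φ σ' + e.cost + 1) σ' from
    H _ σ (.refl _ _) h0 le_rfl
  intro N
  induction N with
  | zero =>
    intro σ' hF hI hN
    by_cases hz : e.den σ' = 0
    · exact ⟨_, σ', .loop_false (hok _ hF hI) hz, by omega, hI, hz⟩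
    · obtain ⟨b, t, σ'', _, _, _, hb⟩ := hstep _ hF hI hz
      omega
  | succ N ih =>
    intro σ' hF hI hN
    by_cases hz : e.den σ' = 0
    · exact ⟨_, σ', .loop_false (hok _ hF hI) hz, by omega, hI, hz⟩
    · obtain ⟨b, t, σ'', hr, ht, hI', hb⟩ := hstep _ hF hI hz
      obtain ⟨t', σ₃, hr', ht', hQ⟩ := ih σ'' (hF.trans hr.frame) hI' (by omega)
      exact ⟨_, σ₃, .loop_true (hok _ hF hI) hz hr hr', by omega, hQ⟩

/-- `for x := lo, …, hi - 1 do c`. -/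
def Cd.for (x : Reg) (lo hi : Ex) (c : Cd) : Cd :=
  .set x lo ;; .loop (.op .lt x hi) (c ;; .set x (x + 1))

/-- The cost may depend on the iteration, which is needed for amortized bounds. The body does not
write the counter, and `hi` keeps its value in all states that occur, so the number of iterations is
known in advance. -/
theorem WP.for {x : Reg} {lo hi : Ex} {c : Cd} {σ : Store} {a b : ℕ} (I : ℕ → Store → Prop)
    (cost : ℕ → ℕ) (hab : a ≤ b) (hlo : lo.ok C σ) (hlo' : lo.den σ = a)
    (hx : c.wr x = false)
    (hhi : ∀ σ', Frame (Cd.for x lo hi c) σ σ' → hi.ok C σ' ∧ hi.den σ' = b)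
    (hb : (b : ℤ) ≤ C.big)
    (h0 : I a (σ.set x a))
    (hstep : ∀ k σ', a ≤ k → k < b → Frame (Cd.for x lo hi c) σ σ' → σ'.r x = k → I k σ' →
      WP C c (fun σ'' => I (k + 1) (σ''.set x (k + 1))) (cost k) σ') :
    WP C (Cd.for x lo hi c) (fun σ' => I b σ' ∧ σ'.r x = b)
      (∑ k ∈ Finset.Ico a b, (cost k + hi.cost + 10) + lo.cost + hi.cost + 5) σ := by
  have hc1 : (Ex.op .lt x hi).cost = hi.cost + 2 := by
    simp only [Ex.cost, Ex.compile, Expr.cost]; omega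
  have hc2 : (Ex.reg x + 1 : Ex).cost = 3 := rfl
  have h1 : WP C (.set x lo) (fun σ' => σ' = σ.set x a) (lo.cost + 1) σ :=
    ⟨_, _, .set hlo, le_rfl, by rw [hlo']⟩
  refine (WP.seq (b' := ∑ k ∈ Finset.Ico a b, (cost k + hi.cost + 10) + hi.cost + 3) h1 ?_).mono
    (by omega) (fun _ _ h => h)
  rintro _ hF0 rfl
  have hF0' : Frame (Cd.for x lo hi c) σ (σ.set x a) := by
    refine hF0.mono ?_ ?_ <;> intro y hy <;>
      simp only [Cd.for, Cd.wr, Cd.wa, Bool.or_eq_false_iff] at hy <;> tauto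
  have hF1 : ∀ σ', Frame (c ;; .set x (x + 1)) (σ.set x a) σ' →
      Frame (Cd.for x lo hi c) σ σ' := by
    intro σ' h
    refine hF0'.trans (h.mono ?_ ?_) <;> intro y hy <;>
      simp only [Cd.for, Cd.wr, Cd.wa, Bool.or_eq_false_iff] at hy ⊢ <;> tauto
  refine (WP.loop (C := C) (e := .op .lt x hi) (c := c ;; .set x (x + 1))
    (fun σ' => ∃ k : ℕ, a ≤ k ∧ k ≤ b ∧ σ'.r x = k ∧ I k σ')
    (fun σ' => ∑ k ∈ Finset.Ico (σ'.r x).toNat b, (cost k + hi.cost + 10))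
    ⟨a, le_rfl, hab, by simp, h0⟩ ?_ ?_).mono ?_ ?_
  · intro σ' hF _
    exact ⟨trivial, (hhi _ (hF1 _ hF)).1⟩
  · rintro σ' hF ⟨k, hak, hkb, hxk, hI⟩ hz
    have hden := (hhi _ (hF1 _ hF)).2
    have hkb' : k < b := by
      by_contra hh
      apply hz
      rw [Ex.den_lt_eq_zero, hden]; change (b : ℤ) ≤ σ'.r x; omega
    refine ⟨cost k + 4, ?_⟩
    refine WP.seq (hstep k σ' hak hkb' (hF1 _ hF) hxk hI) ?_
    intro σ'' hF2 hI2
    have hxk2 : σ''.r x = k := by rw [hF2.r x hx, hxk]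
    have hd : (Ex.reg x + 1 : Ex).den σ'' = k + 1 := by
      change σ''.r x + 1 = _; rw [hxk2]
    have hpos := C.hpos
    refine ⟨_, _, .set ?_, by rw [hc2], ?_⟩
    · refine ⟨trivial, ⟨?_, ?_⟩, ?_, ?_⟩
      · omega
      · omega
      · change -C.big ≤ σ''.r x + 1; omega
      · change σ''.r x + 1 ≤ C.big; omega
    · rw [hd]
      refine ⟨⟨k + 1, by omega, by omega, by simp, hI2⟩, ?_⟩
      rw [hc1, hxk, Store.set_r_same, Int.toNat_natCast]
      have : ((k : ℤ) + 1).toNat = k + 1 := by omega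
      rw [this, Finset.sum_eq_sum_Ico_succ_bot hkb']
      omega
  · rw [hc1, Store.set_r_same, Int.toNat_natCast]; omega
  · rintro σ' hF ⟨⟨k, hak, hkb, hxk, hI⟩, hz⟩
    have hden := (hhi _ (hF1 _ (hF.mono (fun _ h => h) (fun _ h => h)))).2
    rw [Ex.den_lt_eq_zero, hden] at hz
    change (b : ℤ) ≤ σ'.r x at hz
    have : k = b := by omega
    subst this
    exact ⟨hI, hxk⟩

-- Simplification rules for expressions and programs.

infix:64 " ≺ " => Ex.op Op.lt
infix:64 " ≼ " => Ex.op Op.le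
infix:64 " ≐ " => Ex.op Op.eq

namespace Ex

variable (σ : Store) (e f : Ex)

@[simp] theorem den_zero : (0 : Ex).den σ = 0 := rfl
@[simp] theorem den_one : (1 : Ex).den σ = 1 := rfl
@[simp] theorem den_two : (2 : Ex).den σ = 2 := rfl
@[simp] theorem den_lit (z : ℤ) : (Ex.lit z).den σ = z := rfl
@[simp] theorem den_reg (x : Reg) : (Ex.reg x).den σ = σ.r x := rfl
@[simp] theorem den_arr (b : Arr) : (Ex.arr b e).den σ = σ.a b (e.den σ) := rfl
@[simp] theorem den_raw : (Ex.raw e).den σ = σ.rawGet (e.den σ) := rfl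
@[simp] theorem den_add : (e + f).den σ = e.den σ + f.den σ := rfl
@[simp] theorem den_sub : (e - f).den σ = e.den σ - f.den σ := rfl
@[simp] theorem den_mul : (e * f).den σ = e.den σ * f.den σ := rfl
@[simp] theorem den_div : (e / f).den σ = e.den σ / f.den σ := rfl
@[simp] theorem den_mod : (e % f).den σ = e.den σ % f.den σ := rfl
@[simp] theorem den_inv :
    (Ex.op .inv e f).den σ = Int.gcdA (e.den σ) (f.den σ) % f.den σ := rfl
@[simp] theorem den_lt : (e ≺ f).den σ = if e.den σ < f.den σ then 1 else 0 := rfl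
@[simp] theorem den_le : (e ≼ f).den σ = if e.den σ ≤ f.den σ then 1 else 0 := rfl
@[simp] theorem den_eq : (e ≐ f).den σ = if e.den σ = f.den σ then 1 else 0 := rfl

theorem bounds_of_small {z : ℤ} (h : -19 ≤ z) (h' : z ≤ 19) : -C.big ≤ z ∧ z ≤ C.big := by
  have := C.hstride
  simp only [stride, Nat.cast_ofNat] at this
  omega
@[simp] theorem ok_zero : (0 : Ex).ok C σ := bounds_of_small (by decide) (by decide)
@[simp] theorem ok_one : (1 : Ex).ok C σ := bounds_of_small (by decide) (by decide)
@[simp] theorem ok_two : (2 : Ex).ok C σ := bounds_of_small (by decide) (by decide)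
@[simp] theorem ok_lit (z : ℤ) : (Ex.lit z).ok C σ ↔ -C.big ≤ z ∧ z ≤ C.big := Iff.rfl
@[simp] theorem ok_reg (x : Reg) : (Ex.reg x).ok C σ ↔ True := Iff.rfl
@[simp] theorem ok_arr (b : Arr) : (Ex.arr b e).ok C σ ↔
    e.ok C σ ∧ 0 ≤ e.den σ ∧ e.den σ < C.rows := Iff.rfl
@[simp] theorem ok_raw : (Ex.raw e).ok C σ ↔
    e.ok C σ ∧ 0 ≤ e.den σ ∧ e.den σ < C.rows := Iff.rfl
@[simp] theorem ok_add : (e + f).ok C σ ↔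
    e.ok C σ ∧ f.ok C σ ∧ -C.big ≤ e.den σ + f.den σ ∧ e.den σ + f.den σ ≤ C.big := Iff.rfl
@[simp] theorem ok_sub : (e - f).ok C σ ↔
    e.ok C σ ∧ f.ok C σ ∧ -C.big ≤ e.den σ - f.den σ ∧ e.den σ - f.den σ ≤ C.big := Iff.rfl
@[simp] theorem ok_mul : (e * f).ok C σ ↔
    e.ok C σ ∧ f.ok C σ ∧ -C.big ≤ e.den σ * f.den σ ∧ e.den σ * f.den σ ≤ C.big := Iff.rfl
@[simp] theorem ok_div : (e / f).ok C σ ↔ e.ok C σ ∧ f.ok C σ ∧ 0 < f.den σ ∧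
    -C.big ≤ e.den σ / f.den σ ∧ e.den σ / f.den σ ≤ C.big := Iff.rfl
@[simp] theorem ok_mod : (e % f).ok C σ ↔ e.ok C σ ∧ f.ok C σ ∧ 0 < f.den σ ∧
    f.den σ ≤ C.big := Iff.rfl
@[simp] theorem ok_inv : (Ex.op .inv e f).ok C σ ↔ e.ok C σ ∧ f.ok C σ ∧ 1 ≤ f.den σ ∧
    f.den σ ≤ C.big ∧ Int.gcd (e.den σ) (f.den σ) = 1 := Iff.rfl
@[simp] theorem ok_lt : (e ≺ f).ok C σ ↔ e.ok C σ ∧ f.ok C σ := Iff.rfl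
@[simp] theorem ok_le : (e ≼ f).ok C σ ↔ e.ok C σ ∧ f.ok C σ := Iff.rfl
@[simp] theorem ok_eq : (e ≐ f).ok C σ ↔ e.ok C σ ∧ f.ok C σ := Iff.rfl

end Ex

namespace Cd

@[simp] theorem fin_skip (σ : Store) : Cd.skip.fin σ = σ := rfl
@[simp] theorem fin_set (σ : Store) (x : Reg) (e : Ex) :
    (x ::= e).fin σ = σ.set x (e.den σ) := rfl
@[simp] theorem fin_put (σ : Store) (b : Arr) (i e : Ex) :
    (Cd.put b i e).fin σ = σ.put b (i.den σ) (e.den σ) := rfl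
@[simp] theorem fin_seq (σ : Store) (c d : Cd) : (c ;; d).fin σ = d.fin (c.fin σ) := rfl
@[simp] theorem ok_skip (σ : Store) : Cd.skip.ok C σ ↔ True := Iff.rfl
@[simp] theorem ok_set (σ : Store) (x : Reg) (e : Ex) : (x ::= e).ok C σ ↔ e.ok C σ := Iff.rfl
@[simp] theorem ok_put (σ : Store) (b : Arr) (i e : Ex) : (Cd.put b i e).ok C σ ↔
    i.ok C σ ∧ e.ok C σ ∧ 0 ≤ i.den σ ∧ i.den σ < C.rows := Iff.rfl
@[simp] theorem ok_seq (σ : Store) (c d : Cd) :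
    (c ;; d).ok C σ ↔ c.ok C σ ∧ d.ok C (c.fin σ) := Iff.rfl
@[simp] theorem ok_ite (σ : Store) (e : Ex) (c d : Cd) : (Cd.ite e c d).ok C σ ↔
    e.ok C σ ∧ (e.den σ ≠ 0 → c.ok C σ) ∧ (e.den σ = 0 → d.ok C σ) := Iff.rfl

end Cd

theorem Machine.rows_le_big (C : Machine) : (C.rows : ℤ) ≤ C.big := by
  have := C.hbig
  simp only [stride] at this
  push_cast at this
  omega

theorem WP.forC {x : Reg} {lo hi : Ex} {c : Cd} {σ : Store} {a b K B : ℕ} {Q : Store → Prop}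
    (I : ℕ → Store → Prop) (hab : a ≤ b) (hlo : lo.ok C σ) (hlo' : lo.den σ = a)
    (hx : c.wr x = false)
    (hhi : ∀ σ', Frame (Cd.for x lo hi c) σ σ' → hi.ok C σ' ∧ hi.den σ' = b)
    (hb : (b : ℤ) ≤ C.big)
    (h0 : I a (σ.set x a))
    (hstep : ∀ k σ', a ≤ k → k < b → Frame (Cd.for x lo hi c) σ σ' → σ'.r x = k → I k σ' →
      WP C c (fun σ'' => I (k + 1) (σ''.set x (k + 1))) K σ')
    (hB : (b - a) * (K + hi.cost + 10) + lo.cost + hi.cost + 5 ≤ B)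
    (hQ : ∀ σ', Frame (Cd.for x lo hi c) σ σ' → I b σ' → σ'.r x = b → Q σ') :
    WP C (Cd.for x lo hi c) Q B σ :=
  (WP.for I (fun _ => K) hab hlo hlo' hx hhi hb h0 hstep).mono (by simpa using hB)
    fun σ' hF h => hQ σ' hF h.1 h.2

theorem Frame.left {c d : Cd} {σ σ' : Store} (h : Frame c σ σ') : Frame (c ;; d) σ σ' :=
  h.mono (fun x hx => by simp only [Cd.wr, Bool.or_eq_false_iff] at hx; exact hx.1)
    (fun x hx => by simp only [Cd.wa, Bool.or_eq_false_iff] at hx; exact hx.1)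

theorem Frame.right {c d : Cd} {σ σ' : Store} (h : Frame d σ σ') : Frame (c ;; d) σ σ' :=
  h.mono (fun x hx => by simp only [Cd.wr, Bool.or_eq_false_iff] at hx; exact hx.2)
    (fun x hx => by simp only [Cd.wa, Bool.or_eq_false_iff] at hx; exact hx.2)

/-! ### Lists in arrays, linked lists, and sorting nodes by value. -/

/-- The first `len` entries of an array. -/
def lst (f : ℤ → ℤ) (len : ℕ) : List ℤ := (List.range len).map fun i : ℕ => f i

@[simp] theorem lst_length (f : ℤ → ℤ) (len : ℕ) : (lst f len).length = len := by simp [lst]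

theorem lst_succ (f : ℤ → ℤ) (len : ℕ) : lst f (len + 1) = lst f len ++ [f len] := by
  simp [lst, List.range_succ]

theorem mem_lst {f : ℤ → ℤ} {len : ℕ} {x : ℤ} : x ∈ lst f len ↔ ∃ i < len, f i = x := by
  simp [lst]

theorem lst_congr {f g : ℤ → ℤ} {len : ℕ} (h : ∀ i : ℕ, i < len → f i = g i) :
    lst f len = lst g len := by
  refine List.ext_getElem (by simp [lst]) fun i h1 h2 => ?_
  simpa [lst] using h i (by simpa [lst] using h1)

@[simp] theorem lst_getElem (f : ℤ → ℤ) (len i : ℕ) (h : i < (lst f len).length) :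
    (lst f len)[i] = f i := by simp only [lst, List.getElem_map, List.getElem_range]

theorem lst_ne_of_nodup {f : ℤ → ℤ} {len i j : ℕ} (h : (lst f len).Nodup) (hi : i < len)
    (hj : j < len) (hij : i ≠ j) : f i ≠ f j := by
  intro he
  have := (List.Nodup.getElem_inj_iff h (i := i) (j := j) (hi := by simpa) (hj := by simpa)).1
    (by simpa using he)
  exact hij this

theorem lst_update (f : ℤ → ℤ) (len : ℕ) (z : ℤ) :
    lst (Function.update f len z) len = lst f len :=
  lst_congr fun i hi => Function.update_of_ne (by omega) _ _

/-- The array `A` and the register `len` represent the list `xs`. -/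
def Holds (σ : Store) (A : Arr) (len : Reg) (xs : List ℤ) : Prop :=
  σ.r len = xs.length ∧ lst (σ.a A) xs.length = xs

theorem Holds.append {σ σ' : Store} {A : Arr} {len : Reg} {xs : List ℤ} {x : ℤ}
    (h : Holds σ A len xs) (hr : σ'.r len = xs.length + 1)
    (ha : σ'.a A = Function.update (σ.a A) xs.length x) : Holds σ' A len (xs ++ [x]) := by
  refine ⟨by simpa using hr, ?_⟩
  rw [List.length_append, List.length_singleton, lst_succ, ha, lst_update, h.2]
  simp

/-- Starting from `h` and following `nxt` one meets the list `l`, and then `-1`. -/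
def Chain (nxt : ℤ → ℤ) : ℤ → List ℤ → Prop
  | h, [] => h = -1
  | h, x :: l => h = x ∧ Chain nxt (nxt x) l

theorem Chain.congr {nxt nxt' : ℤ → ℤ} {l : List ℤ} {h : ℤ} (hc : Chain nxt h l)
    (he : ∀ x ∈ l, nxt' x = nxt x) : Chain nxt' h l := by
  induction l generalizing h with
  | nil => exact hc
  | cons x l ih =>
    refine ⟨hc.1, ?_⟩
    rw [he x (by simp)]
    exact ih hc.2 fun y hy => he y (by simp [hy])

/-- The elements of `ys` with value `v`, in reverse order. -/
def cls (V : ℤ → ℤ) (ys : List ℤ) (v : ℤ) : List ℤ := (ys.filter fun x => V x = v).reverse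

theorem mem_cls {V : ℤ → ℤ} {ys : List ℤ} {v x : ℤ} : x ∈ cls V ys v ↔ x ∈ ys ∧ V x = v := by
  simp [cls]

theorem cls_append_singleton (V : ℤ → ℤ) (ys : List ℤ) (y v : ℤ) :
    cls V (ys ++ [y]) v = if V y = v then y :: cls V ys v else cls V ys v := by
  by_cases h : V y = v <;> simp [cls, List.filter_append, h]

theorem cls_nodup {V : ℤ → ℤ} {ys : List ℤ} (h : ys.Nodup) (v : ℤ) : (cls V ys v).Nodup := by
  rw [cls, List.nodup_reverse]; exact h.filter _

theorem cls_length_le (V : ℤ → ℤ) (ys : List ℤ) (v : ℤ) : (cls V ys v).length ≤ ys.length := by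
  simp only [cls, List.length_reverse]; exact List.length_filter_le _ _

/-- The linked lists of the elements of `ys` by value, and the lengths of these lists. -/
def Buckets (σ : Store) (p : ℕ) (ys : List ℤ) : Prop :=
  ∀ v : ℤ, 0 ≤ v → v < p → Chain (σ.a .nxt) (σ.a .head v) (cls (σ.a .val) ys v) ∧
    σ.a .cnt v = (cls (σ.a .val) ys v).length

/-- Sort the nodes listed in the array `A` into linked lists by their value. -/
def bucket (A : Arr) (len : Reg) : Cd :=
  .for .bi 0 (.reg .p) (.put .head (.reg .bi) (.lit (-1)) ;; .put .cnt (.reg .bi) 0) ;;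
  .for .bi 0 (.reg len) (
    .bx ::= .arr A (.reg .bi) ;;
    .bk ::= .arr .val (.reg .bx) ;;
    .put .nxt (.reg .bx) (.arr .head (.reg .bk)) ;;
    .put .head (.reg .bk) (.reg .bx) ;;
    .put .cnt (.reg .bk) (.arr .cnt (.reg .bk) + 1))

theorem wp_bucket {A : Arr} {len : Reg} {σ : Store} {p L : ℕ}
    (hA : A ≠ .head ∧ A ≠ .cnt ∧ A ≠ .nxt) (hlen : len ≠ .bi ∧ len ≠ .bx ∧ len ≠ .bk)
    (hp : σ.r .p = p) (hL : σ.r len = L) (hpr : p ≤ C.rows) (hLr : L ≤ C.rows)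
    (hys : ∀ x ∈ lst (σ.a A) L, 0 ≤ x ∧ x < C.rows ∧ 0 ≤ σ.a .val x ∧ σ.a .val x < p)
    (hnd : (lst (σ.a A) L).Nodup) :
    WP C (bucket A len) (fun σ' => Buckets σ' p (lst (σ.a A) L)) (100 * (p + L) + 100) σ := by
  have hb1 := C.rows_le_big; have hb2 := C.hstride
  simp only [stride, Nat.cast_ofNat] at hb2
  refine (WP.seq (R := fun σ' => ∀ v : ℤ, 0 ≤ v → v < p → σ'.a .head v = -1 ∧ σ'.a .cnt v = 0)
    (b := 50 * p + 20) (b' := 80 * L + 20) ?_ ?_).mono (by omega) (fun _ _ h => h)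
  · refine WP.forC (a := 0) (b := p) (K := 30)
      (fun k σ' => ∀ v : ℤ, 0 ≤ v → v < k → σ'.a .head v = -1 ∧ σ'.a .cnt v = 0)
      (by omega) (by simp) (by simp) rfl ?_ (by omega) ?_ ?_ ?_
      (fun _ _ h _ => h)
    · intro σ' hF
      simp [hF.r .p rfl, hp]
    · intro v h0 h1; omega
    · intro k σ' _ hk hF hr hI
      refine WP.straight ?_ ?_ (Nat.le_of_ble_eq_true rfl)
      · simp [hr]; omega
      · intro v h0 h1
        have := hI v h0
        by_cases hv : v = k
        · simp [hr, hv]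
        · simpa [hr, hv] using this (by omega)
    · show (p - 0) * (30 + 1 + 10) + 1 + 1 + 5 ≤ _; omega
  · intro σ₁ hF₁ h₁
    have hA1 : σ₁.a A = σ.a A := hF₁.a A (by
      simp only [Cd.for, Cd.wa]; simp [Ne.symm hA.1, Ne.symm hA.2.1])
    have hval : σ₁.a .val = σ.a .val := hF₁.a .val rfl
    have hlenw : Cd.wr len (Cd.for .bi 0 (.reg len) (
        .bx ::= .arr A (.reg .bi) ;; .bk ::= .arr .val (.reg .bx) ;;
        .put .nxt (.reg .bx) (.arr .head (.reg .bk)) ;;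
        .put .head (.reg .bk) (.reg .bx) ;;
        .put .cnt (.reg .bk) (.arr .cnt (.reg .bk) + 1))) = false := by
      simp [Cd.for, Cd.wr, hlen.1.symm, hlen.2.1.symm, hlen.2.2.symm]
    refine WP.forC (a := 0) (b := L) (K := 60)
      (fun k σ' => Buckets σ' p (lst (σ.a A) k))
      (by omega) (by simp) (by simp) rfl ?_ (by omega) ?_ ?_ ?_
      (fun _ _ h _ => h)
    · intro σ' hF
      have h2 : σ₁.r len = σ.r len := hF₁.r len (by simp [Cd.for, Cd.wr, hlen.1.symm])
      simp [hF.r len hlenw, h2, hL]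
    · intro v h0 h1
      simpa [lst, cls, Chain] using h₁ v h0 h1
    · intro k σ' _ hk hF hr hI
      have hA2 : σ'.a A = σ.a A := (hF.a A (by
        simp [Cd.for, Cd.wa, hA.1.symm, hA.2.1.symm, hA.2.2.symm])).trans hA1
      have hval2 : σ'.a .val = σ.a .val := (hF.a .val rfl).trans hval
      obtain ⟨hx0, hx1, hv0, hv1⟩ := hys (σ.a A k) (mem_lst.2 ⟨k, hk, rfl⟩)
      -- The inserted node occurs in no chain built so far, so changing its link leaves these chains
      -- intact.
      have hnew : σ.a A k ∉ lst (σ.a A) k := by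
        intro hm
        obtain ⟨i, hi, he⟩ := mem_lst.1 hm
        exact lst_ne_of_nodup hnd (by omega) hk (by omega) he
      have hcnt := (hI _ hv0 hv1).2
      have hcl := cls_length_le (σ'.a .val) (lst (σ.a A) k) (σ.a .val (σ.a A k))
      rw [lst_length] at hcl
      refine WP.straight ?_ ?_ (Nat.le_of_ble_eq_true rfl)
      · simp [hr, hA2, hval2, hcnt]
        rw [hval2] at hcl
        omega
      · intro v h0 h1
        rw [lst_succ]
        simp only [Cd.fin_seq, Cd.fin_set, Cd.fin_put, Ex.den_reg, Ex.den_arr, Store.set_r, hr,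
          Store.set_a, Store.put_r, reduceCtorEq, if_true, if_false, Store.put_a, hA2, hval2,
          Ex.den_add, Ex.den_one, cls_append_singleton]
        obtain ⟨hch, hcn⟩ := hI v h0 h1
        rw [hval2] at hch hcn
        have hch' := hch.congr (nxt' := Function.update (σ'.a .nxt) (σ.a A k)
          (σ'.a .head (σ.a .val (σ.a A k)))) (by
            intro x hx
            rw [Function.update_of_ne]
            rintro rfl
            exact hnew (mem_cls.1 hx).1)
        by_cases hv : σ.a .val (σ.a A k) = v
        · subst hv
          exact ⟨by simpa [Chain] using hch', by simp [hcn]⟩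
        · have hv' : v ≠ σ.a .val (σ.a A k) := fun e => hv e.symm
          exact ⟨by simpa [hv, hv'] using hch', by simp [hv, hv', hcn]⟩
    · show (L - 0) * (60 + 1 + 10) + 1 + 1 + 5 ≤ _; omega

/-- The elements of `ys` with values in `[lo, hi)` of multiplicity less than `thr`, ordered by
their values. -/
def flat (V : ℤ → ℤ) (ys : List ℤ) (thr : ℤ) (lo hi : ℕ) : List ℤ :=
  (List.Ico lo hi).flatMap fun v : ℕ =>
    if ((cls V ys v).length : ℤ) < thr then cls V ys v else []

section flat

variable {V : ℤ → ℤ} {ys : List ℤ} {thr : ℤ} {lo hi : ℕ}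

theorem flat_self : flat V ys thr lo lo = [] := by simp [flat]

theorem flat_succ (h : lo ≤ hi) : flat V ys thr lo (hi + 1) = flat V ys thr lo hi ++
    if ((cls V ys hi).length : ℤ) < thr then cls V ys hi else [] := by
  simp only [flat, List.Ico.succ_top h, List.flatMap_append, List.flatMap_singleton]

theorem mem_flat {x : ℤ} : x ∈ flat V ys thr lo hi ↔ x ∈ ys ∧ (lo : ℤ) ≤ V x ∧ V x < hi ∧
    ((cls V ys (V x)).length : ℤ) < thr := by
  simp only [flat, List.mem_flatMap, List.Ico.mem]
  constructor
  · rintro ⟨v, ⟨h1, h2⟩, h3⟩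
    split_ifs at h3 with h4
    · obtain ⟨h5, h6⟩ := mem_cls.1 h3
      rw [h6]; exact ⟨h5, by omega, by omega, h4⟩
    · simp at h3
  · rintro ⟨h1, h2, h3, h4⟩
    obtain ⟨v, hv⟩ := Int.eq_ofNat_of_zero_le (show 0 ≤ V x by omega)
    rw [hv] at h2 h3 h4
    refine ⟨v, by omega, ?_⟩
    rw [if_pos h4]
    exact mem_cls.2 ⟨h1, hv⟩

theorem flat_sorted : (flat V ys thr lo hi).Pairwise (fun x y => V x ≤ V y) := by
  by_cases h : lo ≤ hi
  · induction hi, h using Nat.le_induction with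
    | base => simp [flat_self]
    | succ hi h ih =>
      rw [flat_succ h, List.pairwise_append]
      refine ⟨ih, ?_, ?_⟩
      · split_ifs with h1
        · refine List.pairwise_of_forall_mem_list fun x hx y hy => ?_
          rw [(mem_cls.1 hx).2, (mem_cls.1 hy).2]
        · simp
      · intro x hx y hy
        have := (mem_flat.1 hx).2.2.1
        split_ifs at hy with h1
        · rw [(mem_cls.1 hy).2]; omega
        · simp at hy
  · rw [flat, List.Ico.eq_nil_of_le (by omega)]; simp

theorem flat_nodup (h : ys.Nodup) : (flat V ys thr lo hi).Nodup := by
  by_cases hl : lo ≤ hi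
  · induction hi, hl using Nat.le_induction with
    | base => simp [flat_self]
    | succ hi hl ih =>
      rw [flat_succ hl, List.nodup_append]
      refine ⟨ih, ?_, ?_⟩
      · split_ifs
        · exact cls_nodup h _
        · simp
      · intro x hx y hy
        have := (mem_flat.1 hx).2.2.1
        split_ifs at hy with h1
        · have h2 := (mem_cls.1 hy).2
          rintro rfl
          omega
        · simp at hy
  · rw [flat, List.Ico.eq_nil_of_le (by omega)]; simp

theorem flat_length_le (h : ys.Nodup) : (flat V ys thr lo hi).length ≤ ys.length :=
  ((flat_nodup h).subperm fun _ hx => (mem_flat.1 hx).1).length_le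

theorem flat_length (h : lo ≤ hi) : (flat V ys thr lo hi).length = ∑ v ∈ Finset.Ico lo hi,
    if ((cls V ys v).length : ℤ) < thr then (cls V ys v).length else 0 := by
  induction hi, h using Nat.le_induction with
  | base => simp [flat_self]
  | succ hi h ih =>
    rw [flat_succ h, List.length_append, ih, Finset.sum_Ico_succ_top h]
    split_ifs <;> simp

end flat

/-- List in `x` the nodes with values in `[lo, hi)` of multiplicity less than `thr`. -/
def flatten (lo hi thr : Ex) : Cd :=
  .xlen ::= 0 ;;
  .for .fi lo hi (
    .ite (.arr .cnt (.reg .fi) ≺ thr) (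
      .fx ::= .arr .head (.reg .fi) ;;
      .loop (0 ≼ .reg .fx) (
        .put .x (.reg .xlen) (.reg .fx) ;;
        .xlen ::= .reg .xlen + 1 ;;
        .fx ::= .arr .nxt (.reg .fx)))
    .skip)

/-- The time is linear although the loops are nested: the iteration for a value is charged the
length of its class if the class is listed, and by `flat_length` these lengths add up to the length
of the list produced. -/
theorem wp_flatten {lo hi thr : Ex} {σ : Store} {p a b : ℕ} {T : ℤ} {ys : List ℤ}
    (hab : a ≤ b) (hbp : b ≤ p) (hpr : p ≤ C.rows) (hlen : ys.length ≤ C.rows)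
    (hlo : ∀ σ', Frame (flatten lo hi thr) σ σ' → lo.ok C σ' ∧ lo.den σ' = a)
    (hhi : ∀ σ', Frame (flatten lo hi thr) σ σ' → hi.ok C σ' ∧ hi.den σ' = b)
    (hthr : ∀ σ', Frame (flatten lo hi thr) σ σ' → thr.ok C σ' ∧ thr.den σ' = T)
    (hys : ∀ x ∈ ys, 0 ≤ x ∧ x < C.rows) (hnd : ys.Nodup) (hB : Buckets σ p ys)
    (hcost : lo.cost + hi.cost + thr.cost ≤ 20) :
    WP C (flatten lo hi thr)
      (fun σ' => Holds σ' .x .xlen (flat (σ.a .val) ys T a b))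
      (100 * (p + ys.length) + 100) σ := by
  have hb1 := C.rows_le_big; have hb2 := C.hstride
  simp only [stride, Nat.cast_ofNat] at hb2
  have hflen := flat_length_le (V := σ.a .val) (thr := T) (lo := a) (hi := b) hnd
  refine (WP.seq (R := fun σ' => σ' = σ.set .xlen 0) (b := 2)
    (b' := 100 * (p + ys.length) + 90) ?_ ?_).mono (by omega) (fun _ _ h => h)
  · exact WP.straight (by simp) rfl (Nat.le_of_ble_eq_true rfl)
  rintro _ hF₁ rfl
  have hF₁' : Frame (flatten lo hi thr) σ (σ.set .xlen 0) := hF₁.left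
  have hl := hlo _ hF₁'
  refine (WP.for (a := a) (b := b)
    (fun k σ' => Holds σ' .x .xlen (flat (σ.a .val) ys T a k))
    (fun k => thr.cost + 20 + 30 *
      (if ((cls (σ.a .val) ys k).length : ℤ) < T then (cls (σ.a .val) ys k).length else 0))
    hab hl.1 hl.2 rfl (fun σ' hF => hhi σ' (hF₁'.trans hF.right)) (by omega) ?_ ?_).mono ?_
    (fun _ _ h => h.1)
  · simp [Holds, flat_self, lst]
  · intro k σ' hk hkb hF hr hI
    have hth := hthr σ' (hF₁'.trans hF.right)
    have hcnt : σ'.a .cnt = σ.a .cnt := hF.a .cnt rfl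
    have hhead : σ'.a .head = σ.a .head := hF.a .head rfl
    have hnxt : σ'.a .nxt = σ.a .nxt := hF.a .nxt rfl
    obtain ⟨hch, hcn⟩ := hB k (by omega) (by omega)
    have hc : (Ex.arr .cnt (.reg .fi) ≺ thr).cost = thr.cost + 7 := by
      simp only [Ex.cost, Ex.compile, Expr.cost]; omega
    rw [flat_succ hk]
    refine (WP.ite (b := 12 + 30 *
      (if ((cls (σ.a .val) ys k).length : ℤ) < T then (cls (σ.a .val) ys k).length else 0))
      ?_ ?_ ?_).mono (by rw [hc]; omega) (fun _ _ h => h)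
    · simp [hr, hth.1]; omega
    · intro hne
      have hlt : ((cls (σ.a .val) ys k).length : ℤ) < T := by
        by_contra hh
        apply hne
        rw [Ex.den_lt_eq_zero, hth.2]
        simp [hr, hcnt, hcn]; omega
      simp only [hlt, if_true]
      have htot := flat_length_le (V := σ.a .val) (thr := T) (lo := a) (hi := k + 1) hnd
      rw [flat_succ hk, if_pos hlt, List.length_append] at htot
      refine (WP.seq (R := fun σ'' => σ'' = σ'.set .fx (σ.a .head k)) (b := 7)
        (b' := 5 + 30 * (cls (σ.a .val) ys k).length) ?_ ?_).mono (by omega) (fun _ _ h => h)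
      · exact WP.straight (by simp [hr]; omega) (by simp [hr, hhead])
          (Nat.le_of_ble_eq_true rfl)
      rintro _ hF₂ rfl
      set fk := flat (σ.a .val) ys T a k with hfk
      set ck := cls (σ.a .val) ys k with hck
      refine (WP.loop
        (fun s => ∃ l₁ l₂, ck = l₁ ++ l₂ ∧ Holds s .x .xlen (fk ++ l₁) ∧
          Chain (σ.a .nxt) (s.r .fx) l₂)
        (fun s => 30 * (fk.length + ck.length - (s.r .xlen).toNat)) ?_ ?_ ?_).mono ?_ ?_
      · exact ⟨[], ck, rfl, by simpa [Holds] using hI, by simpa using hch⟩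
      · intro s _ _; simp
      · rintro s hFs ⟨l₁, l₂, he, hH, hC⟩ hz
        have hnx : s.a .nxt = σ.a .nxt := by rw [hFs.a .nxt rfl]; simpa using hnxt
        cases l₂ with
        | nil =>
          exfalso; apply hz
          rw [Ex.den_le_eq_zero]
          simp only [Chain] at hC
          simp [hC]
        | cons y l₂ =>
          have hy := hys y (mem_cls.1 (show y ∈ cls (σ.a .val) ys k by rw [← hck, he]; simp)).1
          simp only [Chain] at hC
          have hlen' : ck.length = l₁.length + l₂.length + 1 := by rw [he]; simp; omega
          have hxl := hH.1
          rw [List.length_append] at hxl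
          push_cast at hxl
          refine ⟨25, WP.straight ?_ ?_ (Nat.le_of_ble_eq_true rfl)⟩
          · simp [hxl, hC.1]; omega
          · refine ⟨⟨l₁ ++ [y], l₂, by simp [he], ?_, ?_⟩, ?_⟩
            · rw [← List.append_assoc]
              refine hH.append ?_ ?_
              · simp [hxl]
              · simp [hxl, hC.1]
            · simpa [hnx, hC.1] using hC.2
            · have : (0 ≼ Ex.reg .fx).cost = 3 := rfl
              simp [hxl, this]
              omega
      · have : (0 ≼ Ex.reg .fx).cost = 3 := rfl
        have h1 := hI.1
        simp [h1, this]
        omega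
      · rintro s hFs ⟨⟨l₁, l₂, he, hH, hC⟩, hz⟩
        have : l₂ = [] := by
          cases l₂ with
          | nil => rfl
          | cons y l₂ =>
            have hy := hys y (mem_cls.1 (show y ∈ cls (σ.a .val) ys k by rw [← hck, he]; simp)).1
            simp only [Chain] at hC
            rw [Ex.den_le_eq_zero] at hz
            simp at hz
            omega
        subst this
        rw [List.append_nil] at he
        rw [he]
        simpa [Holds] using hH
    · intro he
      have hlt : ¬ ((cls (σ.a .val) ys k).length : ℤ) < T := by
        rw [Ex.den_lt_eq_zero, hth.2] at he
        simp [hr, hcnt, hcn] at he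
        omega
      simp only [hlt, if_false, List.append_nil]
      exact WP.straight (by simp) (by simpa [Holds] using hI) (by simp [Cd.bound])
  · have h1 : ∀ k ∈ Finset.Ico a b, thr.cost + 20 + 30 *
        (if ((cls (σ.a .val) ys k).length : ℤ) < T then (cls (σ.a .val) ys k).length else 0) +
        hi.cost + 10 ≤ 50 + 30 *
        (if ((cls (σ.a .val) ys k).length : ℤ) < T then (cls (σ.a .val) ys k).length else 0) := by
      intro k _; omega
    have h2 := Finset.sum_le_sum h1
    have h3 : ∑ k ∈ Finset.Ico a b, (50 + 30 *
        (if ((cls (σ.a .val) ys k).length : ℤ) < T then (cls (σ.a .val) ys k).length else 0)) =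
        50 * (b - a) + 30 * (flat (σ.a .val) ys T a b).length := by
      rw [Finset.sum_add_distrib, ← Finset.mul_sum, ← flat_length hab]
      simp [mul_comm]
    omega

/-! ### Trees of differences. -/

/-- Nodes `0, …, nn - 1` with values `V` modulo `p`: the nodes below `2 p - 1` are leaves, and
every other node is the difference of two earlier nodes, which belong to no other node. The
nodes below `3 p - 2` are differences of leaves, and the later ones are not. -/
structure Tree (p nn : ℕ) (L R V : ℤ → ℤ) : Prop where
  val : ∀ x : ℤ, 0 ≤ x → x < nn → 0 ≤ V x ∧ V x < p
  child : ∀ y : ℤ, 2 * (p : ℤ) - 1 ≤ y → y < nn → 0 ≤ L y ∧ L y < y ∧ 0 ≤ R y ∧ R y < y ∧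
    L y ≠ R y ∧ V y ≡ V (R y) - V (L y) [ZMOD p]
  -- This serves to count the selected leaves: a difference of leaves selects exactly one of its two
  -- leaves, whatever its state, whereas a later node only decides about the states of two other
  -- differences.
  level : ∀ y : ℤ, 2 * (p : ℤ) - 1 ≤ y → y < nn →
    (y < 3 * (p : ℤ) - 2 ∧ L y < 2 * (p : ℤ) - 1 ∧ R y < 2 * (p : ℤ) - 1) ∨
    (3 * (p : ℤ) - 2 ≤ y ∧ 2 * (p : ℤ) - 1 ≤ L y ∧ 2 * (p : ℤ) - 1 ≤ R y)
  inj : ∀ y y' : ℤ, 2 * (p : ℤ) - 1 ≤ y → y < y' → y' < nn →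
    L y ≠ L y' ∧ L y ≠ R y' ∧ R y ≠ L y' ∧ R y ≠ R y'

/-- A node that belongs to no later node. -/
def IsRoot (p nn : ℕ) (L R : ℤ → ℤ) (x : ℤ) : Prop :=
  0 ≤ x ∧ x < nn ∧ ∀ y : ℤ, 2 * (p : ℤ) - 1 ≤ y → y < nn → L y ≠ x ∧ R y ≠ x

section

variable {p nn : ℕ} {L R V : ℤ → ℤ} {l r v : ℤ}

theorem Tree.extend (hT : Tree p nn L R V) (hl : IsRoot p nn L R l) (hr : IsRoot p nn L R r)
    (hlr : l ≠ r) (hv0 : 0 ≤ v) (hv1 : v < p) (hv : v ≡ V r - V l [ZMOD p])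
    (hlev : ((nn : ℤ) < 3 * (p : ℤ) - 2 ∧ l < 2 * (p : ℤ) - 1 ∧ r < 2 * (p : ℤ) - 1) ∨
      (3 * (p : ℤ) - 2 ≤ nn ∧ 2 * (p : ℤ) - 1 ≤ l ∧ 2 * (p : ℤ) - 1 ≤ r)) :
    Tree p (nn + 1) (Function.update L nn l) (Function.update R nn r)
      (Function.update V nn v) := by
  have hne : ∀ {f : ℤ → ℤ} {x z : ℤ}, x < nn → Function.update f nn z x = f x :=
    fun h => Function.update_of_ne (by omega) _ _
  constructor
  · intro x h0 h1
    by_cases hx : x = nn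
    · subst hx; simp [hv0, hv1]
    · rw [hne (by omega)]; exact hT.val x h0 (by omega)
  · intro y h0 h1
    by_cases hy : y = nn
    · subst hy
      simp only [Function.update_self]
      rw [hne hl.2.1, hne hr.2.1]
      exact ⟨hl.1, hl.2.1, hr.1, hr.2.1, hlr, hv⟩
    · have := hT.child y h0 (by omega)
      rw [hne (f := L) (by omega), hne (f := R) (by omega), hne (f := V) (by omega),
        hne (by omega), hne (by omega)]
      exact this
  · intro y h0 h1
    by_cases hy : y = nn
    · subst hy; simpa using hlev
    · rw [hne (f := L) (by omega), hne (f := R) (by omega)]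
      exact hT.level y h0 (by omega)
  · intro y y' h0 h1 h2
    rw [hne (f := L) (x := y) (by omega), hne (f := R) (x := y) (by omega)]
    by_cases hy : y' = nn
    · subst hy
      simp only [Function.update_self]
      have h3 := hl.2.2 y h0 h1
      have h4 := hr.2.2 y h0 h1
      exact ⟨h3.1, h4.1, h3.2, h4.2⟩
    · rw [hne (f := L) (by omega), hne (f := R) (by omega)]
      exact hT.inj y y' h0 h1 (by omega)

theorem IsRoot.extend {x : ℤ} (hx : IsRoot p nn L R x) (h1 : x ≠ l) (h2 : x ≠ r) :
    IsRoot p (nn + 1) (Function.update L nn l) (Function.update R nn r) x := by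
  refine ⟨hx.1, by have := hx.2.1; push_cast; omega, fun y h3 h4 => ?_⟩
  by_cases hy : y = nn
  · subst hy; simp [h1.symm, h2.symm]
  · rw [Function.update_of_ne hy, Function.update_of_ne hy]
    exact hx.2.2 y h3 (by push_cast at h4; omega)

theorem Tree.isRoot_new (hT : Tree p nn L R V) (hl : l < nn) (hr : r < nn) :
    IsRoot p (nn + 1) (Function.update L nn l) (Function.update R nn r) nn := by
  refine ⟨by omega, by push_cast; omega, fun y h3 h4 => ?_⟩
  by_cases hy : y = nn
  · subst hy; simp; omega
  · rw [Function.update_of_ne hy, Function.update_of_ne hy]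
    have := hT.child y h3 (by push_cast at h4; omega)
    push_cast at h4
    omega

end

/-- The nodes stored in `σ`; the leaf `lone` is switched on, all other nodes are off, and
register `base` holds the sum of the values of the leaves that are then selected. -/
structure Nodes (p nn : ℕ) (lone : ℤ) (σ : Store) : Prop where
  reg : σ.r .nn = nn
  tree : Tree p nn (σ.a .lft) (σ.a .rgt) (σ.a .val)
  lone_lt : lone < 2 * (p : ℤ) - 1
  root : IsRoot p nn (σ.a .lft) (σ.a .rgt) lone
  st : ∀ x : ℤ, 0 ≤ x → x < nn → σ.a .st x = if x = lone then 1 else 0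
  -- A node hands its state to the right child and the opposite state to the left child. It
  -- therefore contributes the value of its left child, and in addition its own value if it is on.
  -- With all differences that are roots off, the left children and the leaf `lone` remain.
  base : σ.r .base ≡ σ.a .val lone +
    ∑ y ∈ Finset.Ico (2 * p - 1) nn, σ.a .val (σ.a .lft y) [ZMOD p]
  base_lt : 0 ≤ σ.r .base ∧ σ.r .base < p

abbrev Nodes.IsRoot (σ : Store) (p nn : ℕ) (x : ℤ) : Prop :=
  EGZ.IsRoot p nn (σ.a .lft) (σ.a .rgt) x

/-- Create the node `nn` as the difference of `pl` and `pr` with value `pd`, and list it in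
`y`. -/
def newNode : Cd :=
  .put .val (.reg .nn) (.reg .pd) ;;
  .put .lft (.reg .nn) (.reg .pl) ;;
  .put .rgt (.reg .nn) (.reg .pr) ;;
  .put .st (.reg .nn) 0 ;;
  .put .y (.reg .ylen) (.reg .nn) ;;
  .ylen ::= .reg .ylen + 1 ;;
  .base ::= (.reg .base + .arr .val (.reg .pl)) % .reg .p ;;
  .nn ::= .reg .nn + 1

theorem newNode_ok {σ : Store} {p nn : ℕ} {lone : ℤ} (hN : Nodes p nn lone σ)
    (hp : σ.r .p = p) (hp1 : 1 ≤ p) (hpr : 2 * p ≤ C.rows) (hnr : nn < C.rows)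
    (hy0 : 0 ≤ σ.r .ylen) (hy1 : σ.r .ylen < C.rows)
    (hl : Nodes.IsRoot σ p nn (σ.r .pl)) : newNode.ok C σ := by
  have hb1 := C.rows_le_big; have hb2 := C.hstride
  simp only [stride, Nat.cast_ofNat] at hb2
  have h1 := hN.base_lt
  have h2 := hN.reg
  have h3 := hN.tree.val _ hl.1 hl.2.1
  have h4 := hl.1
  have h5 := hl.2.1
  have h6 : σ.r .pl ≠ nn := by omega
  simp [newNode, h2, hp, Function.update_of_ne h6]
  omega

theorem newNode_fin {σ : Store} {p nn : ℕ} {lone : ℤ} (hN : Nodes p nn lone σ)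
    (hp : σ.r .p = p) (hp1 : 1 ≤ p) (hnn : 2 * p - 1 ≤ nn)
    (hl : Nodes.IsRoot σ p nn (σ.r .pl)) (hr : Nodes.IsRoot σ p nn (σ.r .pr))
    (hlr : σ.r .pl ≠ σ.r .pr) (hlo : lone ≠ σ.r .pl) (hlo' : lone ≠ σ.r .pr)
    (hd0 : 0 ≤ σ.r .pd) (hd1 : σ.r .pd < p)
    (hd : σ.r .pd = σ.a .val (σ.r .pr) - σ.a .val (σ.r .pl))
    (hlev : ((nn : ℤ) < 3 * (p : ℤ) - 2 ∧ σ.r .pl < 2 * (p : ℤ) - 1 ∧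
        σ.r .pr < 2 * (p : ℤ) - 1) ∨
      (3 * (p : ℤ) - 2 ≤ nn ∧ 2 * (p : ℤ) - 1 ≤ σ.r .pl ∧ 2 * (p : ℤ) - 1 ≤ σ.r .pr)) :
    Nodes p (nn + 1) lone (newNode.fin σ) := by
  have hreg := hN.reg
  have hfa : ∀ b, (newNode.fin σ).a b =
      if b = .val then Function.update (σ.a b) nn (σ.r .pd) else
      if b = .lft then Function.update (σ.a b) nn (σ.r .pl) else
      if b = .rgt then Function.update (σ.a b) nn (σ.r .pr) else
      if b = .st then Function.update (σ.a b) nn 0 else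
      if b = .y then Function.update (σ.a b) (σ.r .ylen) nn else σ.a b := by
    intro b
    simp only [newNode, Cd.fin_seq, Cd.fin_put, Cd.fin_set, Store.set_a, Store.put_a,
      Store.put_r, Ex.den_reg, hreg, Ex.den_zero]
    cases b <;> simp
  have hval := hfa .val
  have hlft := hfa .lft
  have hrgt := hfa .rgt
  have hst := hfa .st
  simp only [reduceCtorEq, if_true, if_false] at hval hlft hrgt hst
  have hpl : σ.r .pl ≠ nn := by have := hl.2.1; omega
  have hbase : (newNode.fin σ).r .base = (σ.r .base + σ.a .val (σ.r .pl)) % p := by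
    simp [newNode, hreg, hp, Function.update_of_ne hpl]
  have hln : lone ≠ nn := by have := hN.root.2.1; omega
  constructor
  · simp [newNode, hreg]
  · rw [hval, hlft, hrgt]
    exact hN.tree.extend hl hr hlr hd0 hd1 (by rw [hd]) hlev
  · exact hN.lone_lt
  · rw [hlft, hrgt]
    exact hN.root.extend hlo hlo'
  · intro x h0 h1
    rw [hst]
    by_cases hx : x = nn
    · subst hx; simp [hln.symm]
    · rw [Function.update_of_ne hx]; exact hN.st x h0 (by push_cast at h1; omega)
  · rw [hbase, hval, hlft, Finset.sum_Ico_succ_top hnn]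
    rw [Function.update_of_ne hln, Function.update_self, Function.update_of_ne hpl]
    refine (Int.mod_modEq _ _).trans ?_
    rw [← add_assoc]
    refine Int.ModEq.add_right _ (hN.base.trans ?_)
    refine Int.ModEq.add_left _ ?_
    rw [Finset.sum_congr rfl]
    intro y hy
    rw [Finset.mem_Ico] at hy
    have h2 := hN.tree.child y (by omega) (by omega)
    rw [Function.update_of_ne (by omega : (y : ℤ) ≠ nn), Function.update_of_ne (by omega)]
  · rw [hbase]
    exact ⟨Int.emod_nonneg _ (by omega), Int.emod_lt_of_pos _ (by omega)⟩

/-! ### Pairing the entries of a sorted list. -/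

/-- From the list in `x` create the differences, at most `D`, of entries at distance `s`. -/
def pair (len s D : Ex) : Cd :=
  .for .pi 0 (len - s) (
    .pl ::= .arr .x (.reg .pi) ;;
    .pr ::= .arr .x (.reg .pi + s) ;;
    .pd ::= .arr .val (.reg .pr) - .arr .val (.reg .pl) ;;
    .ite (((.reg .pi) / s) % 2 ≐ 0) (.ite (.reg .pd ≼ D) newNode .skip) .skip)

/-- The positions at which `pair` creates a node. -/
def pairIdx (X V : ℤ → ℤ) (s : ℕ) (D : ℤ) (k : ℕ) : List ℕ :=
  -- The list is cut into blocks of length `s`, and a block with an even number is matched with the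
  -- block after it. So no entry takes part in two differences.
  (List.range k).filter fun i : ℕ => i / s % 2 = 0 ∧ V (X (i + s)) - V (X i) ≤ D

theorem pairIdx_succ (X V : ℤ → ℤ) (s : ℕ) (D : ℤ) (k : ℕ) :
    (pairIdx X V s D (k + 1)).length = (pairIdx X V s D k).length +
      if k / s % 2 = 0 ∧ V (X (k + s)) - V (X k) ≤ D then 1 else 0 := by
  rw [pairIdx, List.range_succ, List.filter_append, List.length_append, ← pairIdx,
    List.filter_cons, List.filter_nil]
  split_ifs with h h' h' <;> simp_all

theorem pairIdx_length_le (X V : ℤ → ℤ) (s : ℕ) (D : ℤ) (k : ℕ) :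
    (pairIdx X V s D k).length ≤ k :=
  (List.length_filter_le _ _).trans (by simp)

/-- The result of `pair`: `c` new nodes. -/
structure Paired (p nn c s k : ℕ) (D lone : ℤ) (X : ℤ → ℤ) (σ σ' : Store) : Prop where
  nodes : Nodes p (nn + c) lone σ'
  val : ∀ x : ℤ, x < nn → σ'.a .val x = σ.a .val x
  old : ∀ x, Nodes.IsRoot σ p nn x → 
    (∀ i : ℕ, i < k → i / s % 2 = 0 → x ≠ X i ∧ x ≠ X (i + s)) → Nodes.IsRoot σ' p (nn + c) x
  new : ∀ y : ℤ, nn ≤ y → y < nn + c → Nodes.IsRoot σ' p (nn + c) y ∧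
    ∃ i : ℕ, i < k ∧ i / s % 2 = 0 ∧ σ'.a .lft y = X i ∧ σ'.a .rgt y = X (i + s) ∧
      σ'.a .val y = σ.a .val (X (i + s)) - σ.a .val (X i) ∧ σ'.a .val y ≤ D
  list : ∀ ys, Holds σ .y .ylen ys →
    Holds σ' .y .ylen (ys ++ (List.range c).map fun j : ℕ => ((nn + j : ℕ) : ℤ))

theorem Paired.congr {p nn c s k k' : ℕ} {D lone : ℤ} {X : ℤ → ℤ} {σ σ' σ'' : Store}
    (h : Paired p nn c s k D lone X σ σ') (hk : k ≤ k') (ha : σ''.a = σ'.a)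
    (hnn : σ''.r .nn = σ'.r .nn) (hb : σ''.r .base = σ'.r .base)
    (hy : σ''.r .ylen = σ'.r .ylen) : Paired p nn c s k' D lone X σ σ'' := by
  obtain ⟨⟨h1, h2, h3, h4, h5, h6, h7⟩, h8, h9, h10, h11⟩ := h
  rw [← ha] at h2 h4 h5 h6 h8
  refine ⟨⟨hnn.trans h1, h2, h3, h4, h5, hb ▸ h6, hb ▸ h7⟩, h8, fun x hx hi => ?_,
    fun y hy0 hy1 => ?_, fun ys hys => ?_⟩
  · have := h9 x hx fun i h0 => hi i (by omega)
    simp only [Nodes.IsRoot, ← ha] at this; exact this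
  · obtain ⟨ha1, i, hi, h⟩ := h10 y hy0 hy1
    simp only [Nodes.IsRoot, ← ha] at ha1 h
    exact ⟨ha1, i, by omega, h⟩
  · have := h11 ys hys
    simp only [Holds, ← ha, ← hy] at this
    exact this

theorem Paired.step {p nn c s k : ℕ} {D lone : ℤ} {X : ℤ → ℤ} {σ σ' : Store} {ys : List ℤ}
    (h : Paired p nn c s k D lone X σ σ') (hp : σ'.r .p = p) (hp1 : 1 ≤ p)
    (hnn : 2 * p - 1 ≤ nn)
    (hpl : σ'.r .pl = X k) (hpr : σ'.r .pr = X (k + s))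
    (hpd : σ'.r .pd = σ.a .val (X (k + s)) - σ.a .val (X k))
    (hrl : Nodes.IsRoot σ p nn (X k)) (hrr : Nodes.IsRoot σ p nn (X (k + s)))
    (hkl : ∀ i : ℕ, i < k → i / s % 2 = 0 → X k ≠ X i ∧ X k ≠ X (i + s))
    (hkr : ∀ i : ℕ, i < k → i / s % 2 = 0 → X (k + s) ≠ X i ∧ X (k + s) ≠ X (i + s))
    (hlr : X k ≠ X (k + s)) (hlo : lone ≠ X k) (hlo' : lone ≠ X (k + s))
    (hd0 : 0 ≤ σ'.r .pd) (hd1 : σ'.r .pd < p) (hdD : σ'.r .pd ≤ D) (hev : k / s % 2 = 0)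
    (hlev : (((nn + c : ℕ) : ℤ) < 3 * (p : ℤ) - 2 ∧ X k < 2 * (p : ℤ) - 1 ∧
        X (k + s) < 2 * (p : ℤ) - 1) ∨
      (3 * (p : ℤ) - 2 ≤ (nn + c : ℕ) ∧ 2 * (p : ℤ) - 1 ≤ X k ∧ 2 * (p : ℤ) - 1 ≤ X (k + s)))
    (hpR : 2 * p ≤ C.rows) (hnr : nn + c < C.rows) (hy : Holds σ .y .ylen ys)
    (hyr : ys.length + c < C.rows) :
    newNode.ok C σ' ∧ Paired p nn (c + 1) s (k + 1) D lone X σ (newNode.fin σ') := by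
  have hl : Nodes.IsRoot σ' p (nn + c) (σ'.r .pl) := by rw [hpl]; exact h.old _ hrl hkl
  have hr : Nodes.IsRoot σ' p (nn + c) (σ'.r .pr) := by rw [hpr]; exact h.old _ hrr hkr
  have hH := h.list ys hy
  have hyl : σ'.r .ylen = ys.length + c := by rw [hH.1]; simp
  refine ⟨newNode_ok h.nodes hp hp1 hpR hnr (by omega) (by omega) hl, ?_⟩
  have hVl : σ'.a .val (X k) = σ.a .val (X k) := h.val _ hrl.2.1
  have hVr : σ'.a .val (X (k + s)) = σ.a .val (X (k + s)) := h.val _ hrr.2.1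
  have hN := newNode_fin h.nodes hp hp1 (by omega) hl hr (by rw [hpl, hpr]; exact hlr)
    (by rw [hpl]; exact hlo) (by rw [hpr]; exact hlo') hd0 hd1
    (by rw [hpl, hpr, hVl, hVr]; exact hpd) (by rw [hpl, hpr]; exact hlev)
  have hreg := h.nodes.reg
  have hfa : ∀ b, (newNode.fin σ').a b =
      if b = .val then Function.update (σ'.a b) (nn + c : ℕ) (σ'.r .pd) else
      if b = .lft then Function.update (σ'.a b) (nn + c : ℕ) (X k) else
      if b = .rgt then Function.update (σ'.a b) (nn + c : ℕ) (X (k + s)) else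
      if b = .st then Function.update (σ'.a b) (nn + c : ℕ) 0 else
      if b = .y then Function.update (σ'.a b) (σ'.r .ylen) (nn + c : ℕ) else σ'.a b := by
    intro b
    simp only [newNode, Cd.fin_seq, Cd.fin_put, Cd.fin_set, Store.set_a, Store.put_a,
      Store.put_r, Ex.den_reg, hreg, Ex.den_zero, hpl, hpr]
    cases b <;> simp
  have hval := hfa .val
  have hlft := hfa .lft
  have hrgt := hfa .rgt
  have hyy := hfa .y
  simp only [reduceCtorEq, if_true, if_false] at hval hlft hrgt hyy
  refine ⟨hN, ?_, ?_, ?_, ?_⟩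
  · intro x hx
    rw [hval, Function.update_of_ne (by push_cast; omega)]
    exact h.val x hx
  · intro x hx hi
    have h1 := h.old x hx fun i h0 => hi i (by omega)
    have h2 := hi k (by omega) hev
    rw [Nodes.IsRoot, hlft, hrgt]
    exact h1.extend h2.1 h2.2
  · intro y hy0 hy1
    rw [Nodes.IsRoot, hlft, hrgt, hval]
    by_cases hyc : y = (nn + c : ℕ)
    · subst hyc
      refine ⟨?_, k, by omega, hev, by simp, by simp, by simp [hpd], by simpa using hdD⟩
      have := h.nodes.tree.isRoot_new hl.2.1 hr.2.1
      rw [hpl, hpr] at this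
      exact this
    · have hyn : y < (nn + c : ℕ) := by push_cast at hyc hy1 ⊢; omega
      obtain ⟨h1, i, h2, h3, h4, h5, h6⟩ := h.new y hy0 (by push_cast at hyn; omega)
      rw [Function.update_of_ne hyc, Function.update_of_ne hyc, Function.update_of_ne hyc]
      refine ⟨h1.extend ?_ ?_, i, by omega, h3, h4, h5, h6⟩
      · have := hrl.2.1; omega
      · have := hrr.2.1; omega
  · intro ys' hys'
    have h1 := h.list ys' hys'
    rw [List.range_succ, List.map_append, ← List.append_assoc, List.map_singleton]
    have h2 : σ'.r .ylen = (ys' ++ (List.range c).map fun j : ℕ => ((nn + j : ℕ) : ℤ)).length :=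
      h1.1
    refine h1.append ?_ ?_
    · rw [← h2]
      simp [newNode]
    · rw [hyy, h2]

/-- The program is used once for leaves and afterwards for differences. The alternative `hlev`
states that one call never mixes the two kinds, as the field `level` of `Tree` demands. -/
theorem wp_pair {len s D : Ex} {σ : Store} {p nn N S : ℕ} {Dv lone : ℤ} {ys : List ℤ}
    (hS : 1 ≤ S) (hSN : S ≤ N)
    (hlen : ∀ σ', Frame (pair len s D) σ σ' → len.ok C σ' ∧ len.den σ' = N)
    (hs : ∀ σ', Frame (pair len s D) σ σ' → s.ok C σ' ∧ s.den σ' = S)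
    (hD : ∀ σ', Frame (pair len s D) σ σ' → D.ok C σ' ∧ D.den σ' = Dv)
    (hcost : len.cost + s.cost + D.cost ≤ 20)
    (hN : Nodes p nn lone σ) (hp : σ.r .p = p) (hp1 : 1 ≤ p) (hnn : 2 * p - 1 ≤ nn)
    (hroot : ∀ i : ℕ, i < N → Nodes.IsRoot σ p nn (σ.a .x i) ∧ σ.a .x i ≠ lone)
    (hnd : (lst (σ.a .x) N).Nodup)
    (hsort : ∀ i j : ℕ, i ≤ j → j < N → σ.a .val (σ.a .x i) ≤ σ.a .val (σ.a .x j))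
    (hnr : nn + (N - S) < C.rows) (hNr : N ≤ C.rows) (hpr : 2 * p ≤ C.rows)
    (hy : Holds σ .y .ylen ys) (hyr : ys.length + (N - S) < C.rows)
    (hlev : (nn + (N - S) ≤ 3 * p - 2 ∧ ∀ i : ℕ, i < N → σ.a .x i < 2 * (p : ℤ) - 1) ∨
      (3 * p - 2 ≤ nn ∧ ∀ i : ℕ, i < N → 2 * (p : ℤ) - 1 ≤ σ.a .x i)) :
    WP C (pair len s D)
      (Paired p nn (pairIdx (σ.a .x) (σ.a .val) S Dv (N - S)).length S (N - S) Dv lone (σ.a .x) σ)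
      (200 * N + 50) σ := by
  have hb1 := C.rows_le_big; have hb2 := C.hstride
  simp only [stride, Nat.cast_ofNat] at hb2
  set X := σ.a .x with hX
  set V := σ.a .val with hV
  refine WP.forC (a := 0) (b := N - S) (K := 150)
    (fun k σ' => Paired p nn (pairIdx X V S Dv k).length S k Dv lone X σ σ')
    (by omega) (by simp) (by simp) rfl ?_ (by omega) ?_ ?_ ?_ (fun _ _ h _ => h)
  · intro σ' hF
    obtain ⟨h1, h2⟩ := hlen σ' hF
    obtain ⟨h3, h4⟩ := hs σ' hF
    simp [h1, h2, h3, h4]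
    omega
  · have h0 : (pairIdx X V S Dv 0).length = 0 := by simp [pairIdx]
    rw [h0]
    refine ⟨⟨?_, hN.tree, hN.lone_lt, hN.root, hN.st, ?_, ?_⟩, fun _ _ => rfl,
      fun x h _ => h, fun y _ _ => by omega, fun ys h => ?_⟩
    · simpa using hN.reg
    · simpa using hN.base
    · simpa using hN.base_lt
    · simpa [Holds] using h
  · intro k σ₁ _ hk hF hr hI
    set c := (pairIdx X V S Dv k).length with hc
    have hck : c ≤ k := pairIdx_length_le _ _ _ _ _
    have hX₁ : σ₁.a .x = X := hF.a .x rfl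
    have hp₁ : σ₁.r .p = p := (hF.r .p rfl).trans hp
    obtain ⟨h3, h4⟩ := hs σ₁ hF
    have hra := (hroot k (by omega)).1
    have hrb := (hroot (k + S) (by omega)).1
    have hkS : ((k + S : ℕ) : ℤ) = k + S := by push_cast; rfl
    rw [hkS] at hrb
    have hVa : σ₁.a .val (X k) = V (X k) := hI.val _ hra.2.1
    have hVb : σ₁.a .val (X (k + S)) = V (X (k + S)) := hI.val _ hrb.2.1
    have hra0 := hra.1
    have hra1 := hra.2.1
    have hrb0 := hrb.1
    have hrb1 := hrb.2.1
    have hva : 0 ≤ V (X k) ∧ V (X k) < p := hN.tree.val _ hra.1 hra.2.1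
    have hvb : 0 ≤ V (X (k + S)) ∧ V (X (k + S)) < p := hN.tree.val _ hrb.1 hrb.2.1
    have hso := hsort k (k + S) (by omega) (by omega)
    rw [hkS] at hso
    set σ₂ := ((σ₁.set .pl (X k)).set .pr (X (k + S))).set .pd (V (X (k + S)) - V (X k)) with hσ₂
    have hinc := pairIdx_succ X V S Dv k
    rw [← hc] at hinc
    refine (WP.seq (R := fun σ' => σ' = (σ₁.set .pl (X k))) (b := 7)
      (WP.straight (by simp [hr]; omega) (by simp [hr, hX₁]) (Nat.le_of_ble_eq_true rfl))
      (b' := 140) ?_).mono (by omega) (fun _ _ h => h)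
    rintro _ hF₁ rfl
    obtain ⟨h3', h4'⟩ := hs (σ₁.set .pl (X k)) (hF.trans (hF₁.mono (by
      intro x hx; simp only [Cd.for, Cd.wr, Bool.or_eq_false_iff] at hx ⊢; exact hx.2.1.1)
      (fun _ _ => rfl)))
    refine (WP.seq (R := fun σ' => σ' = (σ₁.set .pl (X k)).set .pr (X (k + S)))
      (b := s.cost + 9)
      (WP.straight (by simp [hr, h3', h4']; omega) (by simp [hr, h4', hX₁]) (by
        change 1 + (1 + s.cost + 1) + 1 + 1 + 1 + 1 + 1 ≤ _
        omega))
      (b' := 110) ?_).mono (by omega) (fun _ _ h => h)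
    rintro _ hF₂ rfl
    refine (WP.seq (R := fun σ' => σ' = σ₂) (b := 14)
      (WP.straight (by simp [hVa, hVb]; omega) (by simp [hVa, hVb, hσ₂])
        (Nat.le_of_ble_eq_true rfl))
      (b' := 96) ?_).mono (by omega) (fun _ _ h => h)
    rintro _ hF₃ rfl
    have hP : Paired p nn c S k Dv lone X σ σ₂ := hI.congr le_rfl rfl rfl rfl rfl
    have hσ₂r : σ₂.r .pi = k := by simp [hσ₂, hr]
    have hFb : ∀ x, (pair len s D).wr x = false → σ₂.r x = σ₁.r x := by
      intro x hx
      simp only [pair, Cd.for, Cd.wr, Bool.or_eq_false_iff, decide_eq_false_iff_not] at hx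
      simp [hσ₂, Ne.symm hx.2.1.1, Ne.symm hx.2.1.2.1, Ne.symm hx.2.1.2.2.1]
    obtain ⟨hs1, hs2⟩ := hs σ₂ (hF.trans ⟨hFb, fun _ _ => rfl⟩)
    obtain ⟨hD1, hD2⟩ := hD σ₂ (hF.trans ⟨hFb, fun _ _ => rfl⟩)
    have hc1 : (((Ex.reg .pi) / s) % 2 ≐ 0).cost = s.cost + 6 := by
      change 1 + s.cost + 1 + 1 + 1 + 1 + 1 = _; omega
    have hc2 : (Ex.reg .pd ≼ D).cost = D.cost + 2 := by change 1 + D.cost + 1 = _; omega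
    have hdiv : ((k : ℤ) / S % 2 = 0) ↔ k / S % 2 = 0 := by norm_cast
    have hdb := Int.ediv_nonneg (show (0 : ℤ) ≤ k by omega) (show (0 : ℤ) ≤ S by omega)
    have hdb' := Int.ediv_le_self (S : ℤ) (show (0 : ℤ) ≤ k by omega)
    have hskip : ¬ (k / S % 2 = 0 ∧ V (X (k + S)) - V (X k) ≤ Dv) →
        WP C .skip (fun σ'' => Paired p nn (pairIdx X V S Dv (k + 1)).length S (k + 1) Dv lone X σ
          (σ''.set .pi (k + 1))) 1 σ₂ := by
      intro hh
      rw [hinc, if_neg hh]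
      exact WP.straight (by simp) (hP.congr (by omega) rfl rfl rfl rfl) le_rfl
    refine (WP.ite (b := 65 + D.cost) ?_ ?_ ?_).mono (by rw [hc1]; omega) (fun _ _ h => h)
    · simp [hs1, hs2, hσ₂r]
      omega
    · intro he
      rw [Ne, Ex.den_eq_eq_zero] at he
      simp [hs2, hσ₂r, hdiv] at he
      refine (WP.ite (b := 60) ?_ ?_ ?_).mono (by rw [hc2]; omega) (fun _ _ h => h)
      · simp [hD1]
      · intro hle
        rw [Ne, Ex.den_le_eq_zero, hD2] at hle
        simp [hσ₂] at hle
        rw [hinc, if_pos ⟨he, by omega⟩]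
        have hne : ∀ i j : ℕ, i < N → j < N → i ≠ j → X i ≠ X j := fun i j hi hj hij =>
          lst_ne_of_nodup hnd hi hj hij
        have hcs : ∀ i : ℕ, ((i : ℤ) + S) = ((i + S : ℕ) : ℤ) := fun i => by push_cast; rfl
        -- The partner of a position in an even block lies in an odd block, where no difference
        -- begins.
        have hodd : ∀ i : ℕ, i / S % 2 = 0 → i + S ≠ k := by
          rintro i hi rfl
          rw [Nat.add_div_right _ (by omega)] at he
          omega
        obtain ⟨h1, h2⟩ := hP.step (C := C) (ys := ys) (by simpa [hσ₂] using hp₁) hp1 hnn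
          (by simp [hσ₂]) (by simp [hσ₂]) (by simp [hσ₂, hV]) hra hrb
          (fun i hi hi2 => ⟨hne _ _ (by omega) (by omega) (by omega), by
            rw [hcs]; exact hne _ _ (by omega) (by omega) (hodd i hi2).symm⟩)
          (fun i hi hi2 => by
            rw [hcs, hcs]
            exact ⟨hne _ _ (by omega) (by omega) (by omega),
              hne _ _ (by omega) (by omega) (by omega)⟩)
          (by rw [hcs]; exact hne _ _ (by omega) (by omega) (by omega))
          (hroot k (by omega)).2.symm (by rw [hcs]; exact (hroot (k + S) (by omega)).2.symm)
          (by simp [hσ₂]; omega) (by simp [hσ₂]; omega) (by simp [hσ₂]; omega) he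
          (by
            rcases hlev with ⟨h5, h6⟩ | ⟨h5, h6⟩
            · have h7 := h6 k (by omega)
              have h8 := h6 (k + S) (by omega)
              rw [hkS] at h8
              left; refine ⟨by omega, h7, h8⟩
            · have h7 := h6 k (by omega)
              have h8 := h6 (k + S) (by omega)
              rw [hkS] at h8
              right; refine ⟨by omega, h7, h8⟩)
          hpr (by omega) hy (by omega)
        exact WP.straight h1 (h2.congr le_rfl rfl rfl rfl rfl) (Nat.le_of_ble_eq_true rfl)
      · intro hle
        rw [Ex.den_le_eq_zero, hD2] at hle
        simp [hσ₂] at hle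
        exact (hskip (by omega)).mono (by omega) (fun _ _ h => h)
    · intro he
      rw [Ex.den_eq_eq_zero] at he
      simp only [Ex.den_mod, Ex.den_div, Ex.den_reg, hs2, hσ₂r, Ex.den_two, Ex.den_zero, ne_eq,
        hdiv] at he
      exact (hskip (by omega)).mono (by omega) (fun _ _ h => h)
  · have : (len - s : Ex).cost = len.cost + s.cost + 1 := rfl
    have h1 : (0 : Ex).cost = 1 := rfl
    rw [this, h1]
    have : (N - S - 0) * (150 + (len.cost + s.cost + 1) + 10) ≤ N * 190 :=
      Nat.mul_le_mul (by omega) (by omega)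
    omega

/-! ### The arithmetic of adding a class of equal values to an interval. -/

/-- Every integer of an interval is a combination of the coprime numbers `b` and `e` with
coefficients from given intervals. -/
theorem exists_combination {b e L m T : ℤ} (hb : 1 ≤ b) (he : 1 ≤ e) (heL : e ≤ L + 1)
    (hco : IsCoprime e b) (hm : 2 * b ≤ m + 2) (h0 : 0 ≤ T)
    (h1 : T ≤ b * L + (m - 2 * b + 2) * e) :
    ∃ i j : ℤ, 0 ≤ i ∧ i ≤ L ∧ 0 ≤ j ∧ j ≤ m ∧ (b - 1) * e + T = b * i + e * j := by
  obtain ⟨r, s, hrs⟩ := hco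
  set W := (b - 1) * e + T with hW
  -- The coefficient of `e` is taken as large as possible: among the `b` consecutive integers up to
  -- `J` one satisfies the necessary congruence modulo `b`. It is `J - d`, since `r` inverts `e`
  -- modulo `b`.
  set J := min (W / e) m with hJ
  have hWe : W / e * e ≤ W := Int.ediv_mul_le W (by omega)
  have hWe' : W < (W / e + 1) * e := Int.lt_ediv_add_one_mul_self W (by omega)
  have hJ0 : b - 1 ≤ W / e := by
    rw [Int.le_ediv_iff_mul_le (by omega)]; omega
  set d := (J - W * r) % b with hd
  have hd0 : 0 ≤ d := Int.emod_nonneg _ (by omega)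
  have hd1 : d < b := Int.emod_lt_of_pos _ (by omega)
  have hdvd : b ∣ W - e * (J - d) := by
    have h2 : b ∣ (J - W * r) - d := Int.dvd_self_sub_emod
    have h3 : W - e * (J - d) = b * (W * s) - e * ((J - W * r) - d) := by
      have : W = W * (r * e + s * b) := by rw [hrs, mul_one]
      linear_combination this
    rw [h3]
    exact dvd_sub (dvd_mul_right _ _) (h2.mul_left _)
  obtain ⟨i, hi⟩ := hdvd
  have hge : 0 ≤ b * i := by
    rw [← hi]
    have : e * (J - d) ≤ e * (W / e) := mul_le_mul_of_nonneg_left (by omega) (by omega)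
    linarith
  -- The coefficient of `e` is at least `J - (b - 1)`. If `J = W / e`, what remains of `W` is less
  -- than `e * b ≤ (L + 1) * b`. If `J = m`, it is at most `T - (m - 2 * b + 2) * e ≤ b * L`.
  have hlt : b * i < b * (L + 1) := by
    rw [← hi]
    rcases le_total (W / e) m with h | h
    · have hJe : J = W / e := by omega
      have h4 : e * (W / e - (b - 1)) ≤ e * (J - d) :=
        mul_le_mul_of_nonneg_left (by omega) (by omega)
      have h5 : e * b ≤ (L + 1) * b := mul_le_mul_of_nonneg_right heL (by omega)
      nlinarith
    · have hJe : J = m := by omega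
      have h4 : e * (m - (b - 1)) ≤ e * (J - d) :=
        mul_le_mul_of_nonneg_left (by omega) (by omega)
      nlinarith
  refine ⟨i, J - d, ?_, ?_, by omega, by omega, by linarith⟩
  · exact nonneg_of_mul_nonneg_right hge (by omega)
  · have := lt_of_mul_lt_mul_left hlt (by omega); omega

/-- `z` is modulo `p` at distance at most `L + 1` from `0`. -/
def Near (p : ℕ) (L z : ℤ) : Prop := z % p ≤ L + 1 ∨ p - z % p ≤ L + 1

theorem near_of_modEq {p : ℕ} {L z e : ℤ} (hp : 0 < p) (he : 0 ≤ e) (heL : e ≤ L + 1)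
    (h : z ≡ e [ZMOD p] ∨ z ≡ -e [ZMOD p]) : Near p L z := by
  have h0 := Int.emod_nonneg z (b := p) (by omega)
  have h1 := Int.emod_lt_of_pos z (b := p) (by omega)
  by_cases hep : (p : ℤ) ≤ e
  · left; omega
  rcases h with h | h
  · left; rw [h, Int.emod_eq_of_lt he (by omega)]; exact heL
  · by_cases he0 : e = 0
    · left; rw [h, he0]; simp; omega
    · right
      rw [h, ← Int.add_emod_right, Int.emod_eq_of_lt (by omega) (by omega)]
      omega

/-- Dirichlet's theorem for `u / p`: with `n` the integer part of `p / (L + 1)` there are `k ≤ n`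
and `j` such that `k * u - p * j` has absolute value at most `p / (n + 1)`, which is less than `L +
1`. -/
theorem exists_near {p : ℕ} (hp : 0 < p) (u : ℤ) {L : ℤ} (hL : 0 ≤ L) (hLp : L < p) :
    ∃ b : ℤ, 1 ≤ b ∧ b * (L + 1) ≤ p ∧ Near p L (b * u) := by
  have hn : 0 < ((p : ℤ) / (L + 1)).toNat := by
    have := (Int.le_ediv_iff_mul_le (show 0 < L + 1 by omega) (a := 1) (b := p)).2 (by omega)
    omega
  obtain ⟨j, k, hk0, hk1, hjk⟩ := Real.exists_int_int_abs_mul_sub_le ((u : ℝ) / p) hn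
  have hdiv0 : 0 ≤ (p : ℤ) / (L + 1) := Int.ediv_nonneg (by omega) (by omega)
  have hkle : k ≤ (p : ℤ) / (L + 1) := by omega
  refine ⟨k, by omega, ?_, ?_⟩
  · rwa [Int.le_ediv_iff_mul_le (by omega)] at hkle
  · have hpR : (0 : ℝ) < p := by exact_mod_cast hp
    have hlt : (p : ℤ) < ((p : ℤ) / (L + 1) + 1) * (L + 1) :=
      Int.lt_ediv_add_one_mul_self _ (by omega)
    set n := ((p : ℤ) / (L + 1)).toNat with hnn
    have hnZ : ((n : ℤ)) = (p : ℤ) / (L + 1) := by omega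
    rw [← hnZ] at hlt
    have hltR : (p : ℝ) < ((n : ℝ) + 1) * (L + 1) := by exact_mod_cast hlt
    have habs : |(k * u - p * j : ℝ)| ≤ L + 1 := by
      have h2 : (k * u - p * j : ℝ) = p * (k * (u / p) - j) := by field_simp
      rw [h2, abs_mul, abs_of_pos hpR]
      calc (p : ℝ) * |(k : ℝ) * ((u : ℝ) / p) - j| ≤ p * (1 / (n + 1)) := by gcongr
        _ ≤ L + 1 := by
          rw [mul_one_div, div_le_iff₀ (by positivity)]
          linarith
    have habs' : |k * u - p * j| ≤ L + 1 := by exact_mod_cast habs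
    rw [abs_le] at habs'
    have hmod : k * u ≡ k * u - p * j [ZMOD p] := by
      rw [Int.modEq_iff_dvd]; exact ⟨-j, by ring⟩
    rcases le_total 0 (k * u - p * j) with h | h
    · exact near_of_modEq hp h habs'.2 (Or.inl hmod)
    · exact near_of_modEq (e := -(k * u - p * j)) hp (by omega) (by omega)
        (Or.inr (by rwa [neg_neg]))

/-- The distance of `y` from `0` on a cycle of length `p`, if it is at most `L + 1`. -/
def dist (p : ℕ) (L y : ℤ) : ℤ := if y ≤ L + 1 then y else p - y

section stage

variable {p : ℕ} {g c L v b m : ℤ}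

/-- The scale, the offset and the length of the interval after a class of `m` elements of value
`v` has been added, where `b` is the least multiplier with `b * (g * v)` near `0`. -/
def stageC (p : ℕ) (g c L v b m : ℤ) : ℤ :=
  let y := b * (g * v) % p
  -- The combinations fill an interval that starts at `(b - 1) * e`, where `e` is the distance. If
  -- `b * (g * v)` is `-e`, each element moves downwards by `e`; counting the elements that are not
  -- taken restores the first case, at the price of the shift by `m * e`.
  if y ≤ L + 1 then (b * c + (b - 1) * y) % p else (b * c + (b - 1) * (p - y) - m * (p - y)) % p

def stageL (p : ℕ) (g L v b m : ℤ) : ℤ :=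
  -- The length of the interval of integers treated in `exists_combination`.
  b * L + (m - 2 * b + 2) * dist p L (b * (g * v) % p)

theorem prime_dvd_of_modEq (hp : p.Prime) {x y z : ℤ} (h : z * x ≡ z * y [ZMOD p]) (hz0 : 0 < z)
    (hzp : z < p) : x ≡ y [ZMOD p] := by
  rw [Int.modEq_iff_dvd, ← mul_sub] at h
  rcases (Nat.prime_iff_prime_int.1 hp).dvd_or_dvd h with h | h
  · have := Int.le_of_dvd hz0 h; omega
  · exact Int.modEq_iff_dvd.2 h

theorem dist_pos (hp : p.Prime) (hg : IsCoprime g p) (hv : IsCoprime v p) (hb : 1 ≤ b)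
    (hbp : b < p) : 1 ≤ dist p L (b * (g * v) % p) := by
  have hp0 := hp.pos
  have h0 := Int.emod_nonneg (b * (g * v)) (b := p) (by omega)
  have h1 := Int.emod_lt_of_pos (b * (g * v)) (b := p) (by omega)
  have h2 : b * (g * v) % p ≠ 0 := by
    intro h
    have hd := Int.dvd_of_emod_eq_zero h
    have hbc : IsCoprime b p := by
      rw [isCoprime_comm, Prime.coprime_iff_not_dvd (Nat.prime_iff_prime_int.1 hp)]
      intro hd; have := Int.le_of_dvd (by omega) hd; omega
    have := ((hbc.mul_left (hg.mul_left hv)).symm.isUnit_of_dvd' dvd_rfl hd)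
    rw [Int.isUnit_iff] at this
    have := hp.two_le
    omega
  simp only [dist]; split_ifs <;> omega

/-- The residues in the new interval are obtained from the old one with at most `m` elements. -/
theorem stage_chain (hp : p.Prime) (hg : IsCoprime g p) (hv : IsCoprime v p) (hL : 0 ≤ L)
    (hb : 1 ≤ b) (hbp : b < p) (hm : 2 * b ≤ m + 2) (hnear : Near p L (b * (g * v)))
    (hmin : ∀ b', 1 ≤ b' → b' < b → ¬ Near p L (b' * (g * v))) {x : ℤ}
    (hx : (b * g * x - stageC p g c L v b m) % p ≤ stageL p g L v b m) :
    ∃ j, 0 ≤ j ∧ j ≤ m ∧ (g * (x - j * v) - c) % p ≤ L := by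
  have hp0 := hp.pos
  have hpos := dist_pos (L := L) hp hg hv hb hbp
  set y := b * (g * v) % p with hy
  set e := dist p L y with he
  have heL : e ≤ L + 1 := by
    simp only [he, dist]
    split_ifs with h
    · exact h
    · exact hnear.resolve_left h
  set T := (b * g * x - stageC p g c L v b m) % p with hT
  have hT0 : 0 ≤ T := Int.emod_nonneg _ (by omega)
  have hbu : b * (g * v) ≡ e [ZMOD p] ∨ b * (g * v) ≡ -e [ZMOD p] := by
    simp only [he, dist]
    split_ifs
    · left; exact (Int.mod_modEq _ _).symm
    · right
      rw [neg_sub]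
      refine (Int.mod_modEq (b * (g * v)) p).symm.trans ?_
      rw [Int.modEq_iff_dvd]; exact ⟨-1, by ring⟩
  -- A common divisor `d` of `e` and `b` could be cancelled modulo `p`, and `b / d` would be a
  -- smaller multiplier, with the distance `e / d`.
  have hco : IsCoprime e b := by
    rw [Int.isCoprime_iff_gcd_eq_one]
    by_contra hne
    set d := Int.gcd e b with hd
    have hd0 : 0 < d := Int.gcd_pos_of_ne_zero_left _ (by omega)
    obtain ⟨e1, he1⟩ : (d : ℤ) ∣ e := Int.gcd_dvd_left ..
    obtain ⟨b1, hb1⟩ : (d : ℤ) ∣ b := Int.gcd_dvd_right ..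
    have hdb : (d : ℤ) ≤ b := Int.le_of_dvd (by omega) ⟨b1, hb1⟩
    have he1p : 0 < e1 := by
      by_contra h; have : (d : ℤ) * e1 ≤ 0 := mul_nonpos_of_nonneg_of_nonpos (by omega) (by omega)
      omega
    have hb1p : 0 < b1 := by
      by_contra h; have : (d : ℤ) * b1 ≤ 0 := mul_nonpos_of_nonneg_of_nonpos (by omega) (by omega)
      omega
    have hd2 : (2 : ℤ) ≤ d := by omega
    refine hmin b1 (by omega) (by nlinarith) (near_of_modEq hp0 (e := e1) (by omega)
      (by nlinarith) ?_)
    refine hbu.imp (fun h => ?_) (fun h => ?_)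
    · refine prime_dvd_of_modEq hp (z := d) ?_ (by omega) (by omega)
      rw [← mul_assoc, ← hb1, ← he1]; exact h
    · refine prime_dvd_of_modEq hp (z := d) ?_ (by omega) (by omega)
      rw [← mul_assoc, ← hb1, mul_neg, ← he1]; exact h
  obtain ⟨i, j, hi0, hi1, hj0, hj1, hij⟩ := exists_combination hb hpos heL hco hm hT0 hx
  have hTm : b * g * x ≡ stageC p g c L v b m + T [ZMOD p] := by
    rw [Int.modEq_iff_dvd]
    have h1 := Int.dvd_self_sub_emod (x := b * g * x - stageC p g c L v b m) (m := (p : ℤ))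
    rw [← hT] at h1
    obtain ⟨q, hq⟩ := h1
    exact ⟨-q, by linear_combination -hq⟩
  -- After cancelling `b` the residue is that of `i`, and the remainder of `0 ≤ i ≤ L` is not larger
  -- than `i`.
  have hfin : ∀ j', b * (g * (x - j' * v) - c) ≡ b * i [ZMOD p] →
      (g * (x - j' * v) - c) % p ≤ L := by
    intro j' h
    have h1 := prime_dvd_of_modEq hp h (by omega) hbp
    rw [h1]
    have h2 := Int.mul_ediv_add_emod i p
    have h3 := mul_nonneg (show (0 : ℤ) ≤ p by omega) (Int.ediv_nonneg hi0 (by omega : (0 : ℤ) ≤ p))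
    omega
  by_cases hc : y ≤ L + 1
  · have hey : e = y := by simp only [he, dist, if_pos hc]
    have hC : stageC p g c L v b m ≡ b * c + (b - 1) * e [ZMOD p] := by
      simp only [stageC, ← hy, if_pos hc, hey]; exact Int.mod_modEq _ _
    refine ⟨j, hj0, hj1, hfin j ?_⟩
    have hbe : b * (g * v) ≡ e [ZMOD p] := by rw [hey]; exact (Int.mod_modEq _ _).symm
    calc b * (g * (x - j * v) - c) = b * g * x - j * (b * (g * v)) - b * c := by ring
      _ ≡ (b * c + (b - 1) * e + T) - j * e - b * c [ZMOD p] :=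
        Int.ModEq.sub_right _ (Int.ModEq.sub (hTm.trans (hC.add_right _)) (hbe.mul_left _))
      _ = b * i := by linear_combination hij
  · have hey : e = p - y := by simp only [he, dist, if_neg hc]
    have hC : stageC p g c L v b m ≡ b * c + (b - 1) * e - m * e [ZMOD p] := by
      simp only [stageC, ← hy, if_neg hc, hey]; exact Int.mod_modEq _ _
    -- Here `j` counts the elements that are not taken.
    refine ⟨m - j, by omega, by omega, hfin (m - j) ?_⟩
    have hbe : b * (g * v) ≡ -e [ZMOD p] := by
      rw [hey, neg_sub]
      refine (Int.mod_modEq (b * (g * v)) p).symm.trans ?_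
      rw [Int.modEq_iff_dvd]; exact ⟨-1, by ring⟩
    calc b * (g * (x - (m - j) * v) - c) =
          b * g * x - (m - j) * (b * (g * v)) - b * c := by ring
      _ ≡ (b * c + (b - 1) * e - m * e + T) - (m - j) * (-e) - b * c [ZMOD p] :=
        Int.ModEq.sub_right _ (Int.ModEq.sub (hTm.trans (hC.add_right _)) (hbe.mul_left _))
      _ = b * i := by linear_combination hij

end stage

/-! ### The program that adds one class. -/

theorem Ex.den_mul_eq_zero' (σ : Store) (e f : Ex) :
    (e * f).den σ = 0 ↔ e.den σ = 0 ∨ f.den σ = 0 := Ex.den_mul_eq_zero σ e f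

/-- Prepare the search for the multiplier of the class of value `cv`. -/
def stageInit : Cd :=
  .cm ::= .arr .cnt (.reg .cv) ;;
  .ite (.reg .st ≐ 0) (.sg ::= .op .inv (.reg .cv) (.reg .p)) .skip ;;
  .cu ::= (.reg .sg * .reg .cv) % .reg .p ;;
  .cb ::= 1 ;;
  .cy ::= .reg .cu

/-- Find the least multiplier for which the class comes near `0`. -/
def stageSearch : Cd :=
  .loop ((.reg .sl + 1 ≺ .reg .cy) * (.reg .sl + 1 ≺ .reg .p - .reg .cy)) (
    .cb ::= .reg .cb + 1 ;;
    .cy ::= (.reg .cy + .reg .cu) % .reg .p)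

/-- Record the present interval. -/
def stageRecord : Cd :=
  .put .sv (.reg .st) (.reg .cv) ;;
  .put .ss (.reg .st) (.reg .sg) ;;
  .put .sc (.reg .st) (.reg .sc) ;;
  .put .sl (.reg .st) (.reg .sl) ;;
  .st ::= .reg .st + 1 ;;
  .sg ::= (.reg .cb * .reg .sg) % .reg .p

/-- Compute the new interval. -/
def stageNext : Cd :=
  .ite (.reg .cy ≼ .reg .sl + 1)
    (.sc ::= (.reg .cb * .reg .sc + (.reg .cb - 1) * .reg .cy) % .reg .p)
    (.cy ::= .reg .p - .reg .cy ;;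
      .sc ::= (.reg .cb * .reg .sc + (.reg .cb - 1) * .reg .cy - .reg .cm * .reg .cy) %
        .reg .p) ;;
  .sl ::= .reg .cb * .reg .sl + (.reg .cm - 2 * .reg .cb + 2) * .reg .cy

/-- Add the class of value `cv`. -/
def stage : Cd := (stageInit ;; stageSearch) ;; stageRecord ;; stageNext

/-- The least multiplier for which a class of `m` elements of value `v` comes near `0`, and
this multiplier is small compared to `m`. -/
structure Mult (p : ℕ) (g L v m b : ℤ) : Prop where
  pos : 1 ≤ b
  le : 2 * b ≤ m + 2
  near : Near p L (b * (g * v))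
  min : ∀ b' : ℤ, 1 ≤ b' → b' < b → ¬ Near p L (b' * (g * v))

/-- The scale with which a class of value `v` is added at stage `q`. -/
def scale (p : ℕ) (g v : ℤ) (q : ℕ) : ℤ := if q = 0 then Int.gcdA v p % p else g

theorem gcdA_spec {p : ℕ} (hp : p.Prime) {v : ℤ} (hv : 0 < v) (hvp : v < p) :
    Int.gcd v p = 1 ∧ 0 ≤ Int.gcdA v p % p ∧ Int.gcdA v p % p < p ∧
      v * (Int.gcdA v p % p) ≡ 1 [ZMOD p] := by
  have hp1 := hp.pos
  have hg : Int.gcd v p = 1 := by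
    rw [← Int.isCoprime_iff_gcd_eq_one, isCoprime_comm,
      Prime.coprime_iff_not_dvd (Nat.prime_iff_prime_int.1 hp)]
    intro h
    have := Int.le_of_dvd hv h
    omega
  refine ⟨hg, Op.eval_inv_spec ?_⟩
  simp only [Op.eval]
  rw [if_pos ⟨by omega, hg⟩]

theorem isCoprime_of_modEq_one {p : ℕ} {x y : ℤ} (h : x * y ≡ 1 [ZMOD p]) : IsCoprime y p := by
  obtain ⟨k, hk⟩ := (Int.modEq_iff_dvd.1 h)
  exact ⟨x, k, by linear_combination -hk⟩

theorem scale_spec {p : ℕ} (hp : p.Prime) {g v : ℤ} {q : ℕ} (hv : 0 < v) (hvp : v < p)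
    (hg : 0 ≤ g ∧ g < p) (hco : q ≠ 0 → IsCoprime g p) :
    0 ≤ scale p g v q ∧ scale p g v q < p ∧ IsCoprime (scale p g v q) p := by
  rw [scale]
  split_ifs with h
  · obtain ⟨_, h1, h2, h3⟩ := gcdA_spec hp hv hvp
    exact ⟨h1, h2, isCoprime_of_modEq_one h3⟩
  · exact ⟨hg.1, hg.2, hco h⟩

/-- The effect of `stage` with the multiplier `b`. -/
structure StageDone (p q : ℕ) (m b : ℤ) (σ σ' : Store) : Prop where
  mult : Mult p (scale p (σ.r .sg) (σ.r .cv) q) (σ.r .sl) (σ.r .cv) m b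
  st : σ'.r .st = q + 1
  sg : σ'.r .sg = b * scale p (σ.r .sg) (σ.r .cv) q % p
  sc : σ'.r .sc = stageC p (scale p (σ.r .sg) (σ.r .cv) q) (σ.r .sc) (σ.r .sl) (σ.r .cv) b m
  sl : σ'.r .sl = stageL p (scale p (σ.r .sg) (σ.r .cv) q) (σ.r .sl) (σ.r .cv) b m
  asv : σ'.a .sv = Function.update (σ.a .sv) q (σ.r .cv)
  ass : σ'.a .ss = Function.update (σ.a .ss) q (scale p (σ.r .sg) (σ.r .cv) q)
  asc : σ'.a .sc = Function.update (σ.a .sc) q (σ.r .sc)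
  asl : σ'.a .sl = Function.update (σ.a .sl) q (σ.r .sl)

theorem mul_bounds {x y B Z : ℤ} (hx : 0 ≤ x) (hxB : x ≤ B) (hy : 0 ≤ y) (hyB : y ≤ B)
    (hB : B * B ≤ Z) : -Z ≤ x * y ∧ x * y ≤ Z ∧ 0 ≤ x * y ∧ x * y ≤ B * B := by
  have h1 : x * y ≤ B * B := mul_le_mul hxB hyB hy (by omega)
  have h2 : 0 ≤ x * y := mul_nonneg hx hy
  exact ⟨by omega, by omega, h2, h1⟩

/-- The multipliers are tried in increasing order, so the first success is the least one. A
multiplier with `2 * b ≤ m + 2` exists by `hex`; hence there are at most `m / 2` iterations, which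
the size of the class pays for. -/
theorem wp_stageSearch {σ : Store} {p q m : ℕ} (hp : p.Prime) (hrp : σ.r .p = p)
    (hv : 0 < σ.r .cv) (hvp : σ.r .cv < p) (hm : σ.a .cnt (σ.r .cv) = m) (hmp : m ≤ p)
    (hg : 0 ≤ σ.r .sg ∧ σ.r .sg < p) (hco : q ≠ 0 → IsCoprime (σ.r .sg) p)
    (hL : 0 ≤ σ.r .sl) (hLp : σ.r .sl < p - 1)
    (hst : σ.r .st = q) (hpr : p ≤ C.rows) (hbig : 10 * ((p : ℤ) * p) ≤ C.big)
    (hex : ∃ b : ℤ, 1 ≤ b ∧ 2 * b ≤ m + 2 ∧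
      Near p (σ.r .sl) (b * (scale p (σ.r .sg) (σ.r .cv) q * σ.r .cv))) :
    WP C (stageInit ;; stageSearch) (fun σ' => ∃ b : ℤ,
      Mult p (scale p (σ.r .sg) (σ.r .cv) q) (σ.r .sl) (σ.r .cv) m b ∧ σ'.r .cb = b ∧
      σ'.r .cy = b * (scale p (σ.r .sg) (σ.r .cv) q * σ.r .cv) % p ∧ σ'.r .cm = m ∧
      σ'.r .sg = scale p (σ.r .sg) (σ.r .cv) q) (30 * m + 100) σ := by
  have hb1 := C.rows_le_big; have hb2 := C.hstride
  simp only [stride, Nat.cast_ofNat] at hb2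
  obtain ⟨hgcd, hinv⟩ := gcdA_spec hp hv hvp
  obtain ⟨hg0, hg1, hgc⟩ := scale_spec hp hv hvp hg hco
  set v := σ.r .cv with hvdef
  set L := σ.r .sl with hLdef
  set g := scale p (σ.r .sg) v q with hgdef
  obtain ⟨B, hB1, hBm, hBn⟩ := hex
  have hpp : 1 ≤ p := hp.pos
  have h2p : 10 * (p : ℤ) ≤ C.big := by nlinarith
  have hgv := mul_bounds hg0 (B := p) (by omega) (show 0 ≤ v by omega) (by omega)
    (Z := C.big) (by nlinarith)
  refine (WP.seq (b := 40) (b' := 30 * m + 40) (R := fun σ' => σ'.r .cm = m ∧ σ'.r .sg = g ∧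
    σ'.r .cu = g * v % p ∧ σ'.r .cb = 1 ∧ σ'.r .cy = g * v % p) ?_ ?_).mono (by omega)
    (fun _ _ h => h)
  · refine (WP.seq (b := 10) (b' := 30) (R := fun σ' => σ' = σ.set .cm m)
      (WP.straight (by simp; omega) (by simp [← hvdef, hm]) (Nat.le_of_ble_eq_true rfl)) ?_).mono
      (by omega) (fun _ _ h => h)
    rintro _ _ rfl
    refine (WP.seq (b := 10) (b' := 20) (R := fun σ' => σ' = (σ.set .cm m).set .sg g)
      ?_ ?_).mono (by omega) (fun _ _ h => h)
    · refine (WP.ite (b := 5) (by simp) (fun h => ?_) (fun h => ?_)).mono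
        (Nat.le_of_ble_eq_true rfl) (fun _ _ h => h)
      · have hq0 : q = 0 := by
          rw [Ne, Ex.den_eq_eq_zero] at h; simpa [hst] using h
        refine WP.straight ?_ ?_ (Nat.le_of_ble_eq_true rfl)
        · simp [← hvdef, hrp, hgcd]; omega
        · simp [hgdef, scale, hq0, hrp, ← hvdef]
      · have hq0 : q ≠ 0 := by
          rw [Ex.den_eq_eq_zero] at h; simpa [hst] using h
        refine WP.straight (by simp) ?_ (Nat.le_of_ble_eq_true rfl)
        have : g = σ.r .sg := by simp [hgdef, scale, hq0]
        rw [this]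
        ext x
        · by_cases hx : x = .sg
          · subst hx; simp
          · simp [hx]
        · simp
    · rintro _ _ rfl
      refine WP.straight ?_ ?_ (Nat.le_of_ble_eq_true rfl)
      · simp [← hvdef, hrp]; omega
      · simp [← hvdef, hrp]
  rintro σ₁ hF₁ ⟨hcm, hsg, hcu, hcb, hcy⟩
  have hp₁ : σ₁.r .p = p := (hF₁.r .p rfl).trans hrp
  have hsl₁ : σ₁.r .sl = L := hF₁.r .sl rfl
  have hmodb : ∀ z : ℤ, 0 ≤ z % p ∧ z % p < p := fun z =>
    ⟨Int.emod_nonneg _ (by omega), Int.emod_lt_of_pos _ (by omega)⟩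
  have hlc : ((.reg .sl + 1 ≺ .reg .cy : Ex) * (.reg .sl + 1 ≺ .reg .p - .reg .cy)).cost = 13 :=
    rfl
  refine (WP.loop (fun s => ∃ b : ℤ, 1 ≤ b ∧ b ≤ B ∧ s.r .cb = b ∧ s.r .cy = b * (g * v) % p ∧
    ∀ b' : ℤ, 1 ≤ b' → b' < b → ¬ Near p L (b' * (g * v))) (fun s => 40 * (B - s.r .cb).toNat)
    ⟨1, le_rfl, hB1, hcb, by simpa using hcy, fun b' _ _ => by omega⟩ ?_ ?_).mono ?_ ?_
  · rintro s hF ⟨b, h1, h2, h3, h4, h5⟩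
    have hp' : s.r .p = p := (hF.r .p rfl).trans hp₁
    have hsl' : s.r .sl = L := (hF.r .sl rfl).trans hsl₁
    have := hmodb (b * (g * v))
    have hsm : ∀ (P Q : Prop) [Decidable P] [Decidable Q],
        -C.big ≤ (if P then (1 : ℤ) else 0) * (if Q then 1 else 0) ∧
        (if P then (1 : ℤ) else 0) * (if Q then 1 else 0) ≤ C.big := by
      intro P Q _ _; split_ifs <;> constructor <;> omega
    refine ⟨?_, ?_, hsm _ _⟩
    · simp [hsl']; omega
    · simp [hsl', h4, hp']; omega
  · rintro s hF ⟨b, h1, h2, h3, h4, h5⟩ hz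
    have hp' : s.r .p = p := (hF.r .p rfl).trans hp₁
    have hsl' : s.r .sl = L := (hF.r .sl rfl).trans hsl₁
    have hcu' : s.r .cu = g * v % p := (hF.r .cu rfl).trans hcu
    have hmb := hmodb (b * (g * v))
    have hmg := hmodb (g * v)
    have hnn : ¬ Near p L (b * (g * v)) := by
      intro hn
      apply hz
      rw [Ex.den_mul_eq_zero', Ex.den_lt_eq_zero, Ex.den_lt_eq_zero]
      simpa [hsl', h4, hp', Near] using hn
    have hbB : b ≠ B := by rintro rfl; exact hnn hBn
    refine ⟨25, WP.straight ?_ ⟨⟨b + 1, by omega, by omega, ?_, ?_, ?_⟩, ?_⟩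
      (Nat.le_of_ble_eq_true rfl)⟩
    · simp [h3, h4, hcu', hp']; omega
    · simp [h3]
    · simp only [Cd.fin_seq, Cd.fin_set, Ex.den_mod, Ex.den_add, Ex.den_reg, Store.set_r,
        reduceCtorEq, if_false, if_true, h4, hcu', hp']
      rw [← Int.add_emod]; congr 1; ring
    · intro b' hb' hb''
      by_cases he : b' = b
      · rw [he]; exact hnn
      · exact h5 b' hb' (by omega)
    · rw [hlc]; simp [h3]; omega
  · rw [hlc, hcb]; omega
  · rintro s hF ⟨⟨b, h1, h2, h3, h4, h5⟩, hz⟩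
    have hp' : s.r .p = p := (hF.r .p rfl).trans hp₁
    have hsl' : s.r .sl = L := (hF.r .sl rfl).trans hsl₁
    refine ⟨b, ⟨h1, by omega, ?_, h5⟩, h3, h4, (hF.r .cm rfl).trans hcm, (hF.r .sg rfl).trans hsg⟩
    rw [Ex.den_mul_eq_zero', Ex.den_lt_eq_zero, Ex.den_lt_eq_zero] at hz
    simpa [hsl', h4, hp', Near] using hz

theorem wp_stageNext {σ₂ : Store} {p q : ℕ} {m b g v c L : ℤ} (hrp : σ₂.r .p = p) (hp1 : 1 ≤ p)
    (hM : Mult p g L v m b) (hm0 : 0 ≤ m) (hmp : m ≤ p)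
    (hg : 0 ≤ g ∧ g < p) (hc : 0 ≤ c ∧ c < p) (hL : 0 ≤ L ∧ L < p - 1) (hq : q < C.rows)
    (hpr : p ≤ C.rows) (hbig : 10 * ((p : ℤ) * p) ≤ C.big)
    (hcb₂ : σ₂.r .cb = b) (hcy₂ : σ₂.r .cy = b * (g * v) % p) (hcm₂ : σ₂.r .cm = m)
    (hsg₂ : σ₂.r .sg = g) (hcv₂ : σ₂.r .cv = v) (hsc₂ : σ₂.r .sc = c) (hsl₂ : σ₂.r .sl = L)
    (hst₂ : σ₂.r .st = q) :
    WP C (stageRecord ;; stageNext) (fun σ' => σ'.r .st = q + 1 ∧ σ'.r .sg = b * g % p ∧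
      σ'.r .sc = stageC p g c L v b m ∧ σ'.r .sl = stageL p g L v b m ∧
      σ'.a .sv = Function.update (σ₂.a .sv) q v ∧ σ'.a .ss = Function.update (σ₂.a .ss) q g ∧
      σ'.a .sc = Function.update (σ₂.a .sc) q c ∧ σ'.a .sl = Function.update (σ₂.a .sl) q L)
      300 σ₂ := by
  have hb1 := C.rows_le_big; have hb2 := C.hstride
  simp only [stride, Nat.cast_ofNat] at hb2
  have hp₂ := hrp
  have hmodb : ∀ z : ℤ, 0 ≤ z % p ∧ z % p < p := fun z =>
    ⟨Int.emod_nonneg _ (by omega), Int.emod_lt_of_pos _ (by omega)⟩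
  set y := b * (g * v) % p with hydef
  have hy := hmodb (b * (g * v))
  rw [← hydef] at hy
  have hb0 := hM.pos
  have hbm := hM.le
  -- From `2 * b ≤ m + 2` and `m ≤ p`. All factors below are thus at most `p`, and the few products
  -- that are added stay below `10 * p ^ 2`.
  have hbp : b ≤ p := by omega
  have hPP : (p : ℤ) * p ≤ C.big := by nlinarith
  have e1 := mul_bounds (show 0 ≤ b by omega) hbp hg.1 (by omega) hPP
  have e2 := mul_bounds (show 0 ≤ b by omega) hbp hc.1 (by omega) hPP
  have e3 := mul_bounds (show 0 ≤ b by omega) hbp hL.1 (by omega) hPP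
  have e4 : ∀ z : ℤ, 0 ≤ z → z ≤ p → 0 ≤ (b - 1) * z ∧ (b - 1) * z ≤ (p : ℤ) * p := by
    intro z h h'
    have := mul_bounds (show 0 ≤ b - 1 by omega) (show b - 1 ≤ (p : ℤ) by omega) h h' hPP
    exact this.2.2
  have e5 : ∀ z : ℤ, 0 ≤ z → z ≤ p → 0 ≤ m * z ∧ m * z ≤ (p : ℤ) * p := by
    intro z h h'
    have := mul_bounds hm0 hmp h h' hPP
    exact this.2.2
  have e6 : ∀ z : ℤ, 0 ≤ z → z ≤ p →
      0 ≤ (m - 2 * b + 2) * z ∧ (m - 2 * b + 2) * z ≤ (p : ℤ) * p := by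
    intro z h h'
    have := mul_bounds (show (0 : ℤ) ≤ m - 2 * b + 2 by omega)
      (show (m : ℤ) - 2 * b + 2 ≤ (p : ℤ) by omega) h h' hPP
    exact this.2.2
  have d1 := e4 y hy.1 (by omega)
  have d2 := e4 (p - y) (by omega) (by omega)
  have d3 := e5 (p - y) (by omega) (by omega)
  have d4 := e6 y hy.1 (by omega)
  have d5 := e6 (p - y) (by omega) (by omega)
  have hbig3 : (p : ℤ) ≤ p * p := by nlinarith
  refine (WP.seq (b := 65) (b' := 200) (R := fun σ' => σ' = (((((σ₂.put .sv q v).put .ss q g).put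
    .sc q c).put .sl q L).set .st (q + 1)).set .sg (b * g % p))
    (WP.straight ?_ ?_ (Nat.le_of_ble_eq_true rfl)) ?_).mono (by omega) (fun _ _ h => h)
  · simp [stageRecord, hst₂, hcb₂, hsg₂, hp₂]; omega
  · simp [stageRecord, hst₂, hcb₂, hsg₂, hp₂, hcv₂, hsc₂, hsl₂]
  rintro σ₃ _ rfl
  refine (WP.seq (b := 80) (b' := 60) (R := fun σ' => σ'.r .cy = dist p L y ∧
    σ'.r .sc = stageC p g c L v b m) ?_ ?_).mono (by omega) (fun _ _ h => h)
  · refine (WP.ite (b := 50) (by simp [hsl₂]; omega) (fun h => ?_) (fun h => ?_)).mono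
      (Nat.le_of_ble_eq_true rfl) (fun _ _ h => h)
    · rw [Ne, Ex.den_le_eq_zero] at h
      simp [hcy₂, hsl₂] at h
      refine WP.straight ?_ ?_ (Nat.le_of_ble_eq_true rfl)
      · simp [hcb₂, hsc₂, hcy₂, hp₂]; omega
      · simp [hcb₂, hsc₂, hcy₂, hp₂, dist, h, stageC, ← hydef]
    · rw [Ex.den_le_eq_zero] at h
      simp [hcy₂, hsl₂] at h
      have h' : ¬ y ≤ L + 1 := by omega
      refine WP.straight ?_ ?_ (Nat.le_of_ble_eq_true rfl)
      · simp [hcb₂, hsc₂, hcy₂, hp₂, hcm₂]; omega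
      · simp [hcb₂, hsc₂, hcy₂, hp₂, hcm₂, dist, h', stageC, ← hydef]
  · rintro σ₄ hF₄ ⟨hcy₄, hsc₄⟩
    have r1 : σ₄.r .cb = b := by rw [hF₄.r .cb rfl]; simp [hcb₂]
    have r2 : σ₄.r .sl = L := by rw [hF₄.r .sl rfl]; simp [hsl₂]
    have r3 : σ₄.r .cm = m := by rw [hF₄.r .cm rfl]; simp [hcm₂]
    have d6 : 0 ≤ (m - 2 * b + 2) * dist p L y ∧
        (m - 2 * b + 2) * dist p L y ≤ (p : ℤ) * p := by
      simp only [dist]; split_ifs <;> assumption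
    refine WP.straight ?_ ⟨?_, ?_, ?_, ?_, ?_, ?_, ?_, ?_⟩ (Nat.le_of_ble_eq_true rfl)
    · simp [r1, r2, r3, hcy₄]; omega
    · simp [hF₄.r .st rfl]
    · simp [hF₄.r .sg rfl]
    · simp [hsc₄]
    · simp [r1, r2, r3, hcy₄, stageL, hydef]
    · simp [hF₄.a .sv rfl]
    · simp [hF₄.a .ss rfl]
    · simp [hF₄.a .sc rfl]
    · simp [hF₄.a .sl rfl]

theorem wp_stage {σ : Store} {p q m : ℕ} (hp : p.Prime) (hrp : σ.r .p = p)
    (hv : 0 < σ.r .cv) (hvp : σ.r .cv < p) (hm : σ.a .cnt (σ.r .cv) = m) (hmp : m ≤ p)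
    (hg : 0 ≤ σ.r .sg ∧ σ.r .sg < p) (hco : q ≠ 0 → IsCoprime (σ.r .sg) p)
    (hc : 0 ≤ σ.r .sc ∧ σ.r .sc < p) (hL : 0 ≤ σ.r .sl) (hLp : σ.r .sl < p - 1)
    (hst : σ.r .st = q) (hq : q < C.rows) (hpr : p ≤ C.rows) (hbig : 10 * ((p : ℤ) * p) ≤ C.big)
    (hex : ∃ b : ℤ, 1 ≤ b ∧ 2 * b ≤ m + 2 ∧
      Near p (σ.r .sl) (b * (scale p (σ.r .sg) (σ.r .cv) q * σ.r .cv))) :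
    WP C stage (fun σ' => ∃ b : ℤ, StageDone p q m b σ σ') (50 * m + 400) σ := by
  obtain ⟨hg0, hg1, -⟩ := scale_spec hp hv hvp hg hco
  refine (WP.seq (b' := 300) (wp_stageSearch hp hrp hv hvp hm hmp hg hco hL hLp hst hpr hbig hex)
    ?_).mono (by omega) (fun _ _ h => h)
  rintro σ₂ hF ⟨b, hM, h1, h2, h3, h4⟩
  refine (wp_stageNext (q := q) ((hF.r .p rfl).trans hrp) hp.pos hM (by omega) (by omega)
    ⟨hg0, hg1⟩ hc ⟨hL, hLp⟩ hq hpr hbig h1 h2 h3 h4 (hF.r .cv rfl) (hF.r .sc rfl)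
    (hF.r .sl rfl) ((hF.r .st rfl).trans hst)).mono le_rfl ?_
  rintro σ' - ⟨a1, a2, a3, a4, a5, a6, a7, a8⟩
  rw [hF.a .sv rfl] at a5
  rw [hF.a .ss rfl] at a6
  rw [hF.a .sc rfl] at a7
  rw [hF.a .sl rfl] at a8
  exact ⟨b, hM, a1, a2, a3, a4, a5, a6, a7, a8⟩

/-! ### Chains of recorded intervals. -/

/-- Stage `i` uses at most `m` elements of value `v` to get from the interval given by `s'`, `c'`,
`l'` to the interval given by `s`, `c`, `l`. -/
def Link (p : ℕ) (m v s c l s' c' l' : ℤ) : Prop :=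
  ∀ x : ℤ, (s' * x - c') % p ≤ l' → ∃ j : ℤ, 0 ≤ j ∧ j ≤ m ∧ (s * (x - j * v) - c) % p ≤ l

/-- The recorded stages, and the present interval. -/
structure Stages (p q : ℕ) (σ : Store) : Prop where
  st : σ.r .st = q
  sg : 0 ≤ σ.r .sg ∧ σ.r .sg < p
  co : q ≠ 0 → IsCoprime (σ.r .sg) p
  sc : 0 ≤ σ.r .sc ∧ σ.r .sc < p
  sl : 0 ≤ σ.r .sl
  init : q = 0 → σ.r .sc = 0 ∧ σ.r .sl = 0
  val : ∀ i : ℕ, i < q → 0 < σ.a .sv i ∧ σ.a .sv i < p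
  bounds : ∀ i : ℕ, i < q → (0 ≤ σ.a .ss i ∧ σ.a .ss i < p) ∧ 0 ≤ σ.a .sc i ∧ σ.a .sc i < p
  ne : ∀ i j : ℕ, i < j → j < q → σ.a .sv i ≠ σ.a .sv j
  zero : q ≠ 0 → IsCoprime (σ.a .ss 0) p ∧ σ.a .sc 0 = 0 ∧ σ.a .sl 0 = 0
  link : ∀ i : ℕ, i + 1 < q → Link p (σ.a .cnt (σ.a .sv i)) (σ.a .sv i)
    (σ.a .ss i) (σ.a .sc i) (σ.a .sl i)
    (σ.a .ss (i + 1)) (σ.a .sc (i + 1)) (σ.a .sl (i + 1))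
  last : ∀ i : ℕ, i + 1 = q → Link p (σ.a .cnt (σ.a .sv i)) (σ.a .sv i)
    (σ.a .ss i) (σ.a .sc i) (σ.a .sl i) (σ.r .sg) (σ.r .sc) (σ.r .sl)

theorem Stages.congr {p q : ℕ} {σ σ' : Store} (h : Stages p q σ)
    (hr : ∀ x ∈ [Reg.st, .sg, .sc, .sl], σ'.r x = σ.r x)
    (ha : ∀ b ∈ [Arr.sv, .ss, .sc, .sl, .cnt], σ'.a b = σ.a b) : Stages p q σ' := by
  have r1 := hr .st (by simp)
  have r2 := hr .sg (by simp)
  have r3 := hr .sc (by simp)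
  have r4 := hr .sl (by simp)
  have a1 := ha .sv (by simp)
  have a2 := ha .ss (by simp)
  have a3 := ha .sc (by simp)
  have a4 := ha .sl (by simp)
  have a5 := ha .cnt (by simp)
  obtain ⟨h1, h2, h3, h4, h5, h6, h7, h8, h9, h10, h11, h12⟩ := h
  constructor <;> simp only [r1, r2, r3, r4, a1, a2, a3, a4, a5] <;> assumption

theorem isCoprime_of_lt {p : ℕ} (hp : p.Prime) {b : ℤ} (hb : 0 < b) (hbp : b < p) :
    IsCoprime b p := by
  rw [isCoprime_comm, Prime.coprime_iff_not_dvd (Nat.prime_iff_prime_int.1 hp)]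
  intro hd; have := Int.le_of_dvd (by omega) hd; omega

theorem isCoprime_emod {p : ℕ} {b : ℤ} (h : IsCoprime b p) : IsCoprime (b % p) p := by
  obtain ⟨x, y, hxy⟩ := h
  refine ⟨x, y + x * (b / p), ?_⟩
  have := Int.emod_add_mul_ediv b p
  linear_combination hxy + x * this

/-- What is recorded at index `q` is the interval before the class is added. The new interval stays
in registers and is linked to it by `stage_chain`; the former `last` becomes a `link`. -/
theorem StageDone.stages {p q : ℕ} {m b : ℤ} {σ σ' : Store} (h : StageDone p q m b σ σ')
    (hp : p.Prime) (hS : Stages p q σ) (hv : 0 < σ.r .cv) (hvp : σ.r .cv < p)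
    (hm : σ.a .cnt (σ.r .cv) = m) (hmp : m < p)
    (hne : ∀ i : ℕ, i < q → σ.a .sv i ≠ σ.r .cv) (hcnt : σ'.a .cnt = σ.a .cnt) :
    Stages p (q + 1) σ' := by
  have hp0 := hp.pos
  have hp2 := hp.two_le
  obtain ⟨hg0, hg1, hgc⟩ := scale_spec hp hv hvp hS.sg hS.co
  set v := σ.r .cv with hvdef
  set g := scale p (σ.r .sg) v q with hgdef
  have hM := h.mult
  have hb0 := hM.pos
  have hb1 := hM.le
  have hbp : b < p := by omega
  have hvc := isCoprime_of_lt hp hv hvp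
  have hbc := isCoprime_of_lt hp (show 0 < b by omega) hbp
  have hmodb : ∀ z : ℤ, 0 ≤ z % p ∧ z % p < p := fun z =>
    ⟨Int.emod_nonneg _ (by omega), Int.emod_lt_of_pos _ (by omega)⟩
  have hdist : 0 ≤ dist p (σ.r .sl) (b * (g * v) % p) :=
    (zero_le_one).trans (dist_pos hp hgc hvc hb0 hbp)
  have hup : ∀ (f : ℤ → ℤ) (z : ℤ) (i : ℕ), i < q → Function.update f q z i = f i :=
    fun f z i hi => Function.update_of_ne (by omega) _ _
  constructor
  · rw [h.st]; push_cast; rfl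
  · rw [h.sg]; exact hmodb _
  · intro _; rw [h.sg]; exact isCoprime_emod (hbc.mul_left hgc)
  · rw [h.sc]; simp only [stageC]; split_ifs <;> exact hmodb _
  · rw [h.sl]
    simp only [stageL, ← hvdef, ← hgdef]
    have := mul_nonneg (show 0 ≤ b by omega) hS.sl
    have := mul_nonneg (show 0 ≤ m - 2 * b + 2 by omega) hdist
    omega
  · intro h0; omega
  · intro i hi
    rw [h.asv]
    by_cases hiq : i = q
    · subst hiq; simp only [Function.update_self]; exact ⟨hv, hvp⟩
    · rw [hup _ _ _ (by omega)]; exact hS.val i (by omega)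
  · intro i hi
    rw [h.ass, h.asc]
    by_cases hiq : i = q
    · subst hiq; simp only [Function.update_self]; exact ⟨⟨hg0, hg1⟩, hS.sc⟩
    · rw [hup _ _ _ (by omega), hup _ _ _ (by omega)]; exact hS.bounds i (by omega)
  · intro i j hij hj
    rw [h.asv, hup _ _ i (by omega)]
    by_cases hjq : j = q
    · subst hjq; simpa using hne i hij
    · rw [hup _ _ _ (by omega)]; exact hS.ne i j hij (by omega)
  · intro _
    rw [h.ass, h.asc, h.asl]
    by_cases hq : q = 0
    · subst hq
      obtain ⟨h1, h2⟩ := hS.init rfl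
      simp only [Nat.cast_zero, Function.update_self]
      exact ⟨hgc, h1, h2⟩
    · have : (0 : ℤ) ≠ q := by omega
      rw [Function.update_of_ne this, Function.update_of_ne this, Function.update_of_ne this]
      exact hS.zero hq
  · intro i hi
    rw [h.asv, h.ass, h.asc, h.asl, hcnt, hup _ _ i (by omega), hup _ _ i (by omega),
      hup _ _ i (by omega), hup _ _ i (by omega)]
    by_cases hiq : i + 1 = q
    · have : (i : ℤ) + 1 = q := by exact_mod_cast hiq
      rw [this]
      simp only [Function.update_self]
      -- The scale is replaced by an inverse only for `q = 0`, when there is no earlier interval to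
      -- be linked.
      have hgs : g = σ.r .sg := by rw [hgdef, scale, if_neg (by omega)]
      rw [← hgdef, hgs]
      exact hS.last i hiq
    · have : (i : ℤ) + 1 ≠ q := by exact_mod_cast hiq
      rw [Function.update_of_ne this, Function.update_of_ne this, Function.update_of_ne this]
      exact hS.link i (by omega)
  · intro i hi
    obtain rfl : i = q := by omega
    rw [h.asv, h.ass, h.asc, h.asl, hcnt, h.sg, h.sc, h.sl]
    simp only [Function.update_self]
    rw [← hgdef, hm]
    intro x hx
    refine stage_chain hp hgc hvc hS.sl hb0 hbp hb1 hM.near hM.min (x := x) ?_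
    convert hx using 1
    exact (((Int.mod_modEq _ _).symm.mul_right _).sub_right _)

/-! ### Passes through the classes. -/

/-- Add the classes with at least `lo` and less than `hi` elements, until all residues are
reached. -/
def pass (lo hi : Ex) : Cd :=
  .for .cv 0 (.reg .p) (
    .ite ((lo ≼ .arr .cnt (.reg .cv)) * (.arr .cnt (.reg .cv) ≺ hi) *
      (.reg .sl ≺ .reg .p - 1)) stage .skip)

/-- `J k q g L` describes the situation before the value `k` is considered, and has to guarantee a
multiplier that is small enough for its class. It is needed only while `L < p - 1`; afterwards
classes are skipped. The classes recorded before the pass have at least `b` elements by `hold`, so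
the pass does not meet them again. -/
theorem wp_pass {lo hi : Ex} {σ : Store} {p q a b : ℕ} (hp : p.Prime) (hrp : σ.r .p = p)
    (cn : ℕ → ℕ) (hcn : ∀ v : ℕ, v < p → σ.a .cnt v = cn v) (hcn0 : cn 0 = 0)
    (hcnp : ∀ v, cn v < p)
    (hlo : ∀ σ', Frame (pass lo hi) σ σ' → lo.ok C σ' ∧ lo.den σ' = a)
    (hhi : ∀ σ', Frame (pass lo hi) σ σ' → hi.ok C σ' ∧ hi.den σ' = b)
    (hcost : lo.cost + hi.cost ≤ 20) (ha : 1 ≤ a)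
    (hS : Stages p q σ) (hqr : q + p ≤ C.rows) (hbig : 10 * ((p : ℤ) * p) ≤ C.big)
    (hold : ∀ i : ℕ, i < q → b ≤ σ.a .cnt (σ.a .sv i))
    (J : ℕ → ℕ → ℤ → ℤ → Prop) (hJ : (p : ℤ) - 1 ≤ σ.r .sl ∨ J 0 q (σ.r .sg) (σ.r .sl))
    (hskip : ∀ (k q : ℕ) (g L : ℤ), k < p → ¬ (a ≤ cn k ∧ cn k < b) → J k q g L → J (k + 1) q g L)
    (hstep : ∀ (k q : ℕ) (g L : ℤ), 0 < k → k < p → a ≤ cn k → cn k < b → 0 ≤ L → L < p - 1 →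
      0 ≤ g ∧ g < p → (q ≠ 0 → IsCoprime g p) → J k q g L →
      (∃ b : ℤ, 1 ≤ b ∧ 2 * b ≤ cn k + 2 ∧ Near p L (b * (scale p g k q * k))) ∧
      ∀ b, Mult p (scale p g k q) L k (cn k) b →
        J (k + 1) (q + 1) (b * scale p g k q % p) (stageL p (scale p g k q) L k b (cn k))) :
    WP C (pass lo hi) (fun σ' => ∃ q' ≤ q + p, Stages p q' σ' ∧
      (∀ i : ℕ, i < q' → a ≤ σ'.a .cnt (σ'.a .sv i) ∨ ∃ j : ℕ, j < q ∧ σ'.a .sv i = σ.a .sv j) ∧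
      ((p : ℤ) - 1 ≤ σ'.r .sl ∨ J p q' (σ'.r .sg) (σ'.r .sl)))
      (500 * p + 50 * (∑ v ∈ Finset.range p, cn v) + 50) σ := by
  have hb1 := C.rows_le_big; have hb2 := C.hstride
  simp only [stride, Nat.cast_ofNat] at hb2
  have hp0 := hp.pos
  refine (WP.for (a := 0) (b := p) (fun k s => ∃ q' ≤ q + k, Stages p q' s ∧
      (∀ i : ℕ, i < q' → (a ≤ s.a .cnt (s.a .sv i) ∧ s.a .sv i < k) ∨
        (b ≤ s.a .cnt (s.a .sv i) ∧ ∃ j : ℕ, j < q ∧ s.a .sv i = σ.a .sv j)) ∧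
      ((p : ℤ) - 1 ≤ s.r .sl ∨ J k q' (s.r .sg) (s.r .sl))) (fun k => 50 * cn k + 450)
    (by omega) (by simp) (by simp) rfl ?_ (by omega) ?_ ?_).mono ?_ ?_
  · intro σ' hF; simp [hF.r .p rfl, hrp]
  · exact ⟨q, by omega, hS.congr (by simp) (by simp), fun i hi => Or.inr
      ⟨hold i hi, i, hi, rfl⟩, by simpa using hJ⟩
  · rintro k σ₁ - hk hF hr ⟨q₁, hq₁, hS₁, hold₁, hJ₁⟩
    have hp₁ : σ₁.r .p = p := (hF.r .p rfl).trans hrp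
    have hcnt₁ : σ₁.a .cnt = σ.a .cnt := hF.a .cnt rfl
    have hck : σ₁.a .cnt k = cn k := by rw [hcnt₁]; exact hcn k hk
    obtain ⟨hl1, hl2⟩ := hlo σ₁ hF
    obtain ⟨hh1, hh2⟩ := hhi σ₁ hF
    have hc1 : ((lo ≼ .arr .cnt (.reg .cv) : Ex) * (.arr .cnt (.reg .cv) ≺ hi) *
      (.reg .sl ≺ .reg .p - 1)).cost = lo.cost + hi.cost + 21 := by
      change lo.cost + 6 + 1 + (6 + hi.cost + 1) + 1 + 5 + 1 = _; omega
    have hsm : ∀ (P Q : Prop) [Decidable P] [Decidable Q],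
        -C.big ≤ (if P then (1 : ℤ) else 0) * (if Q then 1 else 0) ∧
        (if P then (1 : ℤ) else 0) * (if Q then 1 else 0) ≤ C.big := by
      intro P Q _ _; split_ifs <;> constructor <;> omega
    have hsm' : ∀ (P Q R : Prop) [Decidable P] [Decidable Q] [Decidable R],
        -C.big ≤ (if P then (1 : ℤ) else 0) * (if Q then 1 else 0) * (if R then 1 else 0) ∧
        (if P then (1 : ℤ) else 0) * (if Q then 1 else 0) * (if R then 1 else 0) ≤ C.big := by
      intro P Q R _ _ _; split_ifs <;> constructor <;> omega
    refine (WP.ite (b := 50 * cn k + 400) ?_ ?_ ?_).mono (by rw [hc1]; omega) (fun _ _ h => h)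
    · refine ⟨⟨?_, ?_, hsm _ _⟩, ?_, hsm' _ _ _⟩
      · simp [hl1, hr]; omega
      · simp [hh1, hr]; omega
      · simp [hp₁]; omega
    · intro he
      rw [Ne, Ex.den_mul_eq_zero', Ex.den_mul_eq_zero', Ex.den_lt_eq_zero, Ex.den_lt_eq_zero,
        Ex.den_le_eq_zero, hl2, hh2] at he
      simp [hr, hck, hp₁] at he
      obtain ⟨⟨he1, he2⟩, he3⟩ := he
      replace he3 : σ₁.r .sl < p - 1 := by omega
      have hJ' := hJ₁.resolve_left (by omega)
      have hk0 : 0 < k := by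
        rcases Nat.eq_zero_or_pos k with rfl | h
        · omega
        · exact h
      obtain ⟨hs1, hs2⟩ := hstep k q₁ _ _ hk0 hk he1 he2 hS₁.sl he3 hS₁.sg hS₁.co hJ'
      have hcp := hcnp k
      refine (wp_stage hp hp₁ (by omega) (by omega) (m := cn k) (by rw [hr, hck]) (by omega)
        hS₁.sg hS₁.co hS₁.sc hS₁.sl he3 hS₁.st (by omega) (by omega) hbig
        (by rw [hr]; exact hs1)).mono le_rfl ?_
      rintro σ₂ hF₂ ⟨b', hD⟩
      have hcnt₂ : σ₂.a .cnt = σ₁.a .cnt := hF₂.a .cnt rfl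
      have hne : ∀ i : ℕ, i < q₁ → σ₁.a .sv i ≠ σ₁.r .cv := by
        intro i hi hc
        rw [hr] at hc
        have := hold₁ i hi
        rw [hc, hck] at this
        omega
      have hS₂ := hD.stages hp hS₁ (by omega) (by omega) (by rw [hr, hck]) (by omega) hne hcnt₂
      refine ⟨q₁ + 1, by omega, hS₂.congr (by simp) (by simp), ?_, ?_⟩
      · intro i hi
        simp only [Store.set_a, hcnt₂, hD.asv, hr]
        by_cases hiq : i = q₁
        · subst hiq
          left; simp [hck]; omega
        · rw [Function.update_of_ne (by omega)]
          exact (hold₁ i (by omega)).imp_left fun h => ⟨h.1, by push_cast; omega⟩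
      · right
        have hM := hD.mult
        rw [hr] at hM
        have := hs2 _ hM
        simp only [Store.set_r, reduceCtorEq, if_false]
        rw [hD.sg, hD.sl, hr]
        exact this
    · intro he
      rw [Ex.den_mul_eq_zero', Ex.den_mul_eq_zero', Ex.den_lt_eq_zero, Ex.den_lt_eq_zero,
        Ex.den_le_eq_zero, hl2, hh2] at he
      simp [hr, hck, hp₁] at he
      refine WP.straight (by simp) ⟨q₁, by omega, hS₁.congr (by simp) (by simp), ?_, ?_⟩
        (show 1 ≤ _ by omega)
      · intro i hi
        exact (hold₁ i hi).imp_left fun h => ⟨h.1, h.2.trans (by push_cast; omega)⟩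
      · simp only [Cd.fin_skip, Store.set_r, reduceCtorEq, if_false]
        rcases hJ₁ with h | h
        · exact Or.inl h
        · by_cases h2 : (p : ℤ) - 1 ≤ σ₁.r .sl
          · exact Or.inl h2
          · exact Or.inr (hskip _ _ _ _ hk (by omega) h)
  · change ∑ k ∈ Finset.Ico 0 p, (50 * cn k + 450 + 1 + 10) + 1 + 1 + 5 ≤ _
    rw [← Finset.range_eq_Ico]
    have : ∀ k, 50 * cn k + 450 + 1 + 10 = 461 + 50 * cn k := fun k => by ring
    simp only [this, Finset.sum_add_distrib, ← Finset.mul_sum, Finset.sum_const,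
      Finset.card_range, smul_eq_mul]
    omega
  · rintro σ' hF ⟨⟨q', h1, h2, h3, h4⟩, -⟩
    refine ⟨q', h1, h2, fun i hi => ?_, h4⟩
    rcases h3 i hi with h | h
    · exact Or.inl h.1
    · exact Or.inr h.2

/-- `J` is kept by the stages of a pass through the classes with at least `a` and less than `b`
elements. -/
structure Kept (p : ℕ) (cn : ℕ → ℕ) (a b : ℕ) (J : ℕ → ℕ → ℤ → ℤ → Prop) : Prop where
  skip : ∀ (k q : ℕ) (g L : ℤ), k < p → ¬ (a ≤ cn k ∧ cn k < b) → J k q g L → J (k + 1) q g L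
  step : ∀ (k q : ℕ) (g L : ℤ), 0 < k → k < p → a ≤ cn k → cn k < b → 0 ≤ L → L < p - 1 →
    0 ≤ g ∧ g < p → (q ≠ 0 → IsCoprime g p) → J k q g L →
    (∃ b : ℤ, 1 ≤ b ∧ 2 * b ≤ cn k + 2 ∧ Near p L (b * (scale p g k q * k))) ∧
    ∀ b, Mult p (scale p g k q) L k (cn k) b →
      J (k + 1) (q + 1) (b * scale p g k q % p) (stageL p (scale p g k q) L k b (cn k))

/-! ### Two conditions under which all residues are reached. -/

/-- The classes with at least `M` elements, and then the other ones, lead to all residues. -/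
def Reaches (p M : ℕ) (cn : ℕ → ℕ) : Prop :=
  ∃ J₁ J₂ : ℕ → ℕ → ℤ → ℤ → Prop, Kept p cn M (2 * p) J₁ ∧ Kept p cn 1 M J₂ ∧ J₁ 0 0 1 0 ∧
    (∀ q g L, J₁ p q g L → J₂ 0 q g L) ∧ ∀ q g L, J₂ p q g L → (p : ℤ) - 1 ≤ L

theorem one_of_near {p : ℕ} {g L v m b : ℤ} (h : Mult p g L v m b) (hn : Near p L (1 * (g * v))) :
    b = 1 := by
  by_contra hb
  have := h.pos
  exact h.min 1 le_rfl (by omega) hn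

theorem near_one_of_half {p : ℕ} {L : ℤ} (h : (p : ℤ) - 1 ≤ 2 * L) (z : ℤ) : Near p L z := by
  simp only [Near]; omega

theorem stageL_one {p : ℕ} {g L v m : ℤ} : stageL p g L v 1 m =
    L + m * dist p L (g * v % p) := by simp [stageL]

/-- With `e` the distance, the excess over `L + m` equals `(b - 1) * (L - 2) + (m - 2 * b + 2) * (e
- 1)`. -/
theorem stageL_ge {p : ℕ} (hp : p.Prime) {g L v m b : ℤ} (h : Mult p g L v m b)
    (hg : IsCoprime g p) (hv : IsCoprime v p) (hmp : m < p) (hm : 1 ≤ m)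
    (hL : b = 1 ∨ 2 ≤ L) : L + m ≤ stageL p g L v b m := by
  have h1 := h.pos
  have h2 := h.le
  have h3 := dist_pos (L := L) hp hg hv h1 (by omega)
  simp only [stageL]
  rcases hL with rfl | hL
  · nlinarith
  · nlinarith [mul_nonneg (show 0 ≤ b - 1 by omega) (show 0 ≤ L - 2 by omega),
      mul_nonneg (show 0 ≤ m - 2 * b + 2 by omega) (sub_nonneg.2 h3)]

/-- The number of elements in the classes below `k` with at least `a` and less than `b`
elements. -/
def count (cn : ℕ → ℕ) (a b k : ℕ) : ℕ :=
  ∑ v ∈ Finset.range k, if a ≤ cn v ∧ cn v < b then cn v else 0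

/-- The first class is scaled to the value `1`, so from the interval of length `0` it leads to an
interval whose length is its size. -/
theorem scale_first {p : ℕ} (hp : p.Prime) {g : ℤ} {k : ℕ} (hk : 0 < k) (hkp : k < p) :
    scale p g k 0 * k % p = 1 := by
  obtain ⟨_, h1, h2, h3⟩ := gcdA_spec hp (v := k) (by omega) (by omega)
  have := hp.two_le
  rw [scale, if_pos rfl, mul_comm, h3, Int.emod_eq_of_lt (by omega) (by omega)]

/-- After the first large class `L ≥ M`, so `exists_near` provides `b` with `b * (M + 1) ≤ p`, and
`2 * p ≤ M * M` makes `b` small enough for each class of at least `M` elements. Every class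
increases `L` by at least its size (`stageL_ge`). After all large classes `2 * L ≥ p - 1`, every
residue is near `0`, and the multiplier `1` serves for all remaining classes. -/
theorem reaches_high {p M : ℕ} (hp : p.Prime) (cn : ℕ → ℕ) (hM : 2 ≤ M) (hMp : 2 * p ≤ M * M)
    (hcnp : ∀ v, cn v < p) (hhalf : p - 1 ≤ 2 * count cn M (2 * p) p)
    (htot : p - 1 ≤ count cn M (2 * p) p + count cn 1 M p) : Reaches p M cn := by
  have hp2 := hp.two_le
  have hcount : ∀ a b k : ℕ, count cn a b (k + 1) = count cn a b k +
      if a ≤ cn k ∧ cn k < b then cn k else 0 := fun a b k => Finset.sum_range_succ _ _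
  -- Either no large class has occurred yet, or `L` is at least `M` and at least the number of
  -- elements added so far.
  refine ⟨fun k q _ L => (q = 0 ∧ L = 0 ∧ count cn M (2 * p) k = 0) ∨
      (q ≠ 0 ∧ count cn M (2 * p) k ≤ L ∧ M ≤ L),
    fun k q _ L => q ≠ 0 ∧ (p : ℤ) - 1 ≤ 2 * L ∧
      count cn M (2 * p) p + count cn 1 M k ≤ L, ⟨?_, ?_⟩, ⟨?_, ?_⟩, ?_, ?_, ?_⟩
  · intro k q g L hk hn h
    rw [hcount, if_neg hn]; exact h
  · intro k q g L hk0 hk ha hb hL hLp hg hco h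
    rw [hcount, if_pos ⟨ha, hb⟩]
    have hcp := hcnp k
    have hkc := isCoprime_of_lt hp (b := k) (by omega) (by omega)
    obtain ⟨hs0, hs1, hs2⟩ := scale_spec hp (v := k) (by omega) (by omega) hg hco
    rcases h with ⟨rfl, rfl, h0⟩ | ⟨hq, h1, h2⟩
    · have hsk := scale_first hp (g := g) hk0 hk
      have hn : Near p 0 (1 * (scale p g k 0 * k)) := by
        left; rw [one_mul, hsk]; norm_num
      refine ⟨⟨1, le_rfl, by omega, hn⟩, fun b hM' => ?_⟩
      obtain rfl := one_of_near hM' hn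
      have := stageL_ge hp hM' hs2 hkc (by omega) (by omega) (Or.inl rfl)
      right
      refine ⟨by omega, by push_cast; omega, by omega⟩
    · obtain ⟨b, hb1, hb2, hb3⟩ := exists_near hp.pos (scale p g k q * k) hL (by omega)
      have hbM : 2 * b ≤ cn k + 2 := by
        have h3 : b * (M + 1) ≤ p := (mul_le_mul_of_nonneg_left (by omega) (by omega)).trans hb2
        by_contra hc
        have h4 : (M : ℤ) * M + M < 2 * b * (M + 1) := by nlinarith
        zify at hMp
        nlinarith
      refine ⟨⟨b, hb1, hbM, hb3⟩, fun b' hM' => ?_⟩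
      have := stageL_ge hp hM' hs2 hkc (by omega) (by omega) (Or.inr (by omega))
      right
      refine ⟨by omega, by push_cast; omega, by omega⟩
  · intro k q g L hk hn h
    rw [hcount, if_neg hn]; exact h
  · rintro k q g L hk0 hk ha hb hL hLp hg hco ⟨hq, h1, h2⟩
    rw [hcount, if_pos ⟨ha, hb⟩]
    have hcp := hcnp k
    have hkc := isCoprime_of_lt hp (b := k) (by omega) (by omega)
    obtain ⟨hs0, hs1, hs2⟩ := scale_spec hp (v := k) (by omega) (by omega) hg hco
    have hn := near_one_of_half h1 (1 * (scale p g k q * k))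
    refine ⟨⟨1, le_rfl, by omega, hn⟩, fun b hM' => ?_⟩
    obtain rfl := one_of_near hM' hn
    have := stageL_ge hp hM' hs2 hkc (by omega) (by omega) (Or.inl rfl)
    refine ⟨by omega, by omega, by push_cast; omega⟩
  · left; simp [count]
  · rintro q g L (⟨_, _, h⟩ | ⟨h1, h2, h3⟩)
    · omega
    · refine ⟨h1, by omega, ?_⟩
      simpa [count] using h2
  · rintro q g L ⟨h1, h2, h3⟩
    omega

/-- The class of value `1` alone gives `L = cn 1 ≥ T`. All other values that occur are at most `T`,
hence within `L` of `0`: the multiplier and the scale remain `1`, and the class of value `k`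
increases `L` by `k * cn k`. So `L` reaches the sum of all values. -/
theorem reaches_low {p M : ℕ} (hp : p.Prime) (cn : ℕ → ℕ) (T : ℕ) (hM : 1 ≤ M)
    (hMT : M ≤ cn 1) (hT : T ≤ cn 1) (hcnT : ∀ v, 0 < cn v → v ≤ T) (hcnp : ∀ v, cn v < p)
    (hsum : p - 1 ≤ ∑ v ∈ Finset.range p, v * cn v) : Reaches p M cn := by
  have hp2 := hp.two_le
  have hcount : ∀ a b k : ℕ, (∑ v ∈ Finset.range (k + 1), if a ≤ cn v ∧ cn v < b then
      v * cn v else 0) = (∑ v ∈ Finset.range k, if a ≤ cn v ∧ cn v < b then v * cn v else 0) +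
      if a ≤ cn k ∧ cn k < b then k * cn k else 0 := fun a b k => Finset.sum_range_succ _ _
  have hstep : ∀ (k q : ℕ) (g L : ℤ), 0 < k → k < p → 1 ≤ cn k → g = 1 → q ≠ 0 → (T : ℤ) ≤ L →
      L < p - 1 → (∃ b : ℤ, 1 ≤ b ∧ 2 * b ≤ cn k + 2 ∧ Near p L (b * (scale p g k q * k))) ∧
      ∀ b, Mult p (scale p g k q) L k (cn k) b → b * scale p g k q % p = 1 ∧
        stageL p (scale p g k q) L k b (cn k) = L + (k * cn k : ℕ) := by
    rintro k q _ L hk0 hk hc rfl hq hL hLp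
    have h1 : scale p 1 k q = 1 := by rw [scale, if_neg hq]
    have hkT := hcnT k hc
    have h2 : (k : ℤ) % p = k := Int.emod_eq_of_lt (by omega) (by omega)
    rw [h1]
    have hn : Near p L (1 * (1 * k)) := by
      left; rw [one_mul, one_mul, h2]; omega
    refine ⟨⟨1, le_rfl, by omega, hn⟩, fun b hM' => ?_⟩
    obtain rfl := one_of_near hM' hn
    refine ⟨Int.emod_eq_of_lt (by omega) (by omega), ?_⟩
    rw [stageL_one, one_mul, h2, dist, if_pos (by omega)]
    push_cast; ring
  -- The class of value `1` belongs to the first pass by `hMT`. The values are visited in increasing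
  -- order and the class of value `0` is not added, so it is the first class.
  refine ⟨fun k q g L => (k ≤ 1 ∧ q = 0 ∧ L = 0) ∨ (2 ≤ k ∧ q ≠ 0 ∧ g = 1 ∧ (T : ℤ) ≤ L ∧
      ((∑ v ∈ Finset.range k, if M ≤ cn v ∧ cn v < 2 * p then v * cn v else 0 : ℕ) : ℤ) ≤ L),
    fun k q g L => q ≠ 0 ∧ g = 1 ∧ (T : ℤ) ≤ L ∧
      ((∑ v ∈ Finset.range p, if M ≤ cn v ∧ cn v < 2 * p then v * cn v else 0 : ℕ) : ℤ) +
      ((∑ v ∈ Finset.range k, if 1 ≤ cn v ∧ cn v < M then v * cn v else 0 : ℕ) : ℤ) ≤ L,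
    ⟨?_, ?_⟩, ⟨?_, ?_⟩, ?_, ?_, ?_⟩
  · rintro k q g L hk hn (⟨h1, h2⟩ | ⟨h1, h2⟩)
    · left
      refine ⟨?_, h2⟩
      by_contra hc
      obtain rfl : k = 1 := by omega
      exact hn ⟨hMT, by have := hcnp 1; omega⟩
    · right
      rw [hcount, if_neg hn]; exact ⟨by omega, h2⟩
  · rintro k q g L hk0 hk ha hb hL hLp hg hco (⟨h1, rfl, rfl⟩ | ⟨h1, h2, h3, h4, h5⟩)
    · obtain rfl : k = 1 := by omega
      have hsk := scale_first hp (g := g) hk0 hk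
      obtain ⟨hs0, hs1, hs2⟩ := scale_spec hp (v := (1 : ℕ)) (q := 0) (by omega) (by omega) hg hco
      have hs : scale p g (1 : ℕ) 0 = 1 := by
        rw [Nat.cast_one, mul_one] at hsk
        rw [Nat.cast_one] at hs0 hs1
        rwa [Int.emod_eq_of_lt hs0 hs1] at hsk
      rw [hs]
      have hone : (1 : ℤ) % p = 1 := Int.emod_eq_of_lt (by omega) (by omega)
      have hn : Near p 0 (1 * (1 * (1 : ℕ))) := by left; simp [hone]
      refine ⟨⟨1, le_rfl, by omega, hn⟩, fun b hM' => ?_⟩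
      obtain rfl := one_of_near hM' hn
      right
      have hL' : stageL p 1 0 (1 : ℕ) 1 (cn 1) = cn 1 := by
        rw [stageL_one]; simp [hone, dist]
      rw [hL']
      refine ⟨le_rfl, by omega, by simp [hone], by omega, ?_⟩
      rw [hcount, if_pos ⟨ha, hb⟩]
      simp
    · obtain ⟨h6, h7⟩ := hstep k q g L hk0 hk (by omega) h3 h2 h4 hLp
      refine ⟨h6, fun b hM' => Or.inr ?_⟩
      obtain ⟨h8, h9⟩ := h7 b hM'
      rw [h8, h9, hcount, if_pos ⟨ha, hb⟩]
      refine ⟨by omega, by omega, rfl, by omega, ?_⟩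
      push_cast at h5 ⊢; omega
  · rintro k q g L hk hn ⟨h1, h2, h3, h4⟩
    rw [hcount, if_neg hn]; exact ⟨h1, h2, h3, h4⟩
  · rintro k q g L hk0 hk ha hb hL hLp hg hco ⟨h1, h2, h3, h4⟩
    obtain ⟨h6, h7⟩ := hstep k q g L hk0 hk (by omega) h2 h1 h3 hLp
    refine ⟨h6, fun b hM' => ?_⟩
    obtain ⟨h8, h9⟩ := h7 b hM'
    rw [h8, h9, hcount, if_pos ⟨ha, hb⟩]
    refine ⟨by omega, rfl, by omega, ?_⟩
    push_cast at h4 ⊢; omega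
  · left; simp
  · rintro q g L (⟨h, _⟩ | ⟨h1, h2, h3, h4, h5⟩)
    · omega
    · exact ⟨h2, h3, h4, by simpa using h5⟩
  · rintro q g L ⟨h1, h2, h3, h4⟩
    refine le_trans ?_ h4
    rw [← Nat.cast_add, ← Finset.sum_add_distrib]
    have : ∑ v ∈ Finset.range p, v * cn v ≤ ∑ v ∈ Finset.range p,
        ((if M ≤ cn v ∧ cn v < 2 * p then v * cn v else 0) +
          if 1 ≤ cn v ∧ cn v < M then v * cn v else 0) := by
      refine Finset.sum_le_sum fun v _ => ?_
      have hcp := hcnp v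
      by_cases h0 : cn v = 0
      · simp [h0]
      · by_cases hm : M ≤ cn v
        · rw [if_pos ⟨hm, by omega⟩]; omega
        · rw [if_pos (show 1 ≤ cn v ∧ cn v < M by omega)]; omega
    omega

/-- Find a sequence of stages that leads to all residues. -/
def steps : Cd :=
  .st ::= 0 ;; .sg ::= 1 ;; .sc ::= 0 ;; .sl ::= 0 ;;
  pass (.reg .m) (.reg .p + .reg .p) ;; pass 1 (.reg .m)

theorem wp_steps {σ : Store} {p M : ℕ} (hp : p.Prime) (hrp : σ.r .p = p) (hrm : σ.r .m = M)
    (hM : 1 ≤ M) (cn : ℕ → ℕ) (hcn : ∀ v : ℕ, v < p → σ.a .cnt v = cn v) (hcn0 : cn 0 = 0)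
    (hcnp : ∀ v, cn v < p) (hqr : 2 * p ≤ C.rows) (hbig : 10 * ((p : ℤ) * p) ≤ C.big)
    (hJ : Reaches p M cn) :
    WP C steps (fun σ' => ∃ q ≤ 2 * p, Stages p q σ' ∧ (p : ℤ) - 1 ≤ σ'.r .sl)
      (1000 * p + 100 * (∑ v ∈ Finset.range p, cn v) + 200) σ := by
  have hb1 := C.rows_le_big; have hb2 := C.hstride
  simp only [stride, Nat.cast_ofNat] at hb2
  have hp2 := hp.two_le
  obtain ⟨J₁, J₂, hK₁, hK₂, h0, h1, h2⟩ := hJ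
  refine (WP.seq (b := 2) (R := fun s => s = σ.set .st 0)
    (WP.straight (by simp) (by simp) (Nat.le_of_ble_eq_true rfl)) ?_
    (b' := 1000 * p + 100 * (∑ v ∈ Finset.range p, cn v) + 190)).mono (by omega) (fun _ _ h => h)
  rintro _ - rfl
  refine (WP.seq (b := 2) (R := fun s => s = (σ.set .st 0).set .sg 1)
    (WP.straight (by simp) (by simp) (Nat.le_of_ble_eq_true rfl)) ?_
    (b' := 1000 * p + 100 * (∑ v ∈ Finset.range p, cn v) + 180)).mono (by omega) (fun _ _ h => h)
  rintro _ - rfl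
  refine (WP.seq (b := 2) (R := fun s => s = ((σ.set .st 0).set .sg 1).set .sc 0)
    (WP.straight (by simp) (by simp) (Nat.le_of_ble_eq_true rfl)) ?_
    (b' := 1000 * p + 100 * (∑ v ∈ Finset.range p, cn v) + 170)).mono (by omega) (fun _ _ h => h)
  rintro _ - rfl
  refine (WP.seq (b := 2) (R := fun s => s = (((σ.set .st 0).set .sg 1).set .sc 0).set .sl 0)
    (WP.straight (by simp) (by simp) (Nat.le_of_ble_eq_true rfl)) ?_
    (b' := 1000 * p + 100 * (∑ v ∈ Finset.range p, cn v) + 160)).mono (by omega) (fun _ _ h => h)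
  rintro _ - rfl
  set σ₀ := (((σ.set .st 0).set .sg 1).set .sc 0).set .sl 0 with hσ₀
  have hrp₀ : σ₀.r .p = p := by simp [hσ₀, hrp]
  have hrm₀ : σ₀.r .m = M := by simp [hσ₀, hrm]
  have hS₀ : Stages p 0 σ₀ := by
    constructor <;> first | (intro i hi; omega) | skip
    · simp [hσ₀]
    · simp only [hσ₀, Store.set_r, reduceCtorEq, if_true, if_false]; omega
    · intro h; exact absurd rfl h
    · simp only [hσ₀, Store.set_r, reduceCtorEq, if_true, if_false]; omega
    · simp [hσ₀]
    · intro _; simp [hσ₀]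
    · intro h; exact absurd rfl h
  refine (WP.seq (wp_pass (lo := .reg .m) (hi := .reg .p + .reg .p) (a := M) (b := 2 * p) hp hrp₀ cn (by simpa [hσ₀] using hcn) hcn0 hcnp
    (fun s hF => ⟨trivial, by simp [hF.r .m rfl, hrm₀]⟩)
    (fun s hF => ⟨by simp [hF.r .p rfl, hrp₀]; omega, by simp [hF.r .p rfl, hrp₀]; ring⟩)
    (Nat.le_of_ble_eq_true rfl) hM hS₀ (by omega) hbig (fun i hi => by omega) J₁
    (Or.inr (by simpa [hσ₀] using h0)) hK₁.skip hK₁.step)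
    (b' := 500 * p + 50 * (∑ v ∈ Finset.range p, cn v) + 50) ?_).mono (by omega) (fun _ _ h => h)
  rintro σ₁ hF₁ ⟨q₁, hq₁, hS₁, hold₁, hJ₁⟩
  refine (wp_pass (lo := 1) (hi := .reg .m) (a := 1) (b := M) hp ((hF₁.r .p rfl).trans hrp₀) cn
    (by simpa [hF₁.a .cnt rfl, hσ₀] using hcn) hcn0 hcnp
    (fun s hF => ⟨by simp, by simp⟩)
    (fun s hF => ⟨trivial, by simp [hF.r .m rfl, hF₁.r .m rfl, hrm₀]⟩)
    (Nat.le_of_ble_eq_true rfl) le_rfl hS₁ (by omega) hbig (fun i hi => ?_) J₂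
    (hJ₁.imp_right (h1 _ _ _)) hK₂.skip hK₂.step).mono le_rfl ?_
  · rcases hold₁ i hi with h | ⟨j, hj, -⟩
    · exact h
    · omega
  · rintro σ₂ - ⟨q₂, hq₂, hS₂, -, hJ₂⟩
    exact ⟨q₂, by omega, hS₂, hJ₂.elim id (h2 _ _ _)⟩

/-! ### Reconstruction of a set of nodes with a given sum. -/

/-- Go backwards through the stages, and switch on nodes with the sum `- base`. -/
def recon : Cd :=
  .di ::= 0 ;;
  .rx ::= (.reg .p - .reg .base) % .reg .p ;;
  .ri ::= .reg .st ;;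
  .loop (0 ≺ .reg .ri) (
    .ri ::= .reg .ri - 1 ;;
    .dv ::= .arr .sv (.reg .ri) ;;
    .rz ::= .arr .head (.reg .dv) ;;
    .loop (.arr .sl (.reg .ri) ≺ (.arr .ss (.reg .ri) * .reg .rx - .arr .sc (.reg .ri)) % .reg .p) (
      .put .st (.reg .rz) 1 ;;
      .di ::= .reg .di + 1 ;;
      .rz ::= .arr .nxt (.reg .rz) ;;
      .rx ::= (.reg .rx - .reg .dv) % .reg .p))

/-- The nodes in `W` and the node `lone` are switched on, and the residue `x` is missing in the
sum of the values of the nodes in `W`. -/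
structure Marked (nn p : ℕ) (lone t x d : ℤ) (V st : ℤ → ℤ) (ys W : List ℤ) : Prop where
  nodup : W.Nodup
  sub : ∀ z ∈ W, z ∈ ys
  st : ∀ z : ℤ, 0 ≤ z → z < nn → st z = if z = lone ∨ z ∈ W then 1 else 0
  sum : x + (W.map V).sum ≡ t [ZMOD p]
  pos : 0 ≤ x ∧ x < p
  len : d = W.length

theorem Marked.step {nn p : ℕ} {lone t x d z : ℤ} {V st : ℤ → ℤ} {ys W : List ℤ}
    (h : Marked nn p lone t x d V st ys W) (hp : 0 < p) (hz : z ∈ ys) (hzW : z ∉ W) :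
    Marked nn p lone t ((x - V z) % p) (d + 1) V (Function.update st z 1) ys (W ++ [z]) := by
  obtain ⟨h1, h2, h3, h4, h5, h6⟩ := h
  constructor
  · rw [List.nodup_append]
    refine ⟨h1, by simp, fun a ha b hb => ?_⟩
    rw [List.mem_singleton] at hb
    rintro rfl
    exact hzW (hb ▸ ha)
  · intro y hy
    rw [List.mem_append, List.mem_singleton] at hy
    rcases hy with hy | rfl
    · exact h2 y hy
    · exact hz
  · intro y hy0 hy1
    by_cases hyz : y = z
    · subst hyz; simp
    · rw [Function.update_of_ne hyz, h3 y hy0 hy1]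
      simp [hyz]
  · rw [List.map_append, List.sum_append, List.map_singleton, List.sum_singleton]
    refine Int.ModEq.trans ?_ h4
    calc (x - V z) % p + ((W.map V).sum + V z)
        ≡ (x - V z) + ((W.map V).sum + V z) [ZMOD p] := (Int.mod_modEq _ _).add_right _
      _ = x + (W.map V).sum := by ring
  · exact ⟨Int.emod_nonneg _ (by omega), Int.emod_lt_of_pos _ (by omega)⟩
  · simp [h6]

theorem Marked.length_le {nn p : ℕ} {lone t x d : ℤ} {V st : ℤ → ℤ} {ys W : List ℤ}
    (h : Marked nn p lone t x d V st ys W) : W.length ≤ ys.length :=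
  (h.nodup.subperm h.sub).length_le

/-- If the missing residue `x` lies in the interval after a stage, `Link` provides `j` such that `x
- j * v` lies in the interval before it. The inner loop switches on nodes of the class of `v` until
the latter is true, hence as many as the least such `j`. The interval at index `0` contains only the
residue `0`. -/
theorem wp_recon {σ : Store} {p nn q : ℕ} {lone : ℤ} {ys : List ℤ} (hp : p.Prime)
    (hrp : σ.r .p = p) (hN : Nodes p nn lone σ) (hB : Buckets σ p ys) (hS : Stages p q σ)
    (hsl : (p : ℤ) - 1 ≤ σ.r .sl) (hq : q ≤ C.rows) (hys : ∀ x ∈ ys, 0 ≤ x ∧ x < nn)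
    (hnd : ys.Nodup) (hnr : nn ≤ C.rows) (hpr : p ≤ C.rows) (hlen : ys.length ≤ C.rows)
    (hbig : 10 * ((p : ℤ) * p) ≤ C.big) :
    WP C recon (fun σ' => ∃ W : List ℤ, W.Nodup ∧ (∀ z ∈ W, z ∈ ys) ∧
      (∀ x : ℤ, 0 ≤ x → x < nn → σ'.a .st x = if x = lone ∨ x ∈ W then 1 else 0) ∧
      σ.r .base + (W.map (σ.a .val)).sum ≡ 0 [ZMOD p])
      (100 * q + 100 * ys.length + 100) σ := by
  have hb1 := C.rows_le_big; have hb2 := C.hstride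
  simp only [stride, Nat.cast_ofNat] at hb2
  have hp2 := hp.two_le
  have hpp : (p : ℤ) ≤ p * p := by nlinarith
  have hbase := hN.base_lt
  have hmodb : ∀ z : ℤ, 0 ≤ z % p ∧ z % p < p := fun z =>
    ⟨Int.emod_nonneg _ (by omega), Int.emod_lt_of_pos _ (by omega)⟩
  set V := σ.a .val with hV
  set x₀ := (p - σ.r .base) % p with hx₀
  refine (WP.seq (b := 2) (R := fun s => s = σ.set .di 0)
    (WP.straight (by simp) (by simp) (Nat.le_of_ble_eq_true rfl)) ?_
    (b' := 100 * q + 100 * ys.length + 90)).mono (by omega) (fun _ _ h => h)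
  rintro _ - rfl
  refine (WP.seq (b := 6) (R := fun s => s = (σ.set .di 0).set .rx x₀)
    (WP.straight (by simp [hrp]; omega) (by simp [hrp, hx₀]) (Nat.le_of_ble_eq_true rfl)) ?_
    (b' := 100 * q + 100 * ys.length + 80)).mono (by omega) (fun _ _ h => h)
  rintro _ - rfl
  have hst := hS.st
  refine (WP.seq (b := 2) (R := fun s => s = ((σ.set .di 0).set .rx x₀).set .ri q)
    (WP.straight (by simp) (by simp [hst]) (Nat.le_of_ble_eq_true rfl)) ?_
    (b' := 100 * q + 100 * ys.length + 70)).mono (by omega) (fun _ _ h => h)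
  rintro _ - rfl
  set σ₀ := ((σ.set .di 0).set .rx x₀).set .ri q with hσ₀
  have hc1 : (0 ≺ Ex.reg .ri).cost = 3 := rfl
  refine (WP.loop (fun s => ∃ i : ℕ, i ≤ q ∧ s.r .ri = i ∧ ∃ W : List ℤ,
      Marked nn p lone (-σ.r .base) (s.r .rx) (s.r .di) V (s.a .st) ys W ∧
      (∀ z ∈ W, ∃ j : ℕ, i ≤ j ∧ j < q ∧ V z = σ.a .sv j) ∧
      (i < q → (σ.a .ss i * s.r .rx - σ.a .sc i) % p ≤ σ.a .sl i))
    -- The register `di` counts the nodes switched on, and serves only the potentials.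
    (fun s => 100 * (s.r .ri).toNat + 50 * (ys.length - (s.r .di).toNat)) ?_ ?_ ?_).mono ?_ ?_
  · refine ⟨q, le_rfl, by simp [hσ₀], [], ⟨List.nodup_nil, by simp, ?_, ?_, ?_, ?_⟩, by simp,
      fun h => absurd h (lt_irrefl _)⟩
    · intro z h0 h1; simpa [hσ₀] using hN.st z h0 h1
    · simp only [hσ₀, Store.set_r, if_false, if_true, reduceCtorEq, List.map_nil, List.sum_nil,
        add_zero, hx₀]
      refine (Int.mod_modEq _ _).trans ?_
      rw [Int.modEq_iff_dvd]; exact ⟨-1, by ring⟩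
    · simpa [hσ₀] using hmodb _
    · simp [hσ₀]
  · intro s _ _; simp
  · rintro s hF ⟨i', hi', hri, W, hW, hWv, hi⟩ hz
    rw [Ne, Ex.den_lt_eq_zero] at hz
    simp [hri] at hz
    obtain ⟨i, rfl⟩ : ∃ i, i' = i + 1 := ⟨i' - 1, by omega⟩
    have hrp' : s.r .p = p := by rw [hF.r .p rfl]; simp [hσ₀, hrp]
    have hsv : s.a .sv = σ.a .sv := hF.a .sv rfl
    have hss : s.a .ss = σ.a .ss := hF.a .ss rfl
    have hsc : s.a .sc = σ.a .sc := hF.a .sc rfl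
    have hsl' : s.a .sl = σ.a .sl := hF.a .sl rfl
    have hhead : s.a .head = σ.a .head := hF.a .head rfl
    have hnxt : s.a .nxt = σ.a .nxt := hF.a .nxt rfl
    set v := σ.a .sv i with hv
    obtain ⟨hv0, hv1⟩ := hS.val i (by omega)
    rw [← hv] at hv0 hv1
    obtain ⟨hch, hcn⟩ := hB v hv0.le hv1
    set m := cls V ys v with hm
    obtain ⟨⟨hs0, hs1⟩, hc0, hc1'⟩ := hS.bounds i (by omega)
    have hlink : ∃ j : ℤ, 0 ≤ j ∧ j ≤ m.length ∧
        (σ.a .ss i * (s.r .rx - j * v) - σ.a .sc i) % p ≤ σ.a .sl i := by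
      rw [← hcn]
      by_cases hiq : i + 1 < q
      · have := hi hiq
        push_cast at this
        exact hS.link i hiq _ this
      · refine hS.last i (by omega) _ ?_
        -- The final interval has length at least `p - 1` and therefore contains every residue.
        have := hmodb (σ.r .sg * s.r .rx - σ.r .sc)
        omega
    have hlink' : ∃ j : ℕ, j ≤ m.length ∧
        (σ.a .ss i * (s.r .rx - j * v) - σ.a .sc i) % p ≤ σ.a .sl i := by
      obtain ⟨j, h0, h1, h2⟩ := hlink
      obtain ⟨j, rfl⟩ := Int.eq_ofNat_of_zero_le h0
      exact ⟨j, by omega, h2⟩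
    set J := Nat.find hlink' with hJ
    obtain ⟨hJ1, hJ2⟩ := Nat.find_spec hlink'
    rw [← hJ] at hJ1 hJ2
    have hJmin : ∀ j : ℕ, j < J → ¬ (σ.a .ss i * (s.r .rx - j * v) - σ.a .sc i) % p ≤ σ.a .sl i :=
      fun j hj hc => Nat.find_min hlink' hj ⟨by omega, hc⟩
    have hWl := hW.length_le
    have hdi := hW.len
    have hri' : s.r .ri - 1 = i := by rw [hri]; push_cast; ring
    refine ⟨50 + 50 * J, ?_⟩
    refine (WP.seq (b := 4) (R := fun s₁ => s₁ = s.set .ri i)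
      (WP.straight (by simp [hri]; omega) (by simp [hri']) (Nat.le_of_ble_eq_true rfl)) ?_
      (b' := 46 + 50 * J)).mono (by omega) (fun _ _ h => h)
    rintro _ - rfl
    refine (WP.seq (b := 7) (R := fun s₁ => s₁ = (s.set .ri i).set .dv v)
      (WP.straight (by simp; omega) (by simp [hsv, hv]) (Nat.le_of_ble_eq_true rfl)) ?_
      (b' := 39 + 50 * J)).mono (by omega) (fun _ _ h => h)
    rintro _ - rfl
    refine (WP.seq (b := 7) (R := fun s₁ => s₁ = ((s.set .ri i).set .dv v).set .rz (σ.a .head v))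
      (WP.straight (by simp; omega) (by simp [hhead]) (Nat.le_of_ble_eq_true rfl)) ?_
      (b' := 32 + 50 * J)).mono (by omega) (fun _ _ h => h)
    rintro _ - rfl
    set s₀ := ((s.set .ri i).set .dv v).set .rz (σ.a .head v) with hs₀
    have hc2 : (.arr .sl (.reg .ri) ≺ (.arr .ss (.reg .ri) * .reg .rx - .arr .sc (.reg .ri)) %
      .reg .p : Ex).cost = 24 := rfl
    -- Different stages belong to different values, so no node is switched on twice.
    have hmW : ∀ z ∈ m, z ∉ W := by
      intro z hz hzW
      obtain ⟨j, hj, hjq, hjv⟩ := hWv z hzW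
      rw [(mem_cls.1 hz).2, hv] at hjv
      exact hS.ne i j (by omega) hjq hjv
    refine (WP.loop (fun s' => ∃ l₁ l₂, m = l₁ ++ l₂ ∧ l₁.length ≤ J ∧
        Marked nn p lone (-σ.r .base) (s'.r .rx) (s'.r .di) V (s'.a .st) ys (W ++ l₁) ∧
        Chain (σ.a .nxt) (s'.r .rz) l₂ ∧ s'.r .rx ≡ s.r .rx - l₁.length * v [ZMOD p])
      (fun s' => 50 * (J + W.length - (s'.r .di).toNat)) ?_ ?_ ?_).mono ?_ ?_
    · exact ⟨[], m, rfl, by simp, by simpa [hs₀] using hW, by simpa [hs₀] using hch,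
        by simp [hs₀]⟩
    · rintro s' hF' ⟨l₁, l₂, he, hlJ, hM, hC, hx⟩
      have r1 : s'.r .ri = i := by rw [hF'.r .ri rfl]; simp [hs₀]
      have r2 : s'.r .p = p := by rw [hF'.r .p rfl]; simp [hs₀, hrp']
      have a1 : s'.a .ss = σ.a .ss := by rw [hF'.a .ss rfl]; simp [hs₀, hss]
      have a2 : s'.a .sc = σ.a .sc := by rw [hF'.a .sc rfl]; simp [hs₀, hsc]
      have hx0 := hM.pos
      have := mul_bounds hs0 hs1.le hx0.1 hx0.2.le (Z := C.big) (by omega)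
      simp [r1, r2, a1, a2]
      omega
    · rintro s' hF' ⟨l₁, l₂, he, hlJ, hM, hC, hx⟩ hz'
      have r1 : s'.r .ri = i := by rw [hF'.r .ri rfl]; simp [hs₀]
      have r2 : s'.r .p = p := by rw [hF'.r .p rfl]; simp [hs₀, hrp']
      have r3 : s'.r .dv = v := by rw [hF'.r .dv rfl]; simp [hs₀]
      have a1 : s'.a .ss = σ.a .ss := by rw [hF'.a .ss rfl]; simp [hs₀, hss]
      have a2 : s'.a .sc = σ.a .sc := by rw [hF'.a .sc rfl]; simp [hs₀, hsc]
      have a3 : s'.a .sl = σ.a .sl := by rw [hF'.a .sl rfl]; simp [hs₀, hsl']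
      have a4 : s'.a .nxt = σ.a .nxt := by rw [hF'.a .nxt rfl]; simp [hs₀, hnxt]
      have hmod : (σ.a .ss i * s'.r .rx - σ.a .sc i) % p =
          (σ.a .ss i * (s.r .rx - l₁.length * v) - σ.a .sc i) % p :=
        (hx.mul_left _).sub_right _
      rw [Ne, Ex.den_lt_eq_zero] at hz'
      simp only [Ex.den_arr, Ex.den_reg, Ex.den_mod, Ex.den_sub, Ex.den_mul, r1, r2, a1, a2, a3,
        hmod] at hz'
      have hne : l₁.length ≠ J := by rintro h; rw [h] at hz'; exact hz' hJ2
      cases l₂ with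
      | nil => rw [he, List.append_nil] at hJ1; omega
      | cons z l₂ =>
        obtain ⟨hC1, hC2⟩ := hC
        have hzm : z ∈ m := by rw [he]; simp
        obtain ⟨hzy, hzv⟩ := mem_cls.1 hzm
        have hz01 := hys z hzy
        have hnl : z ∉ l₁ := by
          have := cls_nodup (V := V) hnd v
          rw [← hm, he, List.nodup_append] at this
          intro hc
          exact this.2.2 z hc z (by simp) rfl
        have hst' := hM.step (z := z) (by omega) hzy (by
          rw [List.mem_append]
          rintro (hc | hc)
          · exact hmW z hzm hc
          · exact hnl hc)
        have hdl := hM.len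
        have hll := hM.length_le
        have hx0 := hM.pos
        have hll' := hst'.length_le
        rw [List.length_append] at hdl hll
        rw [List.length_append, List.length_append, List.length_singleton] at hll'
        refine ⟨24, WP.straight ?_ ⟨⟨l₁ ++ [z], l₂, by simp [he], by simp; omega, ?_, ?_, ?_⟩,
          ?_⟩ (Nat.le_of_ble_eq_true rfl)⟩
        · simp [hC1, r2, r3]; omega
        · rw [← List.append_assoc]
          simpa [hC1, r2, r3, hzv] using hst'
        · simpa [a4, hC1] using hC2
        · simp only [Cd.fin_seq, Cd.fin_set, Cd.fin_put, Ex.den_mod, Ex.den_sub, Ex.den_reg,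
            Store.set_r, Store.put_r, reduceCtorEq, if_true, if_false, r2, r3]
          refine (Int.mod_modEq _ _).trans ((hx.sub_right _).trans ?_)
          rw [List.length_append, List.length_singleton]
          push_cast
          rw [Int.modEq_iff_dvd]; exact ⟨0, by ring⟩
        · simp only [Cd.fin_seq, Cd.fin_set, Cd.fin_put, Ex.den_add, Ex.den_one, Ex.den_reg,
            Store.set_r, Store.put_r, reduceCtorEq, if_true, if_false, hc2, hdl]
          push_cast; omega
    · simp only [hs₀, Store.set_r, reduceCtorEq, if_false, hc2, hdi]; omega
    · rintro s' hF' ⟨⟨l₁, l₂, he, hlJ, hM, hC, hx⟩, hz'⟩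
      have r1 : s'.r .ri = i := by rw [hF'.r .ri rfl]; simp [hs₀]
      have r2 : s'.r .p = p := by rw [hF'.r .p rfl]; simp [hs₀, hrp']
      have a1 : s'.a .ss = σ.a .ss := by rw [hF'.a .ss rfl]; simp [hs₀, hss]
      have a2 : s'.a .sc = σ.a .sc := by rw [hF'.a .sc rfl]; simp [hs₀, hsc]
      have a3 : s'.a .sl = σ.a .sl := by rw [hF'.a .sl rfl]; simp [hs₀, hsl']
      have hmod : (σ.a .ss i * s'.r .rx - σ.a .sc i) % p =
          (σ.a .ss i * (s.r .rx - l₁.length * v) - σ.a .sc i) % p :=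
        (hx.mul_left _).sub_right _
      rw [Ex.den_lt_eq_zero] at hz'
      simp only [Ex.den_arr, Ex.den_reg, Ex.den_mod, Ex.den_sub, Ex.den_mul, r1, r2, a1, a2,
        a3] at hz'
      have hlJ' : l₁.length = J := by
        by_contra hc
        exact hJmin l₁.length (by omega) (hmod ▸ hz')
      have hdl := hM.len
      have hll := hM.length_le
      rw [List.length_append] at hdl hll
      refine ⟨⟨i, by omega, r1, W ++ l₁, hM, ?_, fun _ => hz'⟩, ?_⟩
      · intro z hz
        rcases List.mem_append.1 hz with hz | hz
        · obtain ⟨j, h1, h2, h3⟩ := hWv z hz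
          exact ⟨j, by omega, h2, h3⟩
        · refine ⟨i, le_rfl, by omega, (mem_cls.1 (show z ∈ cls V ys v from ?_)).2⟩
          rw [← hm, he]; exact List.mem_append_left _ hz
      · rw [r1, hri, hdl, hdi, hc1]; push_cast; omega
  · simp [hσ₀, hc1]
    omega
  · rintro s hF ⟨⟨i, hi, hri, W, hW, hWv, hi2⟩, hz⟩
    rw [Ex.den_lt_eq_zero] at hz
    simp [hri] at hz
    subst hz
    refine ⟨W, hW.nodup, hW.sub, hW.st, ?_⟩
    -- Without any stage the length would be `0`, which is less than `p - 1`.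
    have hq0 : q ≠ 0 := by
      intro h0
      have := (hS.init h0).2
      omega
    have h3 := hi2 (by omega)
    obtain ⟨hco, hz1, hz2⟩ := hS.zero hq0
    simp only [Nat.cast_zero, hz1, hz2, sub_zero] at h3
    have h4 := hmodb (σ.a .ss 0 * s.r .rx)
    have h5 : (p : ℤ) ∣ σ.a .ss 0 * s.r .rx := Int.dvd_of_emod_eq_zero (by omega)
    have h6 := hco.symm.dvd_of_dvd_mul_left h5
    have h7 := hW.sum
    rw [Int.modEq_iff_dvd] at h7 ⊢
    obtain ⟨a, ha⟩ := h7
    obtain ⟨b, hb⟩ := h6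
    exact ⟨a + b, by linear_combination ha + hb⟩

/-! ### From states of nodes to a selection of leaves. -/

/-- Propagate the states of the nodes to the leaves. -/
def finalize : Cd :=
  .fy ::= .reg .nn ;;
  .loop (.reg .p + .reg .p - 1 ≺ .reg .fy) (
    .fy ::= .reg .fy - 1 ;;
    .fs ::= .arr .st (.reg .fy) ;;
    .put .st (.arr .lft (.reg .fy)) (1 - .reg .fs) ;;
    .put .st (.arr .rgt (.reg .fy)) (.reg .fs))

theorem sum_update_of_zero {k : ℕ} {f g : ℤ → ℤ} {l z : ℤ} (h0 : 0 ≤ l) (hl : l < k)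
    (hf : f l = 0) : ∑ x ∈ Finset.range k, Function.update f l z x * g x =
      ∑ x ∈ Finset.range k, f x * g x + z * g l := by
  obtain ⟨i, rfl⟩ := Int.eq_ofNat_of_zero_le h0
  have hi : i ∈ Finset.range k := Finset.mem_range.2 (by omega)
  rw [← Finset.add_sum_erase _ _ hi, ← Finset.add_sum_erase _ _ hi, Function.update_self, hf]
  have : ∑ x ∈ (Finset.range k).erase i, Function.update f i z x * g x =
      ∑ x ∈ (Finset.range k).erase i, f x * g x := by
    refine Finset.sum_congr rfl fun x hx => ?_
    rw [Function.update_of_ne]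
    have := (Finset.mem_erase.1 hx).1
    omega
  rw [this]; ring

theorem sum_update_of_le {k : ℕ} {f : ℤ → ℤ} {l z : ℤ} (hl : k ≤ l) :
    ∑ x ∈ Finset.range k, Function.update f l z x = ∑ x ∈ Finset.range k, f x := by
  refine Finset.sum_congr rfl fun x hx => Function.update_of_ne ?_ _ _
  have := Finset.mem_range.1 hx
  omega

/-- The states `st` of the nodes below `k`, to which no state has been propagated from nodes
below `k`, select leaves with sum `0`. -/
structure Balanced (p nn k : ℕ) (L R V st : ℤ → ℤ) : Prop where
  bit : ∀ x : ℤ, 0 ≤ x → x < k → st x = 0 ∨ st x = 1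
  child : ∀ y : ℤ, 2 * (p : ℤ) - 1 ≤ y → y < k → st (L y) = 0 ∧ st (R y) = 0
  sum : ∑ x ∈ Finset.range k, st x * V x + ∑ y ∈ Finset.Ico (2 * p - 1) k, V (L y) ≡ 0 [ZMOD p]
  -- In the beginning `lone` is the only selected leaf. Each of the `p - 1` differences of leaves
  -- adds one more, so `k = 2 * p - 1` means `p` selected leaves.
  count : ∑ x ∈ Finset.range (2 * p - 1), st x + min k (3 * p - 2 : ℕ) = 3 * p - 1

/-- With `s` the state of `k`, the value `V k ≡ V (R k) - V (L k)` gives `s * V k + V (L k) ≡ (1 -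
s) * V (L k) + s * V (R k)`. The children were off before and belong to no other node, so their new
states disturb nothing. -/
theorem Balanced.step {p nn k : ℕ} {L R V st : ℤ → ℤ} (hp : 1 ≤ p) (hT : Tree p nn L R V)
    (hk : 2 * p - 1 ≤ k) (hkn : k < nn) (h : Balanced p nn (k + 1) L R V st) :
    Balanced p nn k L R V (Function.update (Function.update st (L k) (1 - st k)) (R k) (st k)) := by
  obtain ⟨hl0, hl1, hr0, hr1, hlr, hv⟩ := hT.child k (by omega) (by omega)
  obtain ⟨hsl, hsr⟩ := h.child k (by omega) (by omega)
  have hs := h.bit k (by omega) (by omega)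
  constructor
  · intro x hx0 hx1
    have := h.bit x hx0 (by push_cast; omega)
    simp only [Function.update_apply]
    split_ifs <;> omega
  · intro y hy0 hy1
    obtain ⟨h1, h2⟩ := h.child y hy0 (by push_cast; omega)
    obtain ⟨h3, h4, h5, h6⟩ := hT.inj y k hy0 hy1 (by omega)
    simp only [Function.update_apply, if_neg h3, if_neg h4, if_neg h5, if_neg h6]
    exact ⟨h1, h2⟩
  · rw [sum_update_of_zero hr0 hr1 (by rw [Function.update_of_ne hlr.symm]; exact hsr),
      sum_update_of_zero hl0 hl1 hsl]
    have h1 := h.sum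
    rw [Finset.sum_range_succ, Finset.sum_Ico_succ_top hk] at h1
    refine Int.ModEq.trans ?_ h1
    have h2 := hv.mul_left (st k)
    rw [Int.modEq_iff_dvd] at h2 ⊢
    obtain ⟨a, ha⟩ := h2
    exact ⟨-a, by linear_combination -ha⟩
  · have h1 := h.count
    rcases hT.level k (by omega) (by omega) with ⟨h2, h3, h4⟩ | ⟨h2, h3, h4⟩
    · have e1 := sum_update_of_zero (k := 2 * p - 1) (f := Function.update st (L k) (1 - st k))
        (g := fun _ => 1) (z := st k) hr0 (by omega)
        (by rw [Function.update_of_ne hlr.symm]; exact hsr)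
      have e2 := sum_update_of_zero (k := 2 * p - 1) (f := st)
        (g := fun _ => 1) (z := 1 - st k) hl0 (by omega) hsl
      simp only [mul_one] at e1 e2
      rw [e1, e2]
      push_cast at h1 ⊢; omega
    · rw [sum_update_of_le (by omega), sum_update_of_le (by omega)]
      push_cast at h1 ⊢; omega

theorem wp_finalize {σ : Store} {p nn : ℕ} (hp : 1 ≤ p) (hrp : σ.r .p = p) (hrn : σ.r .nn = nn)
    (hT : Tree p nn (σ.a .lft) (σ.a .rgt) (σ.a .val)) (hn : 2 * p - 1 ≤ nn)
    (hnr : nn ≤ C.rows) (hpr : 2 * p ≤ C.rows)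
    (hB : Balanced p nn nn (σ.a .lft) (σ.a .rgt) (σ.a .val) (σ.a .st)) :
    WP C finalize (fun σ' => (∀ x : ℕ, x < 2 * p - 1 → σ'.a .st x = 0 ∨ σ'.a .st x = 1) ∧
      ∑ x ∈ Finset.range (2 * p - 1), σ'.a .st x = p ∧
      ∑ x ∈ Finset.range (2 * p - 1), σ'.a .st x * σ.a .val x ≡ 0 [ZMOD p])
      (100 * nn + 50) σ := by
  have hb1 := C.rows_le_big; have hb2 := C.hstride
  simp only [stride, Nat.cast_ofNat] at hb2
  have hc1 : (.reg .p + .reg .p - 1 ≺ .reg .fy : Ex).cost = 7 := rfl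
  refine (WP.seq (b := 2) (R := fun s => s = σ.set .fy nn)
    (WP.straight (by simp) (by simp [hrn]) (Nat.le_of_ble_eq_true rfl)) ?_
    (b' := 100 * nn + 40)).mono (by omega) (fun _ _ h => h)
  rintro _ - rfl
  refine (WP.loop (fun s => ∃ k : ℕ, 2 * p - 1 ≤ k ∧ k ≤ nn ∧ s.r .fy = k ∧
    Balanced p nn k (σ.a .lft) (σ.a .rgt) (σ.a .val) (s.a .st))
    (fun s => 100 * (s.r .fy).toNat) ?_ ?_ ?_).mono ?_ ?_
  · exact ⟨nn, hn, le_rfl, by simp, hB⟩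
  · intro s hF _
    have : s.r .p = p := by rw [hF.r .p rfl]; simp [hrp]
    simp [this]; omega
  · rintro s hF ⟨k', hk', hkn, hr, hI⟩ hz
    have hrp' : s.r .p = p := by rw [hF.r .p rfl]; simp [hrp]
    have hlf : s.a .lft = σ.a .lft := hF.a .lft rfl
    have hrg : s.a .rgt = σ.a .rgt := hF.a .rgt rfl
    rw [Ne, Ex.den_lt_eq_zero] at hz
    simp [hr, hrp'] at hz
    obtain ⟨k, rfl⟩ : ∃ k, k' = k + 1 := ⟨k' - 1, by omega⟩
    have hrk : s.r .fy - 1 = k := by rw [hr]; push_cast; ring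
    obtain ⟨hl0, hl1, hr0, hr1, hlr, hv⟩ := hT.child k (by omega) (by omega)
    have hs := hI.bit k (by omega) (by push_cast; omega)
    have hfin : Balanced p nn k (σ.a .lft) (σ.a .rgt) (σ.a .val) (Function.update
      (Function.update (s.a .st) (σ.a .lft k) (1 - s.a .st k)) (σ.a .rgt k) (s.a .st k)) :=
      hI.step hp hT (by omega) (by omega)
    refine ⟨60, WP.straight ?_ ⟨⟨k, by omega, by omega, ?_, ?_⟩, ?_⟩ (Nat.le_of_ble_eq_true rfl)⟩
    · simp [hrk, hlf, hrg]
      omega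
    · simp [hrk]
    · simpa [hrk, hlf, hrg] using hfin
    · simp only [Cd.fin_seq, Cd.fin_set, Cd.fin_put, Ex.den_sub, Ex.den_reg, Ex.den_one,
        Store.put_r, Store.set_r, reduceCtorEq, if_true, if_false, hc1, hr]
      omega
  · rw [hc1]; simp
  · rintro s hF ⟨⟨k, hk, hkn, hr, hI⟩, hz⟩
    have hrp' : s.r .p = p := by rw [hF.r .p rfl]; simp [hrp]
    rw [Ex.den_lt_eq_zero] at hz
    simp [hr, hrp'] at hz
    obtain rfl : k = 2 * p - 1 := by omega
    refine ⟨fun x hx => hI.bit x (by omega) (by omega), ?_, ?_⟩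
    · have := hI.count; push_cast at this; omega
    · simpa using hI.sum

theorem sum_indicator {nn : ℕ} {W : List ℤ} (hW : W.Nodup) (hs : ∀ z ∈ W, 0 ≤ z ∧ z < nn)
    (V : ℤ → ℤ) : ∑ x ∈ Finset.range nn, (if (x : ℤ) ∈ W then 1 else 0) * V x =
      (W.map V).sum := by
  rw [List.sum_toFinset V hW |>.symm]
  have h1 : W.toFinset = ((Finset.range nn).filter fun x : ℕ => (x : ℤ) ∈ W).map
      Nat.castEmbedding := by
    ext z
    simp only [List.mem_toFinset, Finset.mem_map, Finset.mem_filter, Finset.mem_range,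
      Nat.castEmbedding_apply]
    constructor
    · intro hz
      obtain ⟨h0, h1⟩ := hs z hz
      obtain ⟨i, rfl⟩ := Int.eq_ofNat_of_zero_le h0
      exact ⟨i, ⟨by omega, hz⟩, rfl⟩
    · rintro ⟨i, ⟨_, h⟩, rfl⟩; exact h
  rw [h1, Finset.sum_map, Finset.sum_filter]
  refine Finset.sum_congr rfl fun x _ => ?_
  split_ifs <;> simp

/-- The nodes switched on have sum `0`. -/
theorem balanced_of_marks {σ : Store} {p nn : ℕ} {lone : ℤ} {st : ℤ → ℤ} {W : List ℤ}
    (hp : 1 ≤ p) (hN : Nodes p nn lone σ) (hn : 3 * p - 2 ≤ nn) (hW : W.Nodup)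
    (hroot : ∀ z ∈ W, Nodes.IsRoot σ p nn z ∧ 2 * (p : ℤ) - 1 ≤ z)
    (hst : ∀ x : ℤ, 0 ≤ x → x < nn → st x = if x = lone ∨ x ∈ W then 1 else 0)
    (hsum : σ.r .base + (W.map (σ.a .val)).sum ≡ 0 [ZMOD p]) :
    Balanced p nn nn (σ.a .lft) (σ.a .rgt) (σ.a .val) st := by
  have hlone := hN.root
  have hl0 := hN.lone_lt
  have hnd : (lone :: W).Nodup := by
    refine List.nodup_cons.2 ⟨fun hc => ?_, hW⟩
    have := (hroot _ hc).2; omega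
  have hst' : ∀ x : ℕ, x < nn → st x = if (x : ℤ) ∈ lone :: W then 1 else 0 := by
    intro x hx
    rw [hst x (by omega) (by omega)]
    simp
  have hbd : ∀ z ∈ lone :: W, 0 ≤ z ∧ z < nn ∧
      ∀ y : ℤ, 2 * (p : ℤ) - 1 ≤ y → y < nn → σ.a .lft y ≠ z ∧ σ.a .rgt y ≠ z := by
    intro z hz
    rcases List.mem_cons.1 hz with rfl | hz
    · exact hlone
    · exact (hroot z hz).1
  constructor
  · intro x h0 h1
    rw [hst x h0 h1]; split_ifs <;> simp
  · intro y h0 h1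
    obtain ⟨c1, c2, c3, c4, c5, c6⟩ := hN.tree.child y h0 h1
    have hno : ∀ z : ℤ, 0 ≤ z → z < nn → z ∉ lone :: W → st z = 0 := by
      intro z hz0 hz1 hz
      rw [hst z hz0 hz1, if_neg]; simpa using hz
    exact ⟨hno _ c1 (by omega) fun hc => ((hbd _ hc).2.2 y h0 h1).1 rfl,
      hno _ c3 (by omega) fun hc => ((hbd _ hc).2.2 y h0 h1).2 rfl⟩
  · have h1 : ∑ x ∈ Finset.range nn, st x * σ.a .val x =
        ∑ x ∈ Finset.range nn, (if (x : ℤ) ∈ lone :: W then 1 else 0) * σ.a .val x :=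
      Finset.sum_congr rfl fun x hx => by rw [hst' x (Finset.mem_range.1 hx)]
    rw [h1, sum_indicator hnd fun z hz => ⟨(hbd z hz).1, (hbd z hz).2.1⟩, List.map_cons,
      List.sum_cons]
    have h2 := hN.base
    rw [Int.modEq_iff_dvd] at h2 hsum ⊢
    obtain ⟨a, ha⟩ := h2
    obtain ⟨b, hb⟩ := hsum
    exact ⟨b - a, by linear_combination hb - ha⟩
  · obtain ⟨l, hl⟩ := Int.eq_ofNat_of_zero_le hlone.1
    have h1 : ∑ x ∈ Finset.range (2 * p - 1), st x =
        ∑ x ∈ Finset.range (2 * p - 1), if x = l then 1 else 0 := by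
      refine Finset.sum_congr rfl fun x hx => ?_
      have hx' := Finset.mem_range.1 hx
      rw [hst x (by omega) (by omega)]
      have hxW : (x : ℤ) ∉ W := fun hc => by have := (hroot _ hc).2; omega
      simp only [hxW, or_false]
      congr 1
      rw [hl]; simp
    rw [h1, Finset.sum_ite_eq' (Finset.range (2 * p - 1)) l, if_pos (Finset.mem_range.2 (by omega))]
    push_cast; omega

/-! ### Auxiliary programs: square root, copying, large classes, and scaling. -/

/-- Let `m` be the least integer, at least `2`, with `2 * p ≤ m * m`. -/
def sqrtCode : Cd :=
  .m ::= 2 ;;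
  .loop (.reg .m * .reg .m ≺ .reg .p + .reg .p) (.m ::= .reg .m + 1)

theorem wp_sqrtCode {σ : Store} {p : ℕ} (hp : 2 ≤ p) (hrp : σ.r .p = p)
    (hbig : 10 * ((p : ℤ) * p) ≤ C.big) :
    WP C sqrtCode (fun σ' => ∃ M : ℕ, σ'.r .m = M ∧ 2 ≤ M ∧ 2 * p ≤ M * M ∧
      (M - 1) * (M - 1) ≤ 2 * p) (40 * p + 40) σ := by
  have hb2 := C.hstride
  simp only [stride, Nat.cast_ofNat] at hb2
  have hpp : (p : ℤ) ≤ p * p := by nlinarith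
  have hc1 : (.reg .m * .reg .m ≺ .reg .p + .reg .p : Ex).cost = 7 := rfl
  refine (WP.seq (b := 2) (R := fun s => s = σ.set .m 2)
    (WP.straight (by simp) (by simp) (Nat.le_of_ble_eq_true rfl)) ?_
    (b' := 40 * p + 30)).mono (by omega) (fun _ _ h => h)
  rintro _ - rfl
  refine (WP.loop (fun s => ∃ M : ℕ, s.r .m = M ∧ 2 ≤ M ∧ M ≤ 2 * p ∧
    (M - 1) * (M - 1) ≤ 2 * p) (fun s => 20 * (2 * p - (s.r .m).toNat)) ?_ ?_ ?_).mono ?_ ?_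
  · exact ⟨2, by simp, le_rfl, by omega, by omega⟩
  · rintro s hF ⟨M, h1, h2, h3, -⟩
    have hrp' : s.r .p = p := by rw [hF.r .p rfl]; simp [hrp]
    have h4 := mul_bounds (show (0 : ℤ) ≤ M by omega) (show (M : ℤ) ≤ 2 * p by omega)
      (show (0 : ℤ) ≤ M by omega) (show (M : ℤ) ≤ 2 * p by omega) (Z := C.big) (by nlinarith)
    simp [h1, hrp']
    omega
  · rintro s hF ⟨M, h1, h2, h3, h4⟩ hz
    have hrp' : s.r .p = p := by rw [hF.r .p rfl]; simp [hrp]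
    rw [Ne, Ex.den_lt_eq_zero] at hz
    simp only [Ex.den_add, Ex.den_mul, Ex.den_reg, h1, hrp', not_le] at hz
    have hz' : M * M < 2 * p := by zify; linarith
    have hM : M < 2 * p := by nlinarith
    refine ⟨4, WP.straight ?_ ⟨⟨M + 1, ?_, by omega, by omega, ?_⟩, ?_⟩
      (Nat.le_of_ble_eq_true rfl)⟩
    · simp [h1]; omega
    · simp [h1]
    · simpa using hz'.le
    · simp only [Cd.fin_set, Store.set_r, if_true, Ex.den_add, Ex.den_reg, Ex.den_one, h1, hc1]
      omega
  · simp [hc1]; omega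
  · rintro s hF ⟨⟨M, h1, h2, h3, h4⟩, hz⟩
    have hrp' : s.r .p = p := by rw [hF.r .p rfl]; simp [hrp]
    rw [Ex.den_lt_eq_zero] at hz
    simp only [Ex.den_add, Ex.den_mul, Ex.den_reg, h1, hrp'] at hz
    exact ⟨M, h1, h2, by zify; linarith, h4⟩

/-- Copy `len` entries of `A`, from position `off` on, to `B`. -/
def copy (A B : Arr) (off len : Reg) : Cd :=
  .for .si 0 (.reg len) (.put B (.reg .si) (.arr A (.reg off + .reg .si)))

theorem wp_copy {A B : Arr} {off len : Reg} {σ : Store} {o L : ℕ} (hAB : A ≠ B)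
    (hoff : off ≠ .si) (hlen : len ≠ .si) (ho : σ.r off = o) (hL : σ.r len = L)
    (hLr : o + L ≤ C.rows) :
    WP C (copy A B off len) (fun σ' => ∀ i : ℕ, i < L → σ'.a B i = σ.a A (o + i))
      (100 * L + 20) σ := by
  have hb1 := C.rows_le_big; have hb2 := C.hstride
  simp only [stride, Nat.cast_ofNat] at hb2
  refine WP.forC (a := 0) (b := L) (K := 40)
    (fun k s => ∀ i : ℕ, i < k → s.a B i = σ.a A (o + i)) (by omega) (by simp) (by simp) rfl ?_
    (by omega) (fun i hi => by omega) ?_ ?_ (fun _ _ h _ => h)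
  · intro s hF
    simp [hF.r len (by simp [Cd.for, Cd.wr, hlen.symm]), hL]
  · intro k s _ hk hF hr hI
    have h1 := hF.r off (by simp [Cd.for, Cd.wr, hoff.symm])
    have h2 := hF.a A (by simp [Cd.for, Cd.wa, hAB.symm])
    refine WP.straight ?_ ?_ (Nat.le_of_ble_eq_true rfl)
    · simp [hr, h1, ho]; omega
    · intro i hi
      by_cases hik : i = k
      · subst hik; simp [hr, h1, h2, ho]
      · have := hI i (by omega)
        simpa [hr, Function.update_of_ne (show (i : ℤ) ≠ k by omega)] using this
  · show (L - 0) * (40 + 1 + 10) + 1 + 1 + 5 ≤ _; omega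

/-- Find a class with at least `thr` elements. -/
def findPopular : Cd :=
  .g ::= 0 ;;
  .for .si 0 (.reg .p) (.ite (.reg .thr ≼ .arr .cnt (.reg .si)) (.g ::= .reg .si) .skip)

theorem wp_findPopular {σ : Store} {p : ℕ} {T : ℤ} (hp : 1 ≤ p) (hrp : σ.r .p = p)
    (hT : σ.r .thr = T) (hpr : p ≤ C.rows) :
    WP C findPopular (fun σ' => ∃ G : ℕ, σ'.r .g = G ∧ G < p ∧ (G ≠ 0 → T ≤ σ.a .cnt G) ∧
      (G = 0 → ∀ v : ℕ, 0 < v → v < p → σ.a .cnt v < T)) (100 * p + 20) σ := by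
  have hb1 := C.rows_le_big; have hb2 := C.hstride
  simp only [stride, Nat.cast_ofNat] at hb2
  refine (WP.seq (b := 2) (R := fun s => s = σ.set .g 0)
    (WP.straight (by simp) (by simp) (Nat.le_of_ble_eq_true rfl)) ?_
    (b' := 100 * p + 10)).mono (by omega) (fun _ _ h => h)
  rintro _ - rfl
  refine WP.forC (a := 0) (b := p) (K := 40)
    (fun k s => ∃ G : ℕ, s.r .g = G ∧ G < p ∧ (G ≠ 0 → T ≤ σ.a .cnt G) ∧
      (G = 0 → ∀ v : ℕ, 0 < v → v < k → σ.a .cnt v < T)) (by omega) (by simp) (by simp) rfl ?_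
    (by omega) ⟨0, by simp, by omega, by simp, fun _ v _ hv => by omega⟩ ?_ ?_
    (fun _ _ h _ => h)
  · intro s hF
    simp [hF.r .p rfl, hrp]
  · rintro k s - hk hF hr ⟨G, h1, h2, h3, h4⟩
    have ht : s.r .thr = T := by rw [hF.r .thr rfl]; simp [hT]
    have hc : s.a .cnt = σ.a .cnt := hF.a .cnt rfl
    refine (WP.ite (b := 3) (by simp [hr]; omega) (fun he => ?_) (fun he => ?_)).mono
      (Nat.le_of_ble_eq_true rfl) (fun _ _ h => h)
    · rw [Ne, Ex.den_le_eq_zero] at he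
      simp [ht, hc, hr] at he
      refine WP.straight (by simp) ⟨k, by simp [hr], hk, fun _ => he, fun h v _ _ => by omega⟩
        (Nat.le_of_ble_eq_true rfl)
    · rw [Ex.den_le_eq_zero] at he
      simp [ht, hc, hr] at he
      refine WP.straight (by simp) ⟨G, by simp [h1], h2, h3, fun h v hv hv' => ?_⟩
        (Nat.le_of_ble_eq_true rfl)
      by_cases hvk : v = k
      · subst hvk; exact he
      · exact h4 h v hv (by omega)
  · show (p - 0) * (40 + 1 + 10) + 1 + 1 + 5 ≤ _; omega

/-- Divide the values of all nodes by `g`. -/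
def rescale : Cd :=
  .ginv ::= .op .inv (.reg .g) (.reg .p) ;;
  .for .si 0 (.reg .nn) (
    .put .val (.reg .si) ((.arr .val (.reg .si) * .reg .ginv) % .reg .p)) ;;
  .base ::= (.reg .base * .reg .ginv) % .reg .p

/-- All conditions on the values are linear congruences modulo `p`, and so survive multiplication by
`h`, provided that `base` is multiplied as well. -/
theorem Nodes.rescale {p nn : ℕ} {lone h : ℤ} {σ σ' : Store} (hN : Nodes p nn lone σ)
    (hp : 1 ≤ p) (hreg : σ'.r .nn = σ.r .nn) (hlf : σ'.a .lft = σ.a .lft)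
    (hrg : σ'.a .rgt = σ.a .rgt) (hst : σ'.a .st = σ.a .st)
    (hval : ∀ x : ℕ, x < nn → σ'.a .val x = σ.a .val x * h % p)
    (hbase : σ'.r .base = σ.r .base * h % p) : Nodes p nn lone σ' := by
  have hv : ∀ x : ℤ, 0 ≤ x → x < nn → σ'.a .val x = σ.a .val x * h % p := by
    intro x h0 h1
    obtain ⟨i, rfl⟩ := Int.eq_ofNat_of_zero_le h0
    exact hval i (by omega)
  have hmodb : ∀ z : ℤ, 0 ≤ z % p ∧ z % p < p := fun z =>
    ⟨Int.emod_nonneg _ (by omega), Int.emod_lt_of_pos _ (by omega)⟩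
  have hm : ∀ x : ℤ, 0 ≤ x → x < nn → σ'.a .val x ≡ σ.a .val x * h [ZMOD p] := by
    intro x h0 h1; rw [hv x h0 h1]; exact Int.mod_modEq _ _
  constructor
  · rw [hreg, hN.reg]
  · obtain ⟨t1, t2, t3, t4⟩ := hN.tree
    rw [hlf, hrg]
    refine ⟨fun x h0 h1 => by rw [hv x h0 h1]; exact hmodb _, fun y h0 h1 => ?_, t3, t4⟩
    obtain ⟨c1, c2, c3, c4, c5, c6⟩ := t2 y h0 h1
    refine ⟨c1, c2, c3, c4, c5, ?_⟩
    refine (hm y (by omega) h1).trans ((c6.mul_right h).trans ?_)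
    rw [sub_mul]
    exact ((hm _ c3 (by omega)).sub (hm _ c1 (by omega))).symm
  · exact hN.lone_lt
  · rw [hlf, hrg]; exact hN.root
  · rw [hst]; exact hN.st
  · rw [hbase, hlf]
    refine (Int.mod_modEq _ _).trans ((hN.base.mul_right h).trans ?_)
    rw [add_mul, Finset.sum_mul]
    refine (Int.ModEq.add (hm _ hN.root.1 hN.root.2.1) ?_).symm
    refine Int.ModEq.sum fun y hy => ?_
    have hy' := Finset.mem_Ico.1 hy
    have hc := hN.tree.child y (by omega) (by omega)
    exact hm _ hc.1 (by omega)
  · rw [hbase]; exact hmodb _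

theorem wp_rescale {σ : Store} {p nn G : ℕ} {lone : ℤ} (hp : p.Prime) (hrp : σ.r .p = p)
    (hN : Nodes p nn lone σ) (hG : σ.r .g = G) (hG0 : 0 < G) (hGp : G < p) (hnr : nn ≤ C.rows)
    (hbig : 10 * ((p : ℤ) * p) ≤ C.big) :
    WP C rescale (fun σ' => Nodes p nn lone σ' ∧ ∃ h : ℤ, G * h ≡ 1 [ZMOD p] ∧
      ∀ x : ℕ, x < nn → σ'.a .val x = σ.a .val x * h % p) (100 * nn + 50) σ := by
  have hb1 := C.rows_le_big; have hb2 := C.hstride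
  simp only [stride, Nat.cast_ofNat] at hb2
  have hpp : (p : ℤ) ≤ p * p := by have := hp.pos; nlinarith
  obtain ⟨hg, hh0, hh1, hh⟩ := gcdA_spec hp (v := G) (by omega) (by omega)
  set h := Int.gcdA G p % p with hdef
  refine (WP.seq (b := 5) (R := fun s => s = σ.set .ginv h)
    (WP.straight ?_ (by simp [hG, hrp, hdef]) (Nat.le_of_ble_eq_true rfl)) ?_
    (b' := 100 * nn + 40)).mono (by omega) (fun _ _ h => h)
  · simp [hG, hrp]
    exact ⟨by omega, by omega, by simpa using hg⟩
  rintro _ - rfl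
  have hv := hN.tree.val
  have hbb := hN.base_lt
  refine (WP.seq (b := 100 * nn + 20) (b' := 20) (R := fun s => ∀ x : ℕ, s.a .val x =
    if x < nn then σ.a .val x * h % p else σ.a .val x) ?_ ?_).mono (by omega) (fun _ _ h => h)
  · refine WP.forC (a := 0) (b := nn) (K := 40)
      (fun k s => ∀ x : ℕ, s.a .val x = if x < k then σ.a .val x * h % p else σ.a .val x)
      (by omega) (by simp) (by simp) rfl ?_ (by omega) (by simp) ?_ ?_ (fun _ _ h _ => h)
    · intro s hF; simp [hF.r .nn rfl, hN.reg]
    · intro k s _ hk hF hr hI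
      have h1 : s.r .p = p := by rw [hF.r .p rfl]; simp [hrp]
      have h2 : s.r .ginv = h := by rw [hF.r .ginv rfl]; simp
      have h3 := hI k
      rw [if_neg (lt_irrefl k)] at h3
      obtain ⟨h4, h5⟩ := hv k (by omega) (by omega)
      have h6 := mul_bounds h4 h5.le hh0 hh1.le (Z := C.big) (by omega)
      refine WP.straight ?_ ?_ (Nat.le_of_ble_eq_true rfl)
      · simp [hr, h1, h2, h3]; omega
      · intro x
        by_cases hx : x = k
        · subst hx; simp [hr, h1, h2, h3]
        · have := hI x
          simp only [Cd.fin_put, Ex.den_reg, hr, Store.set_a, Store.put_a, if_true]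
          rw [Function.update_of_ne (by omega), this]
          exact if_congr (by omega) rfl rfl
    · show (nn - 0) * (40 + 1 + 10) + 1 + 1 + 5 ≤ _; omega
  · intro s hF hI
    have h1 : s.r .p = p := by rw [hF.r .p rfl]; simp [hrp]
    have h2 : s.r .ginv = h := by rw [hF.r .ginv rfl]; simp
    have h3 : s.r .base = σ.r .base := by rw [hF.r .base rfl]; simp
    have h6 := mul_bounds hbb.1 hbb.2.le hh0 hh1.le (Z := C.big) (by omega)
    refine WP.straight ?_ ⟨hN.rescale hp.one_le (h := h) ?_ ?_ ?_ ?_ ?_ ?_, h, hh, ?_⟩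
      (Nat.le_of_ble_eq_true rfl)
    · simp [h1, h2, h3]; omega
    · simp [hF.r .nn rfl]
    · simp [hF.a .lft rfl]
    · simp [hF.a .rgt rfl]
    · simp [hF.a .st rfl]
    · intro x hx; simp only [Cd.fin_set, Store.set_a, hI x, if_pos hx]
    · simp [h1, h2, h3]
    · intro x hx; simp only [Cd.fin_set, Store.set_a, hI x, if_pos hx]

/-! ### Counting small differences and large classes. -/

/-- Every odd block is preceded by a whole even one. -/
theorem two_mul_even_blocks (s k : ℕ) (hs : 1 ≤ s) :
    k ≤ 2 * ((List.range k).filter fun i : ℕ => i / s % 2 = 0).length := by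
  -- The minimum is the present surplus of even positions: within a period it grows to `s` in the
  -- even block and shrinks to `0` in the odd one.
  suffices H : ∀ k, k + min (k % (2 * s)) (2 * s - k % (2 * s)) ≤
      2 * ((List.range k).filter fun i : ℕ => i / s % 2 = 0).length by
    have := H k; omega
  intro k
  induction k with
  | zero => simp
  | succ k ih =>
    rw [List.range_succ, List.filter_append, List.length_append]
    have h1 : k % (2 * s) < 2 * s := Nat.mod_lt _ (by omega)
    have h2 : k / s % 2 = k % (2 * s) / s := by
      rw [mul_comm 2 s, Nat.mod_mul_right_div_self]
    have h3 : (k + 1) % (2 * s) = if k % (2 * s) + 1 = 2 * s then 0 else k % (2 * s) + 1 := by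
      split_ifs with h
      · rw [Nat.add_mod, Nat.mod_eq_of_lt (show 1 < 2 * s by omega), h, Nat.mod_self]
      · rw [Nat.add_mod, Nat.mod_eq_of_lt (show 1 < 2 * s by omega), Nat.mod_eq_of_lt (by omega)]
    rw [h3]
    by_cases h4 : k % (2 * s) < s
    · have h5 : k / s % 2 = 0 := by rw [h2]; exact Nat.div_eq_of_lt h4
      simp only [List.filter_cons, h5, decide_true, if_true, List.filter_nil, List.length_singleton]
      split_ifs <;> omega
    · split_ifs <;> omega

/-- The number of differences at distance `S` in a monotone sequence that are at most `D`. -/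
theorem pairIdx_length_ge {X V : ℤ → ℤ} {S N : ℕ} {D G : ℤ} (hS : 1 ≤ S) (hSN : S ≤ N)
    (hD : 0 ≤ D)
    (hmono : ∀ i j : ℕ, i ≤ j → j < N → V (X i) ≤ V (X j))
    (hV : ∀ i : ℕ, i < N → 0 ≤ V (X i) ∧ V (X i) ≤ G) :
    (D + 1) * ((N - S : ℕ) : ℤ) ≤ 2 * (D + 1) * (pairIdx X V S D (N - S)).length + 2 * (S * G) := by
  set a : ℕ → ℤ := fun i => V (X i) with ha
  have hX : ∀ i : ℕ, V (X (i + S)) = a (S + i) := fun i => by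
    simp only [ha]; push_cast; rw [add_comm]
  -- The sum telescopes to the last `S` entries minus the first `S` entries.
  have htel : ∑ i ∈ Finset.range (N - S), (a (S + i) - a i) ≤ S * G := by
    rw [Finset.sum_sub_distrib]
    have e1 := Finset.sum_range_add a S (N - S)
    have e2 := Finset.sum_range_add a (N - S) S
    rw [show S + (N - S) = N - S + S by omega] at e1
    have e3 : ∑ i ∈ Finset.range S, a (N - S + i) ≤ S * G := by
      refine (Finset.sum_le_card_nsmul _ _ G fun i hi => ?_).trans (by simp)
      have := Finset.mem_range.1 hi
      exact (hV _ (by omega)).2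
    have e4 : 0 ≤ ∑ i ∈ Finset.range S, a i := Finset.sum_nonneg fun i hi => by
      have := Finset.mem_range.1 hi
      exact (hV _ (by omega)).1
    linarith
  have hev := two_mul_even_blocks S (N - S) hS
  -- A position in an even block that creates no node has a difference of at least `D + 1`, and so
  -- takes `D + 1` from the sum of all differences; the other differences are nonnegative.
  have key : ∀ k, k ≤ N - S →
      (D + 1) * (((List.range k).filter fun i : ℕ => i / S % 2 = 0).length : ℤ) ≤
      (D + 1) * (pairIdx X V S D k).length + ∑ i ∈ Finset.range k, (a (S + i) - a i) := by
    intro k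
    induction k with
    | zero => simp [pairIdx]
    | succ k ih =>
      intro hk
      have h1 := ih (by omega)
      rw [Finset.sum_range_succ, pairIdx_succ, List.range_succ, List.filter_append,
        List.length_append]
      have h2 := hmono k (S + k) (by omega) (by omega)
      rw [hX]
      have h3 : V (X k) = a k := rfl
      change a k ≤ a (S + k) at h2
      rw [h3]
      generalize ∑ i ∈ Finset.range k, (a (S + i) - a i) = Z at h1 ⊢
      by_cases h4 : k / S % 2 = 0
      · by_cases h5 : a (S + k) - a k ≤ D
        · simp [h4, h5]; linarith
        · simp [h4, h5]; linarith
      · simp [h4]; linarith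
  have h1 := key (N - S) le_rfl
  have h2 : (D + 1) * ((N - S : ℕ) : ℤ) ≤
      (D + 1) * (2 * (((List.range (N - S)).filter fun i : ℕ => i / S % 2 = 0).length : ℤ)) :=
    mul_le_mul_of_nonneg_left (by exact_mod_cast hev) (by omega)
  linarith

theorem mem_lst_of_lt {f : ℤ → ℤ} {N i : ℕ} (h : i < N) : f i ∈ lst f N :=
  mem_lst.2 ⟨i, h, rfl⟩

/-- In a sorted list without repetitions, in which no value occurs more than `h` times, the
values at distance `K * h` differ by at least `K`. -/
theorem gap_of_sorted {X V : ℤ → ℤ} {N h : ℕ}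
    (hmono : ∀ i j : ℕ, i ≤ j → j < N → V (X i) ≤ V (X j)) (hnd : (lst X N).Nodup)
    (hcls : ∀ x ∈ lst X N, (cls V (lst X N) (V x)).length ≤ h) (K i : ℕ) (hi : i + K * h < N) :
    V (X i) + K ≤ V (X (i + K * h : ℕ)) := by
  induction K with
  | zero => simp
  | succ K ih =>
    have hKh : i + (K + 1) * h = i + K * h + h := by ring
    rw [hKh] at hi ⊢
    have h1 := ih (by omega)
    set j := i + K * h with hj
    have h2 := hmono j (j + h) (by omega) hi
    -- By monotonicity equal values at distance `h` would mean `h + 1` entries in one class.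
    have h3 : V (X j) ≠ V (X (j + h : ℕ)) := by
      intro he
      have hall : ∀ t : ℕ, t < h + 1 → X (j + t : ℕ) ∈ cls V (lst X N) (V (X j)) := by
        intro t ht
        refine mem_cls.2 ⟨mem_lst_of_lt (by omega), ?_⟩
        have h4 := hmono j (j + t) (by omega) (by omega)
        have h5 := hmono (j + t) (j + h) (by omega) hi
        omega
      have h6 := hcls (X j) (mem_lst_of_lt (by omega))
      have h7 : ((List.range (h + 1)).map fun t : ℕ => X (j + t : ℕ)).Nodup := by
        refine List.Nodup.map_on (fun s hs t ht hst => ?_) List.nodup_range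
        rw [List.mem_range] at hs ht
        by_contra hne
        exact lst_ne_of_nodup hnd (i := j + s) (j := j + t) (by omega) (by omega) (by omega) hst
      have h8 := (h7.subperm (l₂ := cls V (lst X N) (V (X j))) (by
        intro x hx
        obtain ⟨t, ht, rfl⟩ := List.mem_map.1 hx
        exact hall t (List.mem_range.1 ht))).length_le
      rw [List.length_map, List.length_range] at h8
      omega
    push_cast at h2 h3 ⊢; omega

theorem flat_length_eq {V : ℤ → ℤ} {ys : List ℤ} {a b : ℕ} {thr : ℤ} (hnd : ys.Nodup)
    (hv : ∀ x ∈ ys, (a : ℤ) ≤ V x ∧ V x < b ∧ (cls V ys (V x)).length < thr) :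
    (flat V ys thr a b).length = ys.length :=
  List.Perm.length_eq ((List.perm_ext_iff_of_nodup (flat_nodup hnd) hnd).2 fun x =>
    mem_flat.trans ⟨fun h => h.1, fun h => ⟨h, hv x h⟩⟩)

theorem sum_cls_length {V : ℤ → ℤ} {ys : List ℤ} {a b : ℕ} (hab : a ≤ b) (hnd : ys.Nodup)
    (hv : ∀ x ∈ ys, (a : ℤ) ≤ V x ∧ V x < b) :
    ∑ v ∈ Finset.Ico a b, (cls V ys v).length = ys.length := by
  rw [← flat_length_eq (thr := ys.length + 1) hnd fun x hx => ⟨(hv x hx).1, (hv x hx).2, by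
    have := cls_length_le V ys (V x); omega⟩, flat_length hab]
  refine Finset.sum_congr rfl fun v _ => ?_
  have := cls_length_le V ys v
  rw [if_pos (by omega)]

/-- The pigeonhole principle for `D` possible values. -/
theorem exists_popular {V : ℤ → ℤ} {ys : List ℤ} {D T : ℕ} (hnd : ys.Nodup)
    (hv : ∀ x ∈ ys, 1 ≤ V x ∧ V x ≤ D) (hlen : D * T < ys.length) :
    ∃ v : ℕ, 0 < v ∧ v ≤ D ∧ T < (cls V ys v).length := by
  by_contra! hc
  have h1 := sum_cls_length (V := V) (a := 1) (b := D + 1) (by omega) hnd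
    (fun x hx => ⟨by exact_mod_cast (hv x hx).1, by push_cast; have := (hv x hx).2; omega⟩)
  have h2 : ∑ v ∈ Finset.Ico 1 (D + 1), (cls V ys v).length ≤ ∑ v ∈ Finset.Ico 1 (D + 1), T :=
    Finset.sum_le_sum fun v hv => by
      rw [Finset.mem_Ico] at hv
      exact hc v (by omega) (by omega)
  simp at h2
  omega

/-- The sum of the values of a list, by classes. -/
theorem sum_mul_cls_length {V : ℤ → ℤ} {ys : List ℤ} {p : ℕ}
    (hv : ∀ x ∈ ys, 0 ≤ V x ∧ V x < p) :
    ((∑ v ∈ Finset.range p, v * (cls V ys v).length : ℕ) : ℤ) = (ys.map V).sum := by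
  induction ys using List.reverseRecOn with
  | nil => simp [cls]
  | append_singleton ys y ih =>
    have hy := hv y (by simp)
    rw [List.map_append, List.sum_append, ← ih fun x hx => hv x (by simp [hx])]
    obtain ⟨u, hu⟩ := Int.eq_ofNat_of_zero_le hy.1
    have h1 : ∀ v : ℕ, v * (cls V (ys ++ [y]) v).length = v * (cls V ys v).length +
        if v = u then u else 0 := by
      intro v
      rw [cls_append_singleton, hu]
      by_cases h : v = u
      · subst h; simp; ring
      · rw [if_neg (by exact_mod_cast Ne.symm h), if_neg h, add_zero]
    simp only [h1, Finset.sum_add_distrib, Finset.sum_ite_eq', Finset.mem_range,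
      if_pos (show u < p by omega)]
    simp [hu]

/-! ### Invariants of the lists of nodes. -/

section frame

variable {c : Cd} {σ σ' : Store}

theorem Nodes.frame (hF : Frame c σ σ') {p nn : ℕ} {lone : ℤ} (h : Nodes p nn lone σ)
    (hr : ∀ x ∈ [Reg.nn, .base], c.wr x = false)
    (ha : ∀ b ∈ [Arr.lft, .rgt, .val, .st], c.wa b = false) : Nodes p nn lone σ' := by
  have r1 := hF.r .nn (hr _ (by simp))
  have r2 := hF.r .base (hr _ (by simp))
  have a1 := hF.a .lft (ha _ (by simp))
  have a2 := hF.a .rgt (ha _ (by simp))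
  have a3 := hF.a .val (ha _ (by simp))
  have a4 := hF.a .st (ha _ (by simp))
  obtain ⟨h1, h2, h3, h4, h5, h6, h7⟩ := h
  constructor <;> (try simp only [r1, r2, a1, a2, a3, a4]) <;> assumption

theorem isRoot_frame (hF : Frame c σ σ') {p nn : ℕ} {x : ℤ} (h : Nodes.IsRoot σ p nn x)
    (ha : ∀ b ∈ [Arr.lft, .rgt], c.wa b = false) : Nodes.IsRoot σ' p nn x := by
  have a1 := hF.a .lft (ha _ (by simp))
  have a2 := hF.a .rgt (ha _ (by simp))
  rw [Nodes.IsRoot, a1, a2]; exact h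

theorem Holds.frame (hF : Frame c σ σ') {A : Arr} {len : Reg} {xs : List ℤ} (h : Holds σ A len xs)
    (hr : c.wr len = false) (ha : c.wa A = false) : Holds σ' A len xs := by
  rw [Holds, hF.r _ hr, hF.a _ ha]; exact h

theorem Buckets.frame (hF : Frame c σ σ') {p : ℕ} {ys : List ℤ} (h : Buckets σ p ys)
    (ha : ∀ b ∈ [Arr.head, .nxt, .cnt, .val], c.wa b = false) : Buckets σ' p ys := by
  have a1 := hF.a .head (ha _ (by simp))
  have a2 := hF.a .nxt (ha _ (by simp))
  have a3 := hF.a .cnt (ha _ (by simp))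
  have a4 := hF.a .val (ha _ (by simp))
  rw [Buckets, a1, a2, a3, a4]; exact h

end frame

theorem cls_length_mono {V : ℤ → ℤ} {xs ys : List ℤ} (hnd : xs.Nodup) (h : ∀ x ∈ xs, x ∈ ys)
    (v : ℤ) : (cls V xs v).length ≤ (cls V ys v).length :=
  ((cls_nodup hnd v).subperm fun _ hx =>
    mem_cls.2 ⟨h _ (mem_cls.1 hx).1, (mem_cls.1 hx).2⟩).length_le

/-- Distinct roots that are no leaves. -/
structure Roots (p nn : ℕ) (σ : Store) (ys : List ℤ) : Prop where
  nodup : ys.Nodup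
  root : ∀ y ∈ ys, Nodes.IsRoot σ p nn y
  node : ∀ y ∈ ys, 2 * (p : ℤ) - 1 ≤ y

theorem Roots.frame {c : Cd} {σ σ' : Store} {p nn : ℕ} {ys : List ℤ} (h : Roots p nn σ ys)
    (hF : Frame c σ σ') (ha : ∀ b ∈ [Arr.lft, .rgt], c.wa b = false) : Roots p nn σ' ys :=
  ⟨h.nodup, fun y hy => isRoot_frame hF (h.root y hy) ha, h.node⟩

theorem Roots.sub {σ : Store} {p nn : ℕ} {xs ys : List ℤ} (h : Roots p nn σ ys)
    (hnd : xs.Nodup) (hs : ∀ x ∈ xs, x ∈ ys) : Roots p nn σ xs :=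
  ⟨hnd, fun y hy => h.root y (hs y hy), fun y hy => h.node y (hs y hy)⟩

/-- The first `N` entries of `x` are distinct roots that are no leaves, sorted by their values;
no value occurs more than `h` times. -/
structure Listing (p nn N h : ℕ) (σ : Store) : Prop extends Roots p nn σ (lst (σ.a .x) N) where
  mono : ∀ i j : ℕ, i ≤ j → j < N → σ.a .val (σ.a .x i) ≤ σ.a .val (σ.a .x j)
  cls : ∀ x ∈ lst (σ.a .x) N, (cls (σ.a .val) (lst (σ.a .x) N) (σ.a .val x)).length ≤ h

theorem mono_of_holds_flat {σ : Store} {a b : ℕ} {V : ℤ → ℤ} {T : ℤ} {ys : List ℤ}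
    (hH : Holds σ .x .xlen (flat V ys T a b)) (i j : ℕ) (hij : i ≤ j)
    (hj : j < (flat V ys T a b).length) : V (σ.a .x i) ≤ V (σ.a .x j) := by
  rcases hij.eq_or_lt with rfl | hij
  · exact le_rfl
  have hs := List.pairwise_iff_getElem.1 (flat_sorted (V := V) (ys := ys) (thr := T)
    (lo := a) (hi := b)) i j (by omega) hj hij
  have e : ∀ k (hk : k < (flat V ys T a b).length), (flat V ys T a b)[k] = σ.a .x k := by
    intro k hk
    rw [← lst_getElem (σ.a .x) _ k (by simpa using hk)]
    exact (List.getElem_of_eq hH.2 _).symm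
  rwa [e, e] at hs

theorem listing_of_flat {σ : Store} {p nn a b h : ℕ} {T : ℤ} {ys : List ℤ}
    (hR : Roots p nn σ ys) (hH : Holds σ .x .xlen (flat (σ.a .val) ys T a b)) (hT : T ≤ h + 1) :
    Listing p nn (flat (σ.a .val) ys T a b).length h σ := by
  have hl := hH.2
  refine ⟨?_, ?_, ?_⟩
  · rw [hl]; exact hR.sub (flat_nodup hR.nodup) fun x hx => (mem_flat.1 hx).1
  · exact mono_of_holds_flat hH
  · intro x hx
    rw [hl] at hx ⊢
    have h1 := cls_length_mono (V := σ.a .val) (flat_nodup (thr := T) (lo := a) (hi := b)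
      (V := σ.a .val) hR.nodup) (fun y hy => (mem_flat.1 hy).1) (σ.a .val x)
    have h2 := (mem_flat.1 hx).2.2.2
    omega

theorem lst_prefix {f : ℤ → ℤ} {N N' : ℕ} (h : N' ≤ N) : ∀ x ∈ lst f N', x ∈ lst f N := by
  intro x hx
  obtain ⟨i, hi, rfl⟩ := mem_lst.1 hx
  exact mem_lst.2 ⟨i, by omega, rfl⟩

theorem lst_nodup_prefix {f : ℤ → ℤ} {N N' : ℕ} (h : N' ≤ N) (hnd : (lst f N).Nodup) :
    (lst f N').Nodup := by
  refine List.Nodup.map_on (fun i hi j hj hij => ?_) List.nodup_range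
  rw [List.mem_range] at hi hj
  by_contra hne
  exact lst_ne_of_nodup hnd (by omega) (by omega) hne hij

theorem Listing.take {σ : Store} {p nn N h N' : ℕ} (hL : Listing p nn N h σ) (hN : N' ≤ N) :
    Listing p nn N' h σ where
  toRoots := hL.toRoots.sub (lst_nodup_prefix hN hL.nodup) (lst_prefix hN)
  mono := fun i j hij hj => hL.mono i j hij (by omega)
  cls := fun x hx => (cls_length_mono (lst_nodup_prefix hN hL.nodup) (lst_prefix hN) _).trans
    (hL.cls x (lst_prefix hN x hx))

theorem Listing.frame {c : Cd} {σ σ' : Store} {p nn N h : ℕ} (hL : Listing p nn N h σ)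
    (hF : Frame c σ σ') (ha : ∀ b ∈ [Arr.lft, .rgt, .x, .val], c.wa b = false) :
    Listing p nn N h σ' := by
  have a1 := hF.a .x (ha _ (by simp))
  have a2 := hF.a .val (ha _ (by simp))
  refine ⟨?_, ?_, ?_⟩
  · rw [a1]; exact hL.toRoots.frame hF fun b hb => ha b (by simp at hb ⊢; tauto)
  · rw [a1, a2]; exact hL.mono
  · rw [a1, a2]; exact hL.cls

/-- The nodes created by a call of `pair`. -/
def newNodes (nn c : ℕ) : List ℤ := (List.range c).map fun j : ℕ => ((nn + j : ℕ) : ℤ)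

theorem mem_newNodes {nn c : ℕ} {y : ℤ} : y ∈ newNodes nn c ↔ nn ≤ y ∧ y < nn + c := by
  simp only [newNodes, List.mem_map, List.mem_range]
  constructor
  · rintro ⟨j, hj, rfl⟩; push_cast; omega
  · rintro ⟨h1, h2⟩; exact ⟨(y - nn).toNat, by omega, by push_cast; omega⟩

@[simp] theorem newNodes_length {nn c : ℕ} : (newNodes nn c).length = c := by simp [newNodes]

theorem newNodes_nodup {nn c : ℕ} : (newNodes nn c).Nodup :=
  List.Nodup.map (fun i j h => by simpa using h) List.nodup_range

/-- The effect of `pair`: `c` nodes with values between `K` and `D` have been created. -/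
structure Created (p nn c K : ℕ) (D lone : ℤ) (xs : List ℤ) (σ σ' : Store) : Prop where
  nodes : Nodes p (nn + c) lone σ'
  val : ∀ x : ℤ, x < nn → σ'.a .val x = σ.a .val x
  old : ∀ ys, Roots p nn σ ys → (∀ y ∈ ys, y ∉ xs) → Roots p (nn + c) σ' ys
  new : Roots p (nn + c) σ' (newNodes nn c)
  bounds : ∀ y ∈ newNodes nn c, K ≤ σ'.a .val y ∧ σ'.a .val y ≤ D
  list : ∀ ys, Holds σ .y .ylen ys → Holds σ' .y .ylen (ys ++ newNodes nn c)

theorem wp_pair_listing {len s D : Ex} {σ : Store} {p nn N S K h : ℕ} {Dv G lone : ℤ}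
    {ys : List ℤ} (hL : Listing p nn N h σ) (hSK : S = K * h) (hS : 1 ≤ S) (hSN : S ≤ N)
    (hlen : ∀ σ', Frame (pair len s D) σ σ' → len.ok C σ' ∧ len.den σ' = N)
    (hs : ∀ σ', Frame (pair len s D) σ σ' → s.ok C σ' ∧ s.den σ' = S)
    (hD : ∀ σ', Frame (pair len s D) σ σ' → D.ok C σ' ∧ D.den σ' = Dv) (hD0 : 0 ≤ Dv)
    (hcost : len.cost + s.cost + D.cost ≤ 20)
    (hN : Nodes p nn lone σ) (hp : σ.r .p = p) (hp1 : 1 ≤ p) (hnn : 3 * p - 2 ≤ nn)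
    (hnr : nn + (N - S) < C.rows) (hNr : N ≤ C.rows) (hpr : 2 * p ≤ C.rows)
    (hy : Holds σ .y .ylen ys) (hyr : ys.length + (N - S) < C.rows)
    (hG : ∀ x ∈ lst (σ.a .x) N, σ.a .val x ≤ G) :
    WP C (pair len s D) (fun σ' => ∃ c : ℕ, c ≤ N - S ∧
      (Dv + 1) * ((N - S : ℕ) : ℤ) ≤ 2 * (Dv + 1) * c + 2 * (S * G) ∧
      Created p nn c K Dv lone (lst (σ.a .x) N) σ σ') (200 * N + 50) σ := by
  have hlone := hN.lone_lt
  have hmem : ∀ i : ℕ, i < N → σ.a .x i ∈ lst (σ.a .x) N := fun i hi => mem_lst_of_lt hi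
  refine (wp_pair hS hSN hlen hs hD hcost hN hp hp1 (by omega) (fun i hi =>
    ⟨hL.root _ (hmem i hi), by have := hL.node _ (hmem i hi); omega⟩) hL.nodup hL.mono hnr hNr hpr
    hy hyr (Or.inr ⟨hnn, fun i hi => hL.node _ (hmem i hi)⟩)).mono le_rfl ?_
  intro σ' _ hP
  refine ⟨_, pairIdx_length_le _ _ _ _ _, pairIdx_length_ge hS hSN hD0 hL.mono (fun i hi => ?_),
    hP.nodes, hP.val, ?_, ?_, ?_, hP.list⟩
  · have := hL.root _ (hmem i hi)
    exact ⟨(hN.tree.val _ this.1 this.2.1).1, hG _ (hmem i hi)⟩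
  · intro ys' hR hn
    refine ⟨hR.nodup, fun y hy => hP.old y (hR.root y hy) fun i hi _ => ⟨?_, ?_⟩, hR.node⟩
    · rintro rfl; exact hn _ hy (hmem i (by omega))
    · intro he
      have := hmem (i + S) (by omega)
      push_cast at this
      rw [← he] at this
      exact hn _ hy this
  · refine ⟨newNodes_nodup, fun y hy => ?_, fun y hy => ?_⟩
    · have := mem_newNodes.1 hy
      exact (hP.new y this.1 this.2).1
    · have := mem_newNodes.1 hy; omega
  · intro y hy
    have h1 := mem_newNodes.1 hy
    obtain ⟨-, i, hi, -, -, -, h2, h3⟩ := hP.new y h1.1 h1.2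
    refine ⟨?_, h3⟩
    have := gap_of_sorted hL.mono hL.nodup hL.cls K i (by omega)
    rw [← hSK] at this
    push_cast at this
    omega

theorem Listing.mono_right {σ : Store} {p nn N h h' : ℕ} (hL : Listing p nn N h σ) (hh : h ≤ h') :
    Listing p nn N h' σ := ⟨hL.toRoots, hL.mono, fun x hx => (hL.cls x hx).trans hh⟩

/-! ### Large primes for which most classes are small. -/

/-- Sort the nodes in `y` into classes, and look for a large class. -/
def bucketPopular : Cd := bucket .y .ylen ;; findPopular

/-- The nodes in `ys` and `zs` during the search for a large class. -/
structure Search (p nn : ℕ) (lone : ℤ) (ys zs : List ℤ) (M : ℕ) (σ : Store) : Prop where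
  nodes : Nodes p nn lone σ
  yroots : Roots p nn σ ys
  zroots : Roots p nn σ zs
  disj : ∀ z ∈ zs, z ∉ ys
  zcls : ∀ z ∈ zs, (cls (σ.a .val) zs (σ.a .val z)).length < M
  yhold : Holds σ .y .ylen ys
  zhold : Holds σ .z .zlen zs
  rp : σ.r .p = p
  rm : σ.r .m = M
  -- The size required of the class that is scaled to `1`. The same number bounds the values of the
  -- differences created in `addSpread`, so that the ones can fill the gaps between them.
  thr : σ.r .thr = 4096 * M

theorem Search.frame {c : Cd} {σ σ' : Store} (hF : Frame c σ σ') {p nn M : ℕ} {lone : ℤ}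
    {ys zs : List ℤ} (h : Search p nn lone ys zs M σ)
    (hr : ∀ x ∈ [Reg.nn, .base, .p, .m, .thr, .ylen, .zlen], c.wr x = false)
    (ha : ∀ b ∈ [Arr.lft, .rgt, .val, .st, .y, .z], c.wa b = false) :
    Search p nn lone ys zs M σ' := by
  have ha' : ∀ b ∈ [Arr.lft, .rgt], c.wa b = false := fun b hb => ha b (by simp at hb ⊢; tauto)
  refine ⟨h.nodes.frame hF (fun x hx => hr x (by simp at hx ⊢; tauto))
    (fun x hx => ha x (by simp at hx ⊢; tauto)), h.yroots.frame hF ha', h.zroots.frame hF ha',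
    h.disj, ?_, h.yhold.frame hF (hr _ (by simp)) (ha _ (by simp)),
    h.zhold.frame hF (hr _ (by simp)) (ha _ (by simp)), ?_, ?_, ?_⟩
  · rw [hF.a .val (ha _ (by simp))]; exact h.zcls
  · rw [hF.r .p (hr _ (by simp))]; exact h.rp
  · rw [hF.r .m (hr _ (by simp))]; exact h.rm
  · rw [hF.r .thr (hr _ (by simp))]; exact h.thr

/-- The result of the search for a large class of value `G`. -/
structure Found (p : ℕ) (ys : List ℤ) (M G : ℕ) (σ : Store) : Prop where
  buckets : Buckets σ p ys
  g : σ.r .g = G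
  lt : G < p
  pop : G ≠ 0 → 4096 * M ≤ (cls (σ.a .val) ys G).length
  unpop : G = 0 → ∀ v : ℕ, 0 < v → v < p → (cls (σ.a .val) ys v).length < 4096 * M

theorem wp_bucketPopular {σ : Store} {p nn M : ℕ} {lone : ℤ} {ys zs : List ℤ} (hp : 1 ≤ p)
    (hS : Search p nn lone ys zs M σ) (hlen : ys.length ≤ p) (hpr : p ≤ C.rows)
    (hnr : nn ≤ C.rows) :
    WP C bucketPopular (fun σ' => ∃ G : ℕ, Search p nn lone ys zs M σ' ∧ Found p ys M G σ')
      (300 * p + 150) σ := by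
  have hl := hS.yhold.2
  refine (WP.seq (wp_bucket (A := .y) (len := .ylen) (by decide) (by decide) hS.rp hS.yhold.1 hpr
    (by omega) (fun x hx => ?_) (by rw [hl]; exact hS.yroots.nodup))
    (b' := 100 * p + 20) ?_).mono (by omega) (fun _ _ h => h)
  · rw [hl] at hx
    have h1 := hS.yroots.root x hx
    have h2 := hS.nodes.tree.val x h1.1 h1.2.1
    exact ⟨h1.1, by have := h1.2.1; omega, h2⟩
  · intro σ₁ hF₁ hB
    rw [hl] at hB
    have hS₁ : Search p nn lone ys zs M σ₁ := hS.frame hF₁ (by decide) (by decide)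
    refine (wp_findPopular hp hS₁.rp hS₁.thr hpr).mono le_rfl ?_
    rintro σ₂ hF₂ ⟨G, h1, h2, h3, h4⟩
    have hB₂ : Buckets σ₂ p ys := hB.frame hF₂ (by decide)
    have hc : ∀ v : ℕ, v < p → σ₁.a .cnt v = (cls (σ₂.a .val) ys v).length := by
      intro v hv
      rw [hF₂.a .val rfl]
      exact (hB v (by omega) (by omega)).2
    refine ⟨G, hS₁.frame hF₂ (by decide) (by decide), hB₂, h1, h2, fun h => ?_,
      fun h v hv hv' => ?_⟩
    · have := h3 h; rw [hc G h2] at this; exact_mod_cast this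
    · have := h4 h v hv hv'; rw [hc v hv'] at this; exact_mod_cast this

/-- Split the list in `x` into two halves, the second of which is moved to `z`. -/
def splitHalf : Cd :=
  .half ::= .reg .xlen / 2 ;;
  .zlen ::= .reg .xlen - .reg .half ;;
  copy .x .z .half .zlen ;;
  .thr ::= .lit 4096 * .reg .m ;;
  .ylen ::= 0

/-- The first half is spent on producing many equal values, the second half on producing a large
sum. A node may enter only one difference, hence the two halves are kept disjoint. -/
theorem wp_splitHalf {σ : Store} {p nn N M : ℕ} {lone : ℤ} (hL : Listing p nn N (M - 1) σ)
    (hN : Nodes p nn lone σ) (hrp : σ.r .p = p) (hxl : σ.r .xlen = N) (hrm : σ.r .m = M)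
    (hM : 1 ≤ M) (hMp : 2 ^ 57 * M ≤ p) (hNr : N ≤ C.rows) (hpr : p ≤ C.rows) :
    WP C splitHalf (fun σ' => ∃ zs : List ℤ, Search p nn lone [] zs M σ' ∧
      zs.length = N - N / 2 ∧ (∀ z ∈ zs, z ∉ lst (σ'.a .x) (N / 2)) ∧
      Listing p nn (N / 2) M σ' ∧ σ'.r .half = (N / 2 : ℕ)) (100 * N + 100) σ := by
  have hb1 := C.rows_le_big; have hb2 := C.hstride
  simp only [stride, Nat.cast_ofNat] at hb2
  norm_num at hMp
  refine (WP.seq (b := 4) (R := fun s => s = σ.set .half (N / 2 : ℕ))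
    (WP.straight (by simp [hxl]; omega) (by simp [hxl]) (Nat.le_of_ble_eq_true rfl)) ?_
    (b' := 100 * N + 90)).mono (by omega) (fun _ _ h => h)
  rintro _ - rfl
  refine (WP.seq (b := 4) (R := fun s => s = (σ.set .half (N / 2 : ℕ)).set .zlen (N - N / 2 : ℕ))
    (WP.straight (by simp [hxl]; omega) ?_ (Nat.le_of_ble_eq_true rfl)) ?_
    (b' := 100 * N + 80)).mono (by omega) (fun _ _ h => h)
  · have : (N : ℤ) - (N / 2 : ℕ) = (N - N / 2 : ℕ) := by omega
    simp only [Cd.fin_set, Ex.den_sub, Ex.den_reg, Store.set_r, reduceCtorEq, if_true, if_false,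
      hxl, this]
  rintro _ - rfl
  set s₀ := (σ.set .half (N / 2 : ℕ)).set .zlen (N - N / 2 : ℕ) with hs₀
  refine (WP.seq (wp_copy (o := N / 2) (L := N - N / 2) (by decide) (by decide) (by decide)
    (by simp [hs₀]) (by simp [hs₀]) (by omega)) (b' := 20) ?_).mono (by omega) (fun _ _ h => h)
  intro σ₁ hF₁ hcp
  have r1 : σ₁.r .m = M := by rw [hF₁.r .m rfl]; simp [hs₀, hrm]
  have r2 : σ₁.r .half = (N / 2 : ℕ) := by rw [hF₁.r .half rfl]; simp [hs₀]
  have r3 : σ₁.r .zlen = (N - N / 2 : ℕ) := by rw [hF₁.r .zlen rfl]; simp [hs₀]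
  have r4 : σ₁.r .nn = σ.r .nn := by rw [hF₁.r .nn rfl]; simp [hs₀]
  have r5 : σ₁.r .base = σ.r .base := by rw [hF₁.r .base rfl]; simp [hs₀]
  have r6 : σ₁.r .p = p := by rw [hF₁.r .p rfl]; simp [hs₀, hrp]
  have a1 : σ₁.a .lft = σ.a .lft := hF₁.a .lft rfl
  have a2 : σ₁.a .rgt = σ.a .rgt := hF₁.a .rgt rfl
  have a3 : σ₁.a .val = σ.a .val := hF₁.a .val rfl
  have a4 : σ₁.a .st = σ.a .st := hF₁.a .st rfl
  have a5 : σ₁.a .x = σ.a .x := hF₁.a .x rfl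
  have hz : lst (σ₁.a .z) (N - N / 2) = (lst (σ.a .x) N).drop (N / 2) := by
    refine List.ext_getElem (by simp) fun i h1 h2 => ?_
    rw [lst_getElem, List.getElem_drop, lst_getElem, hcp i (by simpa using h1)]
    simp [hs₀]
  set zs := (lst (σ.a .x) N).drop (N / 2) with hzs
  have hzl : zs.length = N - N / 2 := by simp [hzs]
  have hsub : ∀ z ∈ zs, z ∈ lst (σ.a .x) N := fun z hz => List.mem_of_mem_drop hz
  have hznd : zs.Nodup := hL.nodup.sublist (List.drop_sublist _ _)
  have hzr := hL.toRoots.sub hznd hsub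
  have hF : Frame splitHalf σ σ₁ := ⟨fun x hx => by
    simp only [splitHalf, Cd.wr, Bool.or_eq_false_iff, decide_eq_false_iff_not] at hx
    rw [hF₁.r x hx.2.2.1]; simp [hs₀, Ne.symm hx.1, Ne.symm hx.2.1], fun b hb => by
    simp only [splitHalf, Cd.wa, Bool.or_eq_false_iff] at hb
    rw [hF₁.a b hb.2.2.1]; simp [hs₀]⟩
  refine WP.straight ?_ ⟨zs, ⟨⟨?_, ?_, hN.lone_lt, ?_, ?_, ?_, ?_⟩, ⟨List.nodup_nil, by simp,
    by simp⟩, ⟨hznd, ?_, hzr.node⟩, by simp, ?_, ⟨by simp, rfl⟩, ⟨?_, ?_⟩, ?_, ?_, ?_⟩, hzl, ?_, ?_,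
    ?_⟩ (Nat.le_of_ble_eq_true rfl)
  · simp [r1]; omega
  · simp [r4, hN.reg]
  · simpa [a1, a2, a3] using hN.tree
  · simpa [a1, a2] using hN.root
  · simpa [a4] using hN.st
  · simpa [a1, a3, r5] using hN.base
  · simpa [r5] using hN.base_lt
  · simpa [Nodes.IsRoot, a1, a2] using hzr.root
  · intro z hz
    simp only [Cd.fin_seq, Cd.fin_set, Store.set_a, a3]
    have := (cls_length_mono hznd hsub _).trans (hL.cls z (hsub z hz))
    omega
  · simp [r3, hzl]
  · rw [hzl]; simpa using hz
  · simp [r6]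
  · simp [r1]
  · simp [r1]
  · simp only [Cd.fin_seq, Cd.fin_set, Store.set_a, a5]
    intro z hz hz'
    obtain ⟨i, hi, rfl⟩ := mem_lst.1 hz'
    obtain ⟨j, hj, he⟩ := List.getElem_of_mem hz
    simp only [hzs, List.getElem_drop, lst_getElem] at he
    exact lst_ne_of_nodup hL.nodup (by omega) (by omega) (show N / 2 + j ≠ i by omega) he
  · have h1 := (hL.take (Nat.div_le_self N 2)).mono_right (show M - 1 ≤ M by omega)
    obtain ⟨⟨b1, b2, b3⟩, b4, b5⟩ := h1
    refine ⟨⟨?_, ?_, ?_⟩, ?_, ?_⟩ <;>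
      simp only [Cd.fin_seq, Cd.fin_set, Store.set_a, a3, a5, Nodes.IsRoot, a1, a2]
    exacts [b1, b2, b3, b4, b5]
  · simp [r2]

/-- The arithmetic of the number of new nodes. -/
theorem count_bound {D n c E : ℤ} {q : ℤ} (hD : 0 ≤ D) (h : (D + 1) * n ≤ 2 * (D + 1) * c + E)
    (hE : q * E ≤ (D + 1) * p) (hq : 0 ≤ q) : q * n ≤ 2 * q * c + p := by
  have h1 : (D + 1) * (q * n) ≤ (D + 1) * (2 * q * c + p) := by
    have := mul_le_mul_of_nonneg_left h hq
    nlinarith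
  exact le_of_mul_le_mul_left h1 (by omega)

/-- Create differences of the nodes in the first half of `x`. -/
def pairFirst : Cd :=
  pair (.reg .half) (.reg .m) (.lit 40 * .reg .m) ;; bucketPopular

theorem Created.search {p nn c K M : ℕ} {D lone : ℤ} {xs zs : List ℤ} {σ σ' : Store} {cd : Cd}
    (h : Created p nn c K D lone xs σ σ') (hS : Search p nn lone [] zs M σ)
    (hF : Frame cd σ σ') (hz : ∀ z ∈ zs, z ∉ xs)
    (hr : ∀ x ∈ [Reg.p, .m, .thr, .zlen], cd.wr x = false)
    (ha : ∀ b ∈ [Arr.z], cd.wa b = false) :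
    Search p (nn + c) lone (newNodes nn c) zs M σ' := by
  have hzlt : ∀ z ∈ zs, z < nn := fun z hz => (hS.zroots.root z hz).2.1
  refine ⟨h.nodes, h.new, h.old zs hS.zroots hz, fun z hz hc => ?_, fun z hz => ?_, ?_,
    hS.zhold.frame hF (hr _ (by simp)) (ha _ (by simp)), ?_, ?_, ?_⟩
  · have := (mem_newNodes.1 hc).1
    have := hzlt z hz
    omega
  · have : ∀ v, cls (σ'.a .val) zs v = cls (σ.a .val) zs v := by
      intro v
      rw [cls, cls]
      congr 1
      refine List.filter_congr fun x hx => ?_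
      rw [h.val x (hzlt x hx)]
    rw [this, h.val z (hzlt z hz)]
    exact hS.zcls z hz
  · simpa using h.list [] hS.yhold
  · rw [hF.r .p (hr _ (by simp))]; exact hS.rp
  · rw [hF.r .m (hr _ (by simp))]; exact hS.rm
  · rw [hF.r .thr (hr _ (by simp))]; exact hS.thr

theorem wp_pairFirst {σ : Store} {p nn H M : ℕ} {lone : ℤ} {zs : List ℤ}
    (hS : Search p nn lone [] zs M σ) (hL : Listing p nn H M σ) (hh : σ.r .half = H)
    (hz : ∀ z ∈ zs, z ∉ lst (σ.a .x) H) (hM : 2 ≤ M) (hMp : 2 ^ 57 * M ≤ p) (hH : H ≤ p)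
    (hHp : p ≤ 4 * H + 4) (hnn : 3 * p - 2 ≤ nn) (hnr : nn + p < C.rows) :
    WP C pairFirst (fun σ' => ∃ c G : ℕ, c ≤ H ∧ p ≤ 11 * c ∧
      Search p (nn + c) lone (newNodes nn c) zs M σ' ∧ Found p (newNodes nn c) M G σ' ∧
      (∀ y ∈ newNodes nn c, 1 ≤ σ'.a .val y ∧ σ'.a .val y ≤ 40 * M) ∧
      ∀ x : ℤ, x < nn → σ'.a .val x = σ.a .val x) (500 * p + 200) σ := by
  have hb1 := C.rows_le_big; have hb2 := C.hstride
  simp only [stride, Nat.cast_ofNat] at hb2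
  norm_num at hMp
  refine (WP.seq (wp_pair_listing (K := 1) (S := M) (h := M) (Dv := 40 * M) (G := p) hL
    (by simp) (by omega) (by omega)
    (fun s hF => ⟨by simp, by simp [hF.r .half rfl, hh]⟩)
    (fun s hF => ⟨by simp, by simp [hF.r .m rfl, hS.rm]⟩)
    (fun s hF => ⟨by simp [hF.r .m rfl, hS.rm]; omega, by simp [hF.r .m rfl, hS.rm]⟩)
    (by omega) (Nat.le_of_ble_eq_true rfl) hS.nodes hS.rp (by omega) hnn (by omega) (by omega)
    (by omega) hS.yhold (by simp; omega) (fun x hx => ?_)) (b' := 300 * p + 150) ?_).mono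
    (by omega) (fun _ _ h => h)
  · have h1 := hL.root x hx
    exact (hS.nodes.tree.val x h1.1 h1.2.1).2.le
  · rintro σ₁ hF₁ ⟨c, hc, hcount, hC⟩
    have hS₁ : Search p (nn + c) lone (newNodes nn c) zs M σ₁ :=
      hC.search hS hF₁ hz (by decide) (by decide)
    -- The differences at distance `M` have sum at most `M * p`, and `20 * (2 * M * p) ≤ (40 * M +
    -- 1) * p`. The result `20 * (H - M) ≤ 40 * c + p`, with `H` at least about `p / 4`, gives `p ≤
    -- 11 * c`.
    have hcp := count_bound (p := p) (q := 20) (by omega) hcount (by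
      have : (0 : ℤ) ≤ M := by omega
      nlinarith) (by omega)
    refine (wp_bucketPopular (by omega) hS₁ (by simp; omega) (by omega) (by omega)).mono le_rfl ?_
    rintro σ₂ hF₂ ⟨G, hS₂, hG⟩
    refine ⟨c, G, by omega, by omega, hS₂, hG, ?_, ?_⟩
    · rw [hF₂.a .val rfl]; exact_mod_cast hC.bounds
    · rw [hF₂.a .val rfl]; exact hC.val

/-- Create differences of the differences. -/
def pairSecond : Cd :=
  flatten 0 (.reg .p) (.reg .thr) ;; .ylen ::= 0 ;;
  pair (.reg .xlen) (.reg .thr) (.lit (2 ^ 30)) ;; bucketPopular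

/-- If no value is frequent, the values in `[1, 40 * M]` are paired again, at distance `4096 * M`.
Differences at this distance are positive and have sum at most `4096 * M * (40 * M)`, which is
`O(p)`. So a fixed proportion of them is at most `2 ^ 30`, and among boundedly many values one is
frequent. -/
theorem wp_pairSecond {σ : Store} {p nn M : ℕ} {lone : ℤ} {ys zs : List ℤ}
    (hS : Search p nn lone ys zs M σ) (hG : Found p ys M 0 σ) (hM : 2 ≤ M)
    (hMp : 2 ^ 57 * M ≤ p) (hM2 : M * M ≤ 8 * p) (hys : ys.length ≤ p)
    (hyp : p ≤ 11 * ys.length) (hyv : ∀ y ∈ ys, 1 ≤ σ.a .val y ∧ σ.a .val y ≤ 40 * M)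
    (hnn : 3 * p - 2 ≤ nn) (hnr : nn + p < C.rows) :
    WP C pairSecond (fun σ' => ∃ c G : ℕ, c ≤ ys.length ∧
      Search p (nn + c) lone (newNodes nn c) zs M σ' ∧ Found p (newNodes nn c) M G σ' ∧
      G ≠ 0 ∧ ∀ x : ℤ, x < nn → σ'.a .val x = σ.a .val x) (800 * p + 400) σ := by
  have hb1 := C.rows_le_big; have hb2 := C.hstride
  simp only [stride, Nat.cast_ofNat] at hb2
  norm_num at hMp
  have hyr : ∀ y ∈ ys, 0 ≤ y ∧ y < C.rows := fun y hy => by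
    have := hS.yroots.root y hy
    exact ⟨this.1, by have := this.2.1; omega⟩
  refine (WP.seq (wp_flatten (a := 0) (b := p) (T := 4096 * M) (ys := ys) (by omega) le_rfl
    (by omega) (by omega) (fun s hF => ⟨by simp, by simp⟩)
    (fun s hF => ⟨by simp, by simp [hF.r .p rfl, hS.rp]⟩)
    (fun s hF => ⟨by simp, by simp [hF.r .thr rfl, hS.thr]⟩) hyr hS.yroots.nodup hG.buckets
    (Nat.le_of_ble_eq_true rfl)) (b' := 600 * p + 300) ?_).mono (by omega) (fun _ _ h => h)
  intro σ₁ hF₁ hH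
  have hS₁ : Search p nn lone ys zs M σ₁ := hS.frame hF₁ (by decide) (by decide)
  have hv₁ : σ₁.a .val = σ.a .val := hF₁.a .val rfl
  rw [← hv₁] at hH
  have hfl : (flat (σ₁.a .val) ys (4096 * M) 0 p).length = ys.length := by
    refine flat_length_eq hS.yroots.nodup fun x hx => ?_
    have h1 := hyv x hx
    have h2 := hS.yroots.root x hx
    have h3 := hS.nodes.tree.val x h2.1 h2.2.1
    rw [hv₁]
    refine ⟨by omega, h3.2, ?_⟩
    obtain ⟨v, hv⟩ := Int.eq_ofNat_of_zero_le h3.1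
    rw [hv]
    have := hG.unpop rfl v (by omega) (by omega)
    exact_mod_cast this
  have hL := listing_of_flat (h := 4096 * M) hS₁.yroots hH (by push_cast; omega)
  have hmem : ∀ x ∈ lst (σ₁.a .x) (flat (σ₁.a .val) ys (4096 * M) 0 p).length, x ∈ ys := by
    rw [hH.2]; intro x hx; exact (mem_flat.1 hx).1
  have hxl := hH.1
  rw [hfl] at hL hmem hxl
  refine (WP.seq (b := 2) (R := fun s => s = σ₁.set .ylen 0)
    (WP.straight (by simp) (by simp) (Nat.le_of_ble_eq_true rfl)) ?_
    (b' := 600 * p + 290)).mono (by omega) (fun _ _ h => h)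
  rintro _ hF₂ rfl
  set σ₂ := σ₁.set .ylen 0 with hσ₂
  have hS₂ : Search p nn lone [] zs M σ₂ :=
    ⟨hS₁.nodes.frame hF₂ (by decide) (by decide), ⟨List.nodup_nil, by simp, by simp⟩,
      hS₁.zroots.frame hF₂ (by decide), by simp, by simpa [hσ₂] using hS₁.zcls,
      ⟨by simp [hσ₂], rfl⟩, hS₁.zhold.frame hF₂ rfl rfl, by simpa [hσ₂] using hS₁.rp,
      by simpa [hσ₂] using hS₁.rm, by simpa [hσ₂] using hS₁.thr⟩
  have hL₂ : Listing p nn ys.length (4096 * M) σ₂ := hL.frame hF₂ (by decide)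
  have hx₂ : σ₂.a .x = σ₁.a .x := rfl
  have hv₂ : σ₂.a .val = σ.a .val := hv₁
  refine (WP.seq (wp_pair_listing (K := 1) (S := 4096 * M) (h := 4096 * M) (Dv := 2 ^ 30)
    (G := 40 * M) (N := ys.length) hL₂ (by simp) (by omega) (by omega)
    (fun s hF => ⟨by simp, by simp [hF.r .xlen rfl, hσ₂, hxl]⟩)
    (fun s hF => ⟨by simp, by simp [hF.r .thr rfl, hS₂.thr]⟩)
    (fun s hF => ⟨by simp; omega, by simp⟩)
    (by omega) (Nat.le_of_ble_eq_true rfl) hS₂.nodes hS₂.rp (by omega) hnn (by omega) (by omega)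
    (by omega) hS₂.yhold (by simp; omega) (fun x hx => ?_)) (b' := 300 * p + 150) ?_).mono
    (by omega) (fun _ _ h => h)
  · rw [hv₂]; exact (hyv x (hmem x hx)).2
  · rintro σ₃ hF₃ ⟨c, hc, hcount, hC⟩
    have hS₃ : Search p (nn + c) lone (newNodes nn c) zs M σ₃ :=
      hC.search hS₂ hF₃ (fun z hz hzx => hS.disj z hz (hmem z hzx)) (by decide) (by decide)
    have hM2' : (M : ℤ) * M ≤ 8 * p := by exact_mod_cast hM2
    -- By `M * M ≤ 8 * p`: the number `400 * (2 * 4096 * 40) * 8` is less than `2 ^ 30`.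
    have hcp := count_bound (p := p) (q := 400) (by omega) hcount (by
      push_cast
      have : (0 : ℤ) ≤ p := by omega
      nlinarith) (by omega)
    refine (wp_bucketPopular (by omega) hS₃ (by simp; omega) (by omega) (by omega)).mono le_rfl ?_
    rintro σ₄ hF₄ ⟨G, hS₄, hG₄⟩
    have hv₄ : σ₄.a .val = σ₃.a .val := hF₄.a .val rfl
    refine ⟨c, G, by omega, hS₄, hG₄, ?_, ?_⟩
    · rintro rfl
      -- The product of the number of values and the threshold is `2 ^ 42 * M`. This is less than
      -- `c`, because `2 ^ 57 * M ≤ p` and `c` is a fixed proportion of `p`.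
      obtain ⟨v, h1, h2, h3⟩ := exists_popular (V := σ₄.a .val) (ys := newNodes nn c)
        (D := 2 ^ 30) (T := 4096 * M) newNodes_nodup (fun x hx => by
          rw [hv₄]; have := hC.bounds x hx; push_cast; omega) (by simp; omega)
      have := hG₄.unpop rfl v h1 (by omega)
      omega
    · rw [hv₄, ← hv₂]; exact hC.val

/-- Move the class of value `g` to `y`, and rescale it to the value `1`. -/
def useClass : Cd :=
  flatten (.reg .g) (.reg .g + 1) (.reg .p + .reg .p) ;;
  .half ::= 0 ;; .ylen ::= .reg .xlen ;; copy .x .y .half .ylen ;; rescale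

/-- All nodes are divided by `G`, not only those of the class, since the tree relates their values.
The unit `h` is recorded in order to return to the original leaves in the end. -/
theorem wp_useClass {σ : Store} {p nn M G : ℕ} {lone : ℤ} {ys zs : List ℤ} (hp : p.Prime)
    (hS : Search p nn lone ys zs M σ) (hG : Found p ys M G σ) (hG0 : G ≠ 0)
    (hys : ys.length ≤ p) (hnr : nn ≤ C.rows) (hpr : 2 * p ≤ C.rows)
    (hbig : 10 * ((p : ℤ) * p) ≤ C.big) :
    WP C useClass (fun σ' => ∃ ys' : List ℤ, Search p nn lone ys' zs M σ' ∧
      (∀ y ∈ ys', σ'.a .val y = 1) ∧ 4096 * M ≤ ys'.length ∧ ys'.length ≤ ys.length ∧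
      ∃ h : ℤ, IsCoprime h p ∧ ∀ x : ℕ, x < nn → σ'.a .val x = σ.a .val x * h % p)
      (100 * nn + 400 * p + 300) σ := by
  have hb1 := C.rows_le_big; have hb2 := C.hstride
  simp only [stride, Nat.cast_ofNat] at hb2
  have hp2 := hp.two_le
  have hyr : ∀ y ∈ ys, 0 ≤ y ∧ y < C.rows := fun y hy => by
    have := hS.yroots.root y hy
    exact ⟨this.1, by have := this.2.1; omega⟩
  have hGp := hG.lt
  refine (WP.seq (wp_flatten (a := G) (b := G + 1) (T := 2 * p) (p := p) (ys := ys) (by omega)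
    (by omega) (by omega) (by omega) (fun s hF => ⟨by simp, by simp [hF.r .g rfl, hG.g]⟩)
    (fun s hF => ⟨by simp [hF.r .g rfl, hG.g]; omega, by simp [hF.r .g rfl, hG.g]⟩)
    (fun s hF => ⟨by simp [hF.r .p rfl, hS.rp]; omega, by simp [hF.r .p rfl, hS.rp]; ring⟩)
    hyr hS.yroots.nodup hG.buckets (Nat.le_of_ble_eq_true rfl))
    (b' := 100 * nn + 200 * p + 200) ?_).mono (by omega) (fun _ _ h => h)
  intro σ₁ hF₁ hH
  have hS₁ : Search p nn lone ys zs M σ₁ := hS.frame hF₁ (by decide) (by decide)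
  have hv₁ : σ₁.a .val = σ.a .val := hF₁.a .val rfl
  have hcl := cls_length_le (σ.a .val) ys G
  have hfl : flat (σ.a .val) ys (2 * p) G (G + 1) = cls (σ.a .val) ys G := by
    rw [flat_succ le_rfl, flat_self, List.nil_append, if_pos (by omega)]
  rw [hfl] at hH
  set ws := cls (σ.a .val) ys G with hws
  have hxl := hH.1
  refine (WP.seq (b := 2) (R := fun s => s = σ₁.set .half 0)
    (WP.straight (by simp) (by simp) (Nat.le_of_ble_eq_true rfl)) ?_
    (b' := 100 * nn + 200 * p + 190)).mono (by omega) (fun _ _ h => h)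
  rintro _ - rfl
  refine (WP.seq (b := 2) (R := fun s => s = (σ₁.set .half 0).set .ylen ws.length)
    (WP.straight (by simp) (by simp [hxl]) (Nat.le_of_ble_eq_true rfl)) ?_
    (b' := 100 * nn + 200 * p + 180)).mono (by omega) (fun _ _ h => h)
  rintro _ - rfl
  set σ₂ := (σ₁.set .half 0).set .ylen ws.length with hσ₂
  refine (WP.seq (wp_copy (o := 0) (L := ws.length) (by decide) (by decide) (by decide)
    (by simp [hσ₂]) (by simp [hσ₂]) (by omega)) (b' := 100 * nn + 50) ?_).mono (by omega)
    (fun _ _ h => h)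
  intro σ₃ hF₃ hcp
  have hsub : ∀ y ∈ ws, y ∈ ys := fun y hy => (mem_cls.1 hy).1
  have hwnd : ws.Nodup := cls_nodup hS.yroots.nodup _
  have hy₃ : Holds σ₃ .y .ylen ws := by
    refine ⟨by rw [hF₃.r .ylen rfl]; simp [hσ₂], ?_⟩
    rw [← hH.2]
    simp only [lst_length]
    exact lst_congr fun i hi => by simpa [hσ₂] using hcp i hi
  have hF₂ : Frame (.half ::= 0 ;; .ylen ::= .reg .xlen) σ₁ σ₂ := ⟨fun x hx => by
    simp only [Cd.wr, Bool.or_eq_false_iff, decide_eq_false_iff_not] at hx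
    simp [hσ₂, Ne.symm hx.1, Ne.symm hx.2], fun _ _ => rfl⟩
  have hS₃ : Search p nn lone ws zs M σ₃ :=
    ⟨(hS₁.nodes.frame hF₂ (by decide) (by decide)).frame hF₃ (by decide) (by decide),
      ((hS₁.yroots.frame hF₂ (by decide)).frame hF₃ (by decide)).sub hwnd hsub,
      (hS₁.zroots.frame hF₂ (by decide)).frame hF₃ (by decide),
      fun z hz hc => hS.disj z hz (hsub z hc), by rw [hF₃.a .val rfl]; exact hS₁.zcls, hy₃,
      (hS₁.zhold.frame hF₂ rfl rfl).frame hF₃ rfl rfl,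
      by rw [hF₃.r .p rfl, hF₂.r .p rfl]; exact hS₁.rp,
      by rw [hF₃.r .m rfl, hF₂.r .m rfl]; exact hS₁.rm,
      by rw [hF₃.r .thr rfl, hF₂.r .thr rfl]; exact hS₁.thr⟩
  have hg₃ : σ₃.r .g = G := by
    rw [hF₃.r .g rfl, hF₂.r .g rfl, hF₁.r .g rfl]; exact hG.g
  have hv₃ : σ₃.a .val = σ.a .val := by rw [hF₃.a .val rfl, hF₂.a .val rfl, hv₁]
  refine (wp_rescale hp hS₃.rp hS₃.nodes hg₃ (by omega) hGp hnr hbig).mono le_rfl ?_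
  rintro σ₄ hF₄ ⟨hN₄, h, hh, hval⟩
  rw [hv₃] at hval
  have hval' : ∀ x : ℤ, 0 ≤ x → x < nn → σ₄.a .val x = σ.a .val x * h % p := by
    intro x h0 h1
    obtain ⟨i, rfl⟩ := Int.eq_ofNat_of_zero_le h0
    exact hval i (by omega)
  refine ⟨ws, ⟨hN₄, hS₃.yroots.frame hF₄ (by decide), hS₃.zroots.frame hF₄ (by decide), hS₃.disj,
    ?_, hS₃.yhold.frame hF₄ rfl rfl, hS₃.zhold.frame hF₄ rfl rfl,
    by rw [hF₄.r .p rfl]; exact hS₃.rp, by rw [hF₄.r .m rfl]; exact hS₃.rm,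
    by rw [hF₄.r .thr rfl]; exact hS₃.thr⟩, ?_, hG.pop hG0, hcl, h,
    isCoprime_of_modEq_one hh, hval⟩
  -- Multiplication by a unit is injective on residues, so the classes of `zs` are not merged.
  · intro z hz
    refine lt_of_le_of_lt ?_ (hS.zcls z hz)
    refine ((cls_nodup hS.zroots.nodup _).subperm fun x hx => ?_).length_le
    obtain ⟨h1, h2⟩ := mem_cls.1 hx
    refine mem_cls.2 ⟨h1, ?_⟩
    have hrx := hS.zroots.root x h1
    have hrz := hS.zroots.root z hz
    rw [hval' x hrx.1 hrx.2.1, hval' z hrz.1 hrz.2.1] at h2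
    have h3 : σ.a .val x ≡ σ.a .val z [ZMOD p] := by
      have h4 : σ.a .val x * h * G ≡ σ.a .val z * h * G [ZMOD p] := Int.ModEq.mul_right _ h2
      have h5 : ∀ v : ℤ, v * h * G ≡ v [ZMOD p] := fun v => by
        have := hh.mul_left v
        rw [mul_one] at this
        rwa [mul_assoc, mul_comm h]
      exact (h5 _).symm.trans (h4.trans (h5 _))
    have h6 := hS.nodes.tree.val x hrx.1 hrx.2.1
    have h7 := hS.nodes.tree.val z hrz.1 hrz.2.1
    rwa [Int.ModEq, Int.emod_eq_of_lt h6.1 h6.2, Int.emod_eq_of_lt h7.1 h7.2] at h3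
  · intro y hy
    have hry := hS.yroots.root y (hsub y hy)
    rw [hval' y hry.1 hry.2.1, (mem_cls.1 hy).2, hh, Int.emod_eq_of_lt (by omega) (by omega)]

/-- The nodes `ys` are sorted into classes that lead to all residues. -/
structure Ready (p nn : ℕ) (lone : ℤ) (ys : List ℤ) (M : ℕ) (σ : Store) : Prop where
  nodes : Nodes p nn lone σ
  roots : Roots p nn σ ys
  buckets : Buckets σ p ys
  rp : σ.r .p = p
  rm : σ.r .m = M
  len : ys.length < p
  pos : ∀ y ∈ ys, σ.a .val y ≠ 0
  reach : Reaches p M fun v : ℕ => (cls (σ.a .val) ys v).length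

/-- Add to the class of value `1` differences of the nodes in `z`. -/
def addSpread : Cd :=
  bucket .z .zlen ;; flatten 0 (.reg .p) (.reg .m) ;;
  pair (.reg .xlen) (.lit 64 * .reg .m) (.reg .thr) ;; bucket .y .ylen

/-- The classes of `zs` have fewer than `M` elements, so entries at distance `64 * M` differ by at
least `64`. Enough of these differences are at most `4096 * M`, the guaranteed number of ones, and
their sum is at least `p - 1`; then `reaches_low` applies. -/
theorem wp_addSpread {σ : Store} {p nn M : ℕ} {lone : ℤ} {ys zs : List ℤ} (hp : p.Prime)
    (hS : Search p nn lone ys zs M σ) (hy1 : ∀ y ∈ ys, σ.a .val y = 1)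
    (hyl : 4096 * M ≤ ys.length) (hzl : p ≤ 4 * zs.length) (hyz : ys.length + zs.length < p)
    (hM : 2 ≤ M) (hMp : 2 ^ 57 * M ≤ p) (hnn : 3 * p - 2 ≤ nn) (hnr : nn + p < C.rows) :
    WP C addSpread (fun σ' => ∃ (nn' : ℕ) (ys' : List ℤ), nn ≤ nn' ∧ nn' ≤ nn + p ∧
      Ready p nn' lone ys' M σ' ∧ ∀ x : ℤ, x < nn → σ'.a .val x = σ.a .val x)
      (1000 * p + 400) σ := by
  have hb1 := C.rows_le_big; have hb2 := C.hstride
  simp only [stride, Nat.cast_ofNat] at hb2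
  norm_num at hMp
  have hl := hS.zhold.2
  have hzr : ∀ z ∈ zs, 0 ≤ z ∧ z < C.rows ∧ 0 ≤ σ.a .val z ∧ σ.a .val z < p := fun x hx => by
    have h1 := hS.zroots.root x hx
    have h2 := hS.nodes.tree.val x h1.1 h1.2.1
    exact ⟨h1.1, by have := h1.2.1; omega, h2⟩
  refine (WP.seq (wp_bucket (A := .z) (len := .zlen) (by decide) (by decide) hS.rp hS.zhold.1
    (by omega) (by omega) (by rwa [hl]) (by rw [hl]; exact hS.zroots.nodup))
    (b' := 800 * p + 300) ?_).mono (by omega) (fun _ _ h => h)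
  intro σ₁ hF₁ hB
  rw [hl] at hB
  have hS₁ : Search p nn lone ys zs M σ₁ := hS.frame hF₁ (by decide) (by decide)
  have hv₁ : σ₁.a .val = σ.a .val := hF₁.a .val rfl
  refine (WP.seq (wp_flatten (a := 0) (b := p) (T := M) (ys := zs) (by omega) le_rfl
    (by omega) (by omega) (fun s hF => ⟨by simp, by simp⟩)
    (fun s hF => ⟨by simp, by simp [hF.r .p rfl, hS₁.rp]⟩)
    (fun s hF => ⟨by simp, by simp [hF.r .m rfl, hS₁.rm]⟩) (fun z hz => ⟨(hzr z hz).1,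
      (hzr z hz).2.1⟩) hS.zroots.nodup hB (Nat.le_of_ble_eq_true rfl))
    (b' := 600 * p + 200) ?_).mono (by omega) (fun _ _ h => h)
  intro σ₂ hF₂ hH
  have hS₂ : Search p nn lone ys zs M σ₂ := hS₁.frame hF₂ (by decide) (by decide)
  have hv₂ : σ₂.a .val = σ₁.a .val := hF₂.a .val rfl
  rw [← hv₂] at hH
  have hfl : (flat (σ₂.a .val) zs M 0 p).length = zs.length :=
    flat_length_eq hS.zroots.nodup fun x hx => ⟨by rw [hv₂, hv₁]; exact (hzr x hx).2.2.1,
      by rw [hv₂, hv₁]; exact (hzr x hx).2.2.2, by exact_mod_cast hS₂.zcls x hx⟩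
  have hL := listing_of_flat (h := M) hS₂.zroots hH (by omega)
  have hmem : ∀ x ∈ lst (σ₂.a .x) (flat (σ₂.a .val) zs M 0 p).length, x ∈ zs := by
    rw [hH.2]; intro x hx; exact (mem_flat.1 hx).1
  have hxl := hH.1
  rw [hfl] at hL hmem hxl
  refine (WP.seq (wp_pair_listing (K := 64) (S := 64 * M) (h := M) (Dv := 4096 * M)
    (G := p) (N := zs.length) hL rfl (by omega) (by omega)
    (fun s hF => ⟨by simp, by simp [hF.r .xlen rfl, hxl]⟩)
    (fun s hF => ⟨by simp [hF.r .m rfl, hS₂.rm]; omega, by simp [hF.r .m rfl, hS₂.rm]⟩)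
    (fun s hF => ⟨by simp, by simp [hF.r .thr rfl, hS₂.thr]⟩)
    (by omega) (Nat.le_of_ble_eq_true rfl) hS₂.nodes hS₂.rp (by omega) hnn (by omega) (by omega)
    (by omega) hS₂.yhold (by omega) (fun x hx => ?_)) (b' := 200 * p + 100) ?_).mono
    (by omega) (fun _ _ h => h)
  · rw [hv₂, hv₁]; exact (hzr x (hmem x hx)).2.2.2.le
  rintro σ₃ hF₃ ⟨c, hc, hcount, hC⟩
  -- With `4 * zs.length ≥ p` this gives `64 * c ≥ 7 * p - 2048 * M`, and each of the `c` new values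
  -- is at least `64`.
  have hcp := count_bound (p := p) (q := 32) (by omega) hcount (by
    push_cast
    have : (0 : ℤ) ≤ M := by omega
    nlinarith) (by omega)
  have hrp₃ : σ₃.r .p = p := by rw [hF₃.r .p rfl]; exact hS₂.rp
  have hY := hC.list ys hS₂.yhold
  set ws := ys ++ newNodes nn c with hws
  have hylt : ∀ y ∈ ys, y < nn := fun y hy => (hS₂.yroots.root y hy).2.1
  have hyo := hC.old ys hS₂.yroots fun y hy hc => hS.disj y (hmem y hc) hy
  have hR : Roots p (nn + c) σ₃ ws := by
    refine ⟨?_, fun y hy => ?_, fun y hy => ?_⟩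
    · rw [hws, List.nodup_append]
      refine ⟨hS.yroots.nodup, newNodes_nodup, fun a ha b hb => ?_⟩
      have := (mem_newNodes.1 hb).1
      have := hylt a ha
      omega
    · exact (List.mem_append.1 hy).elim (hyo.root y) (hC.new.root y)
    · exact (List.mem_append.1 hy).elim (hyo.node y) (hC.new.node y)
  have hwv : ∀ y ∈ ws, σ₃.a .val y = 1 ∨ (64 ≤ σ₃.a .val y ∧ σ₃.a .val y ≤ 4096 * M) := by
    intro y hy
    rcases List.mem_append.1 hy with hy | hy
    · left; rw [hC.val y (hylt y hy), hv₂, hv₁]; exact hy1 y hy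
    · right; exact_mod_cast hC.bounds y hy
  have hwlen : ws.length = ys.length + c := by simp [hws]
  refine (wp_bucket (A := .y) (len := .ylen) (by decide) (by decide) hrp₃ hY.1 (by omega)
    (by omega) (fun x hx => ?_) (by rw [hY.2]; exact hR.nodup)).mono (by omega) ?_
  · rw [hY.2] at hx
    have h1 := hR.root x hx
    exact ⟨h1.1, by have := h1.2.1; push_cast at this; omega, hC.nodes.tree.val x h1.1 h1.2.1⟩
  · intro σ₄ hF₄ hB₄
    rw [hY.2] at hB₄
    have hv₄ : σ₄.a .val = σ₃.a .val := hF₄.a .val rfl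
    refine ⟨nn + c, ws, by omega, by omega, ⟨hC.nodes.frame hF₄ (by decide) (by decide),
      hR.frame hF₄ (by decide), hB₄.frame (.refl _ _) (by decide : ∀ b ∈ _, Cd.wa b .skip = false),
      by rw [hF₄.r .p rfl]; exact hrp₃, by rw [hF₄.r .m rfl, hF₃.r .m rfl]; exact hS₂.rm,
      by omega, ?_, ?_⟩, ?_⟩
    · intro y hy; rw [hv₄]
      have := hwv y hy
      omega
    · rw [hv₄]
      have hone : 4096 * M ≤ (cls (σ₃.a .val) ws (1 : ℕ)).length := by
        refine hyl.trans ((hS.yroots.nodup.subperm fun y hy => mem_cls.2 ⟨?_, ?_⟩).length_le)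
        · exact List.mem_append_left _ hy
        · rw [hC.val y (hylt y hy), hv₂, hv₁]; exact_mod_cast hy1 y hy
      refine reaches_low hp _ (4096 * M) (by omega) (by omega) hone (fun v hv => ?_)
        (fun v => lt_of_le_of_lt (cls_length_le _ _ _) (by omega)) ?_
      · obtain ⟨y, hy⟩ := List.exists_mem_of_length_pos hv
        obtain ⟨h1, h2⟩ := mem_cls.1 hy
        have := hwv y h1
        omega
      · zify
        have hs := sum_mul_cls_length (V := σ₃.a .val) (ys := ws) (p := p) fun x hx => by
          have h1 := hR.root x hx
          exact hC.nodes.tree.val x h1.1 h1.2.1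
        push_cast at hs
        rw [hs, hws, List.map_append, List.sum_append]
        have h1 : 0 ≤ (ys.map (σ₃.a .val)).sum := List.sum_nonneg fun v hv => by
          obtain ⟨y, hy, rfl⟩ := List.mem_map.1 hv
          have := hwv y (List.mem_append_left _ hy); omega
        have h2 : (c : ℤ) * 64 ≤ ((newNodes nn c).map (σ₃.a .val)).sum := by
          have := List.card_nsmul_le_sum ((newNodes nn c).map (σ₃.a .val)) 64 fun v hv => by
            obtain ⟨y, hy, rfl⟩ := List.mem_map.1 hv
            exact (hC.bounds y hy).1
          simpa using this
        omega
    · intro x hx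
      rw [hv₄, hC.val x hx, hv₂, hv₁]

/-- Replace the nodes listed in `x`, whose classes are small, by nodes that lead to all
residues. -/
def low : Cd :=
  splitHalf ;; pairFirst ;; .ite (.reg .g ≐ 0) pairSecond .skip ;; useClass ;; addSpread

theorem wp_low {σ : Store} {p nn N M : ℕ} {lone : ℤ} (hp : p.Prime)
    (hL : Listing p nn N (M - 1) σ) (hN : Nodes p nn lone σ) (hrp : σ.r .p = p)
    (hxl : σ.r .xlen = N) (hrm : σ.r .m = M) (hM : 2 ≤ M) (hMp : 2 ^ 57 * M ≤ p)
    (hM2 : M * M ≤ 8 * p) (hNp : N < p) (hpN : p ≤ 2 * N) (hnn : 3 * p - 2 ≤ nn)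
    (hnr : nn + 4 * p < C.rows) (hbig : 10 * ((p : ℤ) * p) ≤ C.big) :
    WP C low (fun σ' => ∃ (nn' : ℕ) (ys : List ℤ), nn ≤ nn' ∧ nn' ≤ nn + 3 * p ∧
      Ready p nn' lone ys M σ' ∧ ∃ h : ℤ, IsCoprime h p ∧ ∀ x : ℕ, x < nn → σ'.a .val x = σ.a .val x * h % p)
      (100 * nn + 4000 * p + 2000) σ := by
  refine (WP.seq (wp_splitHalf hL hN hrp hxl hrm (by omega) hMp (by omega) (by omega))
    (b' := 100 * nn + 3900 * p + 1900) ?_).mono (by omega) (fun _ _ h => h)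
  rintro σ₁ hF₁ ⟨zs, hS₁, hzl, hz₁, hL₁, hh₁⟩
  have hv₁ : σ₁.a .val = σ.a .val := hF₁.a .val rfl
  refine (WP.seq (wp_pairFirst hS₁ hL₁ hh₁ hz₁ hM hMp (by omega) (by omega) hnn (by omega))
    (b' := 100 * nn + 3400 * p + 1700) ?_).mono (by omega) (fun _ _ h => h)
  rintro σ₂ hF₂ ⟨c, G, hc, hpc, hS₂, hG₂, hb₂, hv₂⟩
  refine (WP.seq (R := fun σ₃ => ∃ (nn' G : ℕ) (ys : List ℤ), nn' ≤ nn + 2 * c ∧ nn ≤ nn' ∧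
      ys.length ≤ c ∧ Search p nn' lone ys zs M σ₃ ∧ Found p ys M G σ₃ ∧ G ≠ 0 ∧
      ∀ x : ℤ, x < nn → σ₃.a .val x = σ₂.a .val x) (b := 800 * p + 410)
    (b' := 100 * nn + 2600 * p + 1290) ?_ ?_).mono (by omega) (fun _ _ h => h)
  · refine (WP.ite (b := 800 * p + 400) (by simp) (fun hz => ?_) (fun hz => ?_)).mono
      (show 3 + 1 + _ ≤ _ by omega) (fun _ _ h => h)
    · have hg : G = 0 := by
        by_contra hne
        apply hz
        simp [hG₂.g, hne]
      subst hg
      refine (wp_pairSecond hS₂ hG₂ hM hMp hM2 (by simp; omega) (by simpa using hpc) hb₂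
        (by omega) (by omega)).mono le_rfl ?_
      rintro σ₃ - ⟨c', G, hc', hS₃, hG₃, hne, hv₃⟩
      rw [newNodes_length] at hc'
      exact ⟨nn + c + c', G, _, by omega, by omega, by simpa using hc', hS₃, hG₃, hne,
        fun x hx => hv₃ x (by push_cast; omega)⟩
    · have hg : G ≠ 0 := by
        rintro rfl
        rw [Ex.den_eq_eq_zero] at hz
        simp [hG₂.g] at hz
      exact WP.straight (by simp) ⟨nn + c, G, _, by omega, by omega, by simp, hS₂, hG₂, hg,
        fun _ _ => rfl⟩ (by simp [Cd.bound])
  rintro σ₃ hF₃ ⟨nn', G', ys, hn', hn'', hyl, hS₃, hG₃, hne, hv₃⟩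
  refine (WP.seq (wp_useClass hp hS₃ hG₃ hne (by omega) (by omega) (by omega) hbig)
    (b' := 1000 * p + 400) ?_).mono (by omega) (fun _ _ h => h)
  rintro σ₄ hF₄ ⟨ys', hS₄, hone, hyl', hyl'', h, hco, hv₄⟩
  refine (wp_addSpread hp hS₄ hone hyl' (by omega) (by omega) hM hMp (by omega)
    (by omega)).mono le_rfl ?_
  rintro σ₅ hF₅ ⟨nn'', ws, hnn₁, hnn₂, hR, hv₅⟩
  refine ⟨nn'', ws, by omega, by omega, hR, h, hco, fun x hx => ?_⟩
  rw [hv₅ x (by omega), hv₄ x (by omega), hv₃ x (by omega), hv₂ x (by omega), hv₁]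

/-- The second bound follows by squaring: `2 ^ 114 * (M * M) ≤ 2 ^ 117 * p ≤ p * p`. It holds only
for large `p`, which is why small primes are treated separately. -/
theorem sqrt_bounds {p M : ℕ} (hp : 2 ^ 120 ≤ p) (h : (M - 1) * (M - 1) ≤ 2 * p) (hM : 2 ≤ M) :
    M * M ≤ 8 * p ∧ 2 ^ 57 * M ≤ p := by
  obtain ⟨k, rfl⟩ : ∃ k, M = k + 1 := ⟨M - 1, by omega⟩
  simp only [Nat.add_sub_cancel] at h
  have h1 : (k + 1) * (k + 1) ≤ 8 * p := by nlinarith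
  refine ⟨h1, ?_⟩
  by_contra hlt
  push Not at hlt
  have h2 : p * p < (2 ^ 57 * (k + 1)) * (2 ^ 57 * (k + 1)) := by
    apply Nat.mul_lt_mul'' hlt hlt
  have h3 : (2 ^ 57 * (k + 1)) * (2 ^ 57 * (k + 1)) = 2 ^ 114 * ((k + 1) * (k + 1)) := by ring
  have h4 : 2 ^ 120 * p ≤ p * p := Nat.mul_le_mul_right _ hp
  have h5 : 2 ^ 114 * ((k + 1) * (k + 1)) ≤ 2 ^ 114 * (8 * p) := Nat.mul_le_mul_left _ h1
  omega

/-! ### Small primes: a table of subset sums. -/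

/-- Look for a residue `di` that has been reached while `di + val x` has not, and record that
`di + val x` is reached by the node `x` at position `ri` of the list `y`. -/
def reachStep : Cd :=
  .dv ::= .arr .val (.arr .y (.reg .ri)) ;;
  .di ::= .lit (-1) ;;
  .for .dx 0 (.reg .p) (
    .ite (.arr .fst (.reg .dx) ≐ 0) .skip
      (.ite (.arr .fst ((.reg .dx + .reg .dv) % .reg .p) ≐ 0) (.di ::= .reg .dx) .skip)) ;;
  .ite (0 ≼ .reg .di)
    (.put .fst ((.reg .di + .reg .dv) % .reg .p) (.reg .ri + 2)) .skip

/-- Compute for every residue the last node of a set of nodes with this sum of values. -/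
def reachAll : Cd :=
  .for .ri 0 (.reg .p) (.put .fst (.reg .ri) 0) ;;
  .put .fst 0 1 ;;
  .for .ri 0 (.reg .ylen) reachStep

/-- Switch on nodes with the sum `- base`. -/
def reachRecon : Cd :=
  .rx ::= (.reg .p - .reg .base) % .reg .p ;;
  .loop (1 ≺ .arr .fst (.reg .rx)) (
    .rz ::= .arr .y (.arr .fst (.reg .rx) - 2) ;;
    .put .st (.reg .rz) 1 ;;
    .rx ::= (.reg .rx - .arr .val (.reg .rz)) % .reg .p)

/-- The residues `r` with `f r ≠ 0` are sums of the first `i` values; for `r ≠ 0` the last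
summand is at position `f r - 2`. -/
structure Sums (p i : ℕ) (f Y V : ℤ → ℤ) : Prop where
  zero : f 0 = 1
  -- The entry `0` means that the residue is not reached, and `1` is reserved for the empty sum.
  -- Entries decrease when the last summand is removed, so the summands have different positions.
  step : ∀ r : ℤ, 0 ≤ r → r < p → f r = 0 ∨ r = 0 ∨ ∃ j : ℕ, j < i ∧ f r = j + 2 ∧
    1 ≤ f ((r - V (Y j)) % p) ∧ f ((r - V (Y j)) % p) < j + 2
  -- Cauchy-Davenport in its simplest form: each nonzero value adds at least one residue, until all
  -- are reached.
  card : min p (i + 1) ≤ ((Finset.range p).filter fun r : ℕ => f r ≠ 0).card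

theorem Sums.bounds {p i : ℕ} {f Y V : ℤ → ℤ} (h : Sums p i f Y V) {r : ℤ} (h0 : 0 ≤ r)
    (h1 : r < p) : 0 ≤ f r ∧ f r < i + 2 := by
  rcases h.step r h0 h1 with h | rfl | ⟨j, hj, h, -⟩
  · omega
  · have := h.zero; omega
  · omega

/-- Recording a single new residue for each element is enough. The residue `d` was reached with
earlier elements only, so its entry is less than `i + 2`. -/
theorem Sums.add {p i : ℕ} {f Y V : ℤ → ℤ} (h : Sums p i f Y V) {d : ℤ} (h0 : 0 ≤ d)
    (h1 : d < p) (hd : f d ≠ 0) (hn : f ((d + V (Y i)) % p) = 0) :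
    Sums p (i + 1) (Function.update f ((d + V (Y i)) % p) (i + 2)) Y V := by
  set e := (d + V (Y i)) % p with he
  have he0 : 0 ≤ e := Int.emod_nonneg _ (by omega)
  have he1 : e < p := Int.emod_lt_of_pos _ (by omega)
  have hne : ∀ r, f r ≠ 0 → r ≠ e := fun r hr hc => hr (hc ▸ hn)
  constructor
  · rw [Function.update_of_ne (hne 0 (by rw [h.zero]; decide)), h.zero]
  · intro r hr0 hr1
    by_cases hr : r = e
    · rw [hr]
      right; right
      have hback : (e - V (Y i)) % p = d := by
        rw [he, Int.emod_sub_emod, add_sub_cancel_right, Int.emod_eq_of_lt h0 h1]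
      refine ⟨i, by omega, by simp, ?_⟩
      rw [hback, Function.update_of_ne (hne d hd)]
      have := h.bounds h0 h1
      omega
    · rw [Function.update_of_ne hr]
      rcases h.step r hr0 hr1 with h2 | h2 | ⟨j, hj, h2, h3, h4⟩
      · exact Or.inl h2
      · exact Or.inr (Or.inl h2)
      · refine Or.inr (Or.inr ⟨j, by omega, h2, ?_⟩)
        rw [Function.update_of_ne (hne _ (by omega))]
        exact ⟨h3, h4⟩
  · obtain ⟨k, hk⟩ := Int.eq_ofNat_of_zero_le he0
    have hsub : insert k ((Finset.range p).filter fun r : ℕ => f r ≠ 0) ⊆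
        (Finset.range p).filter fun r : ℕ => Function.update f e (i + 2) r ≠ 0 := by
      intro r hr
      rw [Finset.mem_insert, Finset.mem_filter, Finset.mem_range] at hr
      rw [Finset.mem_filter, Finset.mem_range]
      rcases hr with rfl | ⟨hr, hr'⟩
      · refine ⟨by omega, ?_⟩
        rw [hk, Function.update_self]; omega
      · exact ⟨hr, by rwa [Function.update_of_ne (hne _ hr')]⟩
    have hcard := Finset.card_le_card hsub
    rw [Finset.card_insert_of_notMem (by simp [← hk, hn])] at hcard
    have := h.card
    omega

/-- A set of residues that contains `0` and is closed under adding a nonzero value contains all its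
multiples, hence all residues modulo the prime `p`. -/
theorem Sums.full {p i : ℕ} {f Y V : ℤ → ℤ} (h : Sums p i f Y V) (hp : p.Prime)
    (hv0 : 0 < V (Y i)) (hv1 : V (Y i) < p)
    (hc : ∀ r : ℤ, 0 ≤ r → r < p → f r ≠ 0 → f ((r + V (Y i)) % p) ≠ 0) :
    Sums p (i + 1) f Y V := by
  have hp2 := hp.two_le
  refine ⟨h.zero, fun r h0 h1 => ?_, ?_⟩
  · rcases h.step r h0 h1 with h | h | ⟨j, hj, h⟩
    · exact Or.inl h
    · exact Or.inr (Or.inl h)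
    · exact Or.inr (Or.inr ⟨j, by omega, h⟩)
  · have hk : ∀ k : ℕ, f (k * V (Y i) % p) ≠ 0 := by
      intro k
      induction k with
      | zero => simp [h.zero]
      | succ k ih =>
        have := hc _ (Int.emod_nonneg _ (by omega)) (Int.emod_lt_of_pos _ (by omega)) ih
        rw [Int.emod_add_emod] at this
        push_cast
        rwa [add_mul, one_mul]
    have hall : (Finset.range p).filter (fun r : ℕ => f r ≠ 0) = Finset.range p := by
      refine Finset.filter_true_of_mem fun r hr => ?_
      rw [Finset.mem_range] at hr
      obtain ⟨_, -, -, hg⟩ := gcdA_spec hp hv0 hv1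
      set w := (r * (Int.gcdA (V (Y i)) p % p)) % p with hw
      have hw0 : 0 ≤ w := Int.emod_nonneg _ (by omega)
      have := hk w.toNat
      have he : (w.toNat : ℤ) * V (Y i) % p = r := by
        rw [Int.toNat_of_nonneg hw0]
        have h2 : w * V (Y i) ≡ r [ZMOD p] := by
          refine ((Int.mod_modEq _ _).mul_right _).trans ?_
          have h5 := hg.mul_left (r : ℤ)
          rwa [mul_one, mul_comm (V (Y i)), ← mul_assoc] at h5
        rw [h2, Int.emod_eq_of_lt (by omega) (by omega)]
      rwa [he] at this
    rw [hall, Finset.card_range]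
    exact min_le_left _ _

theorem Sums.ne_zero {p i : ℕ} {f Y V : ℤ → ℤ} (h : Sums p i f Y V) (hi : p ≤ i + 1) {r : ℤ}
    (h0 : 0 ≤ r) (h1 : r < p) : f r ≠ 0 := by
  obtain ⟨k, rfl⟩ := Int.eq_ofNat_of_zero_le h0
  have hc := h.card
  rw [min_eq_left hi] at hc
  have he := Finset.eq_of_subset_of_card_le (Finset.filter_subset _ (Finset.range p))
    (by rwa [Finset.card_range])
  have : k ∈ Finset.range p := Finset.mem_range.2 (by omega)
  rw [← he, Finset.mem_filter] at this
  exact this.2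

theorem wp_reachStep {σ : Store} {p i : ℕ} (hp : p.Prime) (hrp : σ.r .p = p) (hri : σ.r .ri = i)
    (h : Sums p i (σ.a .fst) (σ.a .y) (σ.a .val)) (hir : i + 2 ≤ C.rows) (hpr : 2 * p ≤ C.rows)
    (hy0 : 0 ≤ σ.a .y i) (hy1 : σ.a .y i < C.rows) (hv0 : 0 < σ.a .val (σ.a .y i))
    (hv1 : σ.a .val (σ.a .y i) < p) :
    WP C reachStep (fun σ' => Sums p (i + 1) (σ'.a .fst) (σ.a .y) (σ.a .val))
      (100 * p + 100) σ := by
  have hb1 := C.rows_le_big; have hb2 := C.hstride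
  simp only [stride, Nat.cast_ofNat] at hb2
  have hp2 := hp.two_le
  set v := σ.a .val (σ.a .y i) with hv
  refine (WP.seq (b := 12) (R := fun s => s = σ.set .dv v)
    (WP.straight (by simp [hri]; omega) (by simp [hri, hv]) (Nat.le_of_ble_eq_true rfl)) ?_
    (b' := 100 * p + 80)).mono (by omega) (fun _ _ h => h)
  rintro _ - rfl
  refine (WP.seq (b := 2) (R := fun s => s = (σ.set .dv v).set .di (-1))
    (WP.straight (by simp; omega) (by simp) (Nat.le_of_ble_eq_true rfl)) ?_
    (b' := 100 * p + 70)).mono (by omega) (fun _ _ h => h)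
  rintro _ - rfl
  set σ₀ := (σ.set .dv v).set .di (-1) with hσ₀
  have hmod : ∀ z : ℤ, 0 ≤ z % p ∧ z % p < p := fun z =>
    ⟨Int.emod_nonneg _ (by omega), Int.emod_lt_of_pos _ (by omega)⟩
  refine (WP.seq (R := fun s => (s.r .di = -1 ∧ ∀ r : ℤ, 0 ≤ r → r < p → σ.a .fst r ≠ 0 →
      σ.a .fst ((r + v) % p) ≠ 0) ∨ (0 ≤ s.r .di ∧ s.r .di < p ∧ σ.a .fst (s.r .di) ≠ 0 ∧
      σ.a .fst ((s.r .di + v) % p) = 0)) (b := 60 * p + 10) (b' := 30) ?_ ?_).mono (by omega)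
      (fun _ _ h => h)
  · refine WP.forC (a := 0) (b := p) (K := 35)
      (fun k s => (s.r .di = -1 ∧ ∀ r : ℤ, 0 ≤ r → r < k → σ.a .fst r ≠ 0 →
        σ.a .fst ((r + v) % p) ≠ 0) ∨ (0 ≤ s.r .di ∧ s.r .di < p ∧ σ.a .fst (s.r .di) ≠ 0 ∧
        σ.a .fst ((s.r .di + v) % p) = 0)) (by omega) (by simp) (by simp) rfl ?_ (by omega)
      (Or.inl ⟨by simp [hσ₀], fun r h0 h1 => by omega⟩) ?_ ?_ (fun _ _ h _ => h)
    · intro s hF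
      have : s.r .p = p := by rw [hF.r .p rfl]; simp [hσ₀, hrp]
      simp [this]
    · intro k s _ hk hF hr hI
      have r1 : s.r .p = p := by rw [hF.r .p rfl]; simp [hσ₀, hrp]
      have r2 : s.r .dv = v := by rw [hF.r .dv rfl]; simp [hσ₀]
      have a1 : s.a .fst = σ.a .fst := by rw [hF.a .fst rfl]; simp [hσ₀]
      have hm := hmod (k + v)
      refine WP.straight ?_ ?_ (Nat.le_of_ble_eq_true rfl)
      · simp [hr, r1, r2, a1]
        refine ⟨by omega, fun _ => by omega⟩
      · simp only [Cd.fin, Ex.den_eq, Ex.den_arr, Ex.den_reg, Ex.den_mod, Ex.den_add, Ex.den_zero,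
          hr, r1, r2, a1]
        by_cases hf : σ.a .fst k = 0
        · simp only [hf, if_true, ne_eq, one_ne_zero, not_false_eq_true, Store.set_r,
            reduceCtorEq, if_false]
          rcases hI with ⟨h1, h2⟩ | hI
          · refine Or.inl ⟨h1, fun r h0 h3 h4 => ?_⟩
            by_cases hrk : r = k
            · subst hrk; exact absurd hf h4
            · exact h2 r h0 (by push_cast at h3; omega) h4
          · exact Or.inr hI
        · by_cases hf' : σ.a .fst ((k + v) % p) = 0
          · simp only [hf, hf', if_true, if_false, ne_eq, one_ne_zero, not_false_eq_true,
              not_true_eq_false, Store.set_r, reduceCtorEq]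
            exact Or.inr ⟨by omega, by omega, by simp, by simp⟩
          · simp only [hf, hf', if_false, ne_eq, not_true_eq_false, Store.set_r, reduceCtorEq]
            rcases hI with ⟨h1, h2⟩ | hI
            · refine Or.inl ⟨h1, fun r h0 h3 h4 => ?_⟩
              by_cases hrk : r = k
              · subst hrk; exact hf'
              · exact h2 r h0 (by push_cast at h3; omega) h4
            · exact Or.inr hI
    · show (p - 0) * (35 + 1 + 10) + 1 + 1 + 5 ≤ _; omega
  · intro s hF hI
    have r1 : s.r .p = p := by rw [hF.r .p rfl]; simp [hσ₀, hrp]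
    have r2 : s.r .dv = v := by rw [hF.r .dv rfl]; simp [hσ₀]
    have r3 : s.r .ri = i := by rw [hF.r .ri rfl]; simp [hσ₀, hri]
    have a1 : s.a .fst = σ.a .fst := by rw [hF.a .fst rfl]; simp [hσ₀]
    have hm := hmod (s.r .di + v)
    refine WP.straight ?_ ?_ (Nat.le_of_ble_eq_true rfl)
    · simp [r1, r2, r3]
      omega
    · rcases hI with ⟨h1, h2⟩ | ⟨h1, h2, h3, h4⟩
      · simp only [Cd.fin, Ex.den_le, Ex.den_zero, Ex.den_reg, h1]
        norm_num
        rw [a1]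
        exact h.full hp hv0 hv1 h2
      · simp only [Cd.fin, Ex.den_le, Ex.den_zero, Ex.den_reg, h1, if_true, ne_eq, one_ne_zero,
          not_false_eq_true, Ex.den_mod, Ex.den_add, r1, r2, r3, Store.put_a, a1, Ex.den_two]
        exact h.add h1 h2 h3 h4

theorem wp_reachAll {σ : Store} {p : ℕ} {ys : List ℤ} (hp : p.Prime) (hrp : σ.r .p = p)
    (hy : Holds σ .y .ylen ys) (hys : ∀ y ∈ ys, 0 ≤ y ∧ y < C.rows ∧ 0 < σ.a .val y ∧ σ.a .val y < p)
    (hlen : ys.length < p) (hpr : 2 * p ≤ C.rows) :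
    WP C reachAll (fun σ' => Sums p ys.length (σ'.a .fst) (σ.a .y) (σ.a .val))
      (200 * (p * p) + 200 * p + 100) σ := by
  have hb1 := C.rows_le_big; have hb2 := C.hstride
  simp only [stride, Nat.cast_ofNat] at hb2
  have hp2 := hp.two_le
  refine (WP.seq (R := fun s => ∀ r : ℤ, 0 ≤ r → r < p → s.a .fst r = 0) (b := 50 * p + 10)
    (b' := 200 * (p * p) + 100 * p + 50) ?_ ?_).mono (by omega) (fun _ _ h => h)
  · refine WP.forC (a := 0) (b := p) (K := 20)
      (fun k s => ∀ r : ℤ, 0 ≤ r → r < k → s.a .fst r = 0)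
      (by omega) (by simp) (by simp) rfl ?_ (by omega) (fun r h0 h1 => by omega) ?_ ?_
      (fun _ _ h _ => h)
    · intro s hF
      simp [hF.r .p rfl, hrp]
    · intro k s _ hk hF hr hI
      refine WP.straight ?_ ?_ (Nat.le_of_ble_eq_true rfl)
      · simp [hr]; omega
      · intro v h0 h1
        by_cases hv : v = k
        · simp [hr, hv]
        · simpa [hr, hv] using hI v h0 (by push_cast at h1; omega)
    · show (p - 0) * (20 + 1 + 10) + 1 + 1 + 5 ≤ _; omega
  intro σ₁ hF₁ h₁
  refine (WP.seq (b := 7) (R := fun s => s = σ₁.put .fst 0 1)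
    (WP.straight (by simp; omega) (by simp) (Nat.le_of_ble_eq_true rfl)) ?_
    (b' := 200 * (p * p) + 100 * p + 40)).mono (by omega) (fun _ _ h => h)
  rintro _ - rfl
  set σ₂ := σ₁.put .fst 0 1 with hσ₂
  have hyl : σ₂.r .ylen = ys.length := by simp [hσ₂, hF₁.r .ylen rfl, hy.1]
  refine WP.forC (a := 0) (b := ys.length) (K := 100 * p + 100)
    (fun k s => Sums p k (s.a .fst) (σ.a .y) (σ.a .val))
    (by omega) (by simp) (by simp) rfl ?_ (by omega) ?_ ?_ ?_ (fun _ _ h _ => h)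
  · intro s hF
    simp [hF.r .ylen rfl, hyl]
  · refine ⟨by simp [hσ₂], fun r h0 h1 => ?_, ?_⟩
    · by_cases hr : r = 0
      · exact Or.inr (Or.inl hr)
      · left; simpa [hσ₂, hr] using h₁ r h0 h1
    · refine (min_le_right _ _).trans (Finset.card_pos.2 ⟨0, ?_⟩)
      simp [hσ₂]; omega
  · intro k s _ hk hF hr hI
    have a1 : s.a .y = σ.a .y := by rw [hF.a .y rfl]; simp [hσ₂, hF₁.a .y rfl]
    have a2 : s.a .val = σ.a .val := by rw [hF.a .val rfl]; simp [hσ₂, hF₁.a .val rfl]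
    have hk' : σ.a .y k ∈ ys := by rw [← hy.2]; exact mem_lst_of_lt hk
    have := hys _ hk'
    refine (wp_reachStep hp (by rw [hF.r .p rfl]; simp [hσ₂, hF₁.r .p rfl, hrp]) hr
      (by rw [a1, a2]; exact hI) (by omega) hpr ?_ ?_ ?_ ?_).mono le_rfl ?_
    · rw [a1]; exact this.1
    · rw [a1]; exact this.2.1
    · rw [a1, a2]; exact this.2.2.1
    · rw [a1, a2]; exact this.2.2.2
    · intro s' _ h; simpa [a1, a2] using h
  · show (ys.length - 0) * (100 * p + 100 + 1 + 10) + 1 + 1 + 5 ≤ _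
    have : (ys.length - 0) * (100 * p + 100 + 1 + 10) ≤ p * (100 * p + 111) :=
      Nat.mul_le_mul (by omega) (by omega)
    nlinarith

theorem wp_reachRecon {σ : Store} {p nn : ℕ} {lone : ℤ} {ys : List ℤ}
    (hrp : σ.r .p = p) (hN : Nodes p nn lone σ) (hy : Holds σ .y .ylen ys)
    (hS : Sums p ys.length (σ.a .fst) (σ.a .y) (σ.a .val)) (hlen : p ≤ ys.length + 1)
    (hys : ∀ y ∈ ys, 0 ≤ y ∧ y < nn) (hnd : ys.Nodup) (hnr : nn ≤ C.rows) (hpr : 2 * p ≤ C.rows)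
    (hlr : ys.length ≤ C.rows) :
    WP C reachRecon (fun σ' => ∃ W : List ℤ, W.Nodup ∧ (∀ z ∈ W, z ∈ ys) ∧
      (∀ x : ℤ, 0 ≤ x → x < nn → σ'.a .st x = if x = lone ∨ x ∈ W then 1 else 0) ∧
      σ.r .base + (W.map (σ.a .val)).sum ≡ 0 [ZMOD p]) (100 * ys.length + 300) σ := by
  have hb1 := C.rows_le_big; have hb2 := C.hstride
  simp only [stride, Nat.cast_ofNat] at hb2
  have hbase := hN.base_lt
  have hmod : ∀ z : ℤ, 0 ≤ z % p ∧ z % p < p := fun z =>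
    ⟨Int.emod_nonneg _ (by omega), Int.emod_lt_of_pos _ (by omega)⟩
  set x₀ := (p - σ.r .base) % p with hx₀
  refine (WP.seq (b := 6) (R := fun s => s = σ.set .rx x₀)
    (WP.straight (by simp [hrp]; omega) (by simp [hrp, hx₀]) (Nat.le_of_ble_eq_true rfl)) ?_
    (b' := 100 * ys.length + 290)).mono (by omega) (fun _ _ h => h)
  rintro _ - rfl
  have hc1 : (1 ≺ .arr .fst (.reg .rx) : Ex).cost = 8 := rfl
  refine (WP.loop (fun s => ∃ W : List ℤ,
      Marked nn p lone (-σ.r .base) (s.r .rx) W.length (σ.a .val) (s.a .st) ys W ∧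
      ∀ z ∈ W, ∃ j : ℕ, j < ys.length ∧ z = σ.a .y j ∧ σ.a .fst (s.r .rx) < j + 2)
    (fun s => 100 * (σ.a .fst (s.r .rx)).toNat) ?_ ?_ ?_).mono ?_ ?_
  · refine ⟨[], ⟨List.nodup_nil, by simp, ?_, ?_, ?_, by simp⟩, by simp⟩
    · intro z h0 h1; simpa using hN.st z h0 h1
    · simp only [Store.set_r, if_true, List.map_nil, List.sum_nil, add_zero, hx₀]
      refine (Int.mod_modEq _ _).trans ?_
      rw [Int.modEq_iff_dvd]; exact ⟨-1, by ring⟩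
    · simpa using hmod _
  · rintro s hF ⟨W, hW, -⟩
    have := hW.pos
    simp; omega
  · rintro s hF ⟨W, hW, hWv⟩ hz
    have a1 : s.a .fst = σ.a .fst := hF.a .fst rfl
    have a2 : s.a .y = σ.a .y := hF.a .y rfl
    have a3 : s.a .val = σ.a .val := hF.a .val rfl
    have r1 : s.r .p = p := by rw [hF.r .p rfl]; simp [hrp]
    rw [Ne, Ex.den_lt_eq_zero] at hz
    simp only [Ex.den_arr, Ex.den_reg, Ex.den_one, a1, not_le] at hz
    have hx := hW.pos
    rcases hS.step _ hx.1 hx.2 with h | h | ⟨j, hj, hf, h3, h4⟩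
    · omega
    · rw [h, hS.zero] at hz; omega
    · have hmem : σ.a .y j ∈ ys := by
        have : σ.a .y j ∈ lst (σ.a .y) ys.length := mem_lst_of_lt hj
        rwa [hy.2] at this
      have hyj := hys _ hmem
      have hnd' : (lst (σ.a .y) ys.length).Nodup := by rw [hy.2]; exact hnd
      have hstep := hW.step (z := σ.a .y j) (by omega) hmem fun hc => by
        obtain ⟨i, hi, he, hlt⟩ := hWv _ hc
        exact lst_ne_of_nodup hnd' hj hi (by omega) he
      have hv := hN.tree.val _ hyj.1 hyj.2
      have e1 : (j : ℤ) + 2 - 2 = j := by ring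
      refine ⟨40, WP.straight ?_ ⟨⟨W ++ [σ.a .y j], ?_, ?_⟩, ?_⟩ (Nat.le_of_ble_eq_true rfl)⟩
      · simp [a1, a2, a3, r1, hf, e1]; omega
      · simpa [a1, a2, a3, r1, hf, e1] using hstep
      · simp only [Cd.fin_seq, Cd.fin_set, Cd.fin_put, Ex.den_mod, Ex.den_sub, Ex.den_reg,
          Ex.den_arr, Store.set_r, Store.put_r, reduceCtorEq, if_true, if_false, r1, a1, a2, a3,
          hf, Ex.den_two, e1, Store.set_a, Store.put_a]
        intro z hz
        rcases List.mem_append.1 hz with hz | hz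
        · obtain ⟨i, hi, he, hlt⟩ := hWv _ hz
          exact ⟨i, hi, he, by omega⟩
        · exact ⟨j, hj, List.mem_singleton.1 hz, h4⟩
      · simp only [Cd.fin_seq, Cd.fin_set, Cd.fin_put, Ex.den_mod, Ex.den_sub, Ex.den_reg,
          Ex.den_arr, Store.set_r, Store.put_r, reduceCtorEq, if_true, if_false, r1, a1, a2, a3,
          hf, Ex.den_two, e1, Store.set_a, Store.put_a, hc1]
        omega
  · have := hS.bounds (hmod (p - σ.r .base)).1 (hmod (p - σ.r .base)).2
    simp only [Store.set_r, if_true, hc1, hx₀]; omega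
  · rintro s hF ⟨⟨W, hW, hWv⟩, hz⟩
    have a1 : s.a .fst = σ.a .fst := hF.a .fst rfl
    rw [Ex.den_lt_eq_zero] at hz
    simp only [Ex.den_arr, Ex.den_reg, Ex.den_one, a1] at hz
    have hx := hW.pos
    have hne := hS.ne_zero hlen hx.1 hx.2
    refine ⟨W, hW.nodup, hW.sub, hW.st, ?_⟩
    rcases hS.step _ hx.1 hx.2 with h | h | ⟨j, hj, hf, h3, h4⟩
    · exact absurd h hne
    · have h7 := hW.sum
      rw [h, zero_add] at h7
      have := h7.add_left (σ.r .base)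
      rwa [add_neg_cancel] at this
    · omega

/-! ### From `2 * p - 1` leaves to `p - 1` nonzero differences. -/

/-- List the leaves in `x`, sorted by their values, and switch them off. -/
def sortLeaves : Cd :=
  .for .si 0 (.reg .p + .reg .p - 1) (
    .put .st (.reg .si) 0 ;; .put .y (.reg .si) (.reg .si)) ;;
  .ylen ::= .reg .p + .reg .p - 1 ;;
  bucket .y .ylen ;;
  flatten 0 (.reg .p) (.reg .p + .reg .p)

/-- The array `x` lists the leaves, sorted by their values; all leaves are switched off. -/
structure Sorted (p : ℕ) (σ : Store) : Prop where
  st : ∀ z : ℤ, 0 ≤ z → z < 2 * (p : ℤ) - 1 → σ.a .st z = 0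
  nodup : (lst (σ.a .x) (2 * p - 1)).Nodup
  leaf : ∀ i : ℕ, i < 2 * p - 1 → 0 ≤ σ.a .x i ∧ σ.a .x i < 2 * (p : ℤ) - 1
  mono : ∀ i j : ℕ, i ≤ j → j < 2 * p - 1 → σ.a .val (σ.a .x i) ≤ σ.a .val (σ.a .x j)

theorem wp_sortLeaves {σ : Store} {p : ℕ} (hp : 1 ≤ p) (hrp : σ.r .p = p)
    (hval : ∀ x : ℤ, 0 ≤ x → x < 2 * (p : ℤ) - 1 → 0 ≤ σ.a .val x ∧ σ.a .val x < p)
    (hpr : 2 * p ≤ C.rows) : WP C sortLeaves (Sorted p) (1000 * p + 300) σ := by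
  have hb1 := C.rows_le_big; have hb2 := C.hstride
  simp only [stride, Nat.cast_ofNat] at hb2
  refine (WP.seq (R := fun s => ∀ z : ℕ, z < 2 * p - 1 → s.a .st z = 0 ∧ s.a .y z = z)
    (b := 100 * p + 20) (b' := 900 * p + 250) ?_ ?_).mono (by omega) (fun _ _ h => h)
  · refine WP.forC (a := 0) (b := 2 * p - 1) (K := 20)
      (fun k s => ∀ z : ℕ, z < k → s.a .st z = 0 ∧ s.a .y z = z)
      (by omega) (by simp) (by simp) rfl ?_ (by omega) (fun r h0 => by omega) ?_ ?_
      (fun _ _ h _ => h)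
    · intro s hF
      have : s.r .p = p := by rw [hF.r .p rfl, hrp]
      simp [this]; omega
    · intro k s _ hk hF hr hI
      refine WP.straight ?_ ?_ (Nat.le_of_ble_eq_true rfl)
      · simp [hr]; omega
      · intro z hz
        by_cases hzk : z = k
        · subst hzk; simp [hr]
        · have : (z : ℤ) ≠ k := by omega
          simpa [hr, this] using hI z (by omega)
    · show (2 * p - 1 - 0) * (20 + 5 + 10) + 1 + 5 + 5 ≤ _; omega
  intro σ₁ hF₁ h₁
  have hrp₁ : σ₁.r .p = p := by rw [hF₁.r .p rfl, hrp]
  have hv₁ : σ₁.a .val = σ.a .val := hF₁.a .val rfl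
  refine (WP.seq (b := 6) (R := fun s => s = σ₁.set .ylen (2 * p - 1 : ℕ))
    (WP.straight (by simp [hrp₁]; omega) ?_ (Nat.le_of_ble_eq_true rfl)) ?_
    (b' := 900 * p + 240)).mono (by omega) (fun _ _ h => h)
  · simp only [Cd.fin_set, Ex.den_sub, Ex.den_add, Ex.den_reg, Ex.den_one, hrp₁]
    congr 1; omega
  rintro _ - rfl
  set σ₂ := σ₁.set .ylen (2 * p - 1 : ℕ) with hσ₂
  have hy₂ : lst (σ₂.a .y) (2 * p - 1) = lst (fun z => z) (2 * p - 1) :=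
    lst_congr fun i hi => (h₁ i hi).2
  have hmem : ∀ z, z ∈ lst (fun z => z) (2 * p - 1) ↔ 0 ≤ z ∧ z < 2 * (p : ℤ) - 1 := by
    intro z
    rw [mem_lst]
    constructor
    · rintro ⟨i, hi, rfl⟩; omega
    · rintro ⟨h1, h2⟩; exact ⟨z.toNat, by omega, by omega⟩
  have hnd : (lst (fun z => z) (2 * p - 1)).Nodup :=
    List.Nodup.map (fun i j h => by simpa using h) List.nodup_range
  set ys := lst (fun z => z) (2 * p - 1) with hys
  have hyl : ys.length = 2 * p - 1 := lst_length _ _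
  refine (WP.seq (wp_bucket (A := .y) (len := .ylen) (L := 2 * p - 1) (by decide) (by decide)
    (p := p) (by simp [hσ₂, hrp₁]) (by simp [hσ₂]) (by omega) (by omega) (fun x hx => ?_)
    (by rwa [hy₂])) (b' := 400 * p + 120) ?_).mono (by omega) (fun _ _ h => h)
  · rw [hy₂, hmem] at hx
    have := hval x hx.1 hx.2
    simp only [hσ₂, Store.set_a, hv₁]
    omega
  intro σ₃ hF₃ hB
  rw [hy₂] at hB
  have hrp₃ : σ₃.r .p = p := by rw [hF₃.r .p rfl]; simp [hσ₂, hrp₁]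
  have hv₃ : σ₃.a .val = σ.a .val := by rw [hF₃.a .val rfl]; simp [hσ₂, hv₁]
  refine (wp_flatten (a := 0) (b := p) (T := 2 * p) (ys := ys) (p := p) (by omega) le_rfl
    (by omega) (by omega) (fun s hF => ⟨by simp, by simp⟩)
    (fun s hF => ⟨by simp, by simp [hF.r .p rfl, hrp₃]⟩)
    (fun s hF => ⟨by simp [hF.r .p rfl, hrp₃]; omega, by simp [hF.r .p rfl, hrp₃]; ring⟩)
    (fun z hz => by rw [hmem] at hz; omega) hnd hB
    (Nat.le_of_ble_eq_true rfl)).mono (by omega) ?_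
  intro σ₄ hF₄ hH
  have hv₄ : σ₄.a .val = σ₃.a .val := hF₄.a .val rfl
  rw [← hv₄] at hH
  have hfl : (flat (σ₄.a .val) ys (2 * p) 0 p).length = 2 * p - 1 := by
    rw [flat_length_eq hnd, hyl]
    intro x hx
    have h1 := cls_length_le (σ₄.a .val) ys (σ₄.a .val x)
    rw [hmem] at hx
    have := hval x hx.1 hx.2
    rw [hv₄, hv₃] at h1 ⊢
    omega
  have hm := mono_of_holds_flat hH
  have hl := hH.2
  rw [hfl] at hm hl
  refine ⟨fun z h0 h1 => ?_, by rw [hl]; exact flat_nodup hnd, fun i hi => ?_, hm⟩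
  · obtain ⟨k, rfl⟩ := Int.eq_ofNat_of_zero_le h0
    rw [hF₄.a .st rfl, hF₃.a .st rfl]
    exact (h₁ k (by omega)).1
  · have : σ₄.a .x i ∈ lst (σ₄.a .x) (2 * p - 1) := mem_lst_of_lt hi
    rw [hl, mem_flat, hmem] at this
    exact this.1

/-- Look for `p` leaves with the same value. -/
def findEqual : Cd :=
  .dup ::= .lit (-1) ;;
  .for .si 0 (.reg .p) (
    .ite (.arr .val (.arr .x (.reg .si)) ≐ .arr .val (.arr .x (.reg .si + .reg .p - 1)))
      (.dup ::= .reg .si) .skip)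

theorem wp_findEqual {σ : Store} {p : ℕ} (hp : 1 ≤ p) (hrp : σ.r .p = p) (hS : Sorted p σ)
    (hpr : 2 * p ≤ C.rows) :
    WP C findEqual (fun σ' =>
      (σ'.r .dup = -1 ∧ ∀ i : ℕ, i < p → σ.a .val (σ.a .x i) ≠ σ.a .val (σ.a .x (i + p - 1 : ℕ))) ∨
      ∃ d : ℕ, d < p ∧ σ'.r .dup = d ∧ σ.a .val (σ.a .x d) = σ.a .val (σ.a .x (d + p - 1 : ℕ)))
      (100 * p + 20) σ := by
  have hb1 := C.rows_le_big; have hb2 := C.hstride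
  simp only [stride, Nat.cast_ofNat] at hb2
  refine (WP.seq (b := 2) (R := fun s => s = σ.set .dup (-1))
    (WP.straight (by simp; omega) (by simp) (Nat.le_of_ble_eq_true rfl)) ?_
    (b' := 100 * p + 10)).mono (by omega) (fun _ _ h => h)
  rintro _ - rfl
  refine WP.forC (a := 0) (b := p) (K := 50) (fun k s => (s.r .dup = -1 ∧
      ∀ i : ℕ, i < k → σ.a .val (σ.a .x i) ≠ σ.a .val (σ.a .x (i + p - 1 : ℕ))) ∨
      ∃ d : ℕ, d < p ∧ s.r .dup = d ∧ σ.a .val (σ.a .x d) = σ.a .val (σ.a .x (d + p - 1 : ℕ)))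
    (by omega) (by simp) (by simp) rfl ?_
    (by omega) (Or.inl ⟨by simp, fun i hi => by omega⟩) ?_ ?_ (fun _ _ h _ => h)
  · intro s hF
    simp [hF.r .p rfl, hrp]
  · rintro k s - hk hF hr hI
    have r1 : s.r .p = p := by rw [hF.r .p rfl]; simp [hrp]
    have a1 : s.a .x = σ.a .x := hF.a .x rfl
    have a2 : s.a .val = σ.a .val := hF.a .val rfl
    have h1 := hS.leaf k (by omega)
    have h2 := hS.leaf (k + p - 1) (by omega)
    have e : (k : ℤ) + p - 1 = (k + p - 1 : ℕ) := by omega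
    refine (WP.ite (b := 3) ?_ (fun he => ?_) (fun he => ?_)).mono
      (Nat.le_of_ble_eq_true rfl) (fun _ _ h => h)
    · simp only [Ex.ok_eq, Ex.ok_arr, Ex.ok_reg, Ex.ok_sub, Ex.ok_add, Ex.ok_one, Ex.den_arr,
        Ex.den_reg, Ex.den_sub, Ex.den_add, Ex.den_one, hr, r1, a1, e, true_and]
      omega
    · rw [Ne, Ex.den_eq_eq_zero] at he
      simp only [Ex.den_arr, Ex.den_reg, Ex.den_sub, Ex.den_add, Ex.den_one, hr, r1, a1, a2, e,
        ne_eq, not_not] at he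
      exact WP.straight (by simp) (Or.inr ⟨k, hk, by simp [hr], he⟩) (Nat.le_of_ble_eq_true rfl)
    · rw [Ex.den_eq_eq_zero] at he
      simp only [Ex.den_arr, Ex.den_reg, Ex.den_sub, Ex.den_add, Ex.den_one, hr, r1, a1, a2, e]
        at he
      refine WP.straight (by simp) ?_ (Nat.le_of_ble_eq_true rfl)
      rcases hI with ⟨h3, h4⟩ | ⟨d, h3, h4, h5⟩
      · refine Or.inl ⟨by simp [h3], fun i hi => ?_⟩
        by_cases hik : i = k
        · subst hik; exact he
        · exact h4 i (by omega)
      · exact Or.inr ⟨d, h3, by simp [h4], h5⟩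
  · show (p - 0) * (50 + 1 + 10) + 1 + 1 + 5 ≤ _; omega

/-- The states `st` select `p` leaves with sum `0`. -/
def Selects (p : ℕ) (V st : ℤ → ℤ) : Prop :=
  (∀ x : ℕ, x < 2 * p - 1 → st x = 0 ∨ st x = 1) ∧
    ∑ x ∈ Finset.range (2 * p - 1), st x = p ∧
    ∑ x ∈ Finset.range (2 * p - 1), st x * V x ≡ 0 [ZMOD p]

/-- Select `p` leaves with the same value. -/
def takeEqual : Cd :=
  .for .si 0 (.reg .p) (.put .st (.arr .x (.reg .dup + .reg .si)) 1)

/-- In the sorted list the `p` entries from position `d` on have the same value, and `p` times this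
value is divisible by `p`. -/
theorem wp_takeEqual {σ : Store} {p d : ℕ} (hrp : σ.r .p = p) (hS : Sorted p σ) (hd : d < p)
    (hrd : σ.r .dup = d) (he : σ.a .val (σ.a .x d) = σ.a .val (σ.a .x (d + p - 1 : ℕ)))
    (hpr : 2 * p ≤ C.rows) :
    WP C takeEqual (fun σ' => Selects p (σ.a .val) (σ'.a .st)) (100 * p + 20) σ := by
  have hb1 := C.rows_le_big; have hb2 := C.hstride
  simp only [stride, Nat.cast_ofNat] at hb2
  set f : ℤ → ℤ := fun i => σ.a .x (d + i) with hf
  have hfx : ∀ i : ℕ, f i = σ.a .x (d + i : ℕ) := fun i => by simp [hf]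
  refine WP.forC (a := 0) (b := p) (K := 40) (fun k s => ∀ z : ℤ, 0 ≤ z → z < 2 * (p : ℤ) - 1 →
      s.a .st z = if z ∈ lst f k then 1 else 0) (by omega) (by simp) (by simp) rfl ?_
    (by omega) (fun z h0 h1 => by simpa [lst] using hS.st z h0 h1) ?_ ?_ ?_
  · intro s hF
    simp [hF.r .p rfl, hrp]
  · rintro k s - hk hF hr hI
    have r1 : s.r .dup = d := by rw [hF.r .dup rfl, hrd]
    have a1 : s.a .x = σ.a .x := hF.a .x rfl
    have h1 := hS.leaf (d + k) (by omega)
    push_cast at h1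
    refine WP.straight ?_ (fun z h0 h2 => ?_) (Nat.le_of_ble_eq_true rfl)
    · simp [hr, r1, a1]; omega
    · have := hI z h0 h2
      simp only [lst_succ, List.mem_append, List.mem_singleton, hf]
      by_cases hz : z = σ.a .x (d + k)
      · subst hz; simp [hr, r1, a1]
      · simp only [Cd.fin_put, Ex.den_arr, Ex.den_add, Ex.den_reg, Ex.den_one, hr, r1, a1,
          Store.set_a, Store.put_a, if_true, Function.update_of_ne hz, hz, or_false]
        exact this
  · show (p - 0) * (40 + 1 + 10) + 1 + 1 + 5 ≤ _; omega
  · intro s hF hI _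
    have hnd : (lst f p).Nodup := by
      refine List.Nodup.map_on (fun i hi j hj hij => ?_) List.nodup_range
      rw [List.mem_range] at hi hj
      by_contra hne
      rw [hfx, hfx] at hij
      exact lst_ne_of_nodup hS.nodup (by omega) (by omega) (by omega) hij
    have hmem : ∀ z ∈ lst f p, 0 ≤ z ∧ z < (2 * p - 1 : ℕ) ∧
        σ.a .val z = σ.a .val (σ.a .x d) := by
      intro z hz
      obtain ⟨i, hi, rfl⟩ := mem_lst.1 hz
      rw [hfx]
      have h1 := hS.leaf (d + i) (by omega)
      have h2 := hS.mono d (d + i) (by omega) (by omega)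
      have h3 := hS.mono (d + i) (d + p - 1) (by omega) (by omega)
      omega
    have hst : ∀ x ∈ Finset.range (2 * p - 1), s.a .st x = if (x : ℤ) ∈ lst f p then 1 else 0 :=
      fun x hx => by have := Finset.mem_range.1 hx; exact hI x (by omega) (by omega)
    refine ⟨fun x hx => ?_, ?_, ?_⟩
    · rw [hst x (Finset.mem_range.2 hx)]; split_ifs <;> simp
    · rw [Finset.sum_congr rfl hst]
      have := sum_indicator hnd (fun z hz => ⟨(hmem z hz).1, (hmem z hz).2.1⟩) (fun _ => 1)
      simpa using this
    · have h1 : ∑ x ∈ Finset.range (2 * p - 1), s.a .st x * σ.a .val x =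
          ∑ x ∈ Finset.range (2 * p - 1), (if (x : ℤ) ∈ lst f p then 1 else 0) * σ.a .val x :=
        Finset.sum_congr rfl fun x hx => by rw [hst x hx]
      rw [h1, sum_indicator hnd (fun z hz => ⟨(hmem z hz).1, (hmem z hz).2.1⟩),
        List.sum_eq_card_nsmul _ (σ.a .val (σ.a .x d)), List.length_map, lst_length, nsmul_eq_mul,
        Int.modEq_zero_iff_dvd]
      · exact dvd_mul_right _ _
      · intro v hv
        obtain ⟨z, hz, rfl⟩ := List.mem_map.1 hv
        exact (hmem z hz).2.2

/-- Create the differences of leaves at distance `p - 1` in the sorted list. -/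
def pairLeaves : Cd :=
  .ylen ::= 0 ;;
  .nn ::= .reg .p + .reg .p - 1 ;;
  .base ::= .arr .val (.arr .x (.reg .p + .reg .p - 2)) ;;
  .put .st (.arr .x (.reg .p + .reg .p - 2)) 1 ;;
  pair (.reg .p + .reg .p - 2) (.reg .p - 1) (.reg .p)

/-- Sorted entries at distance `p - 1` with different values have a difference strictly between `0`
and `p`. The last entry of the list stays without partner and becomes the leaf `lone`. -/
theorem wp_pairLeaves {σ : Store} {p : ℕ} (hp : 2 ≤ p) (hrp : σ.r .p = p) (hS : Sorted p σ)
    (hval : ∀ x : ℤ, 0 ≤ x → x < 2 * (p : ℤ) - 1 → 0 ≤ σ.a .val x ∧ σ.a .val x < p)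
    (hne : ∀ i : ℕ, i < p → σ.a .val (σ.a .x i) ≠ σ.a .val (σ.a .x (i + p - 1 : ℕ)))
    (hpr : 4 * p ≤ C.rows) :
    WP C pairLeaves (fun σ' => ∃ lone : ℤ, Nodes p (3 * p - 2) lone σ' ∧
      Roots p (3 * p - 2) σ' (newNodes (2 * p - 1) (p - 1)) ∧
      Holds σ' .y .ylen (newNodes (2 * p - 1) (p - 1)) ∧
      (∀ y ∈ newNodes (2 * p - 1) (p - 1), 0 < σ'.a .val y) ∧
      ∀ x : ℤ, x < 2 * (p : ℤ) - 1 → σ'.a .val x = σ.a .val x) (500 * p + 100) σ := by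
  have hb1 := C.rows_le_big; have hb2 := C.hstride
  simp only [stride, Nat.cast_ofNat] at hb2
  set lone := σ.a .x (2 * p - 2 : ℕ) with hlone
  have hl := hS.leaf (2 * p - 2) (by omega)
  rw [← hlone] at hl
  have e : (p : ℤ) + p - 2 = (2 * p - 2 : ℕ) := by omega
  have e' : (p : ℤ) + p - 1 = (2 * p - 1 : ℕ) := by omega
  set σ₁ := (((σ.set .ylen 0).set .nn (2 * p - 1 : ℕ)).set .base (σ.a .val lone)).put .st lone 1
    with hσ₁
  refine (WP.seq (b := 2) (R := fun s => s = σ.set .ylen 0)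
    (WP.straight (by simp) (by simp) (Nat.le_of_ble_eq_true rfl)) ?_
    (b' := 500 * p + 95)).mono (by omega) (fun _ _ h => h)
  rintro _ - rfl
  refine (WP.seq (b := 6) (R := fun s => s = (σ.set .ylen 0).set .nn (2 * p - 1 : ℕ))
    (WP.straight (by simp [hrp]; omega) (by simp [hrp, e']) (Nat.le_of_ble_eq_true rfl)) ?_
    (b' := 500 * p + 89)).mono (by omega) (fun _ _ h => h)
  rintro _ - rfl
  refine (WP.seq (b := 16) (R := fun s => s = ((σ.set .ylen 0).set .nn (2 * p - 1 : ℕ)).set .base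
    (σ.a .val lone))
    (WP.straight (by simp [hrp, e, ← hlone]; omega) (by simp [hrp, e, ← hlone])
      (Nat.le_of_ble_eq_true rfl)) ?_ (b' := 500 * p + 73)).mono (by omega) (fun _ _ h => h)
  rintro _ - rfl
  refine (WP.seq (b := 20) (R := fun s => s = σ₁)
    (WP.straight (by simp [hrp, e, ← hlone]; omega) (by simp [hrp, e, ← hlone, hσ₁])
      (Nat.le_of_ble_eq_true rfl)) ?_ (b' := 500 * p + 53)).mono (by omega) (fun _ _ h => h)
  rintro _ - rfl
  have hroot : ∀ x : ℤ, 0 ≤ x → x < 2 * (p : ℤ) - 1 → Nodes.IsRoot σ₁ p (2 * p - 1) x :=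
    fun x h0 h1 => ⟨h0, by omega, fun y h2 h3 => by omega⟩
  have hv₁ : σ₁.a .val = σ.a .val := by simp [hσ₁]
  have hx₁ : σ₁.a .x = σ.a .x := by simp [hσ₁]
  have hN : Nodes p (2 * p - 1) lone σ₁ := by
    refine ⟨by simp [hσ₁], ⟨?_, fun y h0 h1 => by omega, fun y h0 h1 => by omega,
      fun y y' h0 h1 h2 => by omega⟩, hl.2, hroot _ hl.1 hl.2, ?_, ?_, ?_⟩
    · intro x h0 h1; rw [hv₁]; exact hval x h0 (by omega)
    · intro x h0 h1
      by_cases hx : x = lone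
      · simp [hσ₁, hx]
      · simpa [hσ₁, hx] using hS.st x h0 (by omega)
    · simp [hσ₁]
    · simpa [hσ₁] using hval _ hl.1 hl.2
  have hX : ∀ i : ℕ, i < 2 * p - 2 → σ₁.a .x i < 2 * (p : ℤ) - 1 := fun i hi => by
    rw [hx₁]; exact (hS.leaf i (by omega)).2
  refine (wp_pair (N := 2 * p - 2) (S := p - 1) (Dv := p) (ys := []) (lone := lone)
    (nn := 2 * p - 1) (p := p) (by omega) (by omega) (fun s hF => ?_) (fun s hF => ?_)
    (fun s hF => ?_) (Nat.le_of_ble_eq_true rfl) hN (by simp [hσ₁, hrp]) (by omega) le_rfl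
    (fun i hi => ⟨hroot _ ?_ (hX i hi), ?_⟩)
    ?_ ?_ (by omega) (by omega) (by omega) ⟨by simp [hσ₁], rfl⟩ (by simp; omega)
    (Or.inl ⟨by omega, hX⟩)).mono (by omega) ?_
  · have : s.r .p = p := by rw [hF.r .p rfl]; simp [hσ₁, hrp]
    simp [this, e]; omega
  · have : s.r .p = p := by rw [hF.r .p rfl]; simp [hσ₁, hrp]
    simp [this]; omega
  · have : s.r .p = p := by rw [hF.r .p rfl]; simp [hσ₁, hrp]
    simp [this]
  · rw [hx₁]; exact (hS.leaf i (by omega)).1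
  · rw [hx₁]; exact lst_ne_of_nodup hS.nodup (by omega) (by omega) (by omega)
  · rw [hx₁]; exact lst_nodup_prefix (by omega) hS.nodup
  · rw [hx₁, hv₁]; exact fun i j hij hj => hS.mono i j hij (by omega)
  · intro σ₂ _ hP
    -- All positions lie in block `0`, and the bound `p` excludes no difference.
    have hlen : (pairIdx (σ₁.a .x) (σ₁.a .val) (p - 1) p (2 * p - 2 - (p - 1))).length = p - 1 := by
      rw [pairIdx, List.filter_eq_self.2, List.length_range]
      · omega
      · intro i hi
        rw [List.mem_range] at hi
        have h1 := hS.leaf i (by omega)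
        have h2 := hS.leaf (i + (p - 1)) (by omega)
        have h3 := hval _ h1.1 h1.2
        have h4 := hval _ h2.1 h2.2
        have h5 : i / (p - 1) = 0 := Nat.div_eq_of_lt (by omega)
        push_cast at h4
        simp only [h5, hx₁, hv₁, Nat.zero_mod, true_and, decide_eq_true_eq]
        omega
    rw [hlen] at hP
    have hnn : 2 * p - 1 + (p - 1) = 3 * p - 2 := by omega
    obtain ⟨h1, h2, h3, h4, h5⟩ := hP
    rw [hnn] at h1 h3 h4
    have hnew : ∀ y ∈ newNodes (2 * p - 1) (p - 1), Nodes.IsRoot σ₂ p (3 * p - 2) y ∧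
        0 < σ₂.a .val y := by
      intro y hy
      rw [mem_newNodes] at hy
      obtain ⟨g1, i, hi, -, -, -, g2, -⟩ := h4 y hy.1 hy.2
      refine ⟨g1, ?_⟩
      have g3 := hne i (by omega)
      have g4 := hS.mono i (i + p - 1) (by omega) (by omega)
      have g5 : (i : ℤ) + (p - 1 : ℕ) = (i + p - 1 : ℕ) := by omega
      rw [g2, hx₁, hv₁, g5]
      omega
    refine ⟨lone, h1, ⟨newNodes_nodup, fun y hy => (hnew y hy).1, fun y hy => ?_⟩,
      h5 [] ⟨by simp [hσ₁], rfl⟩, fun y hy => (hnew y hy).2, fun x hx => ?_⟩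
    · rw [mem_newNodes] at hy; omega
    · rw [h2 x (by omega), hv₁]

/-! ### The solution for a prime modulus. -/

/-- The states of the nodes in `σ'` select leaves with sum `0`; the values of the leaves are
those in `σ`, multiplied by a unit. -/
structure Solved (p nn : ℕ) (σ σ' : Store) : Prop where
  rp : σ'.r .p = p
  rn : σ'.r .nn = nn
  tree : Tree p nn (σ'.a .lft) (σ'.a .rgt) (σ'.a .val)
  bal : Balanced p nn nn (σ'.a .lft) (σ'.a .rgt) (σ'.a .val) (σ'.a .st)
  val : ∃ h : ℤ, IsCoprime h p ∧ ∀ x : ℕ, x < 2 * p - 1 → σ'.a .val x = σ.a .val x * h % p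

theorem Nodes.solved {cd : Cd} {p nn : ℕ} {lone : ℤ} {σ σ' : Store} {ys W : List ℤ} (hp : 1 ≤ p)
    (hN : Nodes p nn lone σ) (hR : Roots p nn σ ys) (hrp : σ.r .p = p) (hn : 3 * p - 2 ≤ nn)
    (hF : Frame cd σ σ') (hr : ∀ x ∈ [Reg.p, .nn], cd.wr x = false)
    (ha : ∀ b ∈ [Arr.lft, .rgt, .val], cd.wa b = false) (hW : W.Nodup) (hs : ∀ z ∈ W, z ∈ ys)
    (hst : ∀ x : ℤ, 0 ≤ x → x < nn → σ'.a .st x = if x = lone ∨ x ∈ W then 1 else 0)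
    (hsum : σ.r .base + (W.map (σ.a .val)).sum ≡ 0 [ZMOD p]) : Solved p nn σ σ' := by
  have a1 := hF.a .lft (ha _ (by simp))
  have a2 := hF.a .rgt (ha _ (by simp))
  have a3 := hF.a .val (ha _ (by simp))
  refine ⟨by rw [hF.r .p (hr _ (by simp)), hrp], by rw [hF.r .nn (hr _ (by simp)), hN.reg],
    by rw [a1, a2, a3]; exact hN.tree, ?_, 1, isCoprime_one_left, fun x hx => ?_⟩
  · rw [a1, a2, a3]
    exact balanced_of_marks hp hN hn hW (fun z hz => ⟨hR.root z (hs z hz), hR.node z (hs z hz)⟩)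
      hst hsum
  · have := hN.tree.val x (by omega) (by omega)
    rw [a3, mul_one, Int.emod_eq_of_lt this.1 this.2]

theorem wp_stages {σ : Store} {p nn M : ℕ} {lone : ℤ} {ys : List ℤ} (hp : p.Prime)
    (hR : Ready p nn lone ys M σ) (hM : 1 ≤ M) (hn : 3 * p - 2 ≤ nn) (hnr : nn ≤ C.rows)
    (hpr : 2 * p ≤ C.rows) (hbig : 10 * ((p : ℤ) * p) ≤ C.big) :
    WP C (steps ;; recon) (Solved p nn σ) (1400 * p + 300) σ := by
  have hp2 := hp.two_le
  have hlen := hR.len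
  have hval : ∀ y ∈ ys, 0 ≤ σ.a .val y ∧ σ.a .val y < p := fun y hy => by
    have := hR.roots.root y hy
    exact hR.nodes.tree.val y this.1 this.2.1
  have hsum := sum_cls_length (V := σ.a .val) (a := 0) (b := p) (by omega) hR.roots.nodup
    (by simpa using hval)
  rw [Nat.Ico_zero_eq_range] at hsum
  have h1 := wp_steps (C := C) hp hR.rp hR.rm hM (fun v : ℕ => (cls (σ.a .val) ys v).length)
    (fun v hv => (hR.buckets v (by omega) (by omega)).2) (List.length_eq_zero_iff.2
      (List.eq_nil_iff_forall_not_mem.2 fun y hy => by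
        obtain ⟨h1, h2⟩ := mem_cls.1 hy
        exact hR.pos y h1 (by simpa using h2)))
    (fun v => lt_of_le_of_lt (cls_length_le _ _ _) hlen) hpr hbig hR.reach
  rw [hsum] at h1
  refine (WP.seq h1 (Q := fun σ' => ∃ W : List ℤ, W.Nodup ∧ (∀ z ∈ W, z ∈ ys) ∧
      (∀ x : ℤ, 0 ≤ x → x < nn → σ'.a .st x = if x = lone ∨ x ∈ W then 1 else 0) ∧
      σ.r .base + (W.map (σ.a .val)).sum ≡ 0 [ZMOD p]) (b' := 300 * p + 100) ?_).mono (by omega) ?_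
  · rintro σ₁ hF₁ ⟨q, hq, hS, hsl⟩
    have hN₁ : Nodes p nn lone σ₁ := hR.nodes.frame hF₁ (by decide) (by decide)
    refine (wp_recon hp (by rw [hF₁.r .p rfl]; exact hR.rp) hN₁
      (hR.buckets.frame hF₁ (by decide)) hS hsl (by omega) (fun x hx => ?_) hR.roots.nodup hnr
      (by omega) (by omega) hbig).mono (by omega) fun σ₂ _ h => ?_
    · have := hR.roots.root x hx
      exact ⟨this.1, this.2.1⟩
    · rwa [hF₁.r .base rfl, hF₁.a .val rfl] at h
  · rintro σ₂ hF ⟨W, hW, hs, hst, hsum⟩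
    exact hR.nodes.solved (by omega) hR.roots hR.rp hn hF (by decide) (by decide) hW hs hst hsum

theorem Solved.trans {p nn : ℕ} {σ₀ σ σ' : Store} (h : Solved p nn σ σ') {g : ℤ}
    (hg : IsCoprime g p) (hv : ∀ x : ℕ, x < 2 * p - 1 → σ.a .val x = σ₀.a .val x * g % p) :
    Solved p nn σ₀ σ' := by
  obtain ⟨h1, h2, h3, h4, k, hk, h5⟩ := h
  refine ⟨h1, h2, h3, h4, g * k, hg.mul_left hk, fun x hx => ?_⟩
  rw [h5 x hx, hv x hx, ← mul_assoc]
  exact (Int.mod_modEq _ _).mul_right k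

/-- Solve the problem for the differences of the leaves, if `p` is large. -/
def large : Cd :=
  sqrtCode ;; bucket .y .ylen ;; flatten 0 (.reg .p) (.reg .m) ;;
  .ite (.reg .p - 1 ≺ .reg .xlen + .reg .xlen) low .skip ;; steps ;; recon

/-- The nodes `ys`, whose values are not zero, are listed in `y`. -/
structure Leveled (p nn : ℕ) (lone : ℤ) (ys : List ℤ) (σ : Store) : Prop where
  nodes : Nodes p nn lone σ
  roots : Roots p nn σ ys
  hold : Holds σ .y .ylen ys
  pos : ∀ y ∈ ys, 0 < σ.a .val y
  rp : σ.r .p = p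

/-- Let `N` be the number of nodes in classes with fewer than `M` elements. If `p - 1 < 2 * N`, the
program `low` replaces the nodes by better ones. Otherwise the large classes contain at least half
of the `p - 1` nodes, and `reaches_high` applies to the nodes as they are. -/
theorem wp_large {σ : Store} {p nn : ℕ} {lone : ℤ} {ys : List ℤ} (hp : p.Prime)
    (hP : Leveled p nn lone ys σ) (hlen : ys.length + 1 = p) (hn : nn = 3 * p - 2)
    (hpl : 2 ^ 120 ≤ p) (hr : 8 * p ≤ C.rows) (hbig : 10 * ((p : ℤ) * p) ≤ C.big) :
    WP C large (fun σ' => ∃ nn' : ℕ, 3 * p - 2 ≤ nn' ∧ nn' ≤ 6 * p ∧ Solved p nn' σ σ')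
      (10000 * p + 5000) σ := by
  have hb1 := C.rows_le_big; have hb2 := C.hstride
  simp only [stride, Nat.cast_ofNat] at hb2
  have hp2 := hp.two_le
  have hval : ∀ y ∈ ys, 0 ≤ y ∧ y < nn ∧ 0 ≤ σ.a .val y ∧ σ.a .val y < p := fun y hy => by
    have := hP.roots.root y hy
    exact ⟨this.1, this.2.1, hP.nodes.tree.val y this.1 this.2.1⟩
  refine (WP.seq (wp_sqrtCode hp2 hP.rp hbig) (b' := 9900 * p + 4900) ?_).mono
    (by clear hpl; omega) (fun _ _ h => h)
  rintro σ₁ hF₁ ⟨M, hrm₁, hM, hMp, hMp'⟩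
  obtain ⟨hM8, hM57⟩ := sqrt_bounds hpl hMp' hM
  clear hpl
  have hv₁ : σ₁.a .val = σ.a .val := hF₁.a .val rfl
  have hrp₁ : σ₁.r .p = p := by rw [hF₁.r .p rfl, hP.rp]
  have hy₁ := hP.hold.frame hF₁ rfl rfl
  refine (WP.seq (wp_bucket (A := .y) (len := .ylen) (by decide) (by decide) hrp₁ hy₁.1
    (by omega) (by omega) (fun x hx => ?_) (by rw [hy₁.2]; exact hP.roots.nodup))
    (b' := 9500 * p + 4500) ?_).mono (by omega) (fun _ _ h => h)
  · rw [hy₁.2] at hx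
    have := hval x hx
    rw [hv₁]; omega
  intro σ₂ hF₂ hB₂
  rw [hy₁.2] at hB₂
  have hrp₂ : σ₂.r .p = p := by rw [hF₂.r .p rfl, hrp₁]
  have hrm₂ : σ₂.r .m = M := by rw [hF₂.r .m rfl, hrm₁]
  have hv₂ : σ₂.a .val = σ.a .val := by rw [hF₂.a .val rfl, hv₁]
  refine (WP.seq (wp_flatten (a := 0) (b := p) (T := M) (ys := ys) (p := p) (by omega) le_rfl
    (by omega) (by omega) (fun s hF => ⟨by simp, by simp⟩)
    (fun s hF => ⟨by simp, by simp [hF.r .p rfl, hrp₂]⟩)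
    (fun s hF => ⟨by simp, by simp [hF.r .m rfl, hrm₂]⟩)
    (fun z hz => by have := hval z hz; omega) hP.roots.nodup hB₂
    (Nat.le_of_ble_eq_true rfl)) (b' := 9000 * p + 4000) ?_).mono (by omega) (fun _ _ h => h)
  intro σ₃ hF₃ hH
  have hrp₃ : σ₃.r .p = p := by rw [hF₃.r .p rfl, hrp₂]
  have hrm₃ : σ₃.r .m = M := by rw [hF₃.r .m rfl, hrm₂]
  have hv₃ : σ₃.a .val = σ.a .val := by rw [hF₃.a .val rfl, hv₂]
  have hN₃ : Nodes p nn lone σ₃ := ((hP.nodes.frame hF₁ (by decide) (by decide)).frame hF₂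
    (by decide) (by decide)).frame hF₃ (by decide) (by decide)
  have hR₃ : Roots p nn σ₃ ys := ((hP.roots.frame hF₁ (by decide)).frame hF₂
    (by decide)).frame hF₃ (by decide)
  have hB₃ : Buckets σ₃ p ys := hB₂.frame hF₃ (by decide)
  rw [hv₂, ← hv₃] at hH
  have hfl := flat_length_le (V := σ₃.a .val) (thr := M) (lo := 0) (hi := p) hP.roots.nodup
  have hfl2 := flat_length (V := σ₃.a .val) (ys := ys) (thr := M) (lo := 0) (hi := p) (by omega)
  have hL := listing_of_flat (h := M - 1) hR₃ hH (by omega)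
  have hxl := hH.1
  set N := (flat (σ₃.a .val) ys M 0 p).length with hNdef
  refine (WP.seq (R := fun s => ∃ (nn' : ℕ) (ws : List ℤ), nn ≤ nn' ∧ nn' ≤ nn + 3 * p ∧
      Ready p nn' lone ws M s ∧ ∃ h : ℤ, IsCoprime h p ∧ ∀ x : ℕ, x < nn →
      s.a .val x = σ.a .val x * h % p) (b := 7000 * p + 3000) (b' := 1400 * p + 300)
      ?_ ?_).mono (by omega) (fun _ _ h => h)
  · refine (WP.ite (b := 6000 * p + 2000) (by simp [hrp₃, hxl]; omega) (fun hz => ?_)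
      (fun hz => ?_)).mono (show 7 + 1 + _ ≤ _ by omega) (fun _ _ h => h)
    · rw [Ne, Ex.den_lt_eq_zero] at hz
      simp [hrp₃, hxl] at hz
      refine (wp_low hp hL hN₃ hrp₃ hxl hrm₃ hM hM57 hM8 (by omega) (by omega) (by omega)
        (by omega) hbig).mono (by omega) ?_
      rintro σ₄ - ⟨nn', ws, h1, h2, h3, h4⟩
      rw [hv₃] at h4
      exact ⟨nn', ws, h1, h2, h3, h4⟩
    · rw [Ex.den_lt_eq_zero] at hz
      simp [hrp₃, hxl] at hz
      refine WP.straight (by simp) ⟨nn, ys, le_rfl, by omega, ⟨hN₃, hR₃, hB₃, hrp₃, hrm₃,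
        by omega, fun y hy => ?_, ?_⟩, 1, isCoprime_one_left, fun x hx => ?_⟩
        (by simp [Cd.bound])
      · have := hP.pos y hy
        simp only [Cd.fin_skip, hv₃]; omega
      · simp only [Cd.fin_skip]
        have hs := sum_cls_length (V := σ₃.a .val) (a := 0) (b := p) (by omega) hP.roots.nodup
          (fun y hy => by rw [hv₃]; have := hval y hy; push_cast; omega)
        set cn := fun v : ℕ => (cls (σ₃.a .val) ys v).length with hcn
        have hcp : ∀ v, cn v < p := fun v => lt_of_le_of_lt (cls_length_le _ _ _) (by omega)
        have hlow : count cn 1 M p = N := by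
          rw [hfl2, count, ← Nat.Ico_zero_eq_range]
          refine Finset.sum_congr rfl fun v _ => ?_
          by_cases h0 : cn v = 0
          · simp only [hcn] at h0; simp [hcn, h0]
          · have h1 : 1 ≤ cn v := by omega
            simp only [h1, true_and]
            norm_cast
        have htot : count cn M (2 * p) p + count cn 1 M p = ys.length := by
          rw [← hs, count, count, ← Finset.sum_add_distrib, ← Nat.Ico_zero_eq_range]
          refine Finset.sum_congr rfl fun v _ => ?_
          have h1 := hcp v
          change _ = cn v
          split_ifs <;> omega
        exact reaches_high hp cn hM hMp hcp (by omega) (by omega)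
      · have := hN₃.tree.val x (by omega) (by omega)
        rw [hv₃] at this
        simp only [Cd.fin_skip, hv₃, mul_one]
        rw [Int.emod_eq_of_lt this.1 this.2]
  · rintro σ₄ hF₄ ⟨nn', ws, h1, h2, hR, h, hco, hv₄⟩
    refine (wp_stages hp hR (by omega) (by omega) (by omega) (by omega) hbig).mono le_rfl ?_
    intro σ₅ _ hS
    exact ⟨nn', by omega, by omega, hS.trans hco fun x hx => hv₄ x (by omega)⟩

/-- From the values of `2 * p - 1` leaves find states that select `p` leaves with sum `0`. -/
def prime : Cd :=
  sortLeaves ;; findEqual ;;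
  .ite (0 ≼ .reg .dup) takeEqual (
    pairLeaves ;;
    .ite (.reg .p ≺ .lit (2 ^ 120)) (reachAll ;; reachRecon) large ;;
    finalize)

theorem wp_small {σ : Store} {p nn : ℕ} {lone : ℤ} {ys : List ℤ} (hp : p.Prime)
    (hP : Leveled p nn lone ys σ) (hlen : ys.length + 1 = p) (hn : nn = 3 * p - 2)
    (hr : 8 * p ≤ C.rows) :
    WP C (reachAll ;; reachRecon) (fun σ' => ∃ nn' : ℕ, 3 * p - 2 ≤ nn' ∧ nn' ≤ 6 * p ∧
      Solved p nn' σ σ') (200 * (p * p) + 300 * p + 500) σ := by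
  have hp2 := hp.two_le
  have hval : ∀ y ∈ ys, 0 ≤ y ∧ y < nn ∧ 0 ≤ σ.a .val y ∧ σ.a .val y < p := fun y hy => by
    have := hP.roots.root y hy
    exact ⟨this.1, this.2.1, hP.nodes.tree.val y this.1 this.2.1⟩
  refine (WP.seq (wp_reachAll hp hP.rp hP.hold (fun y hy => ?_) (by omega) (by omega))
    (Q := fun σ' => ∃ W : List ℤ, W.Nodup ∧ (∀ z ∈ W, z ∈ ys) ∧
      (∀ x : ℤ, 0 ≤ x → x < nn → σ'.a .st x = if x = lone ∨ x ∈ W then 1 else 0) ∧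
      σ.r .base + (W.map (σ.a .val)).sum ≡ 0 [ZMOD p]) (b' := 100 * p + 300) ?_).mono (by omega) ?_
  · have h1 := hval y hy
    have h2 := hP.pos y hy
    omega
  · intro σ₁ hF₁ hS
    rw [← hF₁.a .y rfl, ← hF₁.a .val rfl] at hS
    refine (wp_reachRecon (by rw [hF₁.r .p rfl]; exact hP.rp)
      (hP.nodes.frame hF₁ (by decide) (by decide)) (hP.hold.frame hF₁ rfl rfl) hS (by omega)
      (fun y hy => ?_) hP.roots.nodup (by omega) (by omega) (by omega)).mono (by omega)
      fun σ₂ _ h => ?_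
    · have := hval y hy; omega
    · rwa [hF₁.r .base rfl, hF₁.a .val rfl] at h
  · rintro σ₂ hF ⟨W, hW, hs, hst, hsum⟩
    exact ⟨nn, by omega, by omega, hP.nodes.solved (by omega) hP.roots hP.rp (by omega) hF
      (by decide) (by decide) hW hs hst hsum⟩

theorem wp_prime {σ : Store} {p : ℕ} (hp : p.Prime) (hrp : σ.r .p = p)
    (hval : ∀ x : ℕ, x < 2 * p - 1 → 0 ≤ σ.a .val x ∧ σ.a .val x < p) (hr : 8 * p ≤ C.rows)
    (hbig : 10 * ((p : ℤ) * p) ≤ C.big) (hbig' : 2 ^ 120 ≤ C.big) :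
    WP C prime (fun σ' => Selects p (σ.a .val) (σ'.a .st)) (2 ^ 137 * p) σ := by
  have hb1 := C.rows_le_big; have hb2 := C.hstride
  simp only [stride, Nat.cast_ofNat] at hb2
  have hp2 := hp.two_le
  have hval' : ∀ x : ℤ, 0 ≤ x → x < 2 * (p : ℤ) - 1 → 0 ≤ σ.a .val x ∧ σ.a .val x < p := by
    intro x h0 h1
    obtain ⟨k, rfl⟩ := Int.eq_ofNat_of_zero_le h0
    exact hval k (by omega)
  refine (WP.seq (wp_sortLeaves (by omega) hrp hval' (by omega)) (b' := 2 ^ 136 * p) ?_).mono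
    (by norm_num; omega) (fun _ _ h => h)
  intro σ₁ hF₁ hS₁
  have hrp₁ : σ₁.r .p = p := by rw [hF₁.r .p rfl, hrp]
  have hv₁ : σ₁.a .val = σ.a .val := hF₁.a .val rfl
  refine (WP.seq (wp_findEqual (by omega) hrp₁ hS₁ (by omega)) (b' := 2 ^ 135 * p) ?_).mono
    (by norm_num; omega) (fun _ _ h => h)
  intro σ₂ hF₂ hcase
  have hrp₂ : σ₂.r .p = p := by rw [hF₂.r .p rfl, hrp₁]
  have hv₂ : σ₂.a .val = σ.a .val := by rw [hF₂.a .val rfl, hv₁]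
  have hx₂ : σ₂.a .x = σ₁.a .x := hF₂.a .x rfl
  have hS₂ : Sorted p σ₂ := by
    obtain ⟨h1, h2, h3, h4⟩ := hS₁
    have e1 := hF₂.a .st rfl
    have e2 := hF₂.a .val rfl
    rw [← e1] at h1; rw [← hx₂] at h2 h3 h4; rw [← e2] at h4
    exact ⟨h1, h2, h3, h4⟩
  rw [hv₁, ← hx₂, ← hv₂] at hcase
  refine (WP.ite (b := 2 ^ 134 * p) (by simp) (fun hz => ?_) (fun hz => ?_)).mono
    (show 3 + 1 + 2 ^ 134 * p ≤ 2 ^ 135 * p by norm_num; omega) (fun _ _ h => h)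
  · rw [Ne, Ex.den_le_eq_zero] at hz
    rcases hcase with ⟨hd, -⟩ | ⟨d, hd, hrd, he⟩
    · simp [hd] at hz
    · refine (wp_takeEqual hrp₂ hS₂ hd hrd he (by omega)).mono (by norm_num; omega) ?_
      intro σ' _ h
      rwa [hv₂] at h
  · rw [Ex.den_le_eq_zero] at hz
    rcases hcase with ⟨hd, hne⟩ | ⟨d, hd, hrd, he⟩
    swap
    · simp [hrd] at hz; omega
    refine (WP.seq (wp_pairLeaves hp2 hrp₂ hS₂ (by rw [hv₂]; exact hval') hne (by omega))
      (b' := 2 ^ 133 * p) ?_).mono (by norm_num; omega) (fun _ _ h => h)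
    rintro σ₃ hF₃ ⟨lone, hN, hR, hy, hpos, hv₃⟩
    have hrp₃ : σ₃.r .p = p := by rw [hF₃.r .p rfl, hrp₂]
    have hP : Leveled p (3 * p - 2) lone (newNodes (2 * p - 1) (p - 1)) σ₃ :=
      ⟨hN, hR, hy, hpos, hrp₃⟩
    have hl : (newNodes (2 * p - 1) (p - 1)).length + 1 = p := by rw [newNodes_length]; omega
    refine (WP.seq (R := fun s => ∃ nn' : ℕ, 3 * p - 2 ≤ nn' ∧ nn' ≤ 6 * p ∧ Solved p nn' σ₃ s)
      (b := 2 ^ 131 * p) (b' := 2 ^ 131 * p) ?_ ?_).mono (by norm_num; omega) (fun _ _ h => h)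
    · refine (WP.ite (b := 2 ^ 130 * p) (by simp; omega) (fun hz => ?_) (fun hz => ?_)).mono
        (show 3 + 1 + 2 ^ 130 * p ≤ _ by norm_num; omega) (fun _ _ h => h)
      · rw [Ne, Ex.den_lt_eq_zero] at hz
        simp only [Ex.den_lit, Ex.den_reg, hrp₃, not_le] at hz
        -- Below `2 ^ 120` quadratic time is linear time with a large constant, which dominates the
        -- constant of the whole program.
        have h1 : p * p ≤ 2 ^ 120 * p := Nat.mul_le_mul_right _ (by exact_mod_cast hz.le)
        refine (wp_small hp hP hl rfl hr).mono ?_ (fun _ _ h => h)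
        norm_num at h1 ⊢
        omega
      · rw [Ex.den_lt_eq_zero] at hz
        simp only [Ex.den_lit, Ex.den_reg, hrp₃] at hz
        exact (wp_large hp hP hl rfl (by exact_mod_cast hz) hr hbig).mono (by norm_num; omega)
          (fun _ _ h => h)
    · rintro σ₄ hF₄ ⟨nn', h1, h2, h3, h4, h5, h6, h, hco, hv₄⟩
      refine (wp_finalize (by omega) h3 h4 h5 (by omega) (by omega) (by omega) h6).mono
        (by norm_num; omega) ?_
      rintro σ₅ - ⟨g1, g2, g3⟩
      refine ⟨g1, g2, ?_⟩
      -- The sum vanishes for the leaves multiplied by the unit `h`, hence also for the original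
      -- leaves.
      have g4 : (∑ x ∈ Finset.range (2 * p - 1), σ₅.a .st x * σ.a .val x) * h ≡
          ∑ x ∈ Finset.range (2 * p - 1), σ₅.a .st x * σ₄.a .val x [ZMOD p] := by
        rw [Finset.sum_mul]
        refine Int.ModEq.sum fun x hx => ?_
        rw [Finset.mem_range] at hx
        rw [hv₄ x hx, hv₃ x (by omega), hv₂, mul_assoc]
        exact (Int.mod_modEq _ _).symm.mul_left _
      rw [Int.modEq_zero_iff_dvd] at g3 ⊢
      have g5 := (Int.ModEq.dvd_iff g4).2 g3
      exact hco.symm.dvd_of_dvd_mul_right g5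

/-! ### Windows of items: loading the values and collecting the selected items. -/

/-- The number of ones among the first `j` bits. -/
def ones (s : ℤ → ℤ) (j : ℕ) : ℤ := ∑ i ∈ Finset.range j, s i

theorem ones_succ (s : ℤ → ℤ) (j : ℕ) : ones s (j + 1) = ones s j + s j :=
  Finset.sum_range_succ _ _

theorem ones_bounds {s : ℤ → ℤ} {m : ℕ} (hs : ∀ j : ℕ, j < m → s j = 0 ∨ s j = 1) {j : ℕ}
    (hj : j ≤ m) : ones s j ≤ ones s m ∧ ones s m - ones s j ≤ m - j := by
  induction m, hj using Nat.le_induction with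
  | base => simp
  | succ m hm ih =>
    have h1 := ih fun i hi => hs i (by omega)
    have h2 := hs m (by omega)
    rw [ones_succ]
    push_cast
    omega

/-- The difference `j - ones s j` counts the zeros before `j`, so this enumerates the items that are
not selected. -/
theorem exists_zero {s : ℤ → ℤ} {m : ℕ} (hs : ∀ j : ℕ, j < m → s j = 0 ∨ s j = 1) (i : ℕ)
    (hi : (i : ℤ) < m - ones s m) : ∃ j : ℕ, j < m ∧ s j = 0 ∧ (j : ℤ) - ones s j = i := by
  induction m with
  | zero => simp [ones] at hi; omega
  | succ m ih =>
    rw [ones_succ] at hi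
    push_cast at hi
    have h1 := hs m (by omega)
    by_cases h2 : (i : ℤ) < m - ones s m
    · obtain ⟨j, hj, h3⟩ := ih (fun j hj => hs j (by omega)) h2
      exact ⟨j, by omega, h3⟩
    · exact ⟨m, by omega, by omega, by omega⟩

/-- Load the values of the next `2 * p - 1` items. -/
def loadWindow : Cd :=
  .for .wpos 0 (.reg .p + .reg .p - 1) (
    .put .val (.reg .wpos) (.arr .iv (.arr .pool (.reg .q + .reg .wpos)) % .reg .p))

theorem wp_loadWindow {σ : Store} {p Q : ℕ} (hp : 1 ≤ p) (hrp : σ.r .p = p) (hrq : σ.r .q = Q)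
    (hQ : Q + 2 * p ≤ C.rows)
    (hid : ∀ j : ℕ, j < 2 * p - 1 → 0 ≤ σ.a .pool (Q + j) ∧ σ.a .pool (Q + j) < C.rows) :
    WP C loadWindow (fun σ' => ∀ j : ℕ, j < 2 * p - 1 →
      σ'.a .val j = σ.a .iv (σ.a .pool (Q + j)) % p) (200 * p + 20) σ := by
  have hb1 := C.rows_le_big; have hb2 := C.hstride
  simp only [stride, Nat.cast_ofNat] at hb2
  refine WP.forC (a := 0) (b := 2 * p - 1) (K := 60)
    (fun k s => ∀ j : ℕ, j < k → s.a .val j = σ.a .iv (σ.a .pool (Q + j)) % p)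
    (by omega) (by simp) (by simp) rfl ?_ (by omega) (fun j hj => by omega) ?_ ?_
    (fun _ _ h _ => h)
  · intro s hF
    have : s.r .p = p := by rw [hF.r .p rfl, hrp]
    simp [this]; omega
  · intro k s _ hk hF hr hI
    have r1 : s.r .p = p := by rw [hF.r .p rfl, hrp]
    have r2 : s.r .q = Q := by rw [hF.r .q rfl, hrq]
    have a1 : s.a .iv = σ.a .iv := hF.a .iv rfl
    have a2 : s.a .pool = σ.a .pool := hF.a .pool rfl
    have := hid k hk
    refine WP.straight ?_ ?_ (Nat.le_of_ble_eq_true rfl)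
    · simp [hr, r1, r2, a2]; omega
    · intro j hj
      by_cases hjk : j = k
      · subst hjk; simp [hr, r1, r2, a1, a2]
      · have hjk' : (j : ℤ) ≠ k := by omega
        simpa [hr, hjk'] using hI j (by omega)
  · show (2 * p - 1 - 0) * (60 + 5 + 10) + 1 + 5 + 5 ≤ _; omega

/-- Add up the values of the selected items of the window, let the item `nid` be their parent,
and move the other items to the end of the window. -/
def collect : Cd :=
  .sum ::= 0 ;;
  .x ::= .reg .q + .reg .p + .reg .p - 1 ;;
  .wpos ::= .reg .p + .reg .p - 1 ;;
  .loop (0 ≺ .reg .wpos) (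
    .wpos ::= .reg .wpos - 1 ;;
    .t ::= .arr .pool (.reg .q + .reg .wpos) ;;
    .ite (.arr .st (.reg .wpos))
      (.sum ::= .reg .sum + .arr .iv (.reg .t) ;; .put .par (.reg .t) (.reg .nid))
      (.x ::= .reg .x - 1 ;; .put .pool (.reg .x) (.reg .t)))

/-- The effect of `collect`. -/
structure Collected (p Q id : ℕ) (σ σ' : Store) : Prop where
  sum : σ'.r .sum = ∑ j ∈ Finset.range (2 * p - 1), σ.a .st j * σ.a .iv (σ.a .pool (Q + j))
  par : ∀ j : ℕ, j < 2 * p - 1 → σ.a .st j = 1 → σ'.a .par (σ.a .pool (Q + j)) = id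
  other : ∀ x : ℤ, (∀ j : ℕ, j < 2 * p - 1 → σ.a .st j = 1 → x ≠ σ.a .pool (Q + j)) →
    σ'.a .par x = σ.a .par x
  pool : ∀ i : ℤ, i < Q + p ∨ Q + 2 * p - 1 ≤ i → σ'.a .pool i = σ.a .pool i
  left : ∃ e : ℕ → ℕ, (∀ i : ℕ, i < p - 1 → e i < 2 * p - 1 ∧ σ.a .st (e i) = 0 ∧
    σ'.a .pool (Q + p + i) = σ.a .pool (Q + e i)) ∧
    ∀ i i' : ℕ, i < p - 1 → i' < p - 1 → e i = e i' → i = i'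

/-- The state of `collect` before the positions below `w` of the window are treated. -/
structure Collecting (p Q id : ℕ) (B : ℤ) (σ : Store) (w : ℕ) (u : Store) : Prop where
  wpos : u.r .wpos = w
  x : u.r .x = Q + p + w - ones (σ.a .st) w
  sum : u.r .sum = ∑ j ∈ Finset.Ico w (2 * p - 1), σ.a .st j * σ.a .iv (σ.a .pool (Q + j))
  bounds : 0 ≤ u.r .sum ∧ u.r .sum ≤ (2 * p - 1 - w) * B
  par : ∀ j : ℕ, w ≤ j → j < 2 * p - 1 → σ.a .st j = 1 → u.a .par (σ.a .pool (Q + j)) = id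
  other : ∀ x : ℤ, (∀ j : ℕ, j < 2 * p - 1 → σ.a .st j = 1 → x ≠ σ.a .pool (Q + j)) →
    u.a .par x = σ.a .par x
  pool : ∀ i : ℤ, i < Q + p + w - ones (σ.a .st) w ∨ Q + 2 * p - 1 ≤ i →
    u.a .pool i = σ.a .pool i
  left : ∀ j : ℕ, w ≤ j → j < 2 * p - 1 → σ.a .st j = 0 →
    u.a .pool (Q + p + j - ones (σ.a .st) j) = σ.a .pool (Q + j)

/-- The item at position `w` is selected. -/
theorem Collecting.select {p Q id w : ℕ} {B : ℤ} {σ u v : Store}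
    (h : Collecting p Q id B σ (w + 1) u) (hw : w < 2 * p - 1) (hs : σ.a .st w = 1)
    (hv0 : 0 ≤ σ.a .iv (σ.a .pool (Q + w))) (hv1 : σ.a .iv (σ.a .pool (Q + w)) ≤ B)
    (r1 : v.r .wpos = w) (r2 : v.r .x = u.r .x)
    (r3 : v.r .sum = u.r .sum + σ.a .iv (σ.a .pool (Q + w))) (a1 : v.a .pool = u.a .pool)
    (a2 : v.a .par = Function.update (u.a .par) (σ.a .pool (Q + w)) id) :
    Collecting p Q id B σ w v := by
  have hos := ones_succ (σ.a .st) w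
  have hb := h.bounds
  push_cast at hb
  have hIco := Finset.sum_eq_sum_Ico_succ_bot
    (f := fun j : ℕ => σ.a .st j * σ.a .iv (σ.a .pool (Q + j))) hw
  refine ⟨r1, by rw [r2, h.x]; push_cast; omega, by rw [r3, h.sum, hIco, hs]; ring,
    ⟨by omega, by rw [r3]; nlinarith⟩, fun j hj hj1 hj2 => ?_, fun x hx => ?_, fun i hi => ?_,
    fun j hj hj1 hj2 => ?_⟩
  · rw [a2]
    by_cases he : σ.a .pool (Q + j) = σ.a .pool (Q + w)
    · rw [he, Function.update_self]
    · have hjw : j ≠ w := by rintro rfl; exact he rfl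
      rw [Function.update_of_ne he]
      exact h.par j (by omega) hj1 hj2
  · rw [a2, Function.update_of_ne (hx w hw hs)]
    exact h.other x hx
  · rw [a1]; exact h.pool i (by push_cast; omega)
  · have : j ≠ w := by rintro rfl; omega
    rw [a1]; exact h.left j (by omega) hj1 hj2

/-- The item at position `w` is not selected. -/
theorem Collecting.leave {p Q id w : ℕ} {B : ℤ} {σ u v : Store}
    (h : Collecting p Q id B σ (w + 1) u) (hw : w < 2 * p - 1) (hs : σ.a .st w = 0) (hB : 0 ≤ B)
    (hst : ∀ j : ℕ, j < 2 * p - 1 → σ.a .st j = 0 ∨ σ.a .st j = 1)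
    (hones : ones (σ.a .st) (2 * p - 1) = p)
    (r1 : v.r .wpos = w) (r2 : v.r .x = u.r .x - 1) (r3 : v.r .sum = u.r .sum)
    (a1 : v.a .pool = Function.update (u.a .pool) (u.r .x - 1) (σ.a .pool (Q + w)))
    (a2 : v.a .par = u.a .par) :
    Collecting p Q id B σ w v := by
  have hos := ones_succ (σ.a .st) w
  have hb := h.bounds
  push_cast at hb
  have hx := h.x
  push_cast at hx
  have hx' : u.r .x - 1 = Q + p + w - ones (σ.a .st) w := by omega
  have hob := ones_bounds hst (j := w + 1) (by omega)
  rw [hones] at hob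
  have hIco := Finset.sum_eq_sum_Ico_succ_bot
    (f := fun j : ℕ => σ.a .st j * σ.a .iv (σ.a .pool (Q + j))) hw
  refine ⟨r1, by rw [r2, hx'], by rw [r3, h.sum, hIco, hs]; ring,
    ⟨by omega, by rw [r3]; nlinarith⟩, fun j hj hj1 hj2 => ?_, fun x hx => ?_, fun i hi => ?_,
    fun j hj hj1 hj2 => ?_⟩
  · have : j ≠ w := by rintro rfl; omega
    rw [a2]; exact h.par j (by omega) hj1 hj2
  · rw [a2]; exact h.other x hx
  · rw [a1, hx', Function.update_of_ne (by omega)]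
    exact h.pool i (by push_cast; omega)
  · rw [a1, hx']
    by_cases hjw : j = w
    · subst hjw; rw [Function.update_self]
    · have h3 := ones_bounds (m := j) (j := w + 1) (fun i hi => hst i (by omega)) (by omega)
      push_cast at h3
      rw [Function.update_of_ne (by omega)]
      exact h.left j (by omega) hj1 hj2

theorem Collecting.done {p Q id : ℕ} {B : ℤ} {σ u : Store} (h : Collecting p Q id B σ 0 u)
    (hp : 1 ≤ p) (hst : ∀ j : ℕ, j < 2 * p - 1 → σ.a .st j = 0 ∨ σ.a .st j = 1)
    (hones : ones (σ.a .st) (2 * p - 1) = p) : Collected p Q id σ u := by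
  have hz0 : ones (σ.a .st) 0 = 0 := rfl
  have hsum := h.sum
  rw [Nat.Ico_zero_eq_range] at hsum
  refine ⟨hsum, fun j => h.par j (by omega), h.other,
    fun i hi => h.pool i (by rw [hz0]; push_cast; omega), ?_⟩
  have hex : ∀ i : ℕ, ∃ j : ℕ, i < p - 1 → j < 2 * p - 1 ∧ σ.a .st j = 0 ∧
      (j : ℤ) - ones (σ.a .st) j = i := by
    intro i
    by_cases hi : i < p - 1
    · obtain ⟨j, hj⟩ := exists_zero hst i (by rw [hones]; omega)
      exact ⟨j, fun _ => hj⟩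
    · exact ⟨0, fun h => absurd h hi⟩
  choose e he using hex
  refine ⟨e, fun i hi => ?_, fun i i' hi hi' hee => ?_⟩
  · obtain ⟨h1, h2, h3⟩ := he i hi
    refine ⟨h1, h2, ?_⟩
    rw [← h.left (e i) (by omega) h1 h2, ← h3]
    congr 1; ring
  · have h1 := (he i hi).2.2
    have h2 := (he i' hi').2.2
    rw [hee] at h1
    omega

/-- The window is traversed downwards. When position `w` is treated, at most `p` of the items up to
it are selected, so the items left over are written at positions not below `Q + w`, which have all
been read. -/
theorem wp_collect {σ : Store} {p Q id : ℕ} {B : ℤ} (hp : 1 ≤ p) (hrp : σ.r .p = p)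
    (hrq : σ.r .q = Q) (hrn : σ.r .nid = id)
    (hst : ∀ j : ℕ, j < 2 * p - 1 → σ.a .st j = 0 ∨ σ.a .st j = 1)
    (hsum : ∑ j ∈ Finset.range (2 * p - 1), σ.a .st j = p)
    (hid : ∀ j : ℕ, j < 2 * p - 1 → 0 ≤ σ.a .pool (Q + j) ∧ σ.a .pool (Q + j) < C.rows)
    (hiv : ∀ j : ℕ, j < 2 * p - 1 → 0 ≤ σ.a .iv (σ.a .pool (Q + j)) ∧
      σ.a .iv (σ.a .pool (Q + j)) ≤ B) (hB : 2 * p * B ≤ C.big)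
    (hQ : Q + 2 * p ≤ C.rows) :
    WP C collect (Collected p Q id σ) (200 * p + 50) σ := by
  have hb1 := C.rows_le_big; have hb2 := C.hstride
  simp only [stride, Nat.cast_ofNat] at hb2
  have hones : ones (σ.a .st) (2 * p - 1) = p := hsum
  have hB0 : 0 ≤ B := by have := hiv 0 (by omega); omega
  have hc1 : (0 ≺ Ex.reg .wpos).cost = 3 := rfl
  refine (WP.seq (b := 2) (R := fun s => s = σ.set .sum 0)
    (WP.straight (by simp) (by simp) (Nat.le_of_ble_eq_true rfl)) ?_
    (b' := 200 * p + 45)).mono (by omega) (fun _ _ h => h)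
  rintro _ - rfl
  refine (WP.seq (b := 8) (R := fun s => s = (σ.set .sum 0).set .x (Q + 2 * p - 1))
    (WP.straight (by simp [hrp, hrq]; omega) ?_ (Nat.le_of_ble_eq_true rfl)) ?_
    (b' := 200 * p + 35)).mono (by omega) (fun _ _ h => h)
  · simp [hrp, hrq, two_mul, add_assoc]
  rintro _ - rfl
  refine (WP.seq (b := 6) (R := fun s => s = ((σ.set .sum 0).set .x (Q + 2 * p - 1)).set .wpos
    (2 * p - 1 : ℕ)) (WP.straight (by simp [hrp]; omega) ?_ (Nat.le_of_ble_eq_true rfl)) ?_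
    (b' := 200 * p + 25)).mono (by omega) (fun _ _ h => h)
  · have : (p : ℤ) + p - 1 = (2 * p - 1 : ℕ) := by omega
    simp [hrp, this]
  rintro _ - rfl
  set σ₀ := ((σ.set .sum 0).set .x (Q + 2 * p - 1)).set .wpos (2 * p - 1 : ℕ) with hσ₀
  refine (WP.loop (fun u => ∃ w : ℕ, w ≤ 2 * p - 1 ∧ Collecting p Q id B σ w u)
    (fun u => 60 * (u.r .wpos).toNat) ?_ ?_ ?_).mono ?_ ?_
  · refine ⟨2 * p - 1, le_rfl, by simp [hσ₀], ?_, by simp [hσ₀], ?_,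
      fun j h0 h1 => by omega, fun x _ => by simp [hσ₀], fun i _ => by simp [hσ₀],
      fun j h0 h1 => by omega⟩
    · rw [hones]; simp [hσ₀]; omega
    · have : ((2 * p - 1 : ℕ) : ℤ) = 2 * p - 1 := by omega
      simp [hσ₀, this]
  · intro u _ _; simp
  · rintro u hF ⟨w', hw', h⟩ hz
    rw [Ne, Ex.den_lt_eq_zero] at hz
    have hrw := h.wpos
    simp [hrw] at hz
    obtain ⟨w, rfl⟩ : ∃ w, w' = w + 1 := ⟨w' - 1, by omega⟩
    have r1 : u.r .q = Q := by rw [hF.r .q rfl]; simp [hσ₀, hrq]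
    have r2 : u.r .nid = id := by rw [hF.r .nid rfl]; simp [hσ₀, hrn]
    have a1 : u.a .iv = σ.a .iv := by rw [hF.a .iv rfl]; simp [hσ₀]
    have a2 : u.a .st = σ.a .st := by rw [hF.a .st rfl]; simp [hσ₀]
    have hw : w < 2 * p - 1 := by omega
    have hsw := hst w hw
    have h1 := hid w hw
    have h2 := hiv w hw
    have hob := ones_bounds hst (j := w) (by omega)
    have hob1 := ones_bounds hst (j := w + 1) (by omega)
    have hob' := ones_bounds (m := w) (j := 0) (fun j hj => hst j (by omega)) (by omega)
    have hos := ones_succ (σ.a .st) w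
    have hz0 : ones (σ.a .st) 0 = 0 := rfl
    rw [hones] at hob hob1
    have hx := h.x
    have hsm := h.bounds
    have hsmB' : (2 * (p : ℤ) - 1 - (w + 1)) * B + B ≤ 2 * p * B := by nlinarith
    push_cast at hrw hx hsm
    have hread : u.a .pool (Q + w) = σ.a .pool (Q + w) := h.pool _ (by push_cast; omega)
    have e2 : (w : ℤ) + 1 - 1 = w := by ring
    refine ⟨50, ?_⟩
    refine (WP.seq (b := 4) (R := fun v => v = u.set .wpos w)
      (WP.straight (by simp [hrw]; omega) (by simp [hrw]) (Nat.le_of_ble_eq_true rfl)) ?_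
      (b' := 46)).mono (by omega) (fun _ _ h => h)
    rintro _ - rfl
    refine (WP.seq (b := 10) (R := fun v => v = (u.set .wpos w).set .t (σ.a .pool (Q + w)))
      (WP.straight (by simp [r1]; omega) (by simp [r1, hread])
        (Nat.le_of_ble_eq_true rfl)) ?_ (b' := 36)).mono (by omega) (fun _ _ h => h)
    rintro _ - rfl
    refine (WP.ite (b := 24) (by simp; omega) (fun hz => ?_) (fun hz => ?_)).mono
      (Nat.le_of_ble_eq_true rfl) (fun _ _ h => h)
    · have hsw1 : σ.a .st w = 1 := by
        simp [a2] at hz; omega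
      refine WP.straight ?_ ⟨⟨w, by omega, h.select hw hsw1 h2.1 h2.2 (by simp) (by simp)
        (by simp [a1]) (by simp) (by simp [r2])⟩, ?_⟩ (Nat.le_of_ble_eq_true rfl)
      · simp [a1]; omega
      · simp [hrw, hc1]; omega
    · have hsw0 : σ.a .st w = 0 := by
        simpa [a2] using hz
      refine WP.straight ?_ ⟨⟨w, by omega, h.leave hw hsw0 hB0 hst hones (by simp) (by simp)
        (by simp) (by simp) (by simp)⟩, ?_⟩ (Nat.le_of_ble_eq_true rfl)
      · simp [hx]; omega
      · simp [hrw, hc1]; omega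
  · simp [hσ₀, hc1]; omega
  · rintro u hF ⟨⟨w, hw, h⟩, hz⟩
    rw [Ex.den_lt_eq_zero] at hz
    have hrw := h.wpos
    simp [hrw] at hz
    subst hz
    exact h.done hp hst hones

/-! ### Disjoint items and the sums that they cover. -/

/-- Items `0, …, id - 1`: the item `x < 2 * n - 1` covers the position `x`, and any other item
covers the positions covered by the items of which it is the parent. -/
structure Items (n id : ℕ) (cov : ℤ → Finset ℕ) (par iv : ℤ → ℤ) : Prop where
  leaf : ∀ i : ℕ, i < 2 * n - 1 → cov i = {i}
  le : 2 * n - 1 ≤ id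
  -- The number `0` can stand for a missing parent, because item `0` is a leaf. Parents have larger
  -- numbers than their children.
  parent : ∀ x : ℤ, 0 ≤ x → x < id → par x = 0 ∨
    (x < par x ∧ 2 * (n : ℤ) - 1 ≤ par x ∧ par x < id)
  node : ∀ y : ℤ, 2 * (n : ℤ) - 1 ≤ y → y < id → ∀ i, i ∈ cov y ↔
    ∃ x : ℤ, 0 ≤ x ∧ x < y ∧ par x = y ∧ i ∈ cov x
  value : ∀ x : ℤ, 0 ≤ x → x < id → 0 ≤ iv x ∧ iv x < n

/-- An item without parent, which covers `D` positions with the sum `D * iv x` modulo `n`. -/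
structure Item (n : ℕ) (a : ℕ → ℤ) (id : ℕ) (cov : ℤ → Finset ℕ) (par iv : ℤ → ℤ) (D : ℕ)
    (x : ℤ) : Prop where
  pos : 0 ≤ x
  lt : x < id
  par : par x = 0
  card : (cov x).card = D
  sub : ∀ i ∈ cov x, i < 2 * n - 1
  sum : ∑ i ∈ cov x, a i ≡ D * iv x [ZMOD n]

/-- The first `k` entries of the pool are items that cover `E` positions, and the `R` entries
after position `Q` are items that cover `D` positions; all these items are disjoint. -/
structure Live (n : ℕ) (a : ℕ → ℤ) (id : ℕ) (cov : ℤ → Finset ℕ) (par iv pool : ℤ → ℤ)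
    (D E k Q R : ℕ) : Prop where
  old : ∀ i : ℕ, i < R → Item n a id cov par iv D (pool (Q + i))
  new : ∀ i : ℕ, i < k → Item n a id cov par iv E (pool i)
  disj_old : ∀ i j : ℕ, i < R → j < R → i ≠ j → Disjoint (cov (pool (Q + i))) (cov (pool (Q + j)))
  disj_new : ∀ i j : ℕ, i < k → j < k → i ≠ j → Disjoint (cov (pool i)) (cov (pool j))
  disj : ∀ i j : ℕ, i < k → j < R → Disjoint (cov (pool i)) (cov (pool (Q + j)))

theorem Item.ne_of_disjoint {n id D : ℕ} {a : ℕ → ℤ} {cov : ℤ → Finset ℕ} {par iv : ℤ → ℤ} {x y : ℤ}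
    (h : Item n a id cov par iv D x) (hD : 1 ≤ D) (hd : Disjoint (cov y) (cov x)) : y ≠ x := by
  rintro rfl
  rw [disjoint_self, Finset.bot_eq_empty] at hd
  have := h.card
  rw [hd, Finset.card_empty] at this
  omega

theorem Item.extend {n id D : ℕ} {a : ℕ → ℤ} {cov cov' : ℤ → Finset ℕ} {par par' iv iv' : ℤ → ℤ}
    {x : ℤ} (h : Item n a id cov par iv D x) (hc : cov' x = cov x) (hp : par' x = par x)
    (hv : iv' x = iv x) : Item n a (id + 1) cov' par' iv' D x :=
  ⟨h.pos, by have := h.lt; push_cast; omega, by rw [hp, h.par], by rw [hc, h.card],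
    by rw [hc]; exact h.sub, by rw [hc, hv]; exact h.sum⟩

/-- The union of the selected items has the sum `D * p * u` modulo `n`, where `p * u` is the sum of
their values. As `n = D * (p * N)`, only `u` modulo `N` matters. The new item is stored in front of
the window, which is possible because `k ≤ Q`. -/
theorem Live.round {n id D p N k Q R : ℕ} {a : ℕ → ℤ} {cov : ℤ → Finset ℕ} {σ σ' : Store}
    (hI : Items n id cov (σ.a .par) (σ.a .iv))
    (hL : Live n a id cov (σ.a .par) (σ.a .iv) (σ.a .pool) D (D * p) k Q R)
    (hC : Collected p Q id σ σ') (hn : D * (p * N) = n) (hn1 : 1 ≤ n) (hR : 2 * p - 1 ≤ R)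
    (hkQ : k ≤ Q) (hst : ∀ j : ℕ, j < 2 * p - 1 → σ.a .st j = 0 ∨ σ.a .st j = 1)
    (hcard : ∑ j ∈ Finset.range (2 * p - 1), σ.a .st j = p)
    (hdvd : ∑ j ∈ Finset.range (2 * p - 1), σ.a .st j * (σ.a .iv (σ.a .pool (Q + j)) % p) ≡ 0
      [ZMOD p]) :
    ∃ cov' : ℤ → Finset ℕ, Items n (id + 1) cov' (Function.update (σ'.a .par) id 0)
        (Function.update (σ.a .iv) id (σ'.r .sum / p % N)) ∧
      Live n a (id + 1) cov' (Function.update (σ'.a .par) id 0)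
        (Function.update (σ.a .iv) id (σ'.r .sum / p % N))
        (Function.update (σ'.a .pool) k id) D (D * p) (k + 1) (Q + p) (R - p) := by
  have hDpN : 0 < D * (p * N) := by omega
  have hD : 1 ≤ D := Nat.pos_of_mul_pos_right hDpN
  have hpN : 0 < p * N := Nat.pos_of_mul_pos_left hDpN
  have hp : 1 ≤ p := Nat.pos_of_mul_pos_right hpN
  have hN : 1 ≤ N := Nat.pos_of_mul_pos_left hpN
  have hNn : (N : ℤ) ≤ n := by
    have : 1 * N ≤ (D * p) * N := Nat.mul_le_mul_right _ (Nat.mul_pos hD hp)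
    rw [mul_assoc, hn] at this; omega
  set par := σ.a .par with hpar
  set iv := σ.a .iv with hiv
  set g : ℕ → ℤ := fun j => σ.a .pool (Q + j) with hg
  set T : Finset ℕ := (Finset.range (2 * p - 1)).filter fun j : ℕ => σ.a .st j = 1 with hT
  have hmemT : ∀ j, j ∈ T ↔ j < 2 * p - 1 ∧ σ.a .st j = 1 := by simp [hT]
  have hsumT : ∀ f : ℕ → ℤ, ∑ j ∈ Finset.range (2 * p - 1), σ.a .st j * f j = ∑ j ∈ T, f j := by
    intro f
    rw [hT, Finset.sum_filter]
    refine Finset.sum_congr rfl fun j hj => ?_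
    rcases hst j (Finset.mem_range.1 hj) with h | h <;> simp [h]
  have hcardT : (T.card : ℤ) = p := by
    rw [← hcard, Finset.card_eq_sum_ones]
    push_cast
    rw [← hsumT fun _ => 1]; simp
  have hTi : ∀ j ∈ T, Item n a id cov par iv D (g j) := fun j hj =>
    hL.old j (by have := ((hmemT j).1 hj).1; omega)
  have hselT : ∀ j ∈ T, σ'.a .par (g j) = id := fun j hj =>
    hC.par j ((hmemT j).1 hj).1 ((hmemT j).1 hj).2
  have hunsel : ∀ x : ℤ, (∀ j ∈ T, x ≠ g j) → σ'.a .par x = par x := fun x hx =>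
    hC.other x fun j h1 h2 => hx j ((hmemT j).2 ⟨h1, h2⟩)
  have hid0 := hI.le
  set U := T.biUnion fun j => cov (g j) with hU
  set cov' := Function.update cov id U with hcov'
  set par' := Function.update (σ'.a .par) id 0 with hpar'
  set v := σ'.r .sum / p % N with hv
  set iv' := Function.update iv id v with hiv'
  have hc : ∀ x : ℤ, x < id → cov' x = cov x := fun x hx => Function.update_of_ne (by omega) _ _
  have hi : ∀ x : ℤ, x < id → iv' x = iv x := fun x hx => Function.update_of_ne (by omega) _ _
  have hpr : ∀ x : ℤ, x < id → par' x = σ'.a .par x := fun x hx =>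
    Function.update_of_ne (by omega) _ _
  have hv01 : 0 ≤ v ∧ v < N :=
    ⟨Int.emod_nonneg _ (by omega), Int.emod_lt_of_pos _ (by omega)⟩
  -- the new item
  have hnewI : Item n a (id + 1) cov' par' iv' (D * p) id := by
    refine ⟨by omega, by push_cast; omega, by simp [hpar'], ?_, ?_, ?_⟩
    · rw [hcov', Function.update_self, hU, Finset.card_biUnion]
      · rw [Finset.sum_congr rfl fun j hj => (hTi j hj).card, Finset.sum_const, smul_eq_mul,
          mul_comm]
        congr 1; exact_mod_cast hcardT
      · intro i hi' j hj hij
        have h1 := ((hmemT i).1 hi').1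
        have h2 := ((hmemT j).1 hj).1
        exact hL.disj_old i j (by omega) (by omega) hij
    · rw [hcov', Function.update_self, hU]
      intro i hi'
      obtain ⟨j, hj, hij⟩ := Finset.mem_biUnion.1 hi'
      exact (hTi j hj).sub i hij
    · rw [hcov', Function.update_self, hiv', Function.update_self, hU, Finset.sum_biUnion]
      swap
      · intro i hi' j hj hij
        have h1 := ((hmemT i).1 hi').1
        have h2 := ((hmemT j).1 hj).1
        exact hL.disj_old i j (by omega) (by omega) hij
      have h1 : ∑ j ∈ T, ∑ i ∈ cov (g j), a i ≡ ∑ j ∈ T, (D : ℤ) * iv (g j) [ZMOD n] :=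
        Int.ModEq.sum fun j hj => (hTi j hj).sum
      rw [← Finset.mul_sum, ← hsumT (fun j => iv (g j))] at h1
      rw [← hC.sum] at h1
      have h2 : (p : ℤ) ∣ σ'.r .sum := by
        rw [← Int.modEq_zero_iff_dvd]
        refine Int.ModEq.trans ?_ hdvd
        rw [hC.sum]
        exact Int.ModEq.sum fun j hj => (Int.mod_modEq _ _).symm.mul_left _
      obtain ⟨u, hu⟩ := h2
      have hv' : v = u % N := by
        rw [hv, hu, Int.mul_ediv_cancel_left _ (by omega)]
      refine h1.trans ?_
      rw [hu, hv', Int.modEq_iff_dvd, ← hn]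
      have h3 := Int.emod_add_mul_ediv u N
      refine ⟨-(u / N), ?_⟩
      push_cast
      linear_combination (D : ℤ) * p * h3
  have hpos : ∀ x : ℤ, 0 ≤ x → x < id → (∃ j ∈ T, x = g j) ∨ ∀ j ∈ T, x ≠ g j := by
    intro x _ _
    by_cases h : ∃ j ∈ T, x = g j
    · exact Or.inl h
    · right; intro j hj he; exact h ⟨j, hj, he⟩
  have hItems : Items n (id + 1) cov' par' iv' := by
    refine ⟨fun i hi' => ?_, by omega, fun x h0 h1 => ?_, fun y h0 h1 i => ?_, fun x h0 h1 => ?_⟩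
    · rw [hc i (by omega)]; exact hI.leaf i hi'
    · by_cases hx : x = id
      · left; rw [hx]; simp [hpar']
      · push_cast at h1
        rw [hpr x (by omega)]
        rcases hpos x h0 (by omega) with ⟨j, hj, rfl⟩ | h
        · right; rw [hselT j hj]; push_cast; omega
        · rw [hunsel x h]
          rcases hI.parent x h0 (by omega) with h | h
          · exact Or.inl h
          · right; push_cast; omega
    · push_cast at h1
      by_cases hy : y = id
      · subst hy
        rw [hcov', Function.update_self, hU, Finset.mem_biUnion]
        constructor
        · rintro ⟨j, hj, hij⟩
          have h := hTi j hj
          refine ⟨g j, h.pos, h.lt, ?_, ?_⟩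
          · rw [hpr _ h.lt, hselT j hj]
          · rw [Function.update_of_ne (by have := h.lt; omega)]; exact hij
        · rintro ⟨x, hx0, hx1, hx2, hx3⟩
          rw [Function.update_of_ne (by omega)] at hx3
          rw [hpr x hx1] at hx2
          rcases hpos x hx0 hx1 with ⟨j, hj, rfl⟩ | h
          · exact ⟨j, hj, hx3⟩
          · rw [hunsel x h] at hx2
            have := hI.parent x hx0 hx1
            omega
      · rw [hc y (by omega), hI.node y h0 (by omega)]
        constructor
        · rintro ⟨x, hx0, hx1, hx2, hx3⟩
          refine ⟨x, hx0, hx1, ?_, by rwa [hc x (by omega)]⟩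
          rw [hpr x (by omega), hunsel x, hx2]
          rintro j hj rfl
          have := (hTi j hj).par
          omega
        · rintro ⟨x, hx0, hx1, hx2, hx3⟩
          rw [hc x (by omega)] at hx3
          rw [hpr x (by omega)] at hx2
          refine ⟨x, hx0, hx1, ?_, hx3⟩
          rcases hpos x hx0 (by omega) with ⟨j, hj, rfl⟩ | h
          · rw [hselT j hj] at hx2; omega
          · rwa [hunsel x h] at hx2
    · push_cast at h1
      by_cases hx : x = id
      · subst hx; simp only [hiv', Function.update_self]; omega
      · rw [hi x (by omega)]; exact hI.value x h0 (by omega)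
  obtain ⟨e, he, hinj⟩ := hC.left
  -- The old position, relative to `Q`, of the item that is now at position `Q + p + i`: the first
  -- `p - 1` are the items left over from the window, all others have not moved.
  set e' : ℕ → ℕ := fun i => if i < p - 1 then e i else i + p with he'
  have he1 : ∀ i, i < R - p → e' i < R ∧ e' i ∉ T ∧
      Function.update (σ'.a .pool) k (id : ℤ) ((Q + p : ℕ) + i) = g (e' i) := by
    intro i hiR
    rw [Function.update_of_ne (by push_cast; omega), hmemT]
    by_cases hip : i < p - 1
    · obtain ⟨h1, h2, h3⟩ := he i hip
      simp only [he', if_pos hip]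
      push_cast
      exact ⟨by omega, by omega, h3⟩
    · simp only [he', if_neg hip, hg]
      refine ⟨by omega, by omega, ?_⟩
      rw [hC.pool _ (by push_cast; omega)]
      congr 1; push_cast; ring
  have he2 : ∀ i j, i < R - p → j < R - p → i ≠ j → e' i ≠ e' j := by
    intro i j hiR hjR hij hee
    simp only [he'] at hee
    split_ifs at hee with h1 h2 h2
    · exact hij (hinj i j h1 h2 hee)
    · have := (he i h1).1; omega
    · have := (he j h2).1; omega
    · omega
  have hpk : ∀ i : ℕ, i < k → Function.update (σ'.a .pool) k (id : ℤ) i = σ.a .pool i := by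
    intro i hik
    rw [Function.update_of_ne (by omega), hC.pool _ (by omega)]
  have hcg : ∀ j, j < R → cov' (g j) = cov (g j) := fun j hj => hc _ (hL.old j hj).lt
  have hcp : ∀ j : ℕ, j < k → cov' (σ.a .pool j) = cov (σ.a .pool j) := fun j hj =>
    hc _ (hL.new j hj).lt
  have hcid : cov' id = U := by rw [hcov', Function.update_self]
  refine ⟨cov', hItems, ⟨fun i hiR => ?_, fun i hik => ?_, fun i j hiR hjR hij => ?_,
    fun i j hik hjk hij => ?_, fun i j hik hjR => ?_⟩⟩
  · obtain ⟨h1, h2, h3⟩ := he1 i hiR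
    rw [h3]
    have h4 := hL.old _ h1
    refine h4.extend (hc _ h4.lt) ?_ (hi _ h4.lt)
    rw [hpr _ h4.lt]
    refine hunsel _ fun j hj => ?_
    refine (hTi j hj).ne_of_disjoint hD (hL.disj_old _ _ h1 ?_ ?_)
    · have := ((hmemT j).1 hj).1; omega
    · rintro rfl; exact h2 hj
  · by_cases hi' : i = k
    · subst hi'; rw [Function.update_self]; exact hnewI
    · rw [hpk i (by omega)]
      have h4 := hL.new i (by omega)
      refine h4.extend (hc _ h4.lt) ?_ (hi _ h4.lt)
      rw [hpr _ h4.lt]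
      refine hunsel _ fun j hj => ?_
      refine (hTi j hj).ne_of_disjoint hD (hL.disj _ _ (by omega) ?_)
      have := ((hmemT j).1 hj).1; omega
  · obtain ⟨h1, h2, h3⟩ := he1 i hiR
    obtain ⟨g1, g2, g3⟩ := he1 j hjR
    rw [h3, g3, hcg _ h1, hcg _ g1]
    exact hL.disj_old _ _ h1 g1 (he2 i j hiR hjR hij)
  · have hkey : ∀ i : ℕ, i < k → Disjoint (cov (σ.a .pool i)) U := fun i hi' => by
      rw [hU, Finset.disjoint_biUnion_right]
      intro j hj
      exact hL.disj i j hi' (by have := ((hmemT j).1 hj).1; omega)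
    by_cases hi' : i = k
    · subst hi'
      rw [Function.update_self, hpk j (by omega), hcid, hcp j (by omega)]
      exact (hkey j (by omega)).symm
    · by_cases hj' : j = k
      · subst hj'
        rw [Function.update_self, hpk i (by omega), hcid, hcp i (by omega)]
        exact hkey i (by omega)
      · rw [hpk i (by omega), hpk j (by omega), hcp i (by omega), hcp j (by omega)]
        exact hL.disj_new i j (by omega) (by omega) hij
  · obtain ⟨g1, g2, g3⟩ := he1 j hjR
    rw [g3, hcg _ g1]
    by_cases hi' : i = k
    · subst hi'
      rw [Function.update_self, hcid, hU, Finset.disjoint_biUnion_left]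
      intro l hl
      refine hL.disj_old _ _ ?_ g1 ?_
      · have := ((hmemT l).1 hl).1; omega
      · rintro rfl; exact g2 hl
    · rw [hpk i (by omega), hcp i (by omega)]
      exact hL.disj i _ (by omega) g1

/-- The registers and arrays represent `id` items, of which those in the pool are as described
by `Live`. -/
structure Pooled (n : ℕ) (a : ℕ → ℤ) (D E k Q R id : ℕ) (σ : Store) : Prop where
  reg_n : σ.r .n = n
  reg_nid : σ.r .nid = id
  items : ∃ cov, Items n id cov (σ.a .par) (σ.a .iv) ∧
    Live n a id cov (σ.a .par) (σ.a .iv) (σ.a .pool) D E k Q R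

theorem Pooled.congr {n D E k Q R id : ℕ} {a : ℕ → ℤ} {σ σ' : Store}
    (h : Pooled n a D E k Q R id σ) (hn : σ'.r .n = σ.r .n) (hid : σ'.r .nid = σ.r .nid)
    (ha : σ'.a = σ.a) : Pooled n a D E k Q R id σ' :=
  ⟨hn.trans h.reg_n, hid.trans h.reg_nid, by rw [ha]; exact h.items⟩

/-- Combine `p` of the next `2 * p - 1` items to a new item. -/
def round : Cd :=
  loadWindow ;; prime ;; collect ;;
  .put .iv (.reg .nid) ((.reg .sum / .reg .p) % .reg .sub) ;;
  .put .par (.reg .nid) 0 ;;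
  .put .pool (.reg .k) (.reg .nid) ;;
  .nid ::= .reg .nid + 1 ;;
  .q ::= .reg .q + .reg .p

theorem wp_round {σ : Store} {n p N D k Q R id : ℕ} {a : ℕ → ℤ} (hp : p.Prime)
    (hn : D * (p * N) = n) (hn1 : 1 ≤ n) (hrp : σ.r .p = p) (hrs : σ.r .sub = N)
    (hrq : σ.r .q = Q) (hrk : σ.r .k = k) (hkQ : k ≤ Q) (hR : 2 * p - 1 ≤ R)
    (h : Pooled n a D (D * p) k Q R id σ) (hr : 8 * n ≤ C.rows) (hid : id < C.rows)
    (hQ : Q + 2 * p ≤ C.rows) (hbig : 10 * ((n : ℤ) * n) ≤ C.big) (hbig' : 2 ^ 120 ≤ C.big) :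
    WP C round (fun s => Pooled n a D (D * p) (k + 1) (Q + p) (R - p) (id + 1) s ∧
      s.r .q = (Q + p : ℕ)) (2 ^ 138 * p) σ := by
  have hb1 := C.rows_le_big; have hb2 := C.hstride
  simp only [stride, Nat.cast_ofNat] at hb2
  obtain ⟨hrn, hrid, cov, hI, hL⟩ := h
  have hp1 := hp.one_le
  have hpn : p ≤ n := Nat.le_of_dvd hn1 ⟨D * N, by rw [← hn]; ring⟩
  have hNn : N ≤ n := Nat.le_of_dvd hn1 ⟨D * p, by rw [← hn]; ring⟩
  have hN1 : 1 ≤ N := by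
    rcases Nat.eq_zero_or_pos N with h | h
    · rw [h] at hn; simp at hn; omega
    · exact h
  have hpp : 10 * ((p : ℤ) * p) ≤ C.big := by
    have : (p : ℤ) * p ≤ n * n := by exact_mod_cast Nat.mul_le_mul hpn hpn
    omega
  have hpn2 : 2 * (p : ℤ) * n ≤ C.big := by
    have : (p : ℤ) * n ≤ n * n := by exact_mod_cast Nat.mul_le_mul_right n hpn
    have : (0 : ℤ) ≤ (n : ℤ) * n := by positivity
    rw [mul_assoc]; omega
  have hwin : ∀ j : ℕ, j < 2 * p - 1 → 0 ≤ σ.a .pool (Q + j) ∧ σ.a .pool (Q + j) < id ∧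
      0 ≤ σ.a .iv (σ.a .pool (Q + j)) ∧ σ.a .iv (σ.a .pool (Q + j)) < n := fun j hj => by
    have h1 := hL.old j (by omega)
    exact ⟨h1.pos, h1.lt, hI.value _ h1.pos h1.lt⟩
  have hwin' : ∀ j : ℕ, j < 2 * p - 1 → 0 ≤ σ.a .pool (Q + j) ∧ σ.a .pool (Q + j) < C.rows :=
    fun j hj => by have := hwin j hj; omega
  refine (WP.seq (wp_loadWindow hp1 hrp hrq hQ hwin') ?_
    (b' := 2 ^ 137 * p + (200 * p + 50 + 100))).mono (by norm_num; omega) (fun _ _ h => h)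
  intro σ₁ hF₁ hv
  refine WP.seq (wp_prime hp (by rw [hF₁.r .p rfl, hrp]) (fun x hx => ?_) (by omega) hpp hbig') ?_
  · rw [hv x hx]
    exact ⟨Int.emod_nonneg _ (by omega), Int.emod_lt_of_pos _ (by omega)⟩
  rintro σ₂ hF₂ ⟨hst, hcard, hdvd⟩
  have q1 : σ₂.a .iv = σ.a .iv := by rw [hF₂.a .iv rfl, hF₁.a .iv rfl]
  have q2 : σ₂.a .pool = σ.a .pool := by rw [hF₂.a .pool rfl, hF₁.a .pool rfl]
  have q3 : σ₂.a .par = σ.a .par := by rw [hF₂.a .par rfl, hF₁.a .par rfl]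
  have r1 : σ₂.r .p = p := by rw [hF₂.r .p rfl, hF₁.r .p rfl, hrp]
  have r2 : σ₂.r .q = Q := by rw [hF₂.r .q rfl, hF₁.r .q rfl, hrq]
  have r3 : σ₂.r .nid = id := by rw [hF₂.r .nid rfl, hF₁.r .nid rfl, hrid]
  have r4 : σ₂.r .n = n := by rw [hF₂.r .n rfl, hF₁.r .n rfl, hrn]
  have r5 : σ₂.r .sub = N := by rw [hF₂.r .sub rfl, hF₁.r .sub rfl, hrs]
  have r6 : σ₂.r .k = k := by rw [hF₂.r .k rfl, hF₁.r .k rfl, hrk]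
  refine WP.seq (wp_collect (id := id) (B := n) hp1 r1 r2 r3 hst hcard
    (fun j hj => by rw [q2]; exact hwin' j hj)
    (fun j hj => by rw [q1, q2]; have := hwin j hj; omega) hpn2 hQ) ?_
  intro σ₃ hF₃ hC
  have s1 : σ₃.r .p = p := by rw [hF₃.r .p rfl, r1]
  have s2 : σ₃.r .q = Q := by rw [hF₃.r .q rfl, r2]
  have s3 : σ₃.r .nid = id := by rw [hF₃.r .nid rfl, r3]
  have s4 : σ₃.r .n = n := by rw [hF₃.r .n rfl, r4]
  have s5 : σ₃.r .sub = N := by rw [hF₃.r .sub rfl, r5]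
  have s6 : σ₃.r .k = k := by rw [hF₃.r .k rfl, r6]
  have p1 : σ₃.a .iv = σ₂.a .iv := hF₃.a .iv rfl
  have hsum : 0 ≤ σ₃.r .sum ∧ σ₃.r .sum ≤ C.big := by
    rw [hC.sum]
    have hterm : ∀ j ∈ Finset.range (2 * p - 1), 0 ≤ σ₂.a .st j * σ₂.a .iv (σ₂.a .pool (Q + j)) ∧
        σ₂.a .st j * σ₂.a .iv (σ₂.a .pool (Q + j)) ≤ n := fun j hj => by
      have hj := Finset.mem_range.1 hj
      have h1 := hwin j hj
      rw [q1, q2]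
      rcases hst j hj with h | h <;> rw [h] <;> omega
    refine ⟨Finset.sum_nonneg fun j hj => (hterm j hj).1, ?_⟩
    refine (Finset.sum_le_card_nsmul _ _ _ fun j hj => (hterm j hj).2).trans ?_
    rw [Finset.card_range, nsmul_eq_mul]
    have : ((2 * p - 1 : ℕ) : ℤ) = 2 * p - 1 := by omega
    rw [this]
    nlinarith
  have hdiv := Int.ediv_nonneg hsum.1 (Int.natCast_nonneg p)
  have hdiv' := Int.ediv_le_self (p : ℤ) hsum.1
  have hRnd := Live.round (n := n) (a := a) (cov := cov) (σ := σ₂) (σ' := σ₃) (N := N) (D := D)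
    (k := k) (R := R) (by rw [q1, q3]; exact hI) (by rw [q1, q2, q3]; exact hL) hC hn hn1 hR hkQ
    hst hcard (by
      refine Int.ModEq.trans (Int.ModEq.sum fun j hj => ?_) hdvd
      rw [hv j (Finset.mem_range.1 hj), q1, q2])
  rw [← p1] at hRnd
  obtain ⟨cov', hI', hL'⟩ := hRnd
  refine WP.straight ?_ ⟨⟨?_, ?_, cov', ?_, ?_⟩, ?_⟩ (Nat.le_of_ble_eq_true rfl)
  · simp [s1, s2, s3, s5, s6]; omega
  · simp [s4]
  · simp [s3]
  · simpa [s1, s3, s5] using hI'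
  · simpa [s1, s3, s5, s6] using hL'
  · simp [s1, s2]

/-! ### The descent through the prime factors. -/

/-- Split the least prime factor off `lev`. -/
def factor : Cd :=
  .p ::= 2 ;; .loop (.reg .lev % .reg .p) (.p ::= .reg .p + 1)

theorem wp_factor {σ : Store} {M : ℕ} (hM : 2 ≤ M) (hrl : σ.r .lev = M) (hb : 2 * (M : ℤ) ≤ C.big) :
    WP C factor (fun s => s = σ.set .p M.minFac) (20 * M + 10) σ := by
  have hb2 := C.hstride
  simp only [stride, Nat.cast_ofNat] at hb2
  have hmf := Nat.minFac_le (n := M) (by omega)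
  have hmp := (Nat.minFac_prime (n := M) (by omega)).two_le
  have hc : (Ex.reg .lev % Ex.reg .p).cost = 3 := rfl
  refine (WP.seq (b := 2) (R := fun s => s = σ.set .p 2)
    (WP.straight (by simp) (by simp) (Nat.le_of_ble_eq_true rfl)) ?_
    (b' := 20 * M + 4)).mono (by omega) (fun _ _ h => h)
  rintro _ - rfl
  refine (WP.loop (fun s => ∃ p : ℕ, 2 ≤ p ∧ p ≤ M.minFac ∧ s = σ.set .p p)
    (fun s => 20 * (M - (s.r .p).toNat)) ⟨2, le_rfl, hmp, rfl⟩ ?_ ?_).mono ?_ ?_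
  · rintro _ _ ⟨p, h1, h2, rfl⟩
    simp; omega
  · rintro _ _ ⟨p, h1, h2, rfl⟩ hz
    simp [hrl] at hz
    have hne : p ≠ M.minFac := by
      rintro rfl
      exact hz (by exact_mod_cast Nat.minFac_dvd M)
    refine ⟨4, WP.straight (by simp; omega) ⟨⟨p + 1, by omega, by omega, ?_⟩, ?_⟩
      (Nat.le_of_ble_eq_true rfl)⟩
    · ext x
      · simp; split_ifs <;> rfl
      · simp
    · simp [hc]; omega
  · simp [hc]
  · rintro _ _ ⟨⟨p, h1, h2, rfl⟩, hz⟩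
    simp [hrl] at hz
    have : M.minFac ≤ p := Nat.minFac_le_of_dvd h1 (by exact_mod_cast hz)
    rw [show p = M.minFac by omega]

/-- Combine the items of one level to those of the next level. -/
def level : Cd :=
  factor ;;
  .sub ::= .reg .lev / .reg .p ;;
  .q ::= 0 ;;
  .for .k 0 (.reg .sub + .reg .sub - 1) round ;;
  .lev ::= .reg .sub

/-- Each round consumes `p` items, so before the last of the `2 * N - 1` rounds exactly `2 * p - 1`
items remain. The rounds cost `O(p)` each, hence `O(M)` together, and so does the trial division. -/
theorem wp_level {σ : Store} {n M D id : ℕ} {a : ℕ → ℤ} (hM : 2 ≤ M) (hn : D * M = n)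
    (hn1 : 1 ≤ n) (hrl : σ.r .lev = M)
    (h : Pooled n a D 0 0 0 (2 * M - 1) id σ) (hid : id + 2 * M ≤ 4 * n) (hr : 8 * n ≤ C.rows)
    (hbig : 10 * ((n : ℤ) * n) ≤ C.big) (hbig' : 2 ^ 120 ≤ C.big) :
    WP C level (fun s => ∃ N D' id' : ℕ, 2 * N ≤ M ∧ 1 ≤ N ∧ D' * N = n ∧ s.r .lev = N ∧
      Pooled n a D' 0 0 0 (2 * N - 1) id' s ∧ id' + 2 * N ≤ 4 * n) (2 ^ 141 * M) σ := by
  have hb1 := C.rows_le_big; have hb2 := C.hstride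
  simp only [stride, Nat.cast_ofNat] at hb2
  have hMn : M ≤ n := Nat.le_of_dvd hn1 ⟨D, by rw [← hn]; ring⟩
  have hp := Nat.minFac_prime (n := M) (by omega)
  obtain ⟨N, hN⟩ := Nat.minFac_dvd M
  set p := M.minFac with hpdef
  have hp2 := hp.two_le
  have hN1 : 1 ≤ N := by
    rcases Nat.eq_zero_or_pos N with h | h
    · rw [h] at hN; omega
    · exact h
  have hpN : 2 * N ≤ M := by rw [hN]; exact Nat.mul_le_mul_right N hp2
  have hpM : p ≤ M := Nat.minFac_le (by omega)
  have hdivN : (M : ℤ) / p = N := by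
    rw [hN]; push_cast; exact Int.mul_ediv_cancel_left _ (by omega)
  have hpNM : p * (2 * N - 1) + p = 2 * M := by
    obtain ⟨j, rfl⟩ : ∃ j, N = j + 1 := ⟨N - 1, by omega⟩
    rw [hN, show 2 * (j + 1) - 1 = 2 * j + 1 by omega]; ring
  have hn' : D * (p * N) = n := by rw [← hN, hn]
  refine (WP.seq (wp_factor hM hrl (by omega)) ?_
    (b' := 8 + 10 + (2 ^ 140 * M) + 20)).mono (by norm_num; omega) (fun _ _ h => h)
  rintro _ - rfl
  refine (WP.seq (b := 8) (R := fun s => s = (σ.set .p p).set .sub N)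
    (WP.straight (by simp [← hpdef, hrl, hdivN]; omega) (by simp [← hpdef, hrl, hdivN])
      (Nat.le_of_ble_eq_true rfl)) ?_ (b' := 10 + (2 ^ 140 * M) + 20)).mono (by omega)
    (fun _ _ h => h)
  rintro _ - rfl
  refine (WP.seq (b := 10) (R := fun s => s = ((σ.set .p p).set .sub N).set .q 0)
    (WP.straight (by simp) (by simp)
      (Nat.le_of_ble_eq_true rfl)) ?_ (b' := (2 ^ 140 * M) + 20)).mono (by omega)
    (fun _ _ h => h)
  rintro _ - rfl
  set σ₁ := ((σ.set .p p).set .sub N).set .q 0 with hσ₁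
  refine WP.seq (R := fun s => s.r .sub = N ∧
    Pooled n a D (D * p) (2 * N - 1) (p * (2 * N - 1)) (2 * M - 1 - p * (2 * N - 1))
      (id + (2 * N - 1)) s)
    (WP.forC (a := 0) (b := 2 * N - 1) (K := 2 ^ 138 * p)
    (fun k s => s.r .q = (p * k : ℕ) ∧
      Pooled n a D (D * p) k (p * k) (2 * M - 1 - p * k) (id + k) s)
    (by omega) (by simp) (by simp) rfl ?_ (by omega) ⟨?_, ?_⟩ ?_ ?_ ?_) ?_
  · intro s hF
    have : s.r .sub = N := by rw [hF.r .sub rfl]; simp [hσ₁]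
    simp [this]; omega
  · simp [hσ₁]
  · obtain ⟨g1, g2, cov, hI, hL⟩ := h
    refine ⟨by simp [hσ₁, g1], by simp [hσ₁, g2], cov, by simpa [hσ₁] using hI, ?_⟩
    simp only [hσ₁, Store.set_a, mul_zero, Nat.sub_zero, add_zero]
    exact ⟨hL.old, fun i hi => by omega, hL.disj_old, fun i j hi => by omega,
      fun i j hi => by omega⟩
  · rintro k s - hk hF hrk ⟨hq, hP⟩
    have r1 : s.r .p = p := by rw [hF.r .p rfl]; simp [hσ₁]
    have r2 : s.r .sub = N := by rw [hF.r .sub rfl]; simp [hσ₁]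
    have hpk : p * k + p ≤ p * (2 * N - 1) := by
      have := Nat.mul_le_mul_left p (show k + 1 ≤ 2 * N - 1 by omega)
      rwa [Nat.mul_succ] at this
    refine (wp_round hp hn' hn1 r1 r2 hq hrk (Nat.le_mul_of_pos_left k (by omega)) (by omega) hP hr
      (by omega) (by omega) hbig hbig').mono le_rfl ?_
    rintro s' - ⟨h1, h2⟩
    have e1 : p * (k + 1) = p * k + p := rfl
    refine ⟨by simp [h2, e1], ?_⟩
    rw [e1, ← Nat.sub_sub]
    exact h1.congr (by simp) (by simp) rfl
  · have hc : (Ex.reg .sub + Ex.reg .sub - 1).cost = 5 := rfl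
    have hc0 : (0 : Ex).cost = 1 := rfl
    rw [hc, hc0, Nat.sub_zero]
    have e : (2 * N - 1) * (2 ^ 138 * p + 5 + 10) = 2 ^ 138 * (p * (2 * N - 1)) + 15 * (2 * N - 1) := by
      ring
    rw [e]
    show _ ≤ 2 ^ 140 * M
    norm_num
    omega
  · intro s hF hI _
    exact ⟨by rw [hF.r .sub rfl]; simp [hσ₁], hI.2⟩
  · rintro s - ⟨hs, g1, g2, cov, hI, hL⟩
    refine WP.straight (by simp) ⟨N, D * p, id + (2 * N - 1), hpN, hN1, by rw [mul_assoc, hn'],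
      by simp [hs], ⟨by simp [g1], by simp [g2], cov, by simpa using hI, ?_⟩, by omega⟩
      (Nat.le_of_ble_eq_true rfl)
    simp only [Cd.fin_set, Store.set_a]
    exact ⟨fun i hi => by simpa using hL.new i hi, fun i hi => by omega,
      fun i j hi hj hij => by simpa using hL.disj_new i j hi hj hij, fun i j hi => by omega,
      fun i j hi => by omega⟩

def levels : Cd := .loop (1 ≺ .reg .lev) level

theorem wp_levels {σ : Store} {n id : ℕ} {a : ℕ → ℤ} (hn1 : 1 ≤ n) (hrl : σ.r .lev = n)
    (h : Pooled n a 1 0 0 0 (2 * n - 1) id σ) (hid : id + 2 * n ≤ 4 * n) (hr : 8 * n ≤ C.rows)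
    (hbig : 10 * ((n : ℤ) * n) ≤ C.big) (hbig' : 2 ^ 120 ≤ C.big) :
    WP C levels (fun s => ∃ id' : ℕ, Pooled n a n 0 0 0 1 id' s ∧ id' ≤ 4 * n)
      (2 ^ 143 * n) σ := by
  have hc : (1 ≺ Ex.reg .lev).cost = 3 := rfl
  refine (WP.loop (fun s => ∃ N D id : ℕ, 1 ≤ N ∧ D * N = n ∧ s.r .lev = N ∧
      Pooled n a D 0 0 0 (2 * N - 1) id s ∧ id + 2 * N ≤ 4 * n)
    -- A level costs `2 ^ 141 * N`, and `lev` loses at least half of its value `N`. So the potential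
    -- drops by enough; the summand `10` pays for the test.
    (fun s => (2 ^ 142 + 10) * (s.r .lev).toNat)
    ⟨n, 1, id, hn1, one_mul n, hrl, h, hid⟩ ?_ ?_).mono ?_ ?_
  · intro s _ _; simp
  · rintro s _ ⟨N, D, id, h1, h2, h3, h4, h5⟩ hz
    rw [Ne, Ex.den_lt_eq_zero] at hz
    simp [h3] at hz
    refine ⟨2 ^ 141 * N, (wp_level (by omega) h2 hn1 h3 h4 h5 hr hbig hbig').mono le_rfl ?_⟩
    rintro s' - ⟨N', D', id', g0, g1, g2, g3, g4, g5⟩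
    refine ⟨⟨N', D', id', g1, g2, g3, g4, g5⟩, ?_⟩
    rw [h3, g3, hc, Int.toNat_natCast, Int.toNat_natCast]
    clear hbig'
    norm_num
    omega
  · rw [hrl, hc, Int.toNat_natCast]
    clear hbig'
    norm_num
    omega
  · rintro s _ ⟨⟨N, D, id, h1, h2, h3, h4, h5⟩, hz⟩
    rw [Ex.den_lt_eq_zero] at hz
    simp [h3] at hz
    obtain rfl : N = 1 := by omega
    obtain rfl : D = n := by omega
    exact ⟨id, h4, by omega⟩

/-! ### Input, marking, and output. -/

/-- Move the input into the array `iv`, reduced modulo `n`. The cell of `iv` with the index `k`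
has the address `19 * k`, so that no input is overwritten before it is read. -/
def loadInput : Cd :=
  .k ::= .reg .n + .reg .n - 1 ;;
  .loop (0 ≺ .reg .k) (.k ::= .reg .k - 1 ;; .put .iv (.reg .k) (.raw (.reg .k) % .reg .n))

/-- The array `iv` has number `0`, so the address written is `19 * i`, which is greater than `j`. -/
theorem rawGet_put_iv (σ : Store) {i j z : ℤ} (hj : 0 ≤ j) (hij : j < i) :
    (σ.put .iv i z).rawGet j = σ.rawGet j := by
  rw [← Store.rawPut_arr, Store.rawPut_rawGet, if_neg]
  simp only [stride]
  push_cast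
  omega

theorem wp_loadInput {σ : Store} {n : ℕ} {a : ℕ → ℤ} (hn1 : 1 ≤ n) (hrn : σ.r .n = n)
    (ha : ∀ i : ℕ, i < 2 * n - 1 → σ.rawGet i = a i) (hr : 8 * n ≤ C.rows) :
    WP C loadInput (fun s => ∀ i : ℕ, i < 2 * n - 1 → s.a .iv i = a i % n) (100 * n + 20) σ := by
  have hb1 := C.rows_le_big; have hb2 := C.hstride
  simp only [stride, Nat.cast_ofNat] at hb2
  have hc : (0 ≺ Ex.reg .k).cost = 3 := rfl
  have h2n : (n : ℤ) + n - 1 = (2 * n - 1 : ℕ) := by omega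
  refine (WP.seq (b := 6) (R := fun s => s = σ.set .k (2 * n - 1 : ℕ))
    (WP.straight (by simp [hrn]; omega) (by simp [hrn, h2n]) (Nat.le_of_ble_eq_true rfl)) ?_
    (b' := 100 * n + 10)).mono (by omega) (fun _ _ h => h)
  rintro _ - rfl
  refine (WP.loop (fun s => ∃ w : ℕ, w ≤ 2 * n - 1 ∧ s.r .k = w ∧
      (∀ i : ℕ, i < w → s.rawGet i = a i) ∧
      ∀ i : ℕ, w ≤ i → i < 2 * n - 1 → s.a .iv i = a i % n)
    (fun s => 40 * (s.r .k).toNat)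
    ⟨2 * n - 1, le_rfl, Store.set_r_same _ _ _, ha, fun i h0 h1 => by omega⟩ ?_ ?_).mono ?_ ?_
  · intro s _ _; simp
  · rintro s hF ⟨w', hw, hk, h1, h2⟩ hz
    rw [Ne, Ex.den_lt_eq_zero] at hz
    simp [hk] at hz
    obtain ⟨w, rfl⟩ : ∃ w, w' = w + 1 := ⟨w' - 1, by omega⟩
    have r1 : s.r .n = n := by rw [hF.r .n rfl]; simp [hrn]
    push_cast at hk
    have hraw : (s.set .k w).rawGet w = a w := h1 w (by omega)
    refine ⟨30, (WP.seq (b := 4) (R := fun v => v = s.set .k w)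
      (WP.straight (by simp [hk]; omega) (by simp [hk]) (Nat.le_of_ble_eq_true rfl)) ?_
      (b' := 26)).mono (by omega) (fun _ _ h => h)⟩
    rintro _ - rfl
    refine WP.straight (by simp [r1]; omega) ⟨⟨w, by omega, by simp, fun i hi => ?_,
      fun i h0 hi => ?_⟩, ?_⟩ (Nat.le_of_ble_eq_true rfl)
    · rw [Cd.fin_put, rawGet_put_iv _ (by omega) (by simp; omega)]
      exact h1 i (by omega)
    · by_cases hiw : i = w
      · subst hiw; simp [hraw, r1]
      · have : (i : ℤ) ≠ w := by omega
        simpa [this] using h2 i (by omega) hi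
    · simp [hk, hc]; omega
  · simp [hc]; omega
  · rintro s _ ⟨⟨w, hw, hk, h1, h2⟩, hz⟩
    rw [Ex.den_lt_eq_zero] at hz
    simp [hk] at hz
    subst hz
    exact fun i hi => h2 i (by omega) hi

/-- Let the inputs be the first items. -/
def leaves : Cd :=
  .for .k 0 (.reg .n + .reg .n - 1) (.put .pool (.reg .k) (.reg .k) ;; .put .par (.reg .k) 0) ;;
  .nid ::= .reg .n + .reg .n - 1 ;;
  .lev ::= .reg .n

theorem wp_leaves {σ : Store} {n : ℕ} {a : ℕ → ℤ} (hn1 : 1 ≤ n) (hrn : σ.r .n = n)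
    (ha : ∀ i : ℕ, i < 2 * n - 1 → σ.a .iv i = a i % n) (hr : 8 * n ≤ C.rows) :
    WP C leaves (fun s => s.r .lev = n ∧ Pooled n a 1 0 0 0 (2 * n - 1) (2 * n - 1) s)
      (100 * n + 30) σ := by
  have hb1 := C.rows_le_big; have hb2 := C.hstride
  simp only [stride, Nat.cast_ofNat] at hb2
  have h2n : (n : ℤ) + n - 1 = (2 * n - 1 : ℕ) := by omega
  refine (WP.seq (b := 100 * n + 20) (R := fun s => ∀ i : ℕ, i < 2 * n - 1 →
      s.a .pool i = i ∧ s.a .par i = 0)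
    (WP.forC (a := 0) (b := 2 * n - 1) (K := 20)
      (fun k s => ∀ i : ℕ, i < k → s.a .pool i = i ∧ s.a .par i = 0)
      (by omega) (by simp) (by simp) rfl ?_ (by omega) (fun j hj => by omega) ?_ ?_
      (fun _ _ h _ => h)) ?_ (b' := 10)).mono (by omega) (fun _ _ h => h)
  · intro s hF
    have : s.r .n = n := by rw [hF.r .n rfl, hrn]
    simp [this]; omega
  · rintro k s - hk _ hrk hI
    refine WP.straight (by simp [hrk]; omega) (fun i hi => ?_) (Nat.le_of_ble_eq_true rfl)
    by_cases hik : i = k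
    · subst hik; simp [hrk]
    · have : (i : ℤ) ≠ k := by omega
      simpa [hrk, this] using hI i (by omega)
  · show (2 * n - 1 - 0) * (20 + 5 + 10) + 1 + 5 + 5 ≤ _; omega
  · intro s hF hs
    have r1 : s.r .n = n := by rw [hF.r .n rfl, hrn]
    have a1 : s.a .iv = σ.a .iv := hF.a .iv rfl
    refine WP.straight (by simp [r1]; omega) ⟨by simp [r1], by simp [r1], by simp [r1, h2n],
      fun x => {x.toNat}, ?_, ?_⟩ (Nat.le_of_ble_eq_true rfl)
    · refine ⟨fun i _ => by simp, le_rfl, fun x h0 h1 => ?_, fun y h0 h1 => by omega,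
        fun x h0 h1 => ?_⟩ <;> lift x to ℕ using h0
      · left; simpa using (hs x (by omega)).2
      · have := ha x (by omega)
        simp only [Cd.fin_seq, Cd.fin_set, Store.set_a, a1, this]
        exact ⟨Int.emod_nonneg _ (by omega), Int.emod_lt_of_pos _ (by omega)⟩
    · simp only [Cd.fin_seq, Cd.fin_set, Store.set_a, a1]
      have hp : ∀ i : ℕ, i < 2 * n - 1 → s.a .pool ((0 : ℕ) + i) = i := fun i hi => by
        simpa using (hs i hi).1
      refine ⟨fun i hi => ?_, fun i hi => by omega, fun i j hi hj hij => ?_,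
        fun i j hi => by omega, fun i j hi => by omega⟩
      · rw [hp i hi]
        refine ⟨by omega, by omega, (hs i hi).2, by simp, by simp; omega, ?_⟩
        simp only [Int.toNat_natCast, Finset.sum_singleton, Nat.cast_one, one_mul, ha i hi]
        exact (Int.mod_modEq _ _).symm
      · rw [hp i hi, hp j hj]; simpa using hij

/-- Mark the items that are contained in the only item of the pool. -/
def mark : Cd :=
  .x ::= .reg .nid ;;
  .loop (0 ≺ .reg .x) (
    .x ::= .reg .x - 1 ;;
    .ite (.reg .x ≐ .arr .pool 0) (.put .sel (.reg .x) 1)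
      (.ite (.arr .par (.reg .x)) (.put .sel (.reg .x) (.arr .sel (.arr .par (.reg .x))))
        (.put .sel (.reg .x) 0)))

/-- `sel` marks, among the items from `w` on, the item `root` and all items whose parent is
marked. -/
def MarkedFrom (root : ℤ) (par sel : ℤ → ℤ) (w id : ℕ) : Prop :=
  ∀ x : ℤ, w ≤ x → x < id →
    (sel x = 0 ∨ sel x = 1) ∧ (sel x = 1 ↔ x = root ∨ par x ≠ 0 ∧ sel (par x) = 1)

/-- From a marked item one climbs through marked parents to `root`, and the covered sets only grow.
Conversely, one descends from `root` through items that cover `i`; each of them has a marked parent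
and so is marked. Both inductions rest on parents having larger numbers. -/
theorem MarkedFrom.mem_iff {n id : ℕ} {cov : ℤ → Finset ℕ} {par iv sel : ℤ → ℤ} {root : ℤ}
    (hM : MarkedFrom root par sel 0 id) (hI : Items n id cov par iv) (hn1 : 1 ≤ n) (h0 : 0 ≤ root)
    (h1 : root < id) (i : ℕ) (hi : i < 2 * n - 1) : sel i = 1 ↔ i ∈ cov root := by
  have hle := hI.le
  constructor
  · have key : ∀ d : ℕ, ∀ x : ℤ, 0 ≤ x → x < id → id - x ≤ d → sel x = 1 →
        cov x ⊆ cov root := by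
      intro d
      induction d with
      | zero => intro x hx0 hx1 hd; omega
      | succ d ih =>
        intro x hx0 hx1 hd hs
        rcases ((hM x hx0 hx1).2).1 hs with rfl | ⟨hp, hs'⟩
        · exact subset_rfl
        · have := hI.parent x hx0 hx1
          refine Finset.Subset.trans ?_ (ih (par x) (by omega) (by omega) (by omega) hs')
          intro j hj
          rw [hI.node (par x) (by omega) (by omega)]
          exact ⟨x, hx0, by omega, rfl, hj⟩
    intro hs
    refine key id i (by omega) (by omega) (by omega) hs ?_
    rw [hI.leaf i hi, Finset.mem_singleton]
  · have key : ∀ d : ℕ, ∀ y : ℤ, 0 ≤ y → y < id → y < d → sel y = 1 → i ∈ cov y → sel i = 1 := by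
      intro d
      induction d with
      | zero => intro y hy0 hy1 hd; omega
      | succ d ih =>
        intro y hy0 hy1 hd hs hiy
        by_cases hy : y < 2 * (n : ℤ) - 1
        · lift y to ℕ using hy0
          rw [hI.leaf y (by omega), Finset.mem_singleton] at hiy
          rwa [hiy]
        · obtain ⟨x, hx0, hxy, hpx, hix⟩ := (hI.node y (by omega) hy1 i).1 hiy
          refine ih x hx0 (by omega) (by omega) ?_ hix
          exact (hM x hx0 (by omega)).2.2 (Or.inr ⟨by omega, by rw [hpx]; exact hs⟩)
    exact key id root h0 h1 h1 ((hM root h0 h1).2.2 (Or.inl rfl))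

theorem MarkedFrom.step {root : ℤ} {par sel : ℤ → ℤ} {w id : ℕ} {z : ℤ}
    (hM : MarkedFrom root par sel (w + 1) id)
    (hpar : ∀ x : ℤ, 0 ≤ x → x < id → par x = 0 ∨ x < par x)
    (hz : (z = 0 ∨ z = 1) ∧ (z = 1 ↔ (w : ℤ) = root ∨ par w ≠ 0 ∧ sel (par w) = 1)) :
    MarkedFrom root par (Function.update sel w z) w id := by
  intro x hx0 hx1
  have hp := hpar x (by omega) hx1
  have hne : par x ≠ 0 → Function.update sel w z (par x) = sel (par x) := fun h =>
    Function.update_of_ne (by omega) _ _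
  have hiff : par x ≠ 0 ∧ Function.update sel w z (par x) = 1 ↔ par x ≠ 0 ∧ sel (par x) = 1 :=
    and_congr_right fun h => by rw [hne h]
  rw [hiff]
  by_cases hxw : x = w
  · subst hxw; rw [Function.update_self]; exact hz
  · rw [Function.update_of_ne hxw]
    exact hM x (by push_cast; omega) hx1

theorem wp_mark {σ : Store} {id : ℕ} (hid : id ≤ C.rows) (hid1 : 1 ≤ id) (hrid : σ.r .nid = id)
    (hpar : ∀ x : ℤ, 0 ≤ x → x < id → σ.a .par x = 0 ∨ x < σ.a .par x ∧ σ.a .par x < id) :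
    WP C mark (fun s => MarkedFrom (σ.a .pool 0) (σ.a .par) (s.a .sel) 0 id) (60 * id + 10) σ := by
  have hb1 := C.rows_le_big; have hb2 := C.hstride
  simp only [stride, Nat.cast_ofNat] at hb2
  have hc : (0 ≺ Ex.reg .x).cost = 3 := rfl
  refine (WP.seq (b := 2) (R := fun s => s = σ.set .x id)
    (WP.straight (by simp) (by simp [hrid]) (Nat.le_of_ble_eq_true rfl)) ?_
    (b' := 60 * id + 5)).mono (by omega) (fun _ _ h => h)
  rintro _ - rfl
  refine (WP.loop (fun s => ∃ w : ℕ, w ≤ id ∧ s.r .x = w ∧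
      MarkedFrom (σ.a .pool 0) (σ.a .par) (s.a .sel) w id)
    (fun s => 60 * (s.r .x).toNat)
    ⟨id, le_rfl, by simp, fun x h0 h1 => by omega⟩ ?_ ?_).mono ?_ ?_
  · intro s _ _; simp
  · rintro s hF ⟨w', hw, hx, hM⟩ hz
    rw [Ne, Ex.den_lt_eq_zero] at hz
    simp [hx] at hz
    obtain ⟨w, rfl⟩ : ∃ w, w' = w + 1 := ⟨w' - 1, by omega⟩
    have a1 : s.a .pool = σ.a .pool := by rw [hF.a .pool rfl]; simp
    have a2 : s.a .par = σ.a .par := by rw [hF.a .par rfl]; simp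
    push_cast at hx
    have hpw := hpar w (by omega) (by omega)
    have hstep := fun z => hM.step (z := z) fun x h0 h1 => (hpar x h0 h1).imp_right And.left
    refine ⟨50, (WP.seq (b := 4) (R := fun v => v = s.set .x w)
      (WP.straight (by simp [hx]; omega) (by simp [hx]) (Nat.le_of_ble_eq_true rfl)) ?_
      (b' := 46)).mono (by omega) (fun _ _ h => h)⟩
    rintro _ - rfl
    refine (WP.ite (b := 36) (by simp; omega) (fun hz => ?_) (fun hz => ?_)).mono
      (Nat.le_of_ble_eq_true rfl) (fun _ _ h => h)
    · simp [a1] at hz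
      refine WP.straight (by simp; omega) ⟨⟨w, by omega, by simp, ?_⟩, ?_⟩
        (Nat.le_of_ble_eq_true rfl)
      · simpa using hstep 1 ⟨Or.inr rfl, by simp [hz]⟩
      · simp [hx, hc]; omega
    · simp [a1] at hz
      refine (WP.ite (b := 28) (by simp; omega) (fun hz' => ?_) (fun hz' => ?_)).mono
        (Nat.le_of_ble_eq_true rfl) (fun _ _ h => h)
      · simp [a2] at hz'
        refine WP.straight (by simp [a2]; omega) ⟨⟨w, by omega, by simp, ?_⟩, ?_⟩
          (Nat.le_of_ble_eq_true rfl)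
        · have hsp := (hM (σ.a .par w) (by push_cast; omega) (by omega)).1
          simpa [a2] using hstep (s.a .sel (σ.a .par w)) ⟨hsp, by simp [hz, hz']⟩
        · simp [hx, hc]; omega
      · simp [a2] at hz'
        refine WP.straight (by simp; omega) ⟨⟨w, by omega, by simp, ?_⟩, ?_⟩
          (Nat.le_of_ble_eq_true rfl)
        · simpa using hstep 0 ⟨Or.inl rfl, by simp [hz, hz']⟩
        · simp [hx, hc]; omega
  · simp [hc]
  · rintro s _ ⟨⟨w, hw, hx, hM⟩, hz⟩
    rw [Ex.den_lt_eq_zero] at hz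
    simp [hx] at hz
    subst hz
    exact hM

/-- List the marked leaves in the first cells of the memory. -/
def output : Cd :=
  .t ::= 0 ;;
  .for .k 0 (.reg .n + .reg .n - 1) (
    .ite (.arr .sel (.reg .k)) (.rawPut (.reg .t) (.reg .k) ;; .t ::= .reg .t + 1) .skip)

/-- The output overwrites the beginning of the interleaved arrays. When `sel` is read at index `k`,
at address `19 * k + 3`, only cells below `ones (σ.a .sel) k ≤ k` have been written, so the entry is
still intact. -/
theorem wp_output {σ : Store} {n : ℕ} (hn1 : 1 ≤ n) (hrn : σ.r .n = n)
    (hs : ∀ i : ℕ, i < 2 * n - 1 → σ.a .sel i = 0 ∨ σ.a .sel i = 1) (hr : 8 * n ≤ C.rows) :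
    WP C output (fun s => ∀ i : ℕ, i < 2 * n - 1 → σ.a .sel i = 1 →
      s.rawGet (ones (σ.a .sel) i) = i) (100 * n + 20) σ := by
  have hb1 := C.rows_le_big; have hb2 := C.hstride
  simp only [stride, Nat.cast_ofNat] at hb2
  have hz0 : ones (σ.a .sel) 0 = 0 := rfl
  refine (WP.seq (b := 2) (R := fun s => s = σ.set .t 0)
    (WP.straight (by simp) (by simp) (Nat.le_of_ble_eq_true rfl)) ?_
    (b' := 100 * n + 18)).mono (by omega) (fun _ _ h => h)
  rintro _ - rfl
  refine WP.forC (a := 0) (b := 2 * n - 1) (K := 20)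
    (fun k s => s.r .t = ones (σ.a .sel) k ∧
      (∀ j : ℤ, ones (σ.a .sel) k ≤ j → s.rawGet j = σ.rawGet j) ∧
      ∀ i : ℕ, i < k → σ.a .sel i = 1 → s.rawGet (ones (σ.a .sel) i) = i)
    (by omega) (by simp) (by simp) rfl ?_ (by omega)
    ⟨by simp [hz0], fun j _ => rfl, fun j hj => by omega⟩ ?_ ?_ (fun _ _ h _ => h.2.2)
  · intro s hF
    have : s.r .n = n := by rw [hF.r .n rfl]; simp [hrn]
    simp [this]; omega
  · rintro k s - hk _ hrk ⟨ht, hraw, hout⟩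
    have hos := ones_succ (σ.a .sel) k
    have hok := ones_bounds (m := k) (j := 0) (fun j hj => hs j (by omega)) (by omega)
    rw [hz0] at hok
    have hsel : s.a .sel k = σ.a .sel k := by
      rw [← Store.rawGet_arr, ← Store.rawGet_arr]
      refine hraw _ ?_
      simp only [stride]
      push_cast
      omega
    refine (WP.ite (b := 8) (by simp [hrk]; omega) (fun hz => ?_) (fun hz => ?_)).mono
      (Nat.le_of_ble_eq_true rfl) (fun _ _ h => h)
    · have hs1 : σ.a .sel k = 1 := by
        have := hs k hk
        simp [hrk, hsel] at hz; omega
      refine WP.straight (by simp [Cd.ok, Cd.fin, ht, Store.rawPut]; omega) ?_ (Nat.le_of_ble_eq_true rfl)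
      have hg : ∀ j, (((s.rawPut (ones (σ.a .sel) k) k).set .t (ones (σ.a .sel) k + 1)).set .k
          (k + 1)).rawGet j = if j = ones (σ.a .sel) k then (k : ℤ) else s.rawGet j := fun j =>
        Store.rawPut_rawGet s _ j _
      have hfin : ((Cd.rawPut (.reg .t) (.reg .k) ;; .t ::= .reg .t + 1).fin s).set .k (k + 1) =
          ((s.rawPut (ones (σ.a .sel) k) k).set .t (ones (σ.a .sel) k + 1)).set .k (k + 1) := by
        simp [Cd.fin, ht, hrk, Store.rawPut]
      rw [hfin]
      refine ⟨by simp [hos, hs1], fun j hj => ?_, fun i hi hi1 => ?_⟩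
      · rw [hg, if_neg (by omega)]; exact hraw j (by omega)
      · rw [hg]
        by_cases hik : i = k
        · subst hik; simp
        · have := ones_bounds (m := k) (j := i + 1) (fun j hj => hs j (by omega)) (by omega)
          have := ones_succ (σ.a .sel) i
          rw [if_neg (by omega)]
          exact hout i (by omega) hi1
    · have hs0 : σ.a .sel k = 0 := by simpa [hrk, hsel] using hz
      refine WP.straight (by simp) ⟨by simp [ht, hos, hs0], fun j hj => hraw j (by omega),
        fun i hi hi1 => ?_⟩ (Nat.le_of_ble_eq_true rfl)
      by_cases hik : i = k
      · subst hik; omega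
      · exact hout i (by omega) hi1
  · show (2 * n - 1 - 0) * (20 + 5 + 10) + 1 + 5 + 5 ≤ _; omega

/-! ### The whole program, and its constants. -/

def program : Cd := loadInput ;; leaves ;; levels ;; mark ;; output

theorem wp_program {σ : Store} {n : ℕ} {a : ℕ → ℤ} (hn1 : 1 ≤ n) (hrn : σ.r .n = n)
    (ha : ∀ i : ℕ, i < 2 * n - 1 → σ.rawGet i = a i) (hr : 8 * n ≤ C.rows)
    (hbig : 10 * ((n : ℤ) * n) ≤ C.big) (hbig' : 2 ^ 120 ≤ C.big) :
    WP C program (fun s => ∃ S : Finset ℕ, S.card = n ∧ (∀ i ∈ S, i < 2 * n - 1) ∧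
      (n : ℤ) ∣ ∑ i ∈ S, a i ∧ ∃ pos : ℕ → ℤ, ∀ i ∈ S, 0 ≤ pos i ∧ pos i < n ∧
        s.rawGet (pos i) = i) (2 ^ 145 * n) σ := by
  refine (WP.seq (wp_loadInput hn1 hrn ha hr) ?_
    (b' := (100 * n + 30) + (2 ^ 143 * n + ((60 * (4 * n) + 10) + (100 * n + 20))))).mono
    (by norm_num; omega) (fun _ _ h => h)
  intro σ₁ hF₁ h₁
  refine WP.seq (wp_leaves hn1 (by rw [hF₁.r .n rfl, hrn]) h₁ hr) ?_
  rintro σ₂ hF₂ ⟨hlev, hP⟩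
  refine WP.seq (wp_levels hn1 hlev hP (by omega) hr hbig hbig') ?_
  rintro σ₃ - ⟨id, ⟨hn, hid, cov, hI, hL⟩, hidn⟩
  have hroot := hL.old 0 one_pos
  simp only [Nat.cast_zero, add_zero] at hroot
  have hle := hI.le
  refine WP.seq ((wp_mark (by omega) (by omega) hid fun x h0 h1 => ?_).mono (by omega)
    fun _ _ h => h) ?_
  · have := hI.parent x h0 h1; omega
  intro σ₄ hF₄ hM
  have hsel := fun i (hi : i < 2 * n - 1) => hM.mem_iff hI hn1 hroot.pos hroot.lt i hi
  have h01 : ∀ i : ℕ, i < 2 * n - 1 → σ₄.a .sel i = 0 ∨ σ₄.a .sel i = 1 := fun i hi =>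
    (hM i (by omega) (by omega)).1
  refine (wp_output hn1 (by rw [hF₄.r .n rfl, hn]) h01 hr).mono le_rfl ?_
  intro s _ hout
  have hones : ones (σ₄.a .sel) (2 * n - 1) = n := by
    have hsub : cov (σ₃.a .pool 0) ⊆ Finset.range (2 * n - 1) := fun i hi =>
      Finset.mem_range.2 (hroot.sub i hi)
    rw [ones, ← Finset.sum_subset hsub]
    · refine Eq.trans ?_ (congrArg Nat.cast hroot.card)
      rw [Finset.cast_card]
      exact Finset.sum_congr rfl fun i hi => (hsel i (hroot.sub i hi)).2 hi
    · intro i hi hi'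
      have hi := Finset.mem_range.1 hi
      exact (h01 i hi).resolve_right fun h => hi' ((hsel i hi).1 h)
  refine ⟨cov (σ₃.a .pool 0), hroot.card, hroot.sub, ?_, fun i => ones (σ₄.a .sel) i,
    fun i hi => ?_⟩
  · rw [← Int.modEq_zero_iff_dvd]
    exact hroot.sum.trans (Int.modEq_zero_iff_dvd.2 (dvd_mul_right _ _))
  · have hi' := hroot.sub i hi
    have hs1 := (hsel i hi').2 hi
    have h1 := ones_bounds h01 (j := i + 1) (by omega)
    have h2 := ones_bounds (m := i) (j := 0) (fun j hj => h01 j (by omega)) (by omega)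
    have h3 := ones_succ (σ₄.a .sel) i
    have h4 : ones (σ₄.a .sel) 0 = 0 := rfl
    exact ⟨by dsimp only; omega, by dsimp only; omega, hout i hi' hs1⟩

/-- The store that represents the input. -/
def start (n : ℕ) (a : Fin (2 * n - 1) → ℤ) : Store :=
  ⟨fun x => if x = .n then n else 0, fun b i => (input n a).mem (stride * i + b.ctorIdx).toNat⟩

theorem rawGet_start (n : ℕ) (a : Fin (2 * n - 1) → ℤ) (i : ℕ) :
    (start n a).rawGet i = (input n a).mem i := by
  have key : ∀ i : ℕ, i < stride → (Arr.ofNat i).ctorIdx = i := by decide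
  have hi : ((i : ℤ) % stride).toNat = i % stride := by
    rw [← Int.natCast_mod, Int.toNat_natCast]
  simp only [Store.rawGet, start, hi]
  rw [key _ (Nat.mod_lt _ (by decide))]
  congr 1
  rw [← Int.natCast_div, ← Nat.cast_mul, ← Nat.cast_add, Int.toNat_natCast, Nat.div_add_mod]

theorem toState_start (n : ℕ) (a : Fin (2 * n - 1) → ℤ) : (start n a).toState = input n a := by
  have hmem : (start n a).toState.mem = (input n a).mem := funext fun i => rawGet_start n a i
  have hreg : (start n a).toState.reg = (input n a).reg := by
    funext k
    simp only [Store.toState, start, input]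
    rcases Nat.eq_zero_or_pos k with rfl | hk
    · rfl
    · rw [if_neg (show k ≠ 0 by omega)]
      split_ifs with h1 h2
      · rw [h2] at h1; change 0 = k at h1; omega
      · rfl
      · rfl
  cases h : (start n a).toState
  cases h' : input n a
  simp_all

/-- The machine of the problem with words of `w` bits and `c * n` words of memory. -/
def machine (n w : ℕ) (hn : 1 ≤ n) (hw : 300 * (Nat.log 2 n + 1) ≤ w) : Machine where
  w := w
  m := 2 ^ 145 * n
  rows := 8 * n
  -- Quadratic in `n` because residues are multiplied; the factor leaves room for the sums of such
  -- products and for the literals of the program.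
  big := 2 ^ 200 * ((n : ℤ) * n)
  hrows := by simp only [stride]; norm_num; omega
  hbig := by
    have : (1 : ℤ) * n ≤ n * n := mul_le_mul_of_nonneg_right (by omega) (by omega)
    simp only [stride]
    push_cast
    omega
  hpos := by
    have : (1 : ℤ) * 1 ≤ n * n := mul_le_mul (by omega) (by omega) (by omega) (by omega)
    norm_num
    omega
  hstride := by
    have : (1 : ℤ) * 1 ≤ n * n := mul_le_mul (by omega) (by omega) (by omega) (by omega)
    norm_num
    omega
  fits := by
    intro z h0 h1
    have h2 : n < 2 ^ (Nat.log 2 n + 1) := Nat.lt_pow_succ_log_self one_lt_two n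
    set m := Nat.log 2 n + 1 with hm
    have h3 : n * n < 2 ^ m * 2 ^ m := Nat.mul_lt_mul_of_lt_of_lt h2 h2
    -- With `m` the number of binary digits of `n`, the exponent `201 + 2 * m` is at most `300 * m ≤
    -- w`.
    have h4 : 2 ^ 201 * (n * n) < 2 ^ w := calc
      2 ^ 201 * (n * n) < 2 ^ 201 * (2 ^ m * 2 ^ m) := Nat.mul_lt_mul_of_pos_left h3 (by positivity)
      _ = 2 ^ (201 + (m + m)) := by rw [pow_add 2 201, pow_add 2 m m]
      _ ≤ 2 ^ w := Nat.pow_le_pow_right two_pos (by omega)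
    have h5 : (2 : ℤ) ^ 201 * ((n : ℤ) * n) < 2 ^ w := by exact_mod_cast h4
    have h6 : (2 : ℤ) ^ 201 = 2 * 2 ^ 200 := by norm_num
    rw [h6, mul_assoc] at h5
    unfold FitsWord
    constructor <;> linarith

theorem isSolution_attachFin {n : ℕ} {a : Fin (2 * n - 1) → ℤ} {S : Finset ℕ} (hS : S.card = n)
    (hlt : ∀ i ∈ S, i < 2 * n - 1) (hsum : (n : ℤ) ∣ ∑ i ∈ S, (input n a).mem i) :
    IsSolution n a (S.attachFin hlt) := by
  refine ⟨by rw [Finset.card_attachFin, hS], ?_⟩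
  convert hsum using 1
  refine Finset.sum_bij (fun i _ => i.1) (fun i hi => by simpa using hi)
    (fun i _ j _ h => Fin.ext h) (fun i hi => ⟨⟨i, hlt i hi⟩, by simpa using hi, rfl⟩)
    fun i _ => ?_
  simp [input, i.2]

/-- The content of a cell determines the element that it stands for, so the positions are different;
`n` different positions among `n` cells form a bijection. -/
theorem outputs_attachFin {n : ℕ} {s : Store} {S : Finset ℕ} (hS : S.card = n)
    (hlt : ∀ i ∈ S, i < 2 * n - 1) (pos : ℕ → ℤ)
    (hpos : ∀ i ∈ S, 0 ≤ pos i ∧ pos i < n ∧ s.rawGet (pos i) = i) :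
    Outputs n s.toState (S.attachFin hlt) := by
  have hp : ∀ i : {i // i ∈ S.attachFin hlt}, 0 ≤ pos i.1 ∧ pos i.1 < n ∧
      s.rawGet (pos i.1) = (i.1 : ℕ) := fun i => hpos _ ((Finset.mem_attachFin hlt).1 i.2)
  let f : {i // i ∈ S.attachFin hlt} → Fin n := fun i => ⟨(pos i.1).toNat, by
    have := hp i; omega⟩
  have hf : ∀ i, s.toState.mem (f i) = (i.1 : ℕ) := fun i => by
    have h := hp i
    change s.rawGet ((pos i.1).toNat : ℕ) = _
    rw [Int.toNat_of_nonneg h.1, h.2.2]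
  have hinj : Function.Injective f := fun i j hij => by
    have h := hf i
    rw [hij, hf j] at h
    exact Subtype.ext (Fin.ext (by exact_mod_cast h.symm))
  have hbij : Function.Bijective f := by
    rw [Fintype.bijective_iff_injective_and_card]
    exact ⟨hinj, by rw [Fintype.card_coe, Finset.card_attachFin, hS, Fintype.card_fin]⟩
  refine ⟨(Equiv.ofBijective f hbij).symm, fun j => ?_⟩
  rw [← hf, Equiv.ofBijective_apply_symm_apply f hbij j]

end EGZ

theorem mainTheorem1 :
    ∃ (P : WordRAM.Prog) (k c : ℕ), ∀ n : ℕ, 1 ≤ n → ∀ w : ℕ, k * (Nat.log 2 n + 1) ≤ w →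
      ∀ a : Fin (2 * n - 1) → ℤ, (∀ i, WordRAM.FitsWord w (a i)) →
        ∃ (t : ℕ) (s : WordRAM.State) (I : Finset (Fin (2 * n - 1))),
          WordRAM.Exec w (c * n) P (EGZ.input n a) t s ∧ t ≤ c * n ∧
            EGZ.IsSolution n a I ∧ EGZ.Outputs n s I := by
  -- The constant `2 ^ 145` comes from the running time. For the memory `19 * 8 * n` words would be
  -- enough.
  refine ⟨EGZ.program.compile, 300, 2 ^ 145, fun n hn w hw a _ => ?_⟩
  have hnn : (1 : ℤ) * 1 ≤ n * n := mul_le_mul (by omega) (by omega) (by omega) (by omega)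
  obtain ⟨t, s, hrun, ht, S, hS, hlt, hsum, pos, hpos⟩ :=
    EGZ.wp_program (C := EGZ.machine n w hn hw) (σ := EGZ.start n a) (a := (EGZ.input n a).mem)
      hn rfl (fun i _ => EGZ.rawGet_start n a i) le_rfl
      (by simp only [EGZ.machine]; norm_num; omega) (by simp only [EGZ.machine]; norm_num; omega)
  have hexec := hrun.exec
  rw [EGZ.toState_start] at hexec
  exact ⟨t, s.toState, S.attachFin hlt, hexec, ht, EGZ.isSolution_attachFin hS hlt hsum,
    EGZ.outputs_attachFin hS hlt pos hpos⟩
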